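/- **Setting.** Consider pure Yang--Mills theory with gauge group $SU(N)$ (in particular $SU(3)$), generators $T^a$ normalised by $\mathrm{tr}(T^aT^b)=\tfrac12\delta^{ab}$, structure constants $[T^a,T^b]=if^{abc}T^c$, coupling $g$, in the covariant gauge with an arbitrary real gauge parameter $\alpha\neq0$: $$\mathcal L=-\tfrac14F^a_{\mu\nu}F^{a\mu\nu}-\tfrac1{2\alpha}(\partial\cdot A^a)^2+(\partial^\mu\xi^a)D^{ab}_\mu\omega^b,$$ $$F^a_{\mu\nu}=\partial_\mu A^a_\nu-\partial_\nu A^a_\mu+gf^{abc}A^b_\mu A^c_\nu,\qquad D^{ab}_\mu=\delta^{ab}\partial_\mu-gf^{abc}A^c_\mu .$$ For a light-like vector $\Delta$ let $$O^{GV}_{em}=-\tfrac1\alpha\,\Delta\cdot A^a\;\Delta\cdot\partial(\partial\cdot A^a)-(\Delta\cdot\partial\xi^a)\,\Delta\cdot D^{ab}\omega^b$$ be the gauge-variant, BRST-exact part of the energy--momentum tensor contracted with $-\tfrac12\Delta^\mu\Delta^\nu$. With all momenta incoming its vertices are $$V^{a_1a_2}_{\mu_1\mu_2}(k_1,k_2)=\tfrac1\alpha\delta^{a_1a_2}\big[k_{1\mu_1}\Delta_{\mu_2}\,\Delta\cdot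 k_1+k_{2\mu_2}\Delta_{\mu_1}\,\Delta\cdot k_2\big]\quad(\text{two gluons}),$$ $$W^{a_1a_2}(k_1,k_2)=\delta^{a_1a_2}\,\Delta\cdot k_1\,\Delta\cdot k_2\quad(\xi\,\omega),\qquad X^{a_1a_2a_3}_{\mu_3}=-igf^{a_1a_2a_3}\,\Delta\cdot k_1\,\Delta_{\mu_3}\quad(\xi\,\omega\,A).$$ A gluon with colour $b$, momentum $p_2$ and polarisation $\varepsilon_2$ enters, a gluon with colour $a$, momentum $p_1$ and polarisation $\varepsilon_1$ leaves, and the momentum $Q=p_1-p_2$ flows into the operator. The polarisations satisfy $\varepsilon_1\cdot p_1=0=\varepsilon_2\cdot p_2$. Let $V=V^{ab}_{\mu_1\mu_2}(-p_1,p_2)\,\varepsilon_1^{\mu_1}\varepsilon_2^{\mu_2}$ be the tree diagram, and let $B(n)=B^{ab}_{\mu_1\mu_2}(-p_1,p_2)\,\varepsilon_1^{\mu_1}\varepsilon_2^{\mu_2}$ be the sum of the one-loop, amputated, one-particle-irreducible diagrams with one insertion of $O^{GV}_{em}$: the gluon triangle with $V$ and two three-gluon vertices; the gluon bubble with $V$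 and the four-gluon vertex (symmetry factor $\tfrac12$); the ghost triangle with $W$ in both orientations; and the two ghost bubbles with $X$. The loop integrals are dimensionally regularised: each is represented by Feynman parameters (with the $+i0$ prescription in the propagators), and $B$ is a meromorphic function of the space-time dimension $n\in\mathbb C$, obtained by analytic continuation. **(i) Massless on-shell gluons.** If $p_1^2=0=p_2^2$ and $Q\neq0$, then the one-loop physical matrix element, with external residue factors equal to $1$, vanishes identically in $n$ (in particular for $n>4$, where the infrared divergences are regulated), for every $\alpha$: $$\langle O^{GV}_{em}(Q)\rangle=V+B(n)=B(n)=0 .$$ **(ii) The limit $n\to4$ with $p_1^2=p_2^2=m^2\ne0$, on-shell in the limiting sense.** Let $p_1,p_2,\varepsilon_1,\varepsilon_2$ vary with $p_1^2=p_2^2=m^2\neq0$ and $\varepsilon_i\cdot p_i=0$ in such a way that $m^2\to0$, all four vectors converge, and $Q^2$ has a non-zero limit. Then $V=0$ throughout, and sufficiently far along the limit $B(n)$ has at most a simple pole at $n=4$, $$B(n)=\frac{c_{1}}{n-4}+c_0+o(1)\qquad(n\to4),$$ where $c_{1}\to0$ and $c_0\to0$ as $m^2\to0$. Thus the physical matrix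 element (on which the residue factors of the external legs have no effect at this order, because $V=0$) again vanishes when $n\to4$ is taken before $m^2\to0$. -/

import Mathlib

/-!
# One-loop matrix elements of the gauge-variant operator in the energy-momentum tensor

Pure Yang-Mills theory in the covariant gauge with gauge parameter `α`:

  `L = -1/4 F^a_{μν} F^{aμν} - 1/(2α) (∂·A^a)² + (∂^μ ξ^a) D_μ^{ab} ω^b`,
  `F^a_{μν} = ∂_μ A^a_ν - ∂_ν A^a_μ + g f^{abc} A^b_μ A^c_ν`,
  `D_μ^{ab} = δ^{ab} ∂_μ - g f^{abc} A^c_μ`,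

with an insertion of the (BRST-exact) operator

  `O = -1/α (Δ·A^a) Δ·∂ (∂·A^a) - (Δ·∂ ξ^a) Δ·D^{ab} ω^b = δ_BRST ((Δ·∂ ξ^a) Δ·A^a)`.

All momenta in vertices are incoming unless said otherwise; the metric is `(+,-,...,-)`.
-/

noncomputable section

namespace GVOperator

open MvPolynomial

/-! ### Colour -/

/-- `T^a` is a basis of generators of `SU(N)` (Hermitian, traceless, normalised by
`tr (T^a T^b) = δ^{ab} / 2`, spanning the traceless Hermitian matrices over `ℝ`) and `f^{abc}` are
the structure constants `[T^a, T^b] = i f^{abc} T^c`. -/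
structure IsSUGenerators {N : ℕ} {ι : Type*} [Fintype ι] [DecidableEq ι]
    (T : ι → Matrix (Fin N) (Fin N) ℂ) (f : ι → ι → ι → ℝ) : Prop where
  hermitian : ∀ a, (T a).IsHermitian
  traceless : ∀ a, (T a).trace = 0
  normalised : ∀ a b, (T a * T b).trace = if a = b then 1 / 2 else 0
  spanning : ∀ M : Matrix (Fin N) (Fin N) ℂ, M.IsHermitian → M.trace = 0 →
    ∃ c : ι → ℝ, M = ∑ a, (c a : ℂ) • T a
  commutator : ∀ a b, T a * T b - T b * T a = Complex.I • ∑ c, (f a b c : ℂ) • T c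

/-! ### External vectors -/

/-- Minkowski metric `η = diag(1, -1, ..., -1)` on the `(d+1)`-dimensional space that contains the
external vectors. -/
def eta {d : ℕ} (μ : Fin (d + 1)) : ℝ := if μ = 0 then 1 else -1

/-- Minkowski product of real vectors. -/
def mdot {d : ℕ} (u v : Fin (d + 1) → ℝ) : ℝ := ∑ μ, eta μ * u μ * v μ

/-- Minkowski product (bilinear) of a complex and a real vector. -/
def cdot {d : ℕ} (u : Fin (d + 1) → ℂ) (v : Fin (d + 1) → ℝ) : ℂ :=
  ∑ μ, (eta μ : ℂ) * u μ * (v μ : ℂ)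

/-! ### Numerator algebra with an `n`-dimensional loop momentum -/

/-- Polynomials in the loop momentum `k`: the variable `none` is the `n`-dimensional square `k²`,
the variable `some μ` is the component `k^μ` of `k` along the space of external vectors.  As the
loop momentum also has components outside this space, `k²` is an independent variable. -/
abbrev LoopPoly (d : ℕ) : Type := MvPolynomial (Option (Fin (d + 1))) ℂ

/-- Vectors `c k + v`, with `c` (the component `none`) and the components of the vector `v` in the
external space being polynomials in the loop momentum. -/
abbrev LVec (d : ℕ) : Type := Option (Fin (d + 1)) → LoopPoly d

/-- The loop momentum `k`. -/
def loopMom {d : ℕ} : LVec d := Pi.single none 1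

/-- An external complex vector. -/
def ext {d : ℕ} (v : Fin (d + 1) → ℂ) : LVec d := fun i => i.elim 0 (fun μ => C (v μ))

/-- An external real vector. -/
def extR {d : ℕ} (v : Fin (d + 1) → ℝ) : LVec d := ext (fun μ => (v μ : ℂ))

/-- Scalar product `(c k + v) · (c' k + v') = c c' k² + c (k · v') + c' (k · v) + v · v'`. -/
def dot {d : ℕ} (u v : LVec d) : LoopPoly d :=
  u none * v none * X none
    + u none * ∑ μ, C (eta μ : ℂ) * X (some μ) * v (some μ)
    + v none * ∑ μ, C (eta μ : ℂ) * X (some μ) * u (some μ)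
    + ∑ μ, C (eta μ : ℂ) * u (some μ) * v (some μ)

/-- Contraction `V^{ρσ} M_{ρσ}` of a tensor `V` with upper indices with a bilinear form `M`. -/
def contract {d : ℕ} (V : Option (Fin (d + 1)) → Option (Fin (d + 1)) → LoopPoly d)
    (M : LVec d → LVec d → LoopPoly d) : LoopPoly d :=
  ∑ r, ∑ s, V r s * M (Pi.single r 1) (Pi.single s 1)

/-- The `n`-dimensional d'Alembertian `∂²/∂k^μ ∂k_μ` on polynomials in `k²` and `k^μ`; it
satisfies `□ (k²) = 2 n` and `∂_μ (k²) = 2 k_μ`. -/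
def box {d : ℕ} (n : ℂ) (P : LoopPoly d) : LoopPoly d :=
  C (2 * n) * pderiv none P + 4 * X none * pderiv none (pderiv none P)
    + 4 * ∑ μ, X (some μ) * pderiv (some μ) (pderiv none P)
    + ∑ μ, C (eta μ : ℂ) * pderiv (some μ) (pderiv (some μ) P)

/-! ### Dimensionally regularised one-loop integrals -/

/-- Barycentric coordinates `(1 - ∑ x, x_1, ..., x_m)`. -/
def bary {m : ℕ} (x : Fin m → ℝ) : Fin (m + 1) → ℝ := Fin.cons (1 - ∑ i, x i) x

/-- The simplex of Feynman parameters. -/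
def feynmanSimplex (m : ℕ) : Set (Fin m → ℝ) := {x | (∀ i, 0 ≤ x i) ∧ ∑ i, x i ≤ 1}

/-- `F(x) = - ∑_{i<j} x_i x_j (q_i - q_j)²`, so that `∑ x_i (k + q_i)² = l² - F(x)` with
`l = k + ∑ x_i q_i`. -/
def secondSymanzik {d m : ℕ} (q : Fin (m + 1) → Fin (d + 1) → ℝ) (x : Fin (m + 1) → ℝ) : ℝ :=
  -∑ i, ∑ j, if i < j then x i * x j * mdot (q i - q j) (q i - q j) else 0

/-- `(F - i0)^s` for real `F`. -/
def powI0 (F : ℝ) (s : ℂ) : ℂ :=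
  if 0 ≤ F then (F : ℂ) ^ s
  else ((-F : ℝ) : ℂ) ^ s * Complex.exp (-(Real.pi : ℂ) * Complex.I * s)

/-- The point `k = - ∑ x_i q_i` (that is, `l = 0`) at which polynomials in the loop momentum are
evaluated. -/
def shiftPoint {d m : ℕ} (q : Fin (m + 1) → Fin (d + 1) → ℝ) (x : Fin (m + 1) → ℝ) :
    Option (Fin (d + 1)) → ℂ :=
  fun i => i.elim ((mdot (∑ j, x j • q j) (∑ j, x j • q j) : ℝ) : ℂ)
    (fun μ => ((-(∑ j, x j • q j) μ : ℝ) : ℂ))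

/-- Feynman-parameter representation of the dimensionally regularised integral

  `∫ d^n k / (2π)^n  P(k) / ∏_i ((k + q_i)² + i0)^{ν_i}`,   `ν_i ≥ 1`,  `A = ∑ ν_i`.

After the shift `k = l - ∑ x_i q_i` the term of order `2r` in `l` is averaged with
`∫ d^n l / (2π)^n  l^{μ_1} ⋯ l^{μ_2r} / (l² - F + i0)^A
  = i (-1)^(A+r) / (4π)^(n/2) · 2^(-r) · Γ(A-r-n/2) / Γ(A) · (F - i0)^(n/2+r-A)
      · (sum over pairings of g^{μμ'} ⋯ g^{μμ'})`,
and the sum over pairings is the action of `□^r / (2^r r!)` on `P`.  The parameter integrals converge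
absolutely for `Re n > 2 A`; the Gamma functions have poles at even integers `n` only. -/
def feynmanIntegral {d m : ℕ} (q : Fin (m + 1) → Fin (d + 1) → ℝ) (ν : Fin (m + 1) → ℕ)
    (P : LoopPoly d) (n : ℂ) : ℂ :=
  ∑ r ∈ Finset.range (P.totalDegree + 1),
    Complex.I * (-1) ^ ((∑ i, ν i) + r) / (4 * (Real.pi : ℂ)) ^ (n / 2)
      * Complex.Gamma (((∑ i, ν i : ℕ) : ℂ) - r - n / 2)
      / ((∏ i, ((ν i - 1).factorial : ℂ)) * 4 ^ r * (r.factorial : ℂ))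
      * ∫ x in feynmanSimplex m,
          (∏ i, ((bary x i : ℝ) : ℂ) ^ (ν i - 1))
            * eval (shiftPoint q (bary x)) ((box n)^[r] P)
            * powI0 (secondSymanzik q (bary x)) (n / 2 + r - ((∑ i, ν i : ℕ) : ℂ))

/-- `B` is the dimensionally regularised amplitude whose parametric representation for
`Re n > 12`, `n ∉ 2ℤ` is `S`: the meromorphic continuation of `S` to all complex dimensions `n`,
with removable singularities removed (and the value `0` at poles).  There is at most one such
`B`. -/
def IsDimRegularised (S B : ℂ → ℂ) : Prop :=
  MeromorphicNFOn B Set.univ ∧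
    ∀ n : ℂ, 12 < n.re → (∀ j : ℤ, n ≠ 2 * (j : ℂ)) → B n = S n

/-! ### Feynman rules of the effective Lagrangian -/

section Rules

variable {d : ℕ} {ι : Type*} [DecidableEq ι] (f : ι → ι → ι → ℝ) (g α : ℝ)

/-- Numerator of the gluon propagator `-i / l² (g_{μν} - (1-α) l_μ l_ν / l²)` over the denominator
`(l²)²`, contracted with `u`; it is diagonal in colour. -/
def gluonProp (l u : LVec d) : LVec d :=
  (C (-Complex.I) : LoopPoly d) • (dot l l • u - (C (1 - (α : ℂ)) * dot l u) • l)

/-- Numerator of the ghost propagator `i / l²`; it is diagonal in colour. -/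
def ghostProp : LoopPoly d := C Complex.I

/-- Three-gluon vertex
`g f^{abc} [g^{μν} (k₁-k₂)^ρ + g^{νρ} (k₂-k₃)^μ + g^{ρμ} (k₃-k₁)^ν]`,
with the indices `μ` and `ν` contracted with `u₁` and `u₂`, and `ρ` left open. -/
def threeGluon (a b c : ι) (k₁ k₂ k₃ u₁ u₂ : LVec d) : LVec d :=
  (C ((g : ℂ) * (f a b c : ℂ)) : LoopPoly d) •
    (dot u₁ u₂ • (k₁ - k₂) + dot (k₂ - k₃) u₁ • u₂ + dot (k₃ - k₁) u₂ • u₁)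

/-- Four-gluon vertex, with the four Lorentz indices contracted with `u₁, ..., u₄`. -/
def fourGluon [Fintype ι] (a b c e : ι) (u₁ u₂ u₃ u₄ : LVec d) : LoopPoly d :=
  C (-Complex.I * (g : ℂ) ^ 2) * ∑ x,
    (C ((f a b x : ℂ) * (f c e x : ℂ)) * (dot u₁ u₃ * dot u₂ u₄ - dot u₁ u₄ * dot u₂ u₃)
      + C ((f a c x : ℂ) * (f b e x : ℂ)) * (dot u₁ u₂ * dot u₃ u₄ - dot u₁ u₄ * dot u₂ u₃)
      + C ((f a e x : ℂ) * (f b c x : ℂ)) * (dot u₁ u₂ * dot u₃ u₄ - dot u₁ u₃ * dot u₂ u₄))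

/-- Ghost-gluon vertex `-g f^{abc} p^μ`, contracted with `u`: the ghost leaves with colour `a` and
outgoing momentum `p`, the gluon has colour `b`, the ghost enters with colour `c`. -/
def ghostGluon (a b c : ι) (p u : LVec d) : LoopPoly d :=
  C (-(g : ℂ) * (f a b c : ℂ)) * dot p u

/-! ### Feynman rules of the operator `O` -/

/-- Two-gluon vertex
`V^{a₁a₂}_{μ₁μ₂}(k₁,k₂) = 1/α δ^{a₁a₂} [k₁_{μ₁} Δ_{μ₂} Δ·k₁ + k₂_{μ₂} Δ_{μ₁} Δ·k₂]`. -/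
def opV (Δ : LVec d) (a₁ a₂ : ι) (k₁ k₂ : LVec d) (r s : Option (Fin (d + 1))) : LoopPoly d :=
  if a₁ = a₂ then
    C ((α : ℂ)⁻¹) * (k₁ r * Δ s * dot Δ k₁ + k₂ s * Δ r * dot Δ k₂)
  else 0

/-- Antighost-ghost vertex `W^{a₁a₂}(k₁,k₂) = δ^{a₁a₂} Δ·k₁ Δ·k₂` (leg 1 is `ξ`, leg 2 is `ω`). -/
def opW (Δ : LVec d) (a₁ a₂ : ι) (k₁ k₂ : LVec d) : LoopPoly d :=
  if a₁ = a₂ then dot Δ k₁ * dot Δ k₂ else 0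

/-- Antighost-ghost-gluon vertex `X^{a₁a₂a₃}_{μ₃} = -i g f^{a₁a₂a₃} Δ·k₁ Δ_{μ₃}` contracted with
`u` (leg 1 is `ξ`, leg 2 is `ω`, leg 3 is the gluon). -/
def opX (Δ : LVec d) (a₁ a₂ a₃ : ι) (k₁ u : LVec d) : LoopPoly d :=
  C (-Complex.I * (g : ℂ) * (f a₁ a₂ a₃ : ℂ)) * (dot Δ k₁ * dot Δ u)

end Rules

/-! ### The matrix element

A gluon `(b, p₂, ε₂)` enters, a gluon `(a, p₁, ε₁)` leaves, and the momentum `Q = p₁ - p₂` flows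
into the operator.  The loop momentum `k` flows from the vertex of gluon 1 to the vertex of
gluon 2; then `l₁ = k + p₁` flows from the operator to the vertex of gluon 1, and `l₂ = k + p₂`
flows from the vertex of gluon 2 into the operator. -/

section Diagrams

variable {d : ℕ} {ι : Type*} [Fintype ι] [DecidableEq ι] (f : ι → ι → ι → ℝ) (g α : ℝ)
  (Δ p₁ p₂ : Fin (d + 1) → ℝ) (ε₁ ε₂ : Fin (d + 1) → ℂ) (a b : ι)

/-- Tree diagram (a): `V^{ab}_{μ₁μ₂}(-p₁,p₂) ε₁^{μ₁} ε₂^{μ₂}`; it does not contain the loop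
momentum, so it is a constant polynomial. -/
def treeElement : ℂ :=
  constantCoeff (contract (opV α (extR Δ) a b (-extR p₁) (extR p₂))
    (fun u v => dot u (ext ε₁) * dot v (ext ε₂)))

/-- Diagram (b), gluon triangle: numerator over `(k²)² (l₁²)² (l₂²)²`. -/
def numB : LoopPoly d :=
  let k : LVec d := loopMom
  let l₁ := k + extR p₁
  let l₂ := k + extR p₂
  ∑ c, ∑ e, ∑ e', contract (opV α (extR Δ) e e' l₂ (-l₁)) (fun u v =>
    dot
      (threeGluon f g b c e (extR p₂) k (-l₂) (ext ε₂)
        (gluonProp α k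
          (threeGluon f g a e' c (-extR p₁) l₁ (-k) (ext ε₁) (gluonProp α l₁ v))))
      (gluonProp α l₂ u))

/-- Diagram (c), gluon bubble with the four-gluon vertex and symmetry factor `1/2`: numerator over
`(l₁²)² (l₂²)²`. -/
def numC : LoopPoly d :=
  let k : LVec d := loopMom
  let l₁ := k + extR p₁
  let l₂ := k + extR p₂
  C (1 / 2) * ∑ e, ∑ e', contract (opV α (extR Δ) e e' l₂ (-l₁)) (fun u v =>
    fourGluon f g a b e e' (ext ε₁) (ext ε₂) (gluonProp α l₂ u) (gluonProp α l₁ v))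

/-- Diagram (d), ghost triangle in which the ghost runs along `l₁, k, l₂`: numerator over
`k² l₁² l₂²`. -/
def numD : LoopPoly d :=
  let k : LVec d := loopMom
  let l₁ := k + extR p₁
  let l₂ := k + extR p₂
  C (-1) * ∑ c, ∑ e, ∑ e', opW (extR Δ) e' e (-l₁) l₂ * ghostProp ^ 3
    * ghostGluon f g c a e' k (ext ε₁) * ghostGluon f g e b c l₂ (ext ε₂)

/-- Diagram (e), ghost triangle with the opposite orientation: numerator over `k² l₁² l₂²`. -/
def numE : LoopPoly d :=
  let k : LVec d := loopMom
  let l₁ := k + extR p₁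
  let l₂ := k + extR p₂
  C (-1) * ∑ c, ∑ e, ∑ e', opW (extR Δ) e e' l₂ (-l₁) * ghostProp ^ 3
    * ghostGluon f g c b e (-k) (ext ε₂) * ghostGluon f g e' a c (-l₁) (ext ε₁)

/-- Diagram (f), ghost bubble with gluon 1 attached to the operator: numerator over `k² l₂²`. -/
def numF : LoopPoly d :=
  let k : LVec d := loopMom
  let l₂ := k + extR p₂
  C (-1) * ∑ c, ∑ e, opX f g (extR Δ) c e a (-k) (ext ε₁) * ghostProp ^ 2
    * ghostGluon f g e b c l₂ (ext ε₂)

/-- Diagram (g), ghost bubble with gluon 2 attached to the operator: numerator over `k² l₁²`. -/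
def numG : LoopPoly d :=
  let k : LVec d := loopMom
  let l₁ := k + extR p₁
  C (-1) * ∑ c, ∑ e, opX f g (extR Δ) e c b (-l₁) (ext ε₂) * ghostProp ^ 2
    * ghostGluon f g c a e k (ext ε₁)

/-- Sum of the one-loop diagrams, `B^{ab}_{μ₁μ₂}(-p₁,p₂) ε₁^{μ₁} ε₂^{μ₂}`, in parametric
representation (for `Re n > 12`, `n ∉ 2ℤ`). -/
def oneLoopSum (n : ℂ) : ℂ :=
  feynmanIntegral ![0, p₁, p₂] ![2, 2, 2] (numB f g α Δ p₁ p₂ ε₁ ε₂ a b) n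
    + feynmanIntegral ![p₁, p₂] ![2, 2] (numC f g α Δ p₁ p₂ ε₁ ε₂ a b) n
    + feynmanIntegral ![0, p₁, p₂] ![1, 1, 1] (numD f g Δ p₁ p₂ ε₁ ε₂ a b) n
    + feynmanIntegral ![0, p₁, p₂] ![1, 1, 1] (numE f g Δ p₁ p₂ ε₁ ε₂ a b) n
    + feynmanIntegral ![0, p₂] ![1, 1] (numF f g Δ p₂ ε₁ ε₂ a b) n
    + feynmanIntegral ![0, p₁] ![1, 1] (numG f g Δ p₁ ε₁ ε₂ a b) n

end Diagrams

end GVOperator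

end

/-!
The tree element vanishes because both terms of the two-gluon vertex are longitudinal in an external
leg.  For the loops, the point is that the operator is BRST-exact: its two-gluon vertex is
longitudinal in one of the two internal gluons.  The propagator of that gluon turns the `1 / α` of
the vertex into a constant, and the Slavnov-Taylor identity for the neighbouring three-gluon vertex
replaces it, up to a term longitudinal in the next gluon, by the difference of the virtuality `m²` of
the external gluon and the inverse propagator of the next gluon.  What is left without a factor `m²`
cancels against the ghost diagrams and the four-gluon diagram, or is odd under the exchange of the
two propagators of a bubble, so that the sum of the one-loop diagrams is `m²` times an explicit
combination of integrals, `massTerms` (`oneLoopSum_eq`).  This proves the massless case.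

The cancellation of propagators is an identity between parametric integrals in `n` dimensions.  In
terms of the quadratic form `F` on the simplex, `(k + q_i)²` is the derivative of `F` along the vector
field that points to the `i`-th vertex, up to terms of higher order in the loop momentum; with the
commutation of powers of the d'Alembertian with `(k + q_i)²` the integrand becomes a total
derivative, and the divergence theorem leaves the integral with one propagator fewer, or the integral
over a face (`feynmanIntegral_propDen_mul`, `feynmanIntegral_contract`).

For `m² → 0` it remains to be shown that `m²` times `massTerms` is small, together with its pole, at
`n = 4`.  All integrals in it are combinations of integrals `∫ x^e (F - i0)^s` over the triangle of
Feynman parameters, and of Beta functions that come from bubbles.  The former have a meromorphic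
continuation in `s` by a recursion in the exponent (`triInt_recursion`, `meromorphic_triMero`).  Their
size is found in conical coordinates with apex at the vertex of the propagator `k²`, where
`F` is, in the ratio `r` of the radial coordinate to its complement, a multiple of `m² + r Q² u (1 - u)`.
Rotating the contour `0 < r < ∞` by a right angle, in the direction that the `i0` prescription
dictates, makes the two terms add in quadrature; this gives absolute convergence, hence holomorphy
near `n = 4`, and a bound by a power of `|m²|` that depends on the exponents `e`
(`exists_holomorphic_triMero`).  For the numerators that occur, the power of `m²` in front of each
integral outweighs this bound (`vanishing_massTerms`).  The loop coefficients contribute at most a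
simple pole at `n = 4`, so Cauchy's estimate bounds both the residue and the finite part.
-/

noncomputable section

namespace GVOperator

open MvPolynomial MeasureTheory Set

/-! ### Colour -/

section Colour

variable {N : ℕ} {ι : Type*} [Fintype ι] [DecidableEq ι]
  {T : ι → Matrix (Fin N) (Fin N) ℂ} {f : ι → ι → ι → ℝ}

theorem IsSUGenerators.trace_commutator_mul (hT : IsSUGenerators T f) (a b c : ι) :
    ((T a * T b - T b * T a) * T c).trace = Complex.I * (f a b c / 2) := by
  rw [hT.commutator, smul_mul_assoc, Matrix.trace_smul, Finset.sum_mul, Matrix.trace_sum]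
  simp [Matrix.trace_smul, hT.normalised, div_eq_mul_inv]

theorem IsSUGenerators.antisymm (hT : IsSUGenerators T f) (a b c : ι) :
    f a b c = -f b a c := by
  have h1 := hT.trace_commutator_mul a b c
  have h2 := hT.trace_commutator_mul b a c
  rw [← neg_sub, neg_mul, Matrix.trace_neg, h1, ← mul_neg] at h2
  have h3 := mul_left_cancel₀ Complex.I_ne_zero h2
  have h4 : (f a b c : ℂ) = ((-f b a c : ℝ) : ℂ) := by
    push_cast
    linear_combination (-2 : ℂ) * h3
  exact_mod_cast h4

theorem IsSUGenerators.cyclic (hT : IsSUGenerators T f) (a b c : ι) :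
    f a b c = f b c a := by
  have h1 := hT.trace_commutator_mul a b c
  have h2 := hT.trace_commutator_mul b c a
  have e1 : (T a * (T b * T c)).trace = (T b * (T c * T a)).trace := by
    rw [Matrix.trace_mul_comm, Matrix.mul_assoc]
  have e2 : (T b * (T a * T c)).trace = (T c * (T b * T a)).trace := by
    rw [← Matrix.mul_assoc, Matrix.trace_mul_comm]
  have h3 : Complex.I * ((f a b c : ℂ) / 2) = Complex.I * (f b c a / 2) := by
    rw [← h1, ← h2]
    simp only [sub_mul, Matrix.trace_sub, Matrix.mul_assoc]
    rw [e1, e2]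
  have h4 := mul_left_cancel₀ Complex.I_ne_zero h3
  have h5 : (f a b c : ℂ) = f b c a := by linear_combination (2 : ℂ) * h4
  exact_mod_cast h5

end Colour

/-! ### Algebra of the numerators -/

section Algebra

variable {d : ℕ}

theorem dot_comm (u v : LVec d) : dot u v = dot v u := by
  unfold dot
  have : ∑ μ, C (eta μ : ℂ) * u (some μ) * v (some μ)
      = ∑ μ, C (eta μ : ℂ) * v (some μ) * u (some μ) :=
    Finset.sum_congr rfl fun μ _ => by ring
  rw [this]
  ring

theorem dot_add_left (u u' v : LVec d) : dot (u + u') v = dot u v + dot u' v := by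
  simp only [dot, Pi.add_apply, mul_add, add_mul, Finset.sum_add_distrib]
  abel

theorem dot_smul_left (c : LoopPoly d) (u v : LVec d) : dot (c • u) v = c * dot u v := by
  have h : ∀ i, (c • u) i = c * u i := fun _ => rfl
  have h₁ : ∑ μ, C (eta μ : ℂ) * X (some μ) * (c * u (some μ))
      = c * ∑ μ, C (eta μ : ℂ) * X (some μ) * u (some μ) := by
    rw [Finset.mul_sum]
    exact Finset.sum_congr rfl fun μ _ => by ring
  have h₂ : ∑ μ, C (eta μ : ℂ) * (c * u (some μ)) * v (some μ)
      = c * ∑ μ, C (eta μ : ℂ) * u (some μ) * v (some μ) := by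
    rw [Finset.mul_sum]
    exact Finset.sum_congr rfl fun μ _ => by ring
  unfold dot
  simp only [h]
  rw [h₁, h₂]
  ring

theorem dot_add_right (u v v' : LVec d) : dot u (v + v') = dot u v + dot u v' := by
  rw [dot_comm, dot_add_left, dot_comm v, dot_comm v']

theorem dot_smul_right (c : LoopPoly d) (u v : LVec d) : dot u (c • v) = c * dot u v := by
  rw [dot_comm, dot_smul_left, dot_comm]

theorem dot_neg_left (u v : LVec d) : dot (-u) v = -dot u v := by
  rw [← neg_one_smul (LoopPoly d), dot_smul_left, neg_one_mul]

theorem dot_neg_right (u v : LVec d) : dot u (-v) = -dot u v := by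
  rw [dot_comm, dot_neg_left, dot_comm]

theorem dot_sub_left (u u' v : LVec d) : dot (u - u') v = dot u v - dot u' v := by
  rw [sub_eq_add_neg, dot_add_left, dot_neg_left, ← sub_eq_add_neg]

theorem dot_sub_right (u v v' : LVec d) : dot u (v - v') = dot u v - dot u v' := by
  rw [dot_comm, dot_sub_left, dot_comm v, dot_comm v']

theorem dot_loopMom_loopMom : dot (loopMom : LVec d) loopMom = X none := by
  simp [dot, loopMom]

theorem dot_ext_ext (u v : Fin (d + 1) → ℂ) :
    dot (ext u) (ext v) = C (∑ μ, (eta μ : ℂ) * u μ * v μ) := by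
  simp [dot, ext, map_sum]

theorem dot_extR_extR (u v : Fin (d + 1) → ℝ) : dot (extR u) (extR v) = C (mdot u v : ℂ) := by
  rw [extR, extR, dot_ext_ext, mdot]
  push_cast
  rfl

theorem dot_ext_extR (u : Fin (d + 1) → ℂ) (v : Fin (d + 1) → ℝ) :
    dot (ext u) (extR v) = C (cdot u v) := by
  rw [extR, dot_ext_ext, cdot]

theorem gluonProp_add (α : ℝ) (l u v : LVec d) :
    gluonProp α l (u + v) = gluonProp α l u + gluonProp α l v := by
  simp only [gluonProp, dot_add_right, ← smul_add]
  congr 1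
  module

theorem gluonProp_smul (α : ℝ) (l u : LVec d) (c : LoopPoly d) :
    gluonProp α l (c • u) = c • gluonProp α l u := by
  simp only [gluonProp, dot_smul_right]
  module

/-- Three-gluon vertex without its coupling constant and its structure constant. -/
def threeGluonTensor (k₁ k₂ k₃ u₁ u₂ : LVec d) : LVec d :=
  dot u₁ u₂ • (k₁ - k₂) + dot (k₂ - k₃) u₁ • u₂ + dot (k₃ - k₁) u₂ • u₁

theorem threeGluon_eq {ι : Type*} (f : ι → ι → ι → ℝ) (g : ℝ) (a b c : ι)
    (k₁ k₂ k₃ u₁ u₂ : LVec d) :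
    threeGluon f g a b c k₁ k₂ k₃ u₁ u₂
      = (C ((g : ℂ) * (f a b c : ℂ)) : LoopPoly d) • threeGluonTensor k₁ k₂ k₃ u₁ u₂ := rfl

theorem threeGluonTensor_add (k₁ k₂ k₃ u₁ u v : LVec d) :
    threeGluonTensor k₁ k₂ k₃ u₁ (u + v)
      = threeGluonTensor k₁ k₂ k₃ u₁ u + threeGluonTensor k₁ k₂ k₃ u₁ v := by
  simp only [threeGluonTensor, dot_add_right]
  module

theorem threeGluonTensor_smul (k₁ k₂ k₃ u₁ u : LVec d) (c : LoopPoly d) :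
    threeGluonTensor k₁ k₂ k₃ u₁ (c • u) = c • threeGluonTensor k₁ k₂ k₃ u₁ u := by
  simp only [threeGluonTensor, dot_smul_right]
  module

/-- A bilinear form contracted with the product of two vectors. -/
theorem sum_mul_bilinear (B : LVec d →ₗ[LoopPoly d] LVec d →ₗ[LoopPoly d] LoopPoly d)
    (u v : LVec d) :
    ∑ r, ∑ s, u r * v s * B (Pi.single r 1) (Pi.single s 1) = B u v := by
  have hu : ∀ w : LVec d, w = ∑ r, w r • (Pi.single r 1 : LVec d) := fun w => by
    funext i
    simp [Finset.sum_apply, Pi.single_apply]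
  conv_rhs => rw [hu u, hu v]
  simp only [map_sum, LinearMap.sum_apply, map_smul, LinearMap.smul_apply, smul_eq_mul,
    Finset.mul_sum]
  rw [Finset.sum_comm]
  refine Finset.sum_congr rfl fun r _ => Finset.sum_congr rfl fun s _ => ?_
  ring

/-- Both terms of the two-gluon vertex are longitudinal in one leg. -/
theorem contract_opV {ι : Type*} [DecidableEq ι] (α : ℝ) (D : LVec d) (a₁ a₂ : ι)
    (k₁ k₂ : LVec d) (B : LVec d →ₗ[LoopPoly d] LVec d →ₗ[LoopPoly d] LoopPoly d) :
    contract (opV α D a₁ a₂ k₁ k₂) (fun u v => B u v)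
      = if a₁ = a₂ then
          C ((α : ℂ)⁻¹) * (dot D k₁ * B k₁ D + dot D k₂ * B D k₂) else 0 := by
  unfold contract opV
  split_ifs with h
  · rw [← sum_mul_bilinear B k₁ D, ← sum_mul_bilinear B D k₂]
    simp only [Finset.mul_sum, ← Finset.sum_add_distrib]
    refine Finset.sum_congr rfl fun r _ => Finset.sum_congr rfl fun s _ => ?_
    ring
  · simp

theorem treeElement_eq_zero {ι : Type*} [DecidableEq ι] (α : ℝ) (Δ p₁ p₂ : Fin (d + 1) → ℝ)
    (ε₁ ε₂ : Fin (d + 1) → ℂ) (a b : ι) (h₁ : cdot ε₁ p₁ = 0) (h₂ : cdot ε₂ p₂ = 0) :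
    treeElement α Δ p₁ p₂ ε₁ ε₂ a b = 0 := by
  have h := contract_opV α (extR Δ) a b (-extR p₁) (extR p₂)
    (LinearMap.mk₂ (LoopPoly d) (fun u v => dot u (ext ε₁) * dot v (ext ε₂))
      (fun u v w => by rw [dot_add_left, add_mul])
      (fun c u v => by rw [dot_smul_left, smul_eq_mul, mul_assoc])
      (fun u v w => by rw [dot_add_left, mul_add])
      (fun c u v => by rw [dot_smul_left, smul_eq_mul, mul_left_comm]))
  simp only [LinearMap.mk₂_apply] at h
  rw [treeElement, h]
  split_ifs with hab
  · rw [dot_comm (-extR p₁) (ext ε₁), dot_neg_right (ext ε₁), dot_ext_extR, h₁,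
      dot_comm (extR p₂) (ext ε₂), dot_ext_extR, h₂]
    simp
  · simp

end Algebra

/-! ### The numerators of the diagrams -/

section Numerators

variable {d : ℕ}

theorem gluonProp_self (α : ℝ) (l : LVec d) :
    gluonProp α l l = (C (-Complex.I * α) * dot l l) • l := by
  simp only [gluonProp, smul_smul, ← sub_smul]
  congr 1
  simp only [map_mul, map_sub, map_neg, map_one]
  ring

theorem dot_gluonProp (α : ℝ) (l u v : LVec d) :
    dot v (gluonProp α l u)
      = C (-Complex.I) * (dot l l * dot v u - C (1 - (α : ℂ)) * (dot l u * dot v l)) := by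
  simp only [gluonProp, dot_smul_right, dot_sub_right]
  ring

/-- Slavnov-Taylor identity of the three-gluon vertex: contracted with the momentum of one leg it
is a difference of inverse propagators of the two other legs. -/
theorem dot_threeGluonTensor_longitudinal (k p e y : LVec d) (he : dot e p = 0) :
    dot (threeGluonTensor p k (-(k + p)) e y) (k + p)
      = (dot p p - dot k k) * dot e y + dot k e * dot k y := by
  simp only [threeGluonTensor, dot_add_left, dot_sub_left, dot_smul_left, dot_add_right,
    dot_neg_left]
  have h1 : dot p e = 0 := by rw [dot_comm, he]
  rw [dot_comm e k, dot_comm y k, dot_comm y p, dot_comm p k, he, h1]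
  ring

/-- The Slavnov-Taylor identity for the leg that carries the loop momentum. -/
theorem dot_loop_threeGluonTensor (k p e w : LVec d) (he : dot e p = 0) :
    dot k (threeGluonTensor (-p) (k + p) (-k) e w)
      = (dot p p - dot (k + p) (k + p)) * dot e w + dot k e * dot (k + p) w := by
  simp only [threeGluonTensor, dot_add_left, dot_sub_left, dot_add_right,
    dot_sub_right, dot_smul_right, dot_neg_left, dot_neg_right]
  have h1 : dot p e = 0 := by rw [dot_comm, he]
  rw [dot_comm p k, h1]
  ring

/-- The Slavnov-Taylor identity for the leg with momentum `k + p`, with the last leg left open. -/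
theorem threeGluonTensor_longitudinal (k p e : LVec d) (he : dot e p = 0) :
    threeGluonTensor (-p) (k + p) (-k) e (k + p)
      = (dot p p - dot k k) • e + dot k e • k := by
  have h1 : dot p e = 0 := by rw [dot_comm, he]
  simp only [threeGluonTensor, dot_add_left, dot_sub_left, dot_add_right,
    dot_neg_left, he, h1]
  rw [dot_comm e k, dot_comm p k]
  module

/-- The three-gluon vertex with momenta `-p`, `k + p`, `-k` contracted with `e`, `v`, `e'`, simplified
for `e · p = 0`. -/
def vertexE (k p e e' v : LVec d) : LoopPoly d :=
  -(dot e v * dot (k + p + p) e') + 2 * (dot k e * dot v e') + dot (p - k) v * dot e e'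

/-- Half of the numerator of the gluon triangle: the term of the operator vertex that is
longitudinal in the gluon `l₂`. -/
def halfTriangle (ξ m : ℂ) (k p₁ p₂ e₁ e₂ D : LVec d) : LoopPoly d :=
  let K := dot k k
  let L₁ := dot (k + p₁) (k + p₁)
  let L₂ := dot (k + p₂) (k + p₂)
  let d₁ := dot D (k + p₁)
  let d₂ := dot D (k + p₂)
  let u₁ := dot k e₁
  let u₂ := dot k e₂
  let Z := L₁ * vertexE k p₁ e₁ e₂ D - C ξ * (d₁ * (u₁ * u₂ + (C m - K) * dot e₁ e₂))
  let Y := C m * (L₁ * dot D e₁ - C ξ * (d₁ * u₁)) - L₁ ^ 2 * dot D e₁ + L₁ * (d₁ * u₁)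
  d₂ * L₂ * (-(C m * (K * Z - C ξ * (Y * u₂))) + K * (K * Z - u₂ * Y))

/-- Half of the numerator of the gluon bubble: the term of the operator vertex that is
longitudinal in the gluon `l₂`. -/
def halfBubble (ξ : ℂ) (k p₁ p₂ e₁ e₂ D : LVec d) : LoopPoly d :=
  let d₁ := dot D (k + p₁)
  let d₂ := dot D (k + p₂)
  C (1 / 2) * (d₂ * dot (k + p₂) (k + p₂) *
    (dot (k + p₁) (k + p₁) * (2 * (dot e₁ e₂ * d₂) - dot D e₁ * dot k e₂
        - dot (k + p₂) e₁ * dot D e₂)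
      - C ξ * (d₁ * (2 * (dot e₁ e₂ * dot (k + p₁) (k + p₂)) - dot k e₁ * dot k e₂
        - dot (k + p₂) e₁ * dot (k + p₁) e₂))))

/-- The colourless gluon triangle as a bilinear form in the two legs of the operator vertex. -/
def triangleForm (α : ℝ) (k p₁ p₂ e₁ e₂ : LVec d) :
    LVec d →ₗ[LoopPoly d] LVec d →ₗ[LoopPoly d] LoopPoly d :=
  LinearMap.mk₂ (LoopPoly d) (fun u v =>
    dot (threeGluonTensor p₂ k (-(k + p₂)) e₂ (gluonProp α k
      (threeGluonTensor (-p₁) (k + p₁) (-k) e₁ (gluonProp α (k + p₁) v))))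
      (gluonProp α (k + p₂) u))
    (fun u v w => by rw [gluonProp_add, dot_add_right])
    (fun c u v => by rw [gluonProp_smul, dot_smul_right, smul_eq_mul])
    (fun u v w => by
      rw [gluonProp_add, threeGluonTensor_add, gluonProp_add, threeGluonTensor_add, dot_add_left])
    (fun c u v => by
      rw [gluonProp_smul, threeGluonTensor_smul, gluonProp_smul, threeGluonTensor_smul,
        dot_smul_left, smul_eq_mul])

theorem triangleForm_apply (α : ℝ) (k p₁ p₂ e₁ e₂ u v : LVec d) :
    triangleForm α k p₁ p₂ e₁ e₂ u v =
      dot (threeGluonTensor p₂ k (-(k + p₂)) e₂ (gluonProp α k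
        (threeGluonTensor (-p₁) (k + p₁) (-k) e₁ (gluonProp α (k + p₁) v))))
        (gluonProp α (k + p₂) u) := rfl

theorem C_I_mul_C_I : (C Complex.I : LoopPoly d) * C Complex.I = -1 := by
  rw [← map_mul, Complex.I_mul_I, map_neg, map_one]

theorem dot_threeGluonTensor_e (k p e e' v : LVec d) (he : dot e p = 0) :
    dot e' (threeGluonTensor (-p) (k + p) (-k) e v) = vertexE k p e e' v := by
  have h1 : dot p e = 0 := by rw [dot_comm, he]
  simp only [threeGluonTensor, vertexE, dot_add_left, dot_sub_left, dot_add_right,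
    dot_sub_right, dot_smul_right, dot_neg_left, dot_neg_right, h1]
  rw [dot_comm e' p, dot_comm e' k, dot_comm e' v, dot_comm e' e]
  ring

theorem vertexE_longitudinal (k p e e' : LVec d) (he : dot e p = 0) :
    vertexE k p e e' (k + p) = dot k e * dot k e' + (dot p p - dot k k) * dot e e' := by
  rw [← dot_threeGluonTensor_e k p e e' _ he, threeGluonTensor_longitudinal k p e he,
    dot_add_right, dot_smul_right, dot_smul_right, dot_comm e' e, dot_comm e' k]
  ring

theorem vertexE_gluonProp (α : ℝ) (k p e e' D : LVec d) (he : dot e p = 0) :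
    vertexE k p e e' (gluonProp α (k + p) D)
      = C (-Complex.I) * (dot (k + p) (k + p) * vertexE k p e e' D
        - C (1 - (α : ℂ)) * (dot D (k + p)
          * (dot k e * dot k e' + (dot p p - dot k k) * dot e e'))) := by
  rw [← vertexE_longitudinal k p e e' he]
  have h : gluonProp α (k + p) D = (C (-Complex.I) * dot (k + p) (k + p)) • D
      - (C (-Complex.I) * (C (1 - (α : ℂ)) * dot D (k + p))) • (k + p) := by
    rw [gluonProp, dot_comm D]
    module
  rw [h]
  generalize k + p = l
  simp only [vertexE, dot_sub_right, dot_smul_right, dot_sub_left _ _ e', dot_smul_left _ _ e']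
  ring

/-- Inserting the term of the operator vertex that is longitudinal in the gluon `l₂`: the propagator
maps `l₂` to `-i α l₂ / l₂²`, so that the gauge parameter cancels the `1 / α` of the operator vertex,
and the Slavnov-Taylor identity applies to the vertex of gluon 2. -/
theorem triangleForm_left (α : ℝ) (m : ℂ) (k p₁ p₂ e₁ e₂ D : LVec d)
    (hp₁ : dot p₁ p₁ = C m) (hp₂ : dot p₂ p₂ = C m) (he₁ : dot e₁ p₁ = 0) (he₂ : dot e₂ p₂ = 0) :
    dot D (k + p₂) * triangleForm α k p₁ p₂ e₁ e₂ (k + p₂) D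
      = C (-Complex.I * α) * halfTriangle (1 - α) m k p₁ p₂ e₁ e₂ D := by
  have h1 : dot e₁ (k + p₁) = dot k e₁ := by rw [dot_add_right, he₁, add_zero, dot_comm]
  have hY : dot k (threeGluonTensor (-p₁) (k + p₁) (-k) e₁ (gluonProp α (k + p₁) D))
      = C (-Complex.I) * (C m * (dot (k + p₁) (k + p₁) * dot D e₁
          - C (1 - (α : ℂ)) * (dot D (k + p₁) * dot k e₁))
        - dot (k + p₁) (k + p₁) ^ 2 * dot D e₁
        + dot (k + p₁) (k + p₁) * (dot D (k + p₁) * dot k e₁)) := by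
    rw [dot_loop_threeGluonTensor k p₁ e₁ _ he₁, dot_gluonProp, dot_gluonProp, hp₁,
      dot_comm (k + p₁) D, h1, dot_comm e₁ D]
    ring
  have hZ := vertexE_gluonProp α k p₁ e₁ e₂ D he₁
  rw [← dot_threeGluonTensor_e k p₁ e₁ e₂ _ he₁, hp₁] at hZ
  rw [triangleForm_apply, gluonProp_self, dot_smul_right,
    dot_threeGluonTensor_longitudinal k p₂ e₂ _ he₂, dot_gluonProp, dot_gluonProp, hY, hZ, hp₂,
    dot_comm e₂ k]
  unfold halfTriangle
  simp only [map_mul, map_sub, map_neg, map_one]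
  have hI := C_I_mul_C_I (d := d)
  generalize dot (k + p₁) (k + p₁) * vertexE k p₁ e₁ e₂ D - (1 - C (α : ℂ)) * (dot D (k + p₁)
    * (dot k e₁ * dot k e₂ + (C m - dot k k) * dot e₁ e₂)) = Z
  generalize C m * (dot (k + p₁) (k + p₁) * dot D e₁
      - (1 - C (α : ℂ)) * (dot D (k + p₁) * dot k e₁)) - dot (k + p₁) (k + p₁) ^ 2 * dot D e₁
        + dot (k + p₁) (k + p₁) * (dot D (k + p₁) * dot k e₁) = Y
  generalize (C Complex.I : LoopPoly d) = J at hI ⊢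
  generalize (C (α : ℂ) : LoopPoly d) = A
  generalize (C m : LoopPoly d) = M
  generalize dot k k = K
  generalize dot k e₂ = u₂
  generalize dot (k + p₂) (k + p₂) = L₂
  generalize dot D (k + p₂) = d₂
  linear_combination (J * A * (d₂ * L₂ * (-(M * (K * Z - (1 - A) * (Y * u₂)))
    + K * (K * Z - u₂ * Y)))) * hI

theorem triangleForm_right (α : ℝ) (m : ℂ) (k p₁ p₂ e₁ e₂ D : LVec d)
    (hp₁ : dot p₁ p₁ = C m) (hp₂ : dot p₂ p₂ = C m) (he₁ : dot e₁ p₁ = 0) (he₂ : dot e₂ p₂ = 0) :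
    dot D (k + p₁) * triangleForm α k p₁ p₂ e₁ e₂ D (k + p₁)
      = C (-Complex.I * α) * halfTriangle (1 - α) m k p₂ p₁ e₂ e₁ D := by
  rw [← triangleForm_left α m k p₂ p₁ e₂ e₁ D hp₂ hp₁ he₂ he₁]
  refine congrArg (dot D (k + p₁) * ·) ?_
  rw [triangleForm_apply, triangleForm_apply]
  have adj : ∀ l u v : LVec d, dot (gluonProp α l u) v = dot u (gluonProp α l v) := fun l u v => by
    rw [dot_comm, dot_gluonProp, dot_gluonProp, dot_comm v u, dot_comm v l, dot_comm l u]
    ring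
  have flip : ∀ p e u v : LVec d, dot (threeGluonTensor p k (-(k + p)) e u) v
      = dot (threeGluonTensor (-p) (k + p) (-k) e v) u := fun p e u v => by
    simp only [threeGluonTensor, dot_add_left, dot_sub_left, dot_smul_left, dot_neg_left]
    rw [dot_comm v u]
    ring
  rw [flip p₂, flip p₁, ← adj, dot_comm]

theorem contract_C_mul (V : Option (Fin (d + 1)) → Option (Fin (d + 1)) → LoopPoly d)
    (c : LoopPoly d) (B : LVec d → LVec d → LoopPoly d) :
    contract V (fun u v => c * B u v) = c * contract V B := by
  unfold contract
  simp only [Finset.mul_sum]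
  refine Finset.sum_congr rfl fun r _ => Finset.sum_congr rfl fun s _ => ?_
  ring

/-- The part of the four-gluon vertex that survives when two legs have the same colour. -/
def bubbleForm (α : ℝ) (k p₁ p₂ e₁ e₂ : LVec d) :
    LVec d →ₗ[LoopPoly d] LVec d →ₗ[LoopPoly d] LoopPoly d :=
  LinearMap.mk₂ (LoopPoly d) (fun u v =>
    2 * (dot e₁ e₂ * dot (gluonProp α (k + p₂) u) (gluonProp α (k + p₁) v))
      - dot e₁ (gluonProp α (k + p₁) v) * dot e₂ (gluonProp α (k + p₂) u)
      - dot e₁ (gluonProp α (k + p₂) u) * dot e₂ (gluonProp α (k + p₁) v))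
    (fun u v w => by simp only [gluonProp_add, dot_add_right, dot_add_left]; ring)
    (fun c u v => by
      simp only [gluonProp_smul, dot_smul_right, dot_smul_left]; rw [smul_eq_mul]; ring)
    (fun u v w => by simp only [gluonProp_add, dot_add_right]; ring)
    (fun c u v => by simp only [gluonProp_smul, dot_smul_right]; rw [smul_eq_mul]; ring)

theorem bubbleForm_apply (α : ℝ) (k p₁ p₂ e₁ e₂ u v : LVec d) :
    bubbleForm α k p₁ p₂ e₁ e₂ u v =
      2 * (dot e₁ e₂ * dot (gluonProp α (k + p₂) u) (gluonProp α (k + p₁) v))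
      - dot e₁ (gluonProp α (k + p₁) v) * dot e₂ (gluonProp α (k + p₂) u)
      - dot e₁ (gluonProp α (k + p₂) u) * dot e₂ (gluonProp α (k + p₁) v) := rfl

theorem bubbleForm_left (α : ℝ) (k p₁ p₂ e₁ e₂ D : LVec d)
    (he₁ : dot e₁ p₁ = 0) (he₂ : dot e₂ p₂ = 0) :
    dot D (k + p₂) * (C (1 / 2) * bubbleForm α k p₁ p₂ e₁ e₂ (k + p₂) D)
      = C (-(α : ℂ)) * halfBubble (1 - α) k p₁ p₂ e₁ e₂ D := by
  have h1 : dot e₁ (k + p₁) = dot k e₁ := by rw [dot_add_right, he₁, add_zero, dot_comm]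
  have h2 : dot e₂ (k + p₂) = dot k e₂ := by rw [dot_add_right, he₂, add_zero, dot_comm]
  rw [bubbleForm_apply, gluonProp_self]
  simp only [dot_smul_left _ (k + p₂), dot_smul_right _ _ (k + p₂), dot_gluonProp]
  unfold halfBubble
  rw [h1, h2, dot_comm e₁ D, dot_comm e₂ D, dot_comm (k + p₁) D, dot_comm (k + p₂) D,
    dot_comm (k + p₂) (k + p₁), dot_comm (k + p₂) e₁, dot_comm (k + p₁) e₂]
  simp only [map_mul, map_sub, map_neg, map_one]
  have hI := C_I_mul_C_I (d := d)
  generalize (C Complex.I : LoopPoly d) = J at hI ⊢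
  generalize (C (α : ℂ) : LoopPoly d) = A
  generalize (C (1 / 2) : LoopPoly d) = H
  generalize dot (k + p₁) (k + p₁) = L₁
  generalize dot (k + p₂) (k + p₂) = L₂
  generalize dot (k + p₁) (k + p₂) = L₃
  generalize dot D (k + p₁) = d₁
  generalize dot D (k + p₂) = d₂
  generalize dot k e₁ = u₁
  generalize dot k e₂ = u₂
  generalize dot e₁ (k + p₂) = v₁
  generalize dot e₂ (k + p₁) = v₂
  generalize dot D e₁ = t₁
  generalize dot D e₂ = t₂
  generalize dot e₁ e₂ = s
  linear_combination (A * (H * (d₂ * L₂ *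
    (L₁ * (2 * (s * d₂) - t₁ * u₂ - v₁ * t₂)
      - (1 - A) * (d₁ * (2 * (s * L₃) - u₁ * u₂ - v₁ * v₂)))))) * hI

theorem bubbleForm_right (α : ℝ) (k p₁ p₂ e₁ e₂ D : LVec d)
    (he₁ : dot e₁ p₁ = 0) (he₂ : dot e₂ p₂ = 0) :
    dot D (k + p₁) * (C (1 / 2) * bubbleForm α k p₁ p₂ e₁ e₂ D (k + p₁))
      = C (-(α : ℂ)) * halfBubble (1 - α) k p₂ p₁ e₂ e₁ D := by
  rw [← bubbleForm_left α k p₂ p₁ e₂ e₁ D he₂ he₁, bubbleForm_apply, bubbleForm_apply,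
    dot_comm e₂ e₁, dot_comm (gluonProp α (k + p₁) (k + p₁))]
  ring

theorem sum_ite_sum {ι : Type*} [Fintype ι] [DecidableEq ι] {M : Type*} [AddCommMonoid M]
    (F : ι → ι → M) : ∑ e, ∑ e', (if e = e' then F e e' else 0) = ∑ e, F e e := by
  simp

variable {N : ℕ} {ι : Type*} [Fintype ι] [DecidableEq ι]
  {T : ι → Matrix (Fin N) (Fin N) ℂ} {f : ι → ι → ι → ℝ}

/-- The colour factor `f^{ace} f^{bce}` shared by all one-loop diagrams. -/
def colourFactor (f : ι → ι → ι → ℝ) (a b : ι) : ℂ :=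
  ∑ c, ∑ e, (f a c e : ℂ) * (f b c e : ℂ)

/-- The numerator of the gluon triangle: the colour factor, and one half for each of the two
longitudinal terms of the operator vertex. -/
theorem numB_eq (hT : IsSUGenerators T f) (g α : ℝ) (hα : α ≠ 0) (m2 : ℝ)
    (Δ p₁ p₂ : Fin (d + 1) → ℝ) (ε₁ ε₂ : Fin (d + 1) → ℂ) (a b : ι)
    (hp₁ : mdot p₁ p₁ = m2) (hp₂ : mdot p₂ p₂ = m2)
    (h₁ : cdot ε₁ p₁ = 0) (h₂ : cdot ε₂ p₂ = 0) :
    numB f g α Δ p₁ p₂ ε₁ ε₂ a b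
      = C (Complex.I * g ^ 2 * colourFactor f a b) *
        (halfTriangle (1 - α) m2 loopMom (extR p₁) (extR p₂) (ext ε₁) (ext ε₂) (extR Δ)
          + halfTriangle (1 - α) m2 loopMom (extR p₂) (extR p₁) (ext ε₂) (ext ε₁) (extR Δ)) := by
  have hp₁' : dot (extR p₁) (extR p₁) = C (m2 : ℂ) := by rw [dot_extR_extR, hp₁]
  have hp₂' : dot (extR p₂) (extR p₂) = C (m2 : ℂ) := by rw [dot_extR_extR, hp₂]
  have h₁' : dot (ext ε₁) (extR p₁) = 0 := by rw [dot_ext_extR, h₁, map_zero]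
  have h₂' : dot (ext ε₂) (extR p₂) = 0 := by rw [dot_ext_extR, h₂, map_zero]
  have hl := triangleForm_left α m2 loopMom _ _ _ _ (extR Δ) hp₁' hp₂' h₁' h₂'
  have hr := triangleForm_right α m2 loopMom _ _ _ _ (extR Δ) hp₁' hp₂' h₁' h₂'
  unfold numB
  simp only [threeGluon_eq, dot_smul_left, gluonProp_smul, threeGluonTensor_smul]
  simp only [← triangleForm_apply]
  have key : ∀ c e e' : ι, contract (opV α (extR Δ) e e' (loopMom + extR p₂)
      (-(loopMom + extR p₁))) (fun u v => C ((g : ℂ) * (f b c e : ℂ)) *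
        (C ((g : ℂ) * (f a e' c : ℂ)) *
          triangleForm α loopMom (extR p₁) (extR p₂) (ext ε₁) (ext ε₂) u v))
      = if e = e' then C (Complex.I * g ^ 2 * ((f a c e : ℂ) * (f b c e : ℂ))) *
        (halfTriangle (1 - α) m2 loopMom (extR p₁) (extR p₂) (ext ε₁) (ext ε₂) (extR Δ)
          + halfTriangle (1 - α) m2 loopMom (extR p₂) (extR p₁) (ext ε₂) (ext ε₁) (extR Δ))
        else 0 := by
    intro c e e'
    rw [contract_C_mul, contract_C_mul, contract_opV]
    split_ifs with h
    · subst h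
      have hc : f a e c = -f a c e := by rw [hT.cyclic a e c, hT.antisymm e c a, ← hT.cyclic a c e]
      rw [map_neg (triangleForm α loopMom (extR p₁) (extR p₂) (ext ε₁) (ext ε₂) (extR Δ)),
        dot_neg_right, neg_mul_neg, hl, hr, ← mul_add, hc, ← mul_assoc, ← mul_assoc, ← mul_assoc,
        ← map_mul, ← map_mul, ← map_mul]
      congr 2
      have : (α : ℂ) ≠ 0 := by exact_mod_cast hα
      push_cast
      field_simp
    · simp
  simp only [key, sum_ite_sum, ← Finset.sum_mul, ← map_sum]
  congr 2
  simp only [colourFactor, Finset.mul_sum]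

theorem numC_eq (hT : IsSUGenerators T f) (g α : ℝ) (hα : α ≠ 0)
    (Δ p₁ p₂ : Fin (d + 1) → ℝ) (ε₁ ε₂ : Fin (d + 1) → ℂ) (a b : ι)
    (h₁ : cdot ε₁ p₁ = 0) (h₂ : cdot ε₂ p₂ = 0) :
    numC f g α Δ p₁ p₂ ε₁ ε₂ a b
      = C (Complex.I * g ^ 2 * colourFactor f a b) *
        (halfBubble (1 - α) loopMom (extR p₁) (extR p₂) (ext ε₁) (ext ε₂) (extR Δ)
          + halfBubble (1 - α) loopMom (extR p₂) (extR p₁) (ext ε₂) (ext ε₁) (extR Δ)) := by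
  have h₁' : dot (ext ε₁) (extR p₁) = 0 := by rw [dot_ext_extR, h₁, map_zero]
  have h₂' : dot (ext ε₂) (extR p₂) = 0 := by rw [dot_ext_extR, h₂, map_zero]
  have hl := bubbleForm_left α loopMom _ _ _ _ (extR Δ) h₁' h₂'
  have hr := bubbleForm_right α loopMom _ _ _ _ (extR Δ) h₁' h₂'
  have hff : ∀ e x, f e e x = 0 := fun e x => by linarith [hT.antisymm e e x]
  have h4 : ∀ (e : ι) (u v : LVec d), fourGluon f g a b e e (ext ε₁) (ext ε₂)
        (gluonProp α (loopMom + extR p₂) u) (gluonProp α (loopMom + extR p₁) v)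
      = C (-Complex.I * g ^ 2 * ∑ x, (f a e x : ℂ) * (f b e x : ℂ)) *
        bubbleForm α loopMom (extR p₁) (extR p₂) (ext ε₁) (ext ε₂) u v := by
    intro e u v
    rw [bubbleForm_apply, fourGluon, map_mul C (-Complex.I * (g : ℂ) ^ 2) (∑ x, _),
      mul_assoc, map_sum, Finset.sum_mul]
    refine congrArg (_ * ·) (Finset.sum_congr rfl fun x _ => ?_)
    rw [hff]
    simp only [Complex.ofReal_zero, mul_zero, map_zero, zero_mul, zero_add]
    ring
  have key : ∀ e e' : ι, contract (opV α (extR Δ) e e' (loopMom + extR p₂)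
      (-(loopMom + extR p₁))) (fun u v => fourGluon f g a b e e' (ext ε₁) (ext ε₂)
        (gluonProp α (loopMom + extR p₂) u) (gluonProp α (loopMom + extR p₁) v))
      = if e = e' then C (Complex.I * g ^ 2 * ∑ x, (f a e x : ℂ) * (f b e x : ℂ)) * (C 2 *
        (halfBubble (1 - α) loopMom (extR p₁) (extR p₂) (ext ε₁) (ext ε₂) (extR Δ)
          + halfBubble (1 - α) loopMom (extR p₂) (extR p₁) (ext ε₂) (ext ε₁) (extR Δ))) else 0 := by
    intro e e'
    split_ifs with h
    · subst h
      simp only [h4]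
      rw [contract_C_mul, contract_opV, if_pos rfl,
        map_neg (bubbleForm α loopMom (extR p₁) (extR p₂) (ext ε₁) (ext ε₂) (extR Δ)),
        dot_neg_right, neg_mul_neg]
      have e1 : ∀ x : LoopPoly d, x = C 2 * (C (1 / 2) * x) := fun x => by
        rw [← mul_assoc, ← map_mul]; norm_num
      have hl' := e1 (dot (extR Δ) (loopMom + extR p₂) * bubbleForm α loopMom (extR p₁) (extR p₂)
        (ext ε₁) (ext ε₂) (loopMom + extR p₂) (extR Δ))
      have hr' := e1 (dot (extR Δ) (loopMom + extR p₁) * bubbleForm α loopMom (extR p₁) (extR p₂)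
        (ext ε₁) (ext ε₂) (extR Δ) (loopMom + extR p₁))
      rw [mul_left_comm (C (1 / 2)), hl] at hl'
      rw [mul_left_comm (C (1 / 2)), hr] at hr'
      rw [hl', hr', ← mul_add, ← mul_add, mul_left_comm (C 2) (C (-(α : ℂ))), ← mul_assoc,
        ← mul_assoc, ← map_mul, ← map_mul]
      refine congrArg (C · * _) ?_
      have : (α : ℂ) ≠ 0 := by exact_mod_cast hα
      field_simp
    · simp [contract, opV, h]
  unfold numC
  simp only [key, sum_ite_sum, ← Finset.sum_mul, ← map_sum]
  rw [mul_left_comm, ← mul_assoc (C (1 / 2)) (C 2), ← map_mul,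
    show (1 / 2 : ℂ) * 2 = 1 by norm_num, map_one, one_mul]
  refine congrArg (C · * _) ?_
  simp only [colourFactor, Finset.mul_sum]

theorem numD_eq (hT : IsSUGenerators T f) (g : ℝ)
    (Δ p₁ p₂ : Fin (d + 1) → ℝ) (ε₁ ε₂ : Fin (d + 1) → ℂ) (a b : ι)
    (h₂ : cdot ε₂ p₂ = 0) :
    numD f g Δ p₁ p₂ ε₁ ε₂ a b
      = C (Complex.I * g ^ 2 * colourFactor f a b) *
        (dot (extR Δ) (loopMom + extR p₁) * dot (extR Δ) (loopMom + extR p₂)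
          * (dot loopMom (ext ε₁) * dot loopMom (ext ε₂))) := by
  have h₂' : dot (extR p₂) (ext ε₂) = 0 := by rw [dot_comm, dot_ext_extR, h₂, map_zero]
  have key : ∀ c e e' : ι, opW (extR Δ) e' e (-(loopMom + extR p₁)) (loopMom + extR p₂)
      * ghostProp ^ 3 * ghostGluon f g c a e' loopMom (ext ε₁)
      * ghostGluon f g e b c (loopMom + extR p₂) (ext ε₂)
      = if e = e' then C (Complex.I * g ^ 2 * ((f a c e : ℂ) * (f b c e : ℂ))) *
        (-(dot (extR Δ) (loopMom + extR p₁) * dot (extR Δ) (loopMom + extR p₂)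
          * (dot loopMom (ext ε₁) * dot loopMom (ext ε₂)))) else 0 := by
    intro c e e'
    unfold opW
    by_cases h : e = e'
    · subst h
      rw [if_pos rfl, if_pos rfl, ghostGluon, ghostGluon, ghostProp, dot_neg_right,
        dot_add_left loopMom (extR p₂) (ext ε₂), h₂', add_zero]
      have hc : f c a e = -f a c e := hT.antisymm c a e
      have hc' : f e b c = f b c e := hT.cyclic e b c
      rw [hc, hc']
      have hI : (C Complex.I : LoopPoly d) ^ 3 = -C Complex.I := by
        rw [← map_pow, Complex.I_pow_three, map_neg]
      rw [hI]
      push_cast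
      simp only [map_mul, map_neg, map_pow]
      ring
    · rw [if_neg h, if_neg (fun h' => h h'.symm)]
      simp
  unfold numD
  simp only [key, sum_ite_sum, ← Finset.sum_mul, ← map_sum]
  simp only [colourFactor, ← Finset.mul_sum, map_neg, map_one]
  ring

theorem numE_eq (hT : IsSUGenerators T f) (g : ℝ)
    (Δ p₁ p₂ : Fin (d + 1) → ℝ) (ε₁ ε₂ : Fin (d + 1) → ℂ) (a b : ι)
    (h₁ : cdot ε₁ p₁ = 0) :
    numE f g Δ p₁ p₂ ε₁ ε₂ a b
      = C (Complex.I * g ^ 2 * colourFactor f a b) *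
        (dot (extR Δ) (loopMom + extR p₁) * dot (extR Δ) (loopMom + extR p₂)
          * (dot loopMom (ext ε₁) * dot loopMom (ext ε₂))) := by
  have h₁' : dot (extR p₁) (ext ε₁) = 0 := by rw [dot_comm, dot_ext_extR, h₁, map_zero]
  have key : ∀ c e e' : ι, opW (extR Δ) e e' (loopMom + extR p₂) (-(loopMom + extR p₁))
      * ghostProp ^ 3 * ghostGluon f g c b e (-loopMom) (ext ε₂)
      * ghostGluon f g e' a c (-(loopMom + extR p₁)) (ext ε₁)
      = if e = e' then C (Complex.I * g ^ 2 * ((f a c e : ℂ) * (f b c e : ℂ))) *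
        (-(dot (extR Δ) (loopMom + extR p₁) * dot (extR Δ) (loopMom + extR p₂)
          * (dot loopMom (ext ε₁) * dot loopMom (ext ε₂)))) else 0 := by
    intro c e e'
    unfold opW
    by_cases h : e = e'
    · subst h
      rw [if_pos rfl, if_pos rfl, ghostGluon, ghostGluon, ghostProp, dot_neg_right, dot_neg_left,
        dot_neg_left, dot_add_left loopMom (extR p₁) (ext ε₁), h₁', add_zero]
      have hc : f c b e = -f b c e := hT.antisymm c b e
      have hc' : f e a c = f a c e := hT.cyclic e a c
      rw [hc, hc']
      have hI : (C Complex.I : LoopPoly d) ^ 3 = -C Complex.I := by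
        rw [← map_pow, Complex.I_pow_three, map_neg]
      rw [hI]
      push_cast
      simp only [map_mul, map_neg, map_pow]
      ring
    · rw [if_neg h, if_neg h]
      simp
  unfold numE
  simp only [key, sum_ite_sum, ← Finset.sum_mul, ← map_sum]
  simp only [colourFactor, ← Finset.mul_sum, map_neg, map_one]
  ring

theorem numF_eq (hT : IsSUGenerators T f) (g : ℝ)
    (Δ p₂ : Fin (d + 1) → ℝ) (ε₁ ε₂ : Fin (d + 1) → ℂ) (a b : ι)
    (h₂ : cdot ε₂ p₂ = 0) :
    numF f g Δ p₂ ε₁ ε₂ a b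
      = C (Complex.I * g ^ 2 * colourFactor f a b) *
        (-(dot (extR Δ) loopMom * dot (extR Δ) (ext ε₁) * dot loopMom (ext ε₂))) := by
  have h₂' : dot (extR p₂) (ext ε₂) = 0 := by rw [dot_comm, dot_ext_extR, h₂, map_zero]
  have key : ∀ c e : ι, opX f g (extR Δ) c e a (-loopMom) (ext ε₁) * ghostProp ^ 2
      * ghostGluon f g e b c (loopMom + extR p₂) (ext ε₂)
      = C (Complex.I * g ^ 2 * ((f a c e : ℂ) * (f b c e : ℂ))) *
        (dot (extR Δ) loopMom * dot (extR Δ) (ext ε₁) * dot loopMom (ext ε₂)) := by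
    intro c e
    rw [opX, ghostGluon, ghostProp, dot_neg_right,
      dot_add_left loopMom (extR p₂) (ext ε₂), h₂', add_zero]
    have hc : f c e a = f a c e := (hT.cyclic a c e).symm
    have hc' : f e b c = f b c e := hT.cyclic e b c
    rw [hc, hc', pow_two (C Complex.I), C_I_mul_C_I]
    simp only [map_mul, map_neg, map_pow]
    ring
  unfold numF
  simp only [key, ← Finset.sum_mul, ← map_sum]
  simp only [colourFactor, ← Finset.mul_sum, map_neg, map_one]
  ring

theorem numG_eq (hT : IsSUGenerators T f) (g : ℝ)
    (Δ p₁ : Fin (d + 1) → ℝ) (ε₁ ε₂ : Fin (d + 1) → ℂ) (a b : ι) :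
    numG f g Δ p₁ ε₁ ε₂ a b
      = C (Complex.I * g ^ 2 * colourFactor f a b) *
        (-(dot (extR Δ) (loopMom + extR p₁) * dot (extR Δ) (ext ε₂) * dot loopMom (ext ε₁))) := by
  have key : ∀ c e : ι, opX f g (extR Δ) e c b (-(loopMom + extR p₁)) (ext ε₂) * ghostProp ^ 2
      * ghostGluon f g c a e loopMom (ext ε₁)
      = C (Complex.I * g ^ 2 * ((f a c e : ℂ) * (f b c e : ℂ))) *
        (dot (extR Δ) (loopMom + extR p₁) * dot (extR Δ) (ext ε₂) * dot loopMom (ext ε₁)) := by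
    intro c e
    rw [opX, ghostGluon, ghostProp, dot_neg_right]
    have hc : f e c b = -f b c e := by rw [hT.antisymm e c b, hT.cyclic b c e]
    have hc' : f c a e = -f a c e := hT.antisymm c a e
    rw [hc, hc', pow_two (C Complex.I), C_I_mul_C_I]
    push_cast
    simp only [map_mul, map_neg, map_pow]
    ring
  unfold numG
  simp only [key, ← Finset.sum_mul, ← map_sum]
  simp only [colourFactor, ← Finset.mul_sum, map_neg, map_one]
  ring

end Numerators

/-! ### The d'Alembertian on polynomials in the loop momentum -/

section Box

variable {d : ℕ}

theorem pderiv_comm {σ : Type*} (i j : σ) (P : MvPolynomial σ ℂ) :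
    pderiv i (pderiv j P) = pderiv j (pderiv i P) := by
  classical
  have h : ⁅(pderiv (R := ℂ) i), (pderiv (R := ℂ) j)⁆ = 0 := by
    refine MvPolynomial.derivation_ext fun l => ?_
    rw [Derivation.commutator_apply, pderiv_X, pderiv_X]
    simp only [Pi.single_apply]
    split_ifs <;> simp
  have h' := congrArg (fun D => D P) h
  rw [Derivation.commutator_apply] at h'
  exact sub_eq_zero.mp h'

theorem box_add (n : ℂ) (P Q : LoopPoly d) : box n (P + Q) = box n P + box n Q := by
  simp only [box, map_add, mul_add, Finset.sum_add_distrib]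
  abel

theorem box_C_mul (n c : ℂ) (P : LoopPoly d) : box n (C c * P) = C c * box n P := by
  have h : ∀ i, pderiv i (C c * P) = C c * pderiv i P := fun i => pderiv_C_mul
  have h2 : ∀ i j, pderiv i (C c * pderiv j P) = C c * pderiv i (pderiv j P) :=
    fun i j => pderiv_C_mul
  have e1 : ∑ μ, X (some μ) * (C c * pderiv (some μ) (pderiv none P))
      = C c * ∑ μ, X (some μ) * pderiv (some μ) (pderiv none P) := by
    rw [Finset.mul_sum]
    exact Finset.sum_congr rfl fun μ _ => mul_left_comm _ _ _
  have e2 : ∑ μ, C (eta μ : ℂ) * (C c * pderiv (some μ) (pderiv (some μ) P))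
      = C c * ∑ μ, C (eta μ : ℂ) * pderiv (some μ) (pderiv (some μ) P) := by
    rw [Finset.mul_sum]
    exact Finset.sum_congr rfl fun μ _ => mul_left_comm _ _ _
  simp only [box, h, h2]
  rw [e1, e2]
  ring

theorem box_zero (n : ℂ) : box n (0 : LoopPoly d) = 0 := by
  simp [box]

theorem box_sum {ι : Type*} (n : ℂ) (s : Finset ι) (P : ι → LoopPoly d) :
    box n (∑ i ∈ s, P i) = ∑ i ∈ s, box n (P i) := by
  classical
  induction s using Finset.induction_on with
  | empty => simp [box_zero]
  | insert i s hi ih => rw [Finset.sum_insert hi, Finset.sum_insert hi, box_add, ih]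

theorem iterate_box_add (n : ℂ) (r : ℕ) (P Q : LoopPoly d) :
    (box n)^[r] (P + Q) = (box n)^[r] P + (box n)^[r] Q := by
  induction r generalizing P Q with
  | zero => rfl
  | succ r ih => simp only [Function.iterate_succ_apply, box_add, ih]

theorem iterate_box_C_mul (n c : ℂ) (r : ℕ) (P : LoopPoly d) :
    (box n)^[r] (C c * P) = C c * (box n)^[r] P := by
  induction r generalizing P with
  | zero => rfl
  | succ r ih => simp only [Function.iterate_succ_apply, box_C_mul, ih]

theorem iterate_box_zero (n : ℂ) (r : ℕ) : (box n)^[r] (0 : LoopPoly d) = 0 := by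
  induction r with
  | zero => rfl
  | succ r ih => rw [Function.iterate_succ_apply, box_zero, ih]

/-- The bilinear form `∂P · ∂Q` that measures the failure of `□` to be a derivation. -/
def gradForm (P Q : LoopPoly d) : LoopPoly d :=
  4 * X none * (pderiv none P * pderiv none Q)
    + 2 * ∑ μ, X (some μ) * (pderiv (some μ) P * pderiv none Q + pderiv none P * pderiv (some μ) Q)
    + ∑ μ, C (eta μ : ℂ) * (pderiv (some μ) P * pderiv (some μ) Q)

theorem box_mul (n : ℂ) (P Q : LoopPoly d) :
    box n (P * Q) = box n P * Q + P * box n Q + 2 * gradForm P Q := by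
  have h : ∀ i, pderiv i (P * Q) = pderiv i P * Q + P * pderiv i Q := fun i => pderiv_mul
  have h2 : ∀ i j, pderiv i (pderiv j (P * Q)) = pderiv i (pderiv j P) * Q
      + pderiv j P * pderiv i Q + pderiv i P * pderiv j Q + P * pderiv i (pderiv j Q) := by
    intro i j
    rw [h, map_add, pderiv_mul, pderiv_mul]
    ring
  have e1 : ∑ μ, X (some μ) * pderiv (some μ) (pderiv none (P * Q))
      = (∑ μ, X (some μ) * pderiv (some μ) (pderiv none P)) * Q
        + P * (∑ μ, X (some μ) * pderiv (some μ) (pderiv none Q))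
        + ∑ μ, X (some μ) * (pderiv (some μ) P * pderiv none Q
          + pderiv none P * pderiv (some μ) Q) := by
    rw [Finset.sum_mul, Finset.mul_sum, ← Finset.sum_add_distrib, ← Finset.sum_add_distrib]
    exact Finset.sum_congr rfl fun μ _ => by rw [h2]; ring
  have e2 : ∑ μ, C (eta μ : ℂ) * pderiv (some μ) (pderiv (some μ) (P * Q))
      = (∑ μ, C (eta μ : ℂ) * pderiv (some μ) (pderiv (some μ) P)) * Q
        + P * (∑ μ, C (eta μ : ℂ) * pderiv (some μ) (pderiv (some μ) Q))
        + 2 * ∑ μ, C (eta μ : ℂ) * (pderiv (some μ) P * pderiv (some μ) Q) := by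
    rw [Finset.sum_mul, Finset.mul_sum, Finset.mul_sum, ← Finset.sum_add_distrib,
      ← Finset.sum_add_distrib]
    exact Finset.sum_congr rfl fun μ _ => by rw [h2]; ring
  unfold box gradForm
  rw [e1, e2, h2, h]
  ring

/-- The derivation `(k + q) · ∂` on polynomials in `k²` and `k^μ`. -/
def eulerOp (q : Fin (d + 1) → ℝ) (P : LoopPoly d) : LoopPoly d :=
  ∑ μ, (X (some μ) + C (q μ : ℂ)) * pderiv (some μ) P
    + (2 * X none + 2 * ∑ μ, C (eta μ : ℂ) * X (some μ) * C (q μ : ℂ)) * pderiv none P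

/-- The inverse propagator `(k + q)²`. -/
def propDen (q : Fin (d + 1) → ℝ) : LoopPoly d :=
  dot (loopMom + extR q) (loopMom + extR q)

theorem propDen_eq (q : Fin (d + 1) → ℝ) :
    propDen q = X none + 2 * ∑ μ, C (eta μ : ℂ) * X (some μ) * C (q μ : ℂ)
      + C (mdot q q : ℂ) := by
  unfold propDen
  rw [dot_add_left, dot_add_right, dot_add_right, dot_loopMom_loopMom, dot_comm (extR q) loopMom,
    dot_extR_extR]
  have : dot (loopMom : LVec d) (extR q) = ∑ μ, C (eta μ : ℂ) * X (some μ) * C (q μ : ℂ) := by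
    simp [dot, loopMom, extR, ext]
  rw [this]
  ring

theorem pderiv_some_sum (c : Fin (d + 1) → ℂ) (ν : Fin (d + 1)) :
    pderiv (some ν) (∑ μ, C (eta μ : ℂ) * X (some μ) * C (c μ) : LoopPoly d)
      = C (eta ν : ℂ) * C (c ν) := by
  rw [map_sum, Finset.sum_eq_single ν]
  · simp [mul_comm]
  · intro μ _ h
    have : pderiv (some ν) (X (some μ) : LoopPoly d) = 0 :=
      pderiv_X_of_ne (fun h' => h (Option.some.inj h'))
    simp [this]
  · simp

theorem pderiv_none_sum (c : Fin (d + 1) → ℂ) :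
    pderiv none (∑ μ, C (eta μ : ℂ) * X (some μ) * C (c μ) : LoopPoly d) = 0 := by
  rw [map_sum]
  refine Finset.sum_eq_zero fun μ _ => ?_
  have : pderiv none (X (some μ) : LoopPoly d) = 0 := pderiv_X_of_ne (by simp)
  simp [this]

theorem pderiv_none_propDen (q : Fin (d + 1) → ℝ) : pderiv none (propDen q) = 1 := by
  rw [propDen_eq, map_add, map_add, two_mul, map_add, pderiv_none_sum]
  simp

theorem pderiv_some_propDen (q : Fin (d + 1) → ℝ) (μ : Fin (d + 1)) :
    pderiv (some μ) (propDen q) = 2 * (C (eta μ : ℂ) * C (q μ : ℂ)) := by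
  rw [propDen_eq, map_add, map_add, two_mul, map_add, pderiv_some_sum (fun μ => (q μ : ℂ)),
    pderiv_X_of_ne (by simp : (none : Option (Fin (d + 1))) ≠ some μ)]
  simp [two_mul]

theorem eta_mul_eta (μ : Fin (d + 1)) : (C (eta μ : ℂ) * C (eta μ : ℂ) : LoopPoly d) = 1 := by
  rw [← map_mul, ← Complex.ofReal_mul]
  unfold eta
  split_ifs <;> simp

theorem gradForm_propDen (q : Fin (d + 1) → ℝ) (P : LoopPoly d) :
    gradForm (propDen q) P = 2 * eulerOp q P := by
  have e1 : ∑ μ, X (some μ) * (pderiv (some μ) (propDen q) * pderiv none P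
        + pderiv none (propDen q) * pderiv (some μ) P)
      = 2 * ((∑ μ, C (eta μ : ℂ) * X (some μ) * C (q μ : ℂ)) * pderiv none P)
        + ∑ μ, X (some μ) * pderiv (some μ) P := by
    rw [Finset.sum_mul, Finset.mul_sum, ← Finset.sum_add_distrib]
    refine Finset.sum_congr rfl fun μ _ => ?_
    rw [pderiv_some_propDen, pderiv_none_propDen]
    ring
  have e2 : ∑ μ, C (eta μ : ℂ) * (pderiv (some μ) (propDen q) * pderiv (some μ) P)
      = 2 * ∑ μ, C (q μ : ℂ) * pderiv (some μ) P := by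
    rw [Finset.mul_sum]
    refine Finset.sum_congr rfl fun μ _ => ?_
    rw [pderiv_some_propDen]
    linear_combination (2 * C (q μ : ℂ) * pderiv (some μ) P) * eta_mul_eta (d := d) μ
  have e3 : ∑ μ, (X (some μ) + C (q μ : ℂ)) * pderiv (some μ) P
      = ∑ μ, X (some μ) * pderiv (some μ) P + ∑ μ, C (q μ : ℂ) * pderiv (some μ) P := by
    rw [← Finset.sum_add_distrib]
    exact Finset.sum_congr rfl fun μ _ => by ring
  unfold gradForm eulerOp
  rw [e1, e2, e3, pderiv_none_propDen]
  ring

theorem box_propDen (n : ℂ) (q : Fin (d + 1) → ℝ) : box n (propDen q) = C (2 * n) := by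
  have h : ∀ μ ν : Fin (d + 1), pderiv (some ν) (2 * (C (eta μ : ℂ) * C (q μ : ℂ)) : LoopPoly d)
      = 0 := fun μ ν => by
    rw [← map_mul, two_mul, map_add, pderiv_C, add_zero]
  simp [box, pderiv_none_propDen, pderiv_some_propDen, h]

theorem box_propDen_mul (n : ℂ) (q : Fin (d + 1) → ℝ) (P : LoopPoly d) :
    box n (propDen q * P) = propDen q * box n P + 4 * eulerOp q P + C (2 * n) * P := by
  rw [box_mul, box_propDen, gradForm_propDen]
  ring

theorem box_pderiv_some (n : ℂ) (μ : Fin (d + 1)) (P : LoopPoly d) :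
    pderiv (some μ) (box n P) = box n (pderiv (some μ) P)
      + 4 * pderiv (some μ) (pderiv none P) := by
  have e1 : pderiv (some μ) (∑ ν, X (some ν) * pderiv (some ν) (pderiv none P))
      = ∑ ν, X (some ν) * pderiv (some ν) (pderiv none (pderiv (some μ) P))
        + pderiv (some μ) (pderiv none P) := by
    have : ∀ ν, pderiv (some μ) (X (some ν) * pderiv (some ν) (pderiv none P))
        = X (some ν) * pderiv (some ν) (pderiv none (pderiv (some μ) P))
          + if ν = μ then pderiv (some μ) (pderiv none P) else 0 := by
      intro ν
      rw [pderiv_mul, pderiv_comm (some μ) (some ν), pderiv_comm (some μ) none P]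
      split_ifs with h
      · subst h
        rw [pderiv_X_self, one_mul, pderiv_comm none (some ν) P]
        ring
      · rw [pderiv_X_of_ne (fun h' => h (Option.some.inj h'))]
        ring
    rw [map_sum, Finset.sum_congr rfl fun ν _ => this ν, Finset.sum_add_distrib]
    simp
  have e2 : pderiv (some μ) (∑ ν, C (eta ν : ℂ) * pderiv (some ν) (pderiv (some ν) P))
      = ∑ ν, C (eta ν : ℂ) * pderiv (some ν) (pderiv (some ν) (pderiv (some μ) P)) := by
    rw [map_sum]
    refine Finset.sum_congr rfl fun ν _ => ?_
    rw [pderiv_C_mul, pderiv_comm (some μ), pderiv_comm (some μ)]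
  have e3 : pderiv (some μ) (4 * X none * pderiv none (pderiv none P))
      = 4 * X none * pderiv none (pderiv none (pderiv (some μ) P)) := by
    rw [show (4 : LoopPoly d) = C (4 : ℂ) from (map_ofNat (C (R := ℂ)) 4).symm, mul_assoc, pderiv_C_mul, pderiv_mul,
      pderiv_X_of_ne (by simp), pderiv_comm (some μ), pderiv_comm (some μ)]
    ring
  unfold box
  rw [map_add, map_add, map_add, e2, e3, show (4 : LoopPoly d) = C (4 : ℂ) from (map_ofNat (C (R := ℂ)) 4).symm, pderiv_C_mul,
    pderiv_C_mul, e1, pderiv_comm (some μ) none]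
  ring

theorem box_pderiv_none (n : ℂ) (P : LoopPoly d) :
    pderiv none (box n P) = box n (pderiv none P)
      + 4 * pderiv none (pderiv none P) := by
  have e1 : pderiv none (∑ ν, X (some ν) * pderiv (some ν) (pderiv none P))
      = ∑ ν, X (some ν) * pderiv (some ν) (pderiv none (pderiv none P)) := by
    rw [map_sum]
    refine Finset.sum_congr rfl fun ν _ => ?_
    rw [pderiv_mul, pderiv_X_of_ne (by simp), pderiv_comm none (some ν)]
    ring
  have e2 : pderiv none (∑ ν, C (eta ν : ℂ) * pderiv (some ν) (pderiv (some ν) P))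
      = ∑ ν, C (eta ν : ℂ) * pderiv (some ν) (pderiv (some ν) (pderiv none P)) := by
    rw [map_sum]
    refine Finset.sum_congr rfl fun ν _ => ?_
    rw [pderiv_C_mul, pderiv_comm none, pderiv_comm none]
  have e3 : pderiv none (4 * X none * pderiv none (pderiv none P))
      = 4 * X none * pderiv none (pderiv none (pderiv none P))
        + 4 * pderiv none (pderiv none P) := by
    rw [show (4 : LoopPoly d) = C (4 : ℂ) from (map_ofNat (C (R := ℂ)) 4).symm, mul_assoc, pderiv_C_mul, pderiv_mul,
      pderiv_X_self]
    ring
  unfold box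
  rw [map_add, map_add, map_add, e2, e3, show (4 : LoopPoly d) = C (4 : ℂ) from (map_ofNat (C (R := ℂ)) 4).symm, pderiv_C_mul,
    pderiv_C_mul, e1]
  ring

theorem box_eulerOp (n : ℂ) (q : Fin (d + 1) → ℝ) (P : LoopPoly d) :
    box n (eulerOp q P) = eulerOp q (box n P) + 2 * box n P := by
  set c : LoopPoly d := 2 * X none + 2 * ∑ μ, C (eta μ : ℂ) * X (some μ) * C (q μ : ℂ) with hc
  have hc' : c = propDen q + X none - C (mdot q q : ℂ) := by rw [hc, propDen_eq]; ring
  have hc0 : pderiv none c = 2 := by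
    rw [hc', map_sub, map_add, pderiv_none_propDen, pderiv_X_self, pderiv_C]; ring
  have hcμ : ∀ μ, pderiv (some μ) c = 2 * (C (eta μ : ℂ) * C (q μ : ℂ)) := fun μ => by
    rw [hc', map_sub, map_add, pderiv_some_propDen, pderiv_X_of_ne (by simp), pderiv_C]; ring
  have hX : box n (X none : LoopPoly d) = C (2 * n) := by
    have h : ∀ μ : Fin (d + 1), pderiv (some μ) (X none : LoopPoly d) = 0 :=
      fun μ => pderiv_X_of_ne (by simp)
    simp [box, h]
  have hC : ∀ z : ℂ, box n (C z : LoopPoly d) = 0 := fun z => by simp [box]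
  have hbc : box n c = C (4 * n) := by
    have h : c = propDen q + X none + C (-(mdot q q : ℂ)) := by rw [hc', map_neg]; ring
    rw [h, box_add, box_add, box_propDen, hX, hC, add_zero, ← map_add]
    ring_nf
  -- the coefficients of `eulerOp` are affine in the variables
  have hl : ∀ μ, box n (X (some μ) + C (q μ : ℂ) : LoopPoly d) = 0 := fun μ => by
    have h : pderiv none (X (some μ) : LoopPoly d) = 0 := pderiv_X_of_ne (by simp)
    have h' : ∀ ν, pderiv (some ν) (pderiv (some ν) (X (some μ) : LoopPoly d)) = 0 := fun ν => by
      rw [pderiv_X]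
      simp only [Pi.single_apply]
      split_ifs <;> simp
    rw [box_add, hC, box, h]
    simp only [h']
    simp
  have hg : ∀ μ Q, gradForm (X (some μ) + C (q μ : ℂ) : LoopPoly d) Q
      = 2 * (X (some μ) * pderiv none Q) + C (eta μ : ℂ) * pderiv (some μ) Q := by
    intro μ Q
    have h : pderiv none (X (some μ) + C (q μ : ℂ) : LoopPoly d) = 0 := by
      rw [map_add, pderiv_C, pderiv_X_of_ne (by simp), add_zero]
    have h' : ∀ ν, pderiv (some ν) (X (some μ) + C (q μ : ℂ) : LoopPoly d)
        = if μ = ν then 1 else 0 := by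
      intro ν
      rw [map_add, pderiv_C, add_zero, pderiv_X, Pi.single_apply]
      simp
    simp only [gradForm, h, h']
    simp
  have hgc : ∀ Q, gradForm c Q = 8 * X none * pderiv none Q
      + 4 * ∑ μ, X (some μ) * pderiv (some μ) Q
      + 4 * ((∑ μ, C (eta μ : ℂ) * X (some μ) * C (q μ : ℂ)) * pderiv none Q)
      + 2 * ∑ μ, C (q μ : ℂ) * pderiv (some μ) Q := by
    intro Q
    have e1 : ∑ μ, X (some μ) * (pderiv (some μ) c * pderiv none Q
          + pderiv none c * pderiv (some μ) Q)
        = 2 * ((∑ μ, C (eta μ : ℂ) * X (some μ) * C (q μ : ℂ)) * pderiv none Q)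
          + 2 * ∑ μ, X (some μ) * pderiv (some μ) Q := by
      rw [Finset.sum_mul, Finset.mul_sum, Finset.mul_sum, ← Finset.sum_add_distrib]
      refine Finset.sum_congr rfl fun μ _ => ?_
      rw [hc0, hcμ]
      ring
    have e2 : ∑ μ, C (eta μ : ℂ) * (pderiv (some μ) c * pderiv (some μ) Q)
        = 2 * ∑ μ, C (q μ : ℂ) * pderiv (some μ) Q := by
      rw [Finset.mul_sum]
      refine Finset.sum_congr rfl fun μ _ => ?_
      rw [hcμ]
      linear_combination (2 * C (q μ : ℂ) * pderiv (some μ) Q) * eta_mul_eta (d := d) μ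
    unfold gradForm
    rw [e1, e2, hc0]
    ring
  have hE : ∀ Q, eulerOp q Q = ∑ μ, (X (some μ) + C (q μ : ℂ)) * pderiv (some μ) Q
      + c * pderiv none Q := fun Q => rfl
  rw [hE, hE, box_add, box_sum, box_mul, hbc, hgc, box_pderiv_none]
  have e4 : ∑ μ, box n ((X (some μ) + C (q μ : ℂ)) * pderiv (some μ) P)
      = ∑ μ, (X (some μ) + C (q μ : ℂ)) * pderiv (some μ) (box n P)
        - 4 * ∑ μ, C (q μ : ℂ) * pderiv (some μ) (pderiv none P)
        + 2 * ∑ μ, C (eta μ : ℂ) * pderiv (some μ) (pderiv (some μ) P) := by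
    rw [Finset.mul_sum, Finset.mul_sum, ← Finset.sum_sub_distrib, ← Finset.sum_add_distrib]
    refine Finset.sum_congr rfl fun μ _ => ?_
    rw [box_mul, hl, hg, box_pderiv_some, pderiv_comm none (some μ)]
    ring
  rw [e4]
  have hb : box n P = C (2 * n) * pderiv none P + 4 * X none * pderiv none (pderiv none P)
    + 4 * ∑ μ, X (some μ) * pderiv (some μ) (pderiv none P)
    + ∑ μ, C (eta μ : ℂ) * pderiv (some μ) (pderiv (some μ) P) := rfl
  have h4 : (C (4 * n) : LoopPoly d) = 2 * C (2 * n) := by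
    rw [show (2 : LoopPoly d) = C (2 : ℂ) from (map_ofNat (C (R := ℂ)) 2).symm, ← map_mul]; ring_nf
  rw [h4, hc]
  linear_combination (-2 : LoopPoly d) * hb

/-- Commutation of powers of `□` with multiplication by an inverse propagator. -/
theorem iterate_box_propDen_mul (n : ℂ) (q : Fin (d + 1) → ℝ) (r : ℕ) (P : LoopPoly d) :
    (box n)^[r + 1] (propDen q * P) = propDen q * (box n)^[r + 1] P
      + C (4 * ((r : ℂ) + 1)) * eulerOp q ((box n)^[r] P)
      + C (2 * n * ((r : ℂ) + 1) + 4 * ((r : ℂ) + 1) * r) * (box n)^[r] P := by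
  induction r with
  | zero =>
    have h4 : (C (4 : ℂ) : LoopPoly d) = 4 := map_ofNat _ 4
    simp [box_propDen_mul, h4]
  | succ r ih =>
    rw [Function.iterate_succ_apply' (box n) (r + 1) (propDen q * P), ih, box_add, box_add,
      box_C_mul, box_C_mul, box_eulerOp, box_propDen_mul,
      ← Function.iterate_succ_apply' (box n) r P,
      ← Function.iterate_succ_apply' (box n) (r + 1) P]
    rw [show (4 : LoopPoly d) = C (4 : ℂ) from (map_ofNat (C (R := ℂ)) 4).symm, show (2 : LoopPoly d) = C (2 : ℂ) from (map_ofNat (C (R := ℂ)) 2).symm]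
    push_cast
    simp only [map_add, map_mul, map_one]
    generalize eulerOp q _ = E
    generalize (box n)^[r + 1] P = B
    rw [show (C 4 : LoopPoly d) = 4 from map_ofNat C 4, show (C 2 : LoopPoly d) = 2 from map_ofNat C 2]
    ring

theorem totalDegree_pderiv_le {σ : Type*} (i : σ) (P : MvPolynomial σ ℂ) :
    (pderiv i P).totalDegree ≤ P.totalDegree - 1 := by
  classical
  rw [totalDegree_eq]
  refine Finset.sup_le fun s hs => ?_
  rw [mem_support_iff, coeff_pderiv] at hs
  have h1 : s + Finsupp.single i 1 ∈ P.support := by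
    rw [mem_support_iff]
    exact left_ne_zero_of_mul hs
  have h2 := le_totalDegree h1
  rw [Finsupp.sum_add_index' (fun _ => rfl) (fun _ _ _ => rfl)] at h2
  simp only [Finsupp.sum_single_index] at h2
  rw [Finsupp.card_toMultiset]
  have h3 : (s.sum fun _ => id) = s.sum fun _ e => e := rfl
  omega

theorem pderiv_eq_zero_of_totalDegree {σ : Type*} (i : σ) (P : MvPolynomial σ ℂ)
    (h : P.totalDegree = 0) : pderiv i P = 0 := by
  rw [totalDegree_eq_zero_iff_eq_C.mp h, pderiv_C]

theorem totalDegree_box_le (n : ℂ) (P : LoopPoly d) :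
    (box n P).totalDegree ≤ P.totalDegree - 1 := by
  have hX : ∀ (c : ℂ) (i j l : Option (Fin (d + 1))),
      (C c * X i * pderiv j (pderiv l P)).totalDegree ≤ P.totalDegree - 1 := by
    intro c i j l
    have h1 := totalDegree_pderiv_le l P
    have h2 := totalDegree_pderiv_le j (pderiv l P)
    rcases Nat.eq_zero_or_pos (pderiv l P).totalDegree with h | h
    · rw [pderiv_eq_zero_of_totalDegree j _ h]
      simp
    · refine (totalDegree_mul _ _).trans ?_
      have h3 := totalDegree_mul (C c) (X i : LoopPoly d)
      rw [totalDegree_C, totalDegree_X] at h3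
      omega
  have hC : ∀ (c : ℂ) (Q : LoopPoly d), Q.totalDegree ≤ P.totalDegree - 1 →
      (C c * Q).totalDegree ≤ P.totalDegree - 1 := by
    intro c Q h
    refine (totalDegree_mul _ _).trans ?_
    rw [totalDegree_C]
    omega
  unfold box
  refine (totalDegree_add _ _).trans (max_le ?_ ?_)
  · refine (totalDegree_add _ _).trans (max_le ?_ ?_)
    · refine (totalDegree_add _ _).trans (max_le ?_ ?_)
      · exact hC _ _ (totalDegree_pderiv_le _ _)
      · rw [show (4 : LoopPoly d) = C (4 : ℂ) from (map_ofNat (C (R := ℂ)) 4).symm]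
        exact hX _ _ _ _
    · rw [show (4 : LoopPoly d) = C (4 : ℂ) from (map_ofNat (C (R := ℂ)) 4).symm]
      refine hC _ _ (totalDegree_finsetSum_le fun μ _ => ?_)
      have := hX 1 (some μ) (some μ) none
      rwa [map_one, one_mul] at this
  · refine totalDegree_finsetSum_le fun μ _ => hC _ _ ?_
    have h1 := totalDegree_pderiv_le (some μ) P
    have h2 := totalDegree_pderiv_le (some μ) (pderiv (some μ) P)
    omega

theorem iterate_box_eq_zero (n : ℂ) (P : LoopPoly d) {r : ℕ} (h : P.totalDegree < r) :
    (box n)^[r] P = 0 := by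
  induction r generalizing P with
  | zero => omega
  | succ r ih =>
    rw [Function.iterate_succ_apply]
    rcases Nat.eq_zero_or_pos P.totalDegree with h0 | h0
    · have : box n P = 0 := by
        rw [totalDegree_eq_zero_iff_eq_C.mp h0]
        simp [box]
      rw [this, iterate_box_zero]
    · exact ih _ (by have := totalDegree_box_le n P; omega)

end Box

/-! ### The power `(F - i0)^s` -/

section PowI0

/-- `(F - i0)^s` as a boundary value of the principal branch. -/
theorem powI0_eq (F : ℝ) (s : ℂ) :
    powI0 F s = Complex.exp (-(Real.pi : ℂ) / 2 * Complex.I * s) * (Complex.I * F) ^ s := by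
  rcases eq_or_ne s 0 with rfl | hs
  · simp [powI0]
  rcases lt_trichotomy F 0 with h | h | h
  · rw [powI0, if_neg (not_le.mpr h)]
    have h1 : (((-F : ℝ) : ℂ)) ≠ 0 := by exact_mod_cast (neg_pos.mpr h).ne'
    have h2 : Complex.I * (F : ℂ) = ((-F : ℝ) : ℂ) * (-Complex.I) := by push_cast; ring
    rw [h2, Complex.cpow_def_of_ne_zero h1, Complex.cpow_def_of_ne_zero (by simpa using h.ne),
      Complex.log_ofReal_mul (neg_pos.mpr h) (neg_ne_zero.mpr Complex.I_ne_zero),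
      Complex.log_neg_I, ← Complex.ofReal_log (neg_pos.mpr h).le, ← Complex.exp_add,
      ← Complex.exp_add]
    congr 1
    ring
  · subst h
    simp [powI0, hs]
  · rw [powI0, if_pos h.le]
    have h1 : (F : ℂ) ≠ 0 := by exact_mod_cast h.ne'
    rw [mul_comm Complex.I, Complex.cpow_def_of_ne_zero h1,
      Complex.cpow_def_of_ne_zero (mul_ne_zero h1 Complex.I_ne_zero),
      Complex.log_ofReal_mul h Complex.I_ne_zero,
      Complex.log_I, ← Complex.ofReal_log h.le, ← Complex.exp_add]
    congr 1
    ring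

theorem continuous_powI0 {s : ℂ} (hs : 0 < s.re) : Continuous fun F : ℝ => powI0 F s := by
  simp only [powI0_eq]
  refine continuous_const.mul (continuous_iff_continuousAt.mpr fun F => ?_)
  have h1 : ContinuousAt (fun F : ℝ => Complex.I * (F : ℂ)) F := by fun_prop
  exact ContinuousAt.comp (f := fun F : ℝ => Complex.I * (F : ℂ)) (g := fun z : ℂ => z ^ s)
    (Complex.continuousAt_cpow_const_of_re_pos (by simp) hs) h1

theorem hasDerivAt_powI0 {s : ℂ} (hs : 1 < s.re) (F : ℝ) :
    HasDerivAt (fun F : ℝ => powI0 F s) (s * powI0 F (s - 1)) F := by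
  have hs' : 0 < (s - 1).re := by simpa using hs
  refine hasDerivAt_of_hasDerivAt_of_ne' (x := 0) (f := fun F : ℝ => powI0 F s)
    (g := fun F : ℝ => s * powI0 F (s - 1)) ?_ (continuous_powI0 (by linarith)).continuousAt
    (continuous_const.mul (continuous_powI0 hs')).continuousAt F
  intro F hF
  have h1 : HasDerivAt (fun z : ℂ => Complex.I * z) Complex.I (F : ℂ) := by
    simpa using (hasDerivAt_id (F : ℂ)).const_mul Complex.I
  have h2 := (h1.cpow_const (c := s) (by
    rw [Complex.mem_slitPlane_iff]; right; simpa using hF)).comp_ofReal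
  have h3 := h2.const_mul (Complex.exp (-(Real.pi : ℂ) / 2 * Complex.I * s))
  simp only [powI0_eq]
  refine h3.congr_deriv ?_
  have h4 : Complex.exp (-(Real.pi : ℂ) / 2 * Complex.I * s)
      = -Complex.I * Complex.exp (-(Real.pi : ℂ) / 2 * Complex.I * (s - 1)) := by
    rw [← Complex.exp_neg_pi_div_two_mul_I, ← Complex.exp_add]
    congr 1
    ring
  rw [h4]
  linear_combination (-(s * Complex.exp (-(Real.pi : ℂ) / 2 * Complex.I * (s - 1))
    * (Complex.I * (F : ℂ)) ^ (s - 1))) * Complex.I_mul_I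

theorem contDiff_powI0 {s : ℂ} (hs : 1 < s.re) : ContDiff ℝ 1 fun F : ℝ => powI0 F s := by
  rw [contDiff_one_iff_deriv]
  refine ⟨fun F => (hasDerivAt_powI0 hs F).differentiableAt, ?_⟩
  have : deriv (fun F : ℝ => powI0 F s) = fun F => s * powI0 F (s - 1) :=
    funext fun F => (hasDerivAt_powI0 hs F).deriv
  rw [this]
  exact continuous_const.mul (continuous_powI0 (by simpa using hs))

theorem powI0_mul_self (F : ℝ) {s : ℂ} (hs : s ≠ 0) :
    (F : ℂ) * powI0 F (s - 1) = powI0 F s := by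
  rcases eq_or_ne F 0 with rfl | hF
  · simp [powI0, hs]
  · have hF' : (F : ℂ) ≠ 0 := by exact_mod_cast hF
    have h4 : Complex.exp (-(Real.pi : ℂ) / 2 * Complex.I * s)
        = -Complex.I * Complex.exp (-(Real.pi : ℂ) / 2 * Complex.I * (s - 1)) := by
      rw [← Complex.exp_neg_pi_div_two_mul_I, ← Complex.exp_add]
      congr 1
      ring
    rw [powI0_eq, powI0_eq, h4, Complex.cpow_sub _ _ (mul_ne_zero Complex.I_ne_zero hF'),
      Complex.cpow_one]
    field_simp
    linear_combination Complex.I_mul_I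

end PowI0

/-! ### Integration by parts on the simplex of Feynman parameters -/

section Simplex

theorem isCompact_feynmanSimplex (m : ℕ) : IsCompact (feynmanSimplex m) := by
  refine IsCompact.of_isClosed_subset (isCompact_Icc (a := (0 : Fin m → ℝ)) (b := 1)) ?_ ?_
  · have h1 : feynmanSimplex m = (⋂ i, {x : Fin m → ℝ | 0 ≤ x i}) ∩ {x | ∑ i, x i ≤ 1} := by
      ext x; simp [feynmanSimplex]
    rw [h1]
    refine (isClosed_iInter fun i => isClosed_le continuous_const (continuous_apply i)).inter ?_
    exact isClosed_le (by fun_prop) continuous_const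
  · rintro x ⟨h0, h1⟩
    refine ⟨h0, fun i => ?_⟩
    exact (Finset.single_le_sum (fun j _ => h0 j) (Finset.mem_univ i)).trans h1

theorem integrableOn_simplex {m : ℕ} {φ : (Fin m → ℝ) → ℂ} (h : Continuous φ) :
    IntegrableOn φ (feynmanSimplex m) :=
  h.continuousOn.integrableOn_compact (isCompact_feynmanSimplex m)

/-- Vertices of the simplex of Feynman parameters. -/
def vtx {m : ℕ} : Fin (m + 1) → Fin m → ℝ := Fin.cons 0 fun j => Pi.single j 1

theorem bary_line {m : ℕ} (i j : Fin (m + 1)) (x : Fin m → ℝ) (t : ℝ) :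
    bary (x + t • (vtx i - x)) j = bary x j + t * ((if j = i then 1 else 0) - bary x j) := by
  have hs : ∀ v : Fin m → ℝ, ∑ l, (x + t • (v - x)) l
      = ∑ l, x l + t * (∑ l, v l - ∑ l, x l) := fun v => by
    simp [Finset.sum_add_distrib, ← Finset.mul_sum]
  refine Fin.cases ?_ (fun l => ?_) j
  · simp only [bary, Fin.cons_zero]
    rw [hs]
    refine Fin.cases ?_ (fun l => ?_) i
    · simp [vtx]; ring
    · simp [vtx]
      rw [if_neg (Ne.symm (Fin.succ_ne_zero l))]
      ring
  · simp only [bary, Fin.cons_succ]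
    refine Fin.cases ?_ (fun l' => ?_) i
    · simp [vtx]
    · simp [vtx, Pi.single_apply, Fin.succ_inj]

theorem sum_bary {m : ℕ} (x : Fin m → ℝ) : ∑ i, bary x i = 1 := by
  rw [Fin.sum_univ_succ]
  simp [bary]

theorem contDiff_bary {m : ℕ} (i : Fin (m + 1)) :
    ContDiff ℝ 1 fun x : Fin m → ℝ => bary x i := by
  refine Fin.cases ?_ (fun l => ?_) i
  · simp only [bary, Fin.cons_zero]
    fun_prop
  · simp only [bary, Fin.cons_succ]
    fun_prop

/-- The monomial `∏ x_i^{K_i}` in the barycentric coordinates. -/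
def wt {m : ℕ} (K : Fin (m + 1) → ℕ) (x : Fin m → ℝ) : ℂ := ∏ i, ((bary x i : ℝ) : ℂ) ^ K i

theorem contDiff_wt {m : ℕ} (K : Fin (m + 1) → ℕ) : ContDiff ℝ 1 (wt (m := m) K) := by
  unfold wt
  refine contDiff_prod fun i _ => ContDiff.pow ?_ _
  exact Complex.ofRealCLM.contDiff.comp (contDiff_bary i)

/-- Derivatives along the lines through a vertex determine the value of the total derivative on
the vector field that points to that vertex. -/
theorem fderiv_vtx {m : ℕ} {φ : (Fin m → ℝ) → ℂ} (hφ : ContDiff ℝ 1 φ) (i : Fin (m + 1))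
    (x : Fin m → ℝ) {D : ℂ} (h : HasDerivAt (fun t : ℝ => φ (x + t • (vtx i - x))) D 0) :
    fderiv ℝ φ x (vtx i - x) = D := by
  have h1 : HasDerivAt (fun t : ℝ => x + t • (vtx i - x)) (vtx i - x) 0 := by
    simpa using ((hasDerivAt_id (0 : ℝ)).smul_const (vtx i - x)).const_add x
  have h2 : HasFDerivAt φ (fderiv ℝ φ x) (x + (0 : ℝ) • (vtx i - x)) := by
    simpa using (hφ.differentiable one_ne_zero x).hasFDerivAt
  exact (h2.comp_hasDerivAt (0 : ℝ) h1).unique h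

theorem hasDerivAt_bary_line {m : ℕ} (i j : Fin (m + 1)) (x : Fin m → ℝ) :
    HasDerivAt (fun t : ℝ => bary (x + t • (vtx i - x)) j)
      ((if j = i then 1 else 0) - bary x j) 0 := by
  simp only [bary_line]
  simpa using ((hasDerivAt_id (0 : ℝ)).mul_const
    ((if j = i then 1 else 0) - bary x j)).const_add (bary x j)

theorem wt_eq_mul_erase {m : ℕ} (K : Fin (m + 1) → ℕ) (i : Fin (m + 1)) (x : Fin m → ℝ) :
    wt K x = ((bary x i : ℝ) : ℂ) ^ K i * ∏ j ∈ Finset.univ.erase i, ((bary x j : ℝ) : ℂ) ^ K j :=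
  (Finset.mul_prod_erase _ (fun j => ((bary x j : ℝ) : ℂ) ^ K j) (Finset.mem_univ i)).symm

theorem wt_update {m : ℕ} (K : Fin (m + 1) → ℕ) (i : Fin (m + 1)) (c : ℕ) (x : Fin m → ℝ) :
    wt (Function.update K i c) x
      = ((bary x i : ℝ) : ℂ) ^ c * ∏ j ∈ Finset.univ.erase i, ((bary x j : ℝ) : ℂ) ^ K j := by
  rw [wt_eq_mul_erase _ i, Function.update_self]
  refine congrArg (_ * ·) (Finset.prod_congr rfl fun j hj => ?_)
  rw [Function.update_of_ne (Finset.ne_of_mem_erase hj)]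

theorem fderiv_wt {m : ℕ} (K : Fin (m + 1) → ℕ) (i : Fin (m + 1)) (x : Fin m → ℝ) :
    fderiv ℝ (wt K) x (vtx i - x)
      = K i * wt (Function.update K i (K i - 1)) x - (∑ j, K j : ℕ) * wt K x := by
  refine fderiv_vtx (contDiff_wt K) i x ?_
  have h1 : ∀ j ∈ Finset.univ, HasDerivAt
      (fun t : ℝ => ((bary (x + t • (vtx i - x)) j : ℝ) : ℂ) ^ K j)
      ((K j : ℂ) * ((bary x j : ℝ) : ℂ) ^ (K j - 1)
        * (((if j = i then 1 else 0) - bary x j : ℝ) : ℂ)) 0 := by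
    intro j _
    have := (hasDerivAt_bary_line i j x).ofReal_comp.fun_pow (K j)
    simpa using this
  refine (HasDerivAt.fun_finsetProd h1).congr_deriv ?_
  simp only [zero_smul, add_zero, smul_eq_mul]
  have h3 : ∀ j, (∏ l ∈ Finset.univ.erase j, ((bary x l : ℝ) : ℂ) ^ K l)
        * ((K j : ℂ) * ((bary x j : ℝ) : ℂ) ^ (K j - 1)
          * (((if j = i then 1 else 0) - bary x j : ℝ) : ℂ))
      = (if j = i then (K i : ℂ) * wt (Function.update K i (K i - 1)) x else 0)
        - K j * wt K x := by
    intro j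
    have e1 : (K j : ℂ) * ((bary x j : ℝ) : ℂ) ^ (K j - 1) * ((bary x j : ℝ) : ℂ)
        = K j * ((bary x j : ℝ) : ℂ) ^ K j := by
      rcases Nat.eq_zero_or_pos (K j) with h | h
      · simp [h]
      · rw [mul_assoc, ← pow_succ, Nat.sub_add_cancel h]
    rw [wt_eq_mul_erase K j]
    split_ifs with h
    · subst h
      rw [wt_update]
      push_cast
      linear_combination (-∏ l ∈ Finset.univ.erase j, ((bary x l : ℝ) : ℂ) ^ K l) * e1
    · push_cast
      linear_combination (-∏ l ∈ Finset.univ.erase j, ((bary x l : ℝ) : ℂ) ^ K l) * e1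
  rw [Finset.sum_congr rfl fun j _ => h3 j, Finset.sum_sub_distrib, Finset.sum_ite_eq',
    if_pos (Finset.mem_univ i), ← Finset.sum_mul]
  push_cast
  rfl

/-- `Λ` is the integral over the face opposite to the vertex `i` of the simplex: the boundary
term of the divergence theorem for the vector field that points to that vertex. -/
def IsFaceIntegral {m : ℕ} (i : Fin (m + 1)) (Λ : ((Fin m → ℝ) → ℂ) → ℂ) : Prop :=
  ∀ φ : (Fin m → ℝ) → ℂ, ContDiff ℝ 1 φ →
    ∫ x in feynmanSimplex m, (fderiv ℝ φ x (vtx i - x) + m * φ x * (-1)) = -Λ φ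

theorem continuous_fderiv_vtx {m : ℕ} {φ : (Fin m → ℝ) → ℂ} (hφ : ContDiff ℝ 1 φ)
    (i : Fin (m + 1)) : Continuous fun x => fderiv ℝ φ x (vtx i - x) :=
  (hφ.continuous_fderiv one_ne_zero).clm_apply (continuous_const.sub continuous_id)

/-- Integration by parts with a monomial weight. -/
theorem IsFaceIntegral.ibp {m : ℕ} {i : Fin (m + 1)} {Λ : ((Fin m → ℝ) → ℂ) → ℂ}
    (hΛ : IsFaceIntegral i Λ) (K : Fin (m + 1) → ℕ) {H : (Fin m → ℝ) → ℂ}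
    (hH : ContDiff ℝ 1 H) :
    ∫ x in feynmanSimplex m, wt K x * ((((∑ j, K j : ℕ) : ℂ) + m) * H x
        - fderiv ℝ H x (vtx i - x))
      = K i * (∫ x in feynmanSimplex m, wt (Function.update K i (K i - 1)) x * H x)
        + Λ (fun x => wt K x * H x) := by
  have hφ : ContDiff ℝ 1 fun x => wt K x * H x := (contDiff_wt K).mul hH
  have h1 := hΛ _ hφ
  have h2 : ∀ x, fderiv ℝ (fun x => wt K x * H x) x (vtx i - x) + m * (wt K x * H x) * (-1)
      = K i * (wt (Function.update K i (K i - 1)) x * H x)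
        - wt K x * ((((∑ j, K j : ℕ) : ℂ) + m) * H x - fderiv ℝ H x (vtx i - x)) := by
    intro x
    have h3 : fderiv ℝ (fun x => wt K x * H x) x (vtx i - x)
        = wt K x * fderiv ℝ H x (vtx i - x) + fderiv ℝ (wt K) x (vtx i - x) * H x := by
      rw [fderiv_fun_mul ((contDiff_wt K).differentiable one_ne_zero x)
        (hH.differentiable one_ne_zero x)]
      simp [mul_comm]
    rw [h3, fderiv_wt]
    ring
  simp only [h2] at h1
  rw [integral_sub, integral_const_mul] at h1
  · linear_combination -h1
  · exact integrableOn_simplex (continuous_const.mul ((contDiff_wt _).continuous.mul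
      hH.continuous))
  · exact integrableOn_simplex ((contDiff_wt _).continuous.mul ((continuous_const.mul
      hH.continuous).sub (continuous_fderiv_vtx hH i)))

end Simplex

/-! ### The divergence theorem on the simplices of dimension one and two -/

section Divergence

theorem integral_simplex_one (φ : (Fin 1 → ℝ) → ℂ) :
    ∫ x in feynmanSimplex 1, φ x = ∫ t in (0 : ℝ)..1, φ fun _ => t := by
  have h : MeasurePreserving (MeasurableEquiv.funUnique (Fin 1) ℝ) (volume : Measure (Fin 1 → ℝ))
      volume := by
    convert volume_preserving_funUnique (Fin 1) ℝ
  have h2 := (h.symm).setIntegral_preimage_emb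
    (MeasurableEquiv.measurableEmbedding _) φ (feynmanSimplex 1)
  rw [← h2, intervalIntegral.integral_of_le zero_le_one, ← integral_Icc_eq_integral_Ioc]
  have h3 : (MeasurableEquiv.funUnique (Fin 1) ℝ).symm ⁻¹' feynmanSimplex 1 = Icc 0 1 := by
    ext t
    simp [feynmanSimplex, MeasurableEquiv.funUnique]
  rw [h3]
  rfl

theorem integral_simplex_two_prod (φ : (Fin 2 → ℝ) → ℂ) :
    ∫ x in feynmanSimplex 2, φ x
      = ∫ z in {z : ℝ × ℝ | 0 ≤ z.1 ∧ 0 ≤ z.2 ∧ z.1 + z.2 ≤ 1}, φ ![z.1, z.2] := by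
  have h := volume_preserving_finTwoArrow ℝ
  have h2 := (h.symm).setIntegral_preimage_emb
    (MeasurableEquiv.measurableEmbedding _) φ (feynmanSimplex 2)
  rw [← h2]
  have h3 : MeasurableEquiv.finTwoArrow.symm ⁻¹' feynmanSimplex 2
      = {z : ℝ × ℝ | 0 ≤ z.1 ∧ 0 ≤ z.2 ∧ z.1 + z.2 ≤ 1} := by
    ext z
    simp [feynmanSimplex, MeasurableEquiv.finTwoArrow, MeasurableEquiv.piFinTwo,
      Fin.forall_fin_two, and_assoc]
  rw [h3]
  rfl

theorem isCompact_triangle : IsCompact {z : ℝ × ℝ | 0 ≤ z.1 ∧ 0 ≤ z.2 ∧ z.1 + z.2 ≤ 1} := by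
  refine IsCompact.of_isClosed_subset (isCompact_Icc (a := ((0, 0) : ℝ × ℝ)) (b := (1, 1))) ?_ ?_
  · exact (isClosed_le continuous_const continuous_fst).inter
      ((isClosed_le continuous_const continuous_snd).inter
        (isClosed_le (continuous_fst.add continuous_snd) continuous_const))
  · rintro z ⟨h1, h2, h3⟩
    refine ⟨⟨h1, h2⟩, ?_, ?_⟩ <;> simp <;> linarith

theorem integral_triangle {f : ℝ × ℝ → ℂ} (hf : Continuous f) :
    ∫ z in {z : ℝ × ℝ | 0 ≤ z.1 ∧ 0 ≤ z.2 ∧ z.1 + z.2 ≤ 1}, f z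
      = ∫ x in (0 : ℝ)..1, ∫ y in (0 : ℝ)..1 - x, f (x, y) := by
  set S := {z : ℝ × ℝ | 0 ≤ z.1 ∧ 0 ≤ z.2 ∧ z.1 + z.2 ≤ 1} with hS
  have hm : MeasurableSet S := isCompact_triangle.isClosed.measurableSet
  have hi : IntegrableOn f S := hf.continuousOn.integrableOn_compact isCompact_triangle
  rw [← integral_indicator hm, Measure.volume_eq_prod, integral_prod]
  · rw [intervalIntegral.integral_of_le zero_le_one, ← integral_Icc_eq_integral_Ioc,
      ← integral_indicator measurableSet_Icc]
    refine integral_congr_ae (Filter.Eventually.of_forall fun x => ?_)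
    simp only
    by_cases hx : x ∈ Icc (0 : ℝ) 1
    · rw [indicator_of_mem hx, intervalIntegral.integral_of_le (by linarith [hx.2]),
        ← integral_Icc_eq_integral_Ioc, ← integral_indicator measurableSet_Icc]
      refine integral_congr_ae (Filter.Eventually.of_forall fun y => ?_)
      simp only [indicator_apply]
      refine if_congr ?_ rfl rfl
      simp only [hS, mem_ofPred_eq, mem_Icc]
      constructor
      · rintro ⟨_, h2, h3⟩; exact ⟨h2, by linarith⟩
      · rintro ⟨h2, h3⟩; exact ⟨hx.1, h2, by linarith⟩
    · rw [indicator_of_notMem hx]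
      refine integral_eq_zero_of_ae (Filter.Eventually.of_forall fun y => ?_)
      refine indicator_of_notMem (fun h => hx ?_) _
      exact ⟨h.1, by linarith [h.2.1, h.2.2]⟩
  · rw [← Measure.volume_eq_prod]
    exact (integrable_indicator_iff hm).mpr hi

theorem integral_triangle_swap {f : ℝ × ℝ → ℂ} (hf : Continuous f) :
    ∫ z in {z : ℝ × ℝ | 0 ≤ z.1 ∧ 0 ≤ z.2 ∧ z.1 + z.2 ≤ 1}, f z
      = ∫ y in (0 : ℝ)..1, ∫ x in (0 : ℝ)..1 - y, f (x, y) := by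
  rw [← integral_triangle (f := fun z => f (z.2, z.1)) (by fun_prop)]
  have h := (Measure.measurePreserving_swap (μ := (volume : Measure ℝ)) (ν := (volume : Measure ℝ)))
  have h2 := h.setIntegral_preimage_emb (MeasurableEquiv.prodComm.measurableEmbedding) f
    {z : ℝ × ℝ | 0 ≤ z.1 ∧ 0 ≤ z.2 ∧ z.1 + z.2 ≤ 1}
  rw [← Measure.volume_eq_prod] at h2
  rw [← h2]
  have h3 : Prod.swap ⁻¹' {z : ℝ × ℝ | 0 ≤ z.1 ∧ 0 ≤ z.2 ∧ z.1 + z.2 ≤ 1}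
      = {z : ℝ × ℝ | 0 ≤ z.1 ∧ 0 ≤ z.2 ∧ z.1 + z.2 ≤ 1} := by
    ext z
    simp only [mem_preimage, mem_ofPred_eq, Prod.fst_swap, Prod.snd_swap]
    constructor <;> rintro ⟨h1, h2, h3⟩ <;> exact ⟨h2, h1, by linarith⟩
  rw [h3]
  rfl

theorem integral_simplex_two {φ : (Fin 2 → ℝ) → ℂ} (hφ : Continuous φ) :
    ∫ x in feynmanSimplex 2, φ x = ∫ x in (0 : ℝ)..1, ∫ y in (0 : ℝ)..1 - x, φ ![x, y] := by
  rw [integral_simplex_two_prod, integral_triangle (f := fun z => φ ![z.1, z.2])]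
  exact hφ.comp (by fun_prop)

theorem integral_simplex_two_swap {φ : (Fin 2 → ℝ) → ℂ} (hφ : Continuous φ) :
    ∫ x in feynmanSimplex 2, φ x = ∫ y in (0 : ℝ)..1, ∫ x in (0 : ℝ)..1 - y, φ ![x, y] := by
  rw [integral_simplex_two_prod, integral_triangle_swap (f := fun z => φ ![z.1, z.2])]
  exact hφ.comp (by fun_prop)

theorem integral_simplex_two_deriv_fst {ψ : (Fin 2 → ℝ) → ℂ} (hψ : ContDiff ℝ 1 ψ) :
    ∫ x in feynmanSimplex 2, fderiv ℝ ψ x (Pi.single 0 1)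
      = ∫ y in (0 : ℝ)..1, (ψ ![1 - y, y] - ψ ![0, y]) := by
  rw [integral_simplex_two_swap ((hψ.continuous_fderiv one_ne_zero).clm_apply continuous_const)]
  refine intervalIntegral.integral_congr fun y _ => ?_
  refine intervalIntegral.integral_eq_sub_of_hasDerivAt (f := fun x => ψ ![x, y]) (fun x _ => ?_) ?_
  · have h1 : HasDerivAt (fun x : ℝ => ![x, y]) (Pi.single 0 1) x := by
      rw [hasDerivAt_pi]
      intro i
      fin_cases i
      · simpa using hasDerivAt_id' x
      · simpa using hasDerivAt_const x y
    exact ((hψ.differentiable one_ne_zero _).hasFDerivAt).comp_hasDerivAt x h1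
  · refine Continuous.intervalIntegrable ?_ _ _
    exact ((hψ.continuous_fderiv one_ne_zero).comp (by fun_prop)).clm_apply continuous_const

theorem integral_simplex_two_deriv_snd {ψ : (Fin 2 → ℝ) → ℂ} (hψ : ContDiff ℝ 1 ψ) :
    ∫ x in feynmanSimplex 2, fderiv ℝ ψ x (Pi.single 1 1)
      = ∫ x in (0 : ℝ)..1, (ψ ![x, 1 - x] - ψ ![x, 0]) := by
  rw [integral_simplex_two ((hψ.continuous_fderiv one_ne_zero).clm_apply continuous_const)]
  refine intervalIntegral.integral_congr fun x _ => ?_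
  refine intervalIntegral.integral_eq_sub_of_hasDerivAt (f := fun y => ψ ![x, y]) (fun y _ => ?_) ?_
  · have h1 : HasDerivAt (fun y : ℝ => ![x, y]) (Pi.single 1 1) y := by
      rw [hasDerivAt_pi]
      intro i
      fin_cases i
      · simpa using hasDerivAt_const y x
      · simpa using hasDerivAt_id' y
    exact ((hψ.differentiable one_ne_zero _).hasFDerivAt).comp_hasDerivAt y h1
  · refine Continuous.intervalIntegrable ?_ _ _
    exact ((hψ.continuous_fderiv one_ne_zero).comp (by fun_prop)).clm_apply continuous_const

/-- The edges of the triangle of Feynman parameters, in the parametrisation by the second of the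
two remaining barycentric coordinates. -/
def edge (i : Fin 3) (t : ℝ) : Fin 2 → ℝ := ![![1 - t, t], ![0, t], ![t, 0]] i

/-- The divergence theorem on the triangle. -/
theorem isFaceIntegral_two (i : Fin 3) :
    IsFaceIntegral (m := 2) i fun φ => ∫ t in (0 : ℝ)..1, φ (edge i t) := by
  intro φ hφ
  set a : ℝ := vtx (m := 2) i 0 with ha
  set b : ℝ := vtx (m := 2) i 1 with hb
  have hlin : ∀ (j : Fin 2) (c : ℝ), ContDiff ℝ 1 fun x : Fin 2 → ℝ => ((c - x j : ℝ) : ℂ) :=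
    fun j c => Complex.ofRealCLM.contDiff.comp (contDiff_const.sub (contDiff_apply ℝ ℝ j))
  have hψ : ∀ (j : Fin 2) (c : ℝ), ContDiff ℝ 1 fun x : Fin 2 → ℝ => ((c - x j : ℝ) : ℂ) * φ x :=
    fun j c => (hlin j c).mul hφ
  have hd : ∀ (j : Fin 2) (c : ℝ) (x : Fin 2 → ℝ),
      fderiv ℝ (fun x : Fin 2 → ℝ => ((c - x j : ℝ) : ℂ) * φ x) x (Pi.single j 1)
        = ((c - x j : ℝ) : ℂ) * fderiv ℝ φ x (Pi.single j 1) - φ x := by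
    intro j c x
    rw [fderiv_fun_mul ((hlin j c).differentiable one_ne_zero x)
      (hφ.differentiable one_ne_zero x)]
    have : HasFDerivAt (fun x : Fin 2 → ℝ => ((c - x j : ℝ) : ℂ))
        (Complex.ofRealCLM.comp (-(ContinuousLinearMap.proj (R := ℝ) j))) x := by
      refine Complex.ofRealCLM.hasFDerivAt.comp x ?_
      exact ((ContinuousLinearMap.proj (R := ℝ) j).hasFDerivAt (x := x)).const_sub c
    rw [this.fderiv]
    simp
    ring
  have e1 : ∀ x : Fin 2 → ℝ, fderiv ℝ φ x (vtx i - x) + (2 : ℕ) * φ x * (-1)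
      = fderiv ℝ (fun x : Fin 2 → ℝ => ((a - x 0 : ℝ) : ℂ) * φ x) x (Pi.single 0 1)
        + fderiv ℝ (fun x : Fin 2 → ℝ => ((b - x 1 : ℝ) : ℂ) * φ x) x (Pi.single 1 1) := by
    intro x
    have : vtx i - x = (a - x 0) • (Pi.single 0 1 : Fin 2 → ℝ)
        + (b - x 1) • (Pi.single 1 1 : Fin 2 → ℝ) := by
      ext j
      fin_cases j <;> simp [ha, hb]
    rw [this, map_add, map_smul, map_smul, hd, hd]
    simp only [Complex.real_smul]
    push_cast
    ring
  simp only [e1]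
  have hc : ∀ (j : Fin 2) (c : ℝ) (γ : ℝ → Fin 2 → ℝ), Continuous γ →
      IntervalIntegrable (fun t => ((c - γ t j : ℝ) : ℂ) * φ (γ t)) volume 0 1 := fun j c γ hγ =>
    Continuous.intervalIntegrable ((hψ j c).continuous.comp hγ) _ _
  have c1 : Continuous fun y : ℝ => ![1 - y, y] := by fun_prop
  have c2 : Continuous fun y : ℝ => ![0, y] := by fun_prop
  have c3 : Continuous fun y : ℝ => ![y, 1 - y] := by fun_prop
  have c4 : Continuous fun y : ℝ => ![y, 0] := by fun_prop
  rw [integral_add, integral_simplex_two_deriv_fst (hψ 0 a), integral_simplex_two_deriv_snd (hψ 1 b)]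
  · rw [intervalIntegral.integral_sub (hc 0 a _ c1) (hc 0 a _ c2),
      intervalIntegral.integral_sub (hc 1 b _ c3) (hc 1 b _ c4)]
    have hsub : ∫ t in (0 : ℝ)..1, ((b - (![t, 1 - t] : Fin 2 → ℝ) 1 : ℝ) : ℂ) * φ ![t, 1 - t]
        = ∫ t in (0 : ℝ)..1, ((b - t : ℝ) : ℂ) * φ ![1 - t, t] := by
      have := intervalIntegral.integral_comp_sub_left (a := (0 : ℝ)) (b := 1)
        (fun t => ((b - t : ℝ) : ℂ) * φ ![1 - t, t]) 1
      simpa using this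
    rw [hsub]
    simp only [Matrix.cons_val_zero, Matrix.cons_val_one]
    have hd1 : IntervalIntegrable (fun t => ((a - (1 - t) : ℝ) : ℂ) * φ ![1 - t, t]) volume 0 1 :=
      hc 0 a _ c1
    have hd2 : IntervalIntegrable (fun t => ((b - t : ℝ) : ℂ) * φ ![1 - t, t]) volume 0 1 :=
      hc 1 b _ c1
    have hd3 : ∀ t : ℝ, ((a - (1 - t) : ℝ) : ℂ) * φ ![1 - t, t] + ((b - t : ℝ) : ℂ) * φ ![1 - t, t]
        = ((a + b - 1 : ℝ) : ℂ) * φ ![1 - t, t] := fun t => by push_cast; ring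
    rw [sub_add_sub_comm, ← intervalIntegral.integral_add hd1 hd2]
    simp only [hd3, intervalIntegral.integral_const_mul]
    have hv : (a, b) = ![((0 : ℝ), (0 : ℝ)), (1, 0), (0, 1)] i := by
      rw [ha, hb]
      fin_cases i
      · simp [vtx]
      · simp [vtx]
      · exact Prod.ext (show (Pi.single (1 : Fin 2) (1 : ℝ) : Fin 2 → ℝ) 0 = 0 by simp)
          (show (Pi.single (1 : Fin 2) (1 : ℝ) : Fin 2 → ℝ) 1 = 1 by simp)
    fin_cases i
    · obtain ⟨h1, h2⟩ := Prod.mk.inj hv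
      rw [h1, h2]
      simp [edge]
    · obtain ⟨h1, h2⟩ := Prod.mk.inj hv
      rw [h1, h2]
      simp [edge]
    · obtain ⟨h1, h2⟩ := Prod.mk.inj hv
      rw [h1, h2]
      simp [edge]
  · exact integrableOn_simplex (((hψ 0 a).continuous_fderiv one_ne_zero).clm_apply continuous_const)
  · exact integrableOn_simplex (((hψ 1 b).continuous_fderiv one_ne_zero).clm_apply continuous_const)

/-- The fundamental theorem of calculus on the segment. -/
theorem isFaceIntegral_one (i : Fin 2) :
    IsFaceIntegral (m := 1) i fun φ => φ fun _ => ![1, 0] i := by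
  intro φ hφ
  set a : ℝ := vtx (m := 1) i 0 with ha
  have h0 : ∀ t : ℝ, HasDerivAt (fun t : ℝ => ((a - t : ℝ) : ℂ) * φ fun _ => t)
      (fderiv ℝ φ (fun _ => t) (vtx i - fun _ => t) + (1 : ℕ) * φ (fun _ => t) * (-1)) t := by
    intro t
    have h1 : HasDerivAt (fun t : ℝ => (fun _ : Fin 1 => t)) (fun _ => 1) t := by
      rw [hasDerivAt_pi]
      exact fun _ => hasDerivAt_id' t
    have h2 := ((hφ.differentiable one_ne_zero (fun _ => t)).hasFDerivAt).comp_hasDerivAt t h1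
    have h3 := ((hasDerivAt_id' t).const_sub a).ofReal_comp
    refine (h3.mul h2).congr_deriv ?_
    have h4 : (vtx i - fun _ => t : Fin 1 → ℝ) = (a - t) • (fun _ => 1) := by
      ext j
      fin_cases j
      simp [ha]
    rw [h4, map_smul, Complex.real_smul]
    simp
    ring
  rw [integral_simplex_one, intervalIntegral.integral_eq_sub_of_hasDerivAt (fun t _ => h0 t)]
  · fin_cases i
    · simp [ha, vtx]
    · simp [ha, vtx]
  · refine Continuous.intervalIntegrable ?_ _ _
    have c : Continuous fun t : ℝ => (fun _ : Fin 1 => t) := by fun_prop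
    exact ((continuous_fderiv_vtx hφ i).add ((continuous_const.mul hφ.continuous).mul
      continuous_const)).comp c

end Divergence

/-! ### Cancellation of propagators -/

section Shift

variable {d m : ℕ}

theorem mdot_add_left (u v w : Fin (d + 1) → ℝ) : mdot (u + v) w = mdot u w + mdot v w := by
  simp only [mdot, Pi.add_apply, mul_add, add_mul, Finset.sum_add_distrib]

theorem mdot_comm (u v : Fin (d + 1) → ℝ) : mdot u v = mdot v u := by
  unfold mdot
  exact Finset.sum_congr rfl fun μ _ => by ring

theorem mdot_smul_left (c : ℝ) (u v : Fin (d + 1) → ℝ) : mdot (c • u) v = c * mdot u v := by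
  simp only [mdot, Pi.smul_apply, smul_eq_mul, Finset.mul_sum]
  exact Finset.sum_congr rfl fun μ _ => by ring

theorem mdot_neg_left (u v : Fin (d + 1) → ℝ) : mdot (-u) v = -mdot u v := by
  simp [mdot]

theorem mdot_sub_left (u v w : Fin (d + 1) → ℝ) : mdot (u - v) w = mdot u w - mdot v w := by
  rw [sub_eq_add_neg, mdot_add_left, mdot_neg_left, ← sub_eq_add_neg]

theorem mdot_sub_right (u v w : Fin (d + 1) → ℝ) : mdot u (v - w) = mdot u v - mdot u w := by
  rw [mdot_comm, mdot_sub_left, mdot_comm v, mdot_comm w]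

theorem mdot_add_right (u v w : Fin (d + 1) → ℝ) : mdot u (v + w) = mdot u v + mdot u w := by
  rw [mdot_comm, mdot_add_left, mdot_comm v, mdot_comm w]

theorem mdot_smul_right (c : ℝ) (u v : Fin (d + 1) → ℝ) : mdot u (c • v) = c * mdot u v := by
  rw [mdot_comm, mdot_smul_left, mdot_comm]

theorem mdot_sum_left {ι : Type*} (s : Finset ι) (u : ι → Fin (d + 1) → ℝ)
    (v : Fin (d + 1) → ℝ) : mdot (∑ i ∈ s, u i) v = ∑ i ∈ s, mdot (u i) v := by
  classical
  induction s using Finset.induction_on with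
  | empty => simp [mdot]
  | insert i s hi ih => rw [Finset.sum_insert hi, Finset.sum_insert hi, mdot_add_left, ih]

theorem mdot_sum_right {ι : Type*} (s : Finset ι) (u : ι → Fin (d + 1) → ℝ)
    (v : Fin (d + 1) → ℝ) : mdot v (∑ i ∈ s, u i) = ∑ i ∈ s, mdot v (u i) := by
  rw [mdot_comm, mdot_sum_left]
  exact Finset.sum_congr rfl fun i _ => mdot_comm _ _

/-- The quadratic form `F` is the mean square deviation of the momenta `q_i`. -/
theorem secondSymanzik_eq (q : Fin (m + 1) → Fin (d + 1) → ℝ) (y : Fin (m + 1) → ℝ)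
    (hy : ∑ i, y i = 1) :
    secondSymanzik q y
      = mdot (∑ j, y j • q j) (∑ j, y j • q j) - ∑ j, y j * mdot (q j) (q j) := by
  set a : Fin (m + 1) → Fin (m + 1) → ℝ := fun i j => y i * y j * mdot (q i - q j) (q i - q j)
    with ha
  have hsymm : ∀ i j, a i j = a j i := fun i j => by
    simp only [ha]
    rw [mdot_sub_left, mdot_sub_right, mdot_sub_right, mdot_sub_left (q j), mdot_sub_right,
      mdot_sub_right, mdot_comm (q j) (q i)]
    ring
  have hdiag : ∀ i, a i i = 0 := fun i => by simp [ha, mdot]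
  have h1 : ∑ i, ∑ j, (if i < j then a i j else 0) = ∑ i, ∑ j, if j < i then a i j else 0 := by
    rw [Finset.sum_comm]
    refine Finset.sum_congr rfl fun i _ => Finset.sum_congr rfl fun j _ => ?_
    rw [hsymm]
  have h2 : ∑ i, ∑ j, a i j = 2 * ∑ i, ∑ j, if i < j then a i j else 0 := by
    rw [two_mul]
    nth_rewrite 2 [h1]
    rw [← Finset.sum_add_distrib]
    refine Finset.sum_congr rfl fun i _ => ?_
    rw [← Finset.sum_add_distrib]
    refine Finset.sum_congr rfl fun j _ => ?_
    rcases lt_trichotomy i j with h | h | h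
    · rw [if_pos h, if_neg h.not_gt, add_zero]
    · subst h; simp [hdiag]
    · rw [if_neg h.not_gt, if_pos h, zero_add]
  have h3 : ∑ i, ∑ j, a i j
      = 2 * ∑ j, y j * mdot (q j) (q j) - 2 * mdot (∑ j, y j • q j) (∑ j, y j • q j) := by
    have e1 : ∀ i j, a i j = y j * (y i * mdot (q i) (q i)) + y i * (y j * mdot (q j) (q j))
        - 2 * (y i * (y j * mdot (q i) (q j))) := by
      intro i j
      simp only [ha]
      rw [mdot_sub_left, mdot_sub_right, mdot_sub_right, mdot_comm (q j) (q i)]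
      ring
    have e2 : mdot (∑ j, y j • q j) (∑ j, y j • q j)
        = ∑ i, ∑ j, y i * (y j * mdot (q i) (q j)) := by
      rw [mdot_sum_left]
      refine Finset.sum_congr rfl fun i _ => ?_
      rw [mdot_sum_right]
      refine Finset.sum_congr rfl fun j _ => ?_
      rw [mdot_smul_left, mdot_smul_right]
    rw [e2]
    simp only [e1, Finset.sum_sub_distrib, Finset.sum_add_distrib, ← Finset.mul_sum]
    simp only [← Finset.sum_mul, hy]
    ring_nf
  have h4 : secondSymanzik q y = -∑ i, ∑ j, if i < j then a i j else 0 := rfl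
  rw [h4]
  linarith

/-- Value of a polynomial in the loop momentum at the point `l = 0`. -/
def evalShift (q : Fin (m + 1) → Fin (d + 1) → ℝ) (P : LoopPoly d) (x : Fin m → ℝ) : ℂ :=
  eval (shiftPoint q (bary x)) P

/-- The quadratic form `F` on the simplex. -/
def symF (q : Fin (m + 1) → Fin (d + 1) → ℝ) (x : Fin m → ℝ) : ℝ :=
  secondSymanzik q (bary x)

theorem contDiff_eval {σ : Type*} {E : Type*} [NormedAddCommGroup E] [NormedSpace ℝ E]
    {c : E → σ → ℂ} (hc : ∀ i, ContDiff ℝ 1 fun x => c x i) (P : MvPolynomial σ ℂ) :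
    ContDiff ℝ 1 fun x => eval (c x) P := by
  induction P using MvPolynomial.induction_on with
  | C a => simpa using contDiff_const
  | add p q hp hq => simpa using hp.add hq
  | mul_X p i hp => simpa using hp.mul (hc i)

theorem hasDerivAt_eval {σ : Type*} [Fintype σ] {c : ℝ → σ → ℂ} {c' : σ → ℂ} {t : ℝ}
    (hc : ∀ i, HasDerivAt (fun t => c t i) (c' i) t) (P : MvPolynomial σ ℂ) :
    HasDerivAt (fun t => eval (c t) P) (∑ i, c' i * eval (c t) (pderiv i P)) t := by
  classical
  induction P using MvPolynomial.induction_on with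
  | C a => simpa using hasDerivAt_const t a
  | add p q hp hq =>
    simp only [map_add, mul_add, Finset.sum_add_distrib]
    exact hp.add hq
  | mul_X p i hp =>
    simp only [map_mul, eval_X]
    refine (hp.mul (hc i)).congr_deriv ?_
    have : ∀ j, c' j * eval (c t) (pderiv j (p * X i))
        = c' j * eval (c t) (pderiv j p) * c t i
          + if j = i then c' i * eval (c t) p else 0 := by
      intro j
      rw [pderiv_mul]
      split_ifs with h
      · subst h
        rw [pderiv_X_self]
        simp
        ring
      · rw [pderiv_X_of_ne (Ne.symm h)]
        simp
        ring
    rw [Finset.sum_congr rfl fun j _ => this j, Finset.sum_add_distrib, Finset.sum_mul]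
    simp
    ring

theorem contDiff_momentum (q : Fin (m + 1) → Fin (d + 1) → ℝ) (μ : Fin (d + 1)) :
    ContDiff ℝ 1 fun x : Fin m → ℝ => (∑ j, bary x j • q j) μ := by
  simp only [Finset.sum_apply, Pi.smul_apply, smul_eq_mul]
  exact ContDiff.sum fun j _ => (contDiff_bary j).mul contDiff_const

theorem contDiff_evalShift (q : Fin (m + 1) → Fin (d + 1) → ℝ) (P : LoopPoly d) :
    ContDiff ℝ 1 (evalShift q P) := by
  refine contDiff_eval (fun i => ?_) P
  cases i with
  | none =>
    have h : ContDiff ℝ 1 fun x : Fin m → ℝ =>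
        mdot (∑ j, bary x j • q j) (∑ j, bary x j • q j) := by
      unfold mdot
      exact ContDiff.sum fun μ _ => (contDiff_const.mul (contDiff_momentum q μ)).mul
        (contDiff_momentum q μ)
    exact Complex.ofRealCLM.contDiff.comp h
  | some μ => exact Complex.ofRealCLM.contDiff.comp (contDiff_momentum q μ).neg

theorem contDiff_symF (q : Fin (m + 1) → Fin (d + 1) → ℝ) : ContDiff ℝ 1 (symF q) := by
  unfold symF secondSymanzik
  refine (ContDiff.sum fun i _ => ContDiff.sum fun j _ => ?_).neg
  split_ifs
  · exact ((contDiff_bary i).mul (contDiff_bary j)).mul contDiff_const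
  · exact contDiff_const

theorem contDiff_powF (q : Fin (m + 1) → Fin (d + 1) → ℝ) {s : ℂ} (hs : 1 < s.re) :
    ContDiff ℝ 1 fun x => powI0 (symF q x) s :=
  (contDiff_powI0 hs).comp (contDiff_symF q)

theorem continuous_powF (q : Fin (m + 1) → Fin (d + 1) → ℝ) {s : ℂ} (hs : 0 < s.re) :
    Continuous fun x => powI0 (symF q x) s :=
  (continuous_powI0 hs).comp (contDiff_symF q).continuous

theorem hasDerivAt_momentum (q : Fin (m + 1) → Fin (d + 1) → ℝ) (i : Fin (m + 1))
    (x : Fin m → ℝ) (μ : Fin (d + 1)) :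
    HasDerivAt (fun t : ℝ => (∑ j, bary (x + t • (vtx i - x)) j • q j) μ)
      (q i μ - (∑ j, bary x j • q j) μ) 0 := by
  simp only [Finset.sum_apply, Pi.smul_apply, smul_eq_mul]
  refine (HasDerivAt.fun_sum fun j _ => (hasDerivAt_bary_line i j x).mul_const (q j μ)).congr_deriv
    ?_
  simp [sub_mul, Finset.sum_sub_distrib]

theorem hasDerivAt_mdot_momentum (q : Fin (m + 1) → Fin (d + 1) → ℝ) (i : Fin (m + 1))
    (x : Fin m → ℝ) :
    HasDerivAt (fun t : ℝ => mdot (∑ j, bary (x + t • (vtx i - x)) j • q j)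
        (∑ j, bary (x + t • (vtx i - x)) j • q j))
      (2 * mdot (∑ j, bary x j • q j) (q i - ∑ j, bary x j • q j)) 0 := by
  unfold mdot
  refine (HasDerivAt.fun_sum fun μ _ => (((hasDerivAt_momentum q i x μ).const_mul
    (eta μ)).mul (hasDerivAt_momentum q i x μ))).congr_deriv ?_
  simp only [zero_smul, add_zero, Finset.mul_sum, Pi.sub_apply]
  exact Finset.sum_congr rfl fun μ _ => by ring

theorem eval_propDen (q : Fin (m + 1) → Fin (d + 1) → ℝ) (i : Fin (m + 1)) (x : Fin m → ℝ) :
    evalShift q (propDen (q i)) x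
      = (mdot (q i - ∑ j, bary x j • q j) (q i - ∑ j, bary x j • q j) : ℝ) := by
  rw [evalShift, propDen_eq, mdot_sub_left, mdot_sub_right, mdot_sub_right,
    mdot_comm (q i) (∑ j, bary x j • q j)]
  set Q := ∑ j, bary x j • q j with hQ
  simp only [map_add, map_mul, map_sum, eval_X, eval_C, shiftPoint, Option.elim, ← hQ]
  have h : mdot Q (q i) = ∑ μ, eta μ * Q μ * q i μ := rfl
  rw [h]
  push_cast
  have h2 : ∑ μ, (eta μ : ℂ) * -(Q μ : ℂ) * (q i μ : ℂ) = -∑ μ, (eta μ : ℂ) * Q μ * q i μ := by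
    rw [← Finset.sum_neg_distrib]
    exact Finset.sum_congr rfl fun μ _ => by ring
  rw [h2]
  simp
  ring

/-- Along the vector field pointing to the vertex `i`, the quadratic form `F` changes by the
inverse propagator `(k + q_i)²`. -/
theorem fderiv_symF (q : Fin (m + 1) → Fin (d + 1) → ℝ) (i : Fin (m + 1)) (x : Fin m → ℝ) :
    HasDerivAt (fun t : ℝ => symF q (x + t • (vtx i - x)))
      (-mdot (q i - ∑ j, bary x j • q j) (q i - ∑ j, bary x j • q j) - symF q x) 0 := by
  have h1 : (fun t : ℝ => symF q (x + t • (vtx i - x))) = fun t =>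
      mdot (∑ j, bary (x + t • (vtx i - x)) j • q j) (∑ j, bary (x + t • (vtx i - x)) j • q j)
        - ∑ j, bary (x + t • (vtx i - x)) j * mdot (q j) (q j) :=
    funext fun t => secondSymanzik_eq q _ (sum_bary _)
  rw [h1]
  refine ((hasDerivAt_mdot_momentum q i x).sub (HasDerivAt.fun_sum fun j _ =>
    (hasDerivAt_bary_line i j x).mul_const (mdot (q j) (q j)))).congr_deriv ?_
  have h2 : symF q x = _ := secondSymanzik_eq q _ (sum_bary _)
  rw [h2]
  simp only [sub_mul, Finset.sum_sub_distrib, ite_mul, one_mul, zero_mul, Finset.sum_ite_eq',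
    Finset.mem_univ, if_true]
  rw [mdot_sub_left, mdot_sub_right, mdot_sub_right, mdot_comm (q i) (∑ j, bary x j • q j)]
  ring

theorem fderiv_evalShift (q : Fin (m + 1) → Fin (d + 1) → ℝ) (P : LoopPoly d)
    (i : Fin (m + 1)) (x : Fin m → ℝ) :
    HasDerivAt (fun t : ℝ => evalShift q P (x + t • (vtx i - x)))
      (-evalShift q (eulerOp (q i) P) x) 0 := by
  set Q := ∑ j, bary x j • q j with hQ
  have hc : ∀ o, HasDerivAt (fun t : ℝ => shiftPoint q (bary (x + t • (vtx i - x))) o)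
      (o.elim (((2 * mdot Q (q i - Q) : ℝ)) : ℂ) fun μ => ((-(q i μ - Q μ) : ℝ) : ℂ)) 0 := by
    intro o
    cases o with
    | none => exact (hasDerivAt_mdot_momentum q i x).ofReal_comp
    | some μ => exact (hasDerivAt_momentum q i x μ).neg.ofReal_comp
  refine (hasDerivAt_eval hc P).congr_deriv ?_
  rw [Fintype.sum_option]
  simp only [zero_smul, add_zero, Option.elim, evalShift, eulerOp, map_add, map_mul, map_sum,
    eval_X, eval_C, shiftPoint, ← hQ]
  have h2 : ∑ μ, (eta μ : ℂ) * ((-Q μ : ℝ) : ℂ) * (q i μ : ℂ) = ((-mdot Q (q i) : ℝ) : ℂ) := by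
    simp only [mdot]
    push_cast
    rw [← Finset.sum_neg_distrib]
    exact Finset.sum_congr rfl fun μ _ => by ring
  rw [h2, mdot_sub_right, neg_add, ← Finset.sum_neg_distrib, add_comm]
  congr 1
  · refine Finset.sum_congr rfl fun μ _ => ?_
    push_cast
    ring
  · push_cast
    simp
    ring

end Shift

section Cancellation

variable {d m : ℕ}

/-- The coefficient of the term of order `2r` in a Feynman integral with `A` propagators, without
the factorials of the exponents of the propagators. -/
def loopCoef (A r : ℕ) (n : ℂ) : ℂ :=
  Complex.I * (-1) ^ (A + r) / (4 * (Real.pi : ℂ)) ^ (n / 2)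
    * Complex.Gamma ((A : ℂ) - r - n / 2) / (4 ^ r * (r.factorial : ℂ))

/-- The parameter integral of the term of order `2r`, where `K` are the exponents of the propagators
lowered by one. -/
def paramIntegral (q : Fin (m + 1) → Fin (d + 1) → ℝ) (K : Fin (m + 1) → ℕ) (Q : LoopPoly d)
    (s : ℂ) : ℂ :=
  ∫ x in feynmanSimplex m, wt K x * (evalShift q Q x * powI0 (symF q x) s)

theorem integrableOn_param (q : Fin (m + 1) → Fin (d + 1) → ℝ) (K : Fin (m + 1) → ℕ)
    (Q : LoopPoly d) {s : ℂ} (hs : 0 < s.re) :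
    IntegrableOn (fun x => wt K x * (evalShift q Q x * powI0 (symF q x) s)) (feynmanSimplex m) :=
  integrableOn_simplex ((contDiff_wt K).continuous.mul
    ((contDiff_evalShift q Q).continuous.mul (continuous_powF q hs)))

theorem evalShift_add (q : Fin (m + 1) → Fin (d + 1) → ℝ) (P Q : LoopPoly d) (x : Fin m → ℝ) :
    evalShift q (P + Q) x = evalShift q P x + evalShift q Q x := map_add _ _ _

theorem evalShift_mul (q : Fin (m + 1) → Fin (d + 1) → ℝ) (P Q : LoopPoly d) (x : Fin m → ℝ) :
    evalShift q (P * Q) x = evalShift q P x * evalShift q Q x := map_mul _ _ _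

theorem evalShift_C (q : Fin (m + 1) → Fin (d + 1) → ℝ) (c : ℂ) (x : Fin m → ℝ) :
    evalShift q (C c) x = c := eval_C _

theorem paramIntegral_add (q : Fin (m + 1) → Fin (d + 1) → ℝ) (K : Fin (m + 1) → ℕ)
    (P Q : LoopPoly d) {s : ℂ} (hs : 0 < s.re) :
    paramIntegral q K (P + Q) s = paramIntegral q K P s + paramIntegral q K Q s := by
  unfold paramIntegral
  rw [← integral_add (integrableOn_param q K P hs) (integrableOn_param q K Q hs)]
  refine integral_congr_ae (Filter.Eventually.of_forall fun x => ?_)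
  simp only [evalShift_add]
  ring

theorem paramIntegral_C_mul (q : Fin (m + 1) → Fin (d + 1) → ℝ) (K : Fin (m + 1) → ℕ)
    (c : ℂ) (Q : LoopPoly d) (s : ℂ) :
    paramIntegral q K (C c * Q) s = c * paramIntegral q K Q s := by
  unfold paramIntegral
  rw [← integral_const_mul]
  refine integral_congr_ae (Filter.Eventually.of_forall fun x => ?_)
  simp only [evalShift_mul, evalShift_C]
  ring

theorem paramIntegral_zero (q : Fin (m + 1) → Fin (d + 1) → ℝ) (K : Fin (m + 1) → ℕ) (s : ℂ) :
    paramIntegral q K (0 : LoopPoly d) s = 0 := by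
  simp [paramIntegral, evalShift]

/-- A Feynman integral as a finite sum whose length may exceed the degree of the numerator. -/
theorem feynmanIntegral_eq_sum (q : Fin (m + 1) → Fin (d + 1) → ℝ) (ν K : Fin (m + 1) → ℕ)
    (hν : ∀ i, ν i = K i + 1) (P : LoopPoly d) (n : ℂ) {R : ℕ} (hR : P.totalDegree < R) :
    feynmanIntegral q ν P n = ∑ r ∈ Finset.range R,
      loopCoef (∑ i, K i + m + 1) r n / (∏ i, ((K i).factorial : ℂ))
        * paramIntegral q K ((box n)^[r] P) (n / 2 + r - (∑ i, K i + m + 1 : ℕ)) := by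
  have hA : ∑ i, ν i = ∑ i, K i + m + 1 := by
    simp [hν, Finset.sum_add_distrib, add_assoc]
  have hsub : Finset.range (P.totalDegree + 1) ⊆ Finset.range R := Finset.range_mono hR
  rw [← Finset.sum_subset hsub]
  · unfold feynmanIntegral
    refine Finset.sum_congr rfl fun r _ => ?_
    rw [hA]
    have h1 : ∀ i, ν i - 1 = K i := fun i => by rw [hν]; rfl
    simp only [h1]
    congr 1
    · unfold loopCoef
      rw [mul_assoc (∏ i, _), div_div, mul_comm (4 ^ r * (r.factorial : ℂ))]
    · unfold paramIntegral
      refine integral_congr_ae (Filter.Eventually.of_forall fun x => ?_)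
      simp only [wt, evalShift, symF, mul_assoc]
  · intro r _ hr
    rw [iterate_box_eq_zero n P (by simpa using hr), paramIntegral_zero, mul_zero]

/-- The exponent of `F` in the term of order `2r` after the cancellation of one propagator. -/
theorem one_lt_re_exponent {n : ℂ} {A : ℕ} (r : ℕ) (hn : 2 * ((A : ℝ) + 1) < n.re) :
    1 < (n / 2 + r - (A : ℂ)).re := by
  have : (n / 2).re = n.re / 2 := by
    rw [show (2 : ℂ) = ((2 : ℝ) : ℂ) by norm_num, Complex.div_ofReal_re]
  simp [this]
  have : (0 : ℝ) ≤ r := r.cast_nonneg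
  linarith

/-- Cancelling a propagator in the term of order `2r` costs a factor from the functional equation of
the Gamma function. -/
theorem loopCoef_succ {n : ℂ} {A : ℕ} (r : ℕ) (hs : n / 2 + r - (A : ℂ) ≠ 0) :
    loopCoef (A + 1) r n = loopCoef A r n * (n / 2 + r - (A : ℂ)) := by
  have h : ((A + 1 : ℕ) : ℂ) - r - n / 2 = ((A : ℂ) - r - n / 2) + 1 := by push_cast; ring
  have h0 : (A : ℂ) - r - n / 2 ≠ 0 := fun h' => hs (by linear_combination -h')
  unfold loopCoef
  rw [h, Complex.Gamma_add_one _ h0]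
  ring

theorem loopCoef_succ_succ (n : ℂ) (A r : ℕ) :
    loopCoef (A + 1) (r + 1) n * (4 * ((r : ℂ) + 1)) = loopCoef A r n := by
  have h : ((A + 1 : ℕ) : ℂ) - (r + 1 : ℕ) - n / 2 = (A : ℂ) - r - n / 2 := by push_cast; ring
  have h1 : (r : ℂ) + 1 ≠ 0 := by exact_mod_cast Nat.succ_ne_zero r
  have h2 : (r.factorial : ℂ) ≠ 0 := by exact_mod_cast r.factorial_ne_zero
  have h3 : (-1 : ℂ) ^ (A + 1 + (r + 1)) = (-1) ^ (A + r) := by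
    rw [show A + 1 + (r + 1) = (A + r) + 2 by ring, pow_add]; simp
  unfold loopCoef
  rw [h, h3, Nat.factorial_succ]
  push_cast
  field_simp
  ring

/-- The numerator `(k + q_i)²` turns the integrand into a total derivative along the vector field
that points to the vertex `i` of the simplex. -/
theorem feynmanIntegral_propDen_mul (q : Fin (m + 1) → Fin (d + 1) → ℝ)
    (ν K : Fin (m + 1) → ℕ) (hν : ∀ i, ν i = K i + 1) (i : Fin (m + 1)) (P : LoopPoly d) (n : ℂ)
    (hn : 2 * (((∑ j, K j + m : ℕ) : ℝ) + 1) < n.re)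
    {Λ : ((Fin m → ℝ) → ℂ) → ℂ} (hΛ : IsFaceIntegral i Λ) {R : ℕ} (hR : P.totalDegree < R) :
    feynmanIntegral q ν (propDen (q i) * P) n = ∑ r ∈ Finset.range R,
      loopCoef (∑ j, K j + m) r n / (∏ j, ((K j).factorial : ℂ)) *
        (K i * paramIntegral q (Function.update K i (K i - 1)) ((box n)^[r] P)
            (n / 2 + r - (∑ j, K j + m : ℕ))
          + Λ (fun x => wt K x * (evalShift q ((box n)^[r] P) x
            * powI0 (symF q x) (n / 2 + r - (∑ j, K j + m : ℕ))))) := by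
  set A : ℕ := ∑ j, K j + m with hA
  set N : ℂ := ∏ j, ((K j).factorial : ℂ)
  -- a bound for the number of terms that is large enough for both numerators
  obtain ⟨R', hR', hRR'⟩ : ∃ R', (propDen (q i) * P).totalDegree < R' + 1 ∧ R ≤ R' :=
    ⟨max R (propDen (q i) * P).totalDegree, by omega, le_max_left _ _⟩
  have hs1 : ∀ r : ℕ, 1 < (n / 2 + r - (A : ℂ)).re := fun r => one_lt_re_exponent r hn
  have hs0 : ∀ r : ℕ, 0 < (n / 2 + r - ((A + 1 : ℕ) : ℂ)).re := fun r => by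
    have := hs1 r
    simp at this ⊢
    linarith
  have hext : ∀ T : ℕ → LoopPoly d → ℂ, (∀ r, T r 0 = 0) →
      ∑ r ∈ Finset.range R, T r ((box n)^[r] P) = ∑ r ∈ Finset.range R', T r ((box n)^[r] P) := by
    intro T hT
    refine Finset.sum_subset (Finset.range_mono hRR') fun r _ hr => ?_
    rw [iterate_box_eq_zero n P (hR.trans_le (by simpa using hr)), hT]
  have hΛ0 : Λ (fun _ => 0) = 0 := by
    have := hΛ (fun _ => 0) contDiff_const
    simpa using this
  rw [hext (fun r Q => loopCoef A r n / N * (K i * paramIntegral q (Function.update K i (K i - 1)) Q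
      (n / 2 + r - (A : ℂ)) + Λ (fun x => wt K x * (evalShift q Q x
            * powI0 (symF q x) (n / 2 + r - (A : ℂ))))))
      (fun r => by simp [paramIntegral_zero, evalShift, hΛ0])]
  have h1 : ∀ r : ℕ, paramIntegral q K ((box n)^[r + 1] (propDen (q i) * P))
        (n / 2 + (r + 1 : ℕ) - ((A + 1 : ℕ) : ℂ))
      = paramIntegral q K (propDen (q i) * (box n)^[r + 1] P)
          (n / 2 + (r + 1 : ℕ) - ((A + 1 : ℕ) : ℂ))
        + (4 * ((r : ℂ) + 1)) * (paramIntegral q K (eulerOp (q i) ((box n)^[r] P))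
            (n / 2 + (r + 1 : ℕ) - ((A + 1 : ℕ) : ℂ))
          + (n / 2 + r) * paramIntegral q K ((box n)^[r] P)
            (n / 2 + (r + 1 : ℕ) - ((A + 1 : ℕ) : ℂ))) := by
    intro r
    rw [iterate_box_propDen_mul, paramIntegral_add _ _ _ _ (hs0 _),
      paramIntegral_add _ _ _ _ (hs0 _), paramIntegral_C_mul, paramIntegral_C_mul]
    ring
  have h0 := feynmanIntegral_eq_sum q ν K hν (propDen (q i) * P) n hR'
  rw [← hA] at h0
  set t : ℕ → ℂ := fun r => loopCoef (A + 1) r n / N *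
    paramIntegral q K (propDen (q i) * (box n)^[r] P) (n / 2 + r - ((A + 1 : ℕ) : ℂ)) with ht
  set u : ℕ → ℂ := fun r => loopCoef (A + 1) (r + 1) n / N *
    ((4 * ((r : ℂ) + 1)) * (paramIntegral q K (eulerOp (q i) ((box n)^[r] P))
            (n / 2 + (r + 1 : ℕ) - ((A + 1 : ℕ) : ℂ))
          + (n / 2 + r) * paramIntegral q K ((box n)^[r] P)
            (n / 2 + (r + 1 : ℕ) - ((A + 1 : ℕ) : ℂ)))) with hu
  have hstep : ∀ r : ℕ, loopCoef (A + 1) (r + 1) n / N *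
      paramIntegral q K ((box n)^[r + 1] (propDen (q i) * P))
        (n / 2 + (r + 1 : ℕ) - ((A + 1 : ℕ) : ℂ)) = t (r + 1) + u r := by
    intro r
    rw [h1, mul_add]
  have hlast : t R' = 0 := by
    simp only [ht]
    rw [iterate_box_eq_zero n P (hR.trans_le hRR'), mul_zero, paramIntegral_zero, mul_zero]
  have hsum : feynmanIntegral q ν (propDen (q i) * P) n = ∑ r ∈ Finset.range R', (t r + u r) := by
    rw [h0, Finset.sum_range_succ', Finset.sum_congr rfl (fun r _ => hstep r),
      Finset.sum_add_distrib, Finset.sum_add_distrib]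
    have h2 := Finset.sum_range_succ' t R'
    rw [Finset.sum_range_succ, hlast, add_zero] at h2
    rw [h2]
    have h3 : t 0 = loopCoef (A + 1) 0 n / N * paramIntegral q K
        ((box n)^[0] (propDen (q i) * P)) (n / 2 + (0 : ℕ) - ((A + 1 : ℕ) : ℂ)) := rfl
    rw [← h3]
    ring
  rw [hsum]
  refine Finset.sum_congr rfl fun r _ => ?_
  simp only [ht, hu]
  set Q := (box n)^[r] P
  have hexp : n / 2 + (r + 1 : ℕ) - ((A + 1 : ℕ) : ℂ) = n / 2 + r - (A : ℂ) := by push_cast; ring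
  have hexp' : n / 2 + r - ((A + 1 : ℕ) : ℂ) = (n / 2 + r - (A : ℂ)) - 1 := by push_cast; ring
  rw [hexp, hexp']
  set s := n / 2 + r - (A : ℂ) with hs
  have hs1' : 1 < s.re := hs1 r
  have hsne : s ≠ 0 := fun h => by rw [h] at hs1'; norm_num at hs1'
  have hH : ContDiff ℝ 1 fun x : Fin m → ℝ => evalShift q Q x * powI0 (symF q x) s :=
    (contDiff_evalShift q Q).mul (contDiff_powF q hs1')
  have hibp := hΛ.ibp K hH
  have hder : ∀ x, fderiv ℝ (fun x : Fin m → ℝ => evalShift q Q x * powI0 (symF q x) s) x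
        (vtx i - x)
      = -(evalShift q (eulerOp (q i) Q) x * powI0 (symF q x) s)
        - s * (evalShift q (propDen (q i) * Q) x * powI0 (symF q x) (s - 1))
        - s * (evalShift q Q x * powI0 (symF q x) s) := by
    intro x
    refine fderiv_vtx hH i x ?_
    have e1 := fderiv_evalShift q Q i x
    have e2 : HasDerivAt (fun F : ℝ => powI0 F s) (s * powI0 (symF q x) (s - 1))
        (symF q (x + (0 : ℝ) • (vtx i - x))) := by
      rw [zero_smul, add_zero]
      exact hasDerivAt_powI0 hs1' _
    have e3 := HasDerivAt.scomp (0 : ℝ) e2 (fderiv_symF q i x)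
    refine (e1.mul e3).congr_deriv ?_
    have e4 := powI0_mul_self (symF q x) hsne
    rw [evalShift_mul, eval_propDen]
    simp only [Function.comp, zero_smul, add_zero, Complex.real_smul]
    push_cast
    linear_combination (-(s * evalShift q Q x)) * e4
  simp only [hder] at hibp
  have hI : ∫ x in feynmanSimplex m, wt K x * ((((∑ j, K j : ℕ) : ℂ) + m)
        * (evalShift q Q x * powI0 (symF q x) s)
        - (-(evalShift q (eulerOp (q i) Q) x * powI0 (symF q x) s)
        - s * (evalShift q (propDen (q i) * Q) x * powI0 (symF q x) (s - 1))
        - s * (evalShift q Q x * powI0 (symF q x) s)))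
      = (n / 2 + r) * paramIntegral q K Q s + paramIntegral q K (eulerOp (q i) Q) s
        + s * paramIntegral q K (propDen (q i) * Q) (s - 1) := by
    unfold paramIntegral
    have hs0' : 0 < (s - 1).re := by simpa using hs1'
    have hs0'' : 0 < s.re := by linarith
    have i1 := (integrableOn_param q K Q hs0'').const_mul (n / 2 + r)
    have i2 := integrableOn_param q K (eulerOp (q i) Q) hs0''
    have i3 := (integrableOn_param q K (propDen (q i) * Q) hs0').const_mul s
    have e1 := integral_add i1 i2
    have e2 := integral_add (i1.add i2) i3
    simp only [Pi.add_apply] at e1 e2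
    rw [← integral_const_mul, ← integral_const_mul, ← e1, ← e2]
    refine integral_congr_ae (Filter.Eventually.of_forall fun x => ?_)
    have hA' : ((∑ j, K j : ℕ) : ℂ) + m = n / 2 + r - s := by
      rw [hs, hA]; push_cast; ring
    simp only [hA']
    ring
  have hibp' := hI.symm.trans hibp
  have hpar : (K i : ℂ) * paramIntegral q (Function.update K i (K i - 1)) Q s
      = K i * ∫ x in feynmanSimplex m,
        wt (Function.update K i (K i - 1)) x * (evalShift q Q x * powI0 (symF q x) s) := rfl
  rw [hpar, ← hibp', loopCoef_succ r (by rwa [← hs]), ← hs]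
  have hc : loopCoef (A + 1) (r + 1) n / N * (4 * ((r : ℂ) + 1)) = loopCoef A r n / N := by
    rw [← loopCoef_succ_succ n A r]; ring
  rw [← mul_assoc (loopCoef (A + 1) (r + 1) n / N), hc]
  ring

end Cancellation

section Propagators

variable {d m : ℕ}

/-- A propagator with exponent at least two loses one power to the numerator `(k + q_i)²`; the
boundary term vanishes because the Feynman parameter of the propagator vanishes on the face. -/
theorem feynmanIntegral_lower (q : Fin (m + 1) → Fin (d + 1) → ℝ)
    (ν : Fin (m + 1) → ℕ) (hν : ∀ i, 1 ≤ ν i) (i : Fin (m + 1)) (hi : 2 ≤ ν i) (P : LoopPoly d)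
    (n : ℂ) (hn : 2 * ((∑ j, ν j : ℕ) : ℝ) < n.re)
    {Λ : ((Fin m → ℝ) → ℂ) → ℂ} (hΛ : IsFaceIntegral i Λ)
    (hface : ∀ (K : Fin (m + 1) → ℕ) (H : (Fin m → ℝ) → ℂ), K i ≠ 0 →
      Λ (fun x => wt K x * H x) = 0) :
    feynmanIntegral q ν (propDen (q i) * P) n
      = feynmanIntegral q (Function.update ν i (ν i - 1)) P n := by
  set K : Fin (m + 1) → ℕ := fun j => ν j - 1 with hK
  have hνK : ∀ j, ν j = K j + 1 := fun j => by have := hν j; simp only [hK]; omega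
  have hKi : K i = ν i - 1 := rfl
  have hsum : ∑ j, ν j = ∑ j, K j + m + 1 := by
    simp [hνK, Finset.sum_add_distrib, add_assoc]
  have hn' : 2 * (((∑ j, K j + m : ℕ) : ℝ) + 1) < n.re := by
    rw [hsum] at hn; exact_mod_cast hn
  have hν' : ∀ j, Function.update ν i (ν i - 1) j = Function.update K i (K i - 1) j + 1 := by
    intro j
    by_cases h : j = i
    · subst h
      simp only [Function.update_self]; omega
    · simp only [Function.update_of_ne h, hνK]
  have hsumK : ∑ j, Function.update K i (K i - 1) j + m + 1 = ∑ j, K j + m := by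
    have h1 := Finset.sum_update_of_mem (Finset.mem_univ i) K (K i - 1)
    have h2 := Finset.add_sum_erase Finset.univ K (Finset.mem_univ i)
    rw [Finset.sdiff_singleton_eq_erase] at h1
    rw [h1, ← h2]; omega
  have hprod : ∏ j, ((K j).factorial : ℂ)
      = K i * ∏ j, ((Function.update K i (K i - 1) j).factorial : ℂ) := by
    rw [← Finset.mul_prod_erase Finset.univ _ (Finset.mem_univ i),
      ← Finset.mul_prod_erase Finset.univ (fun j => ((Function.update K i (K i - 1) j).factorial : ℂ))
        (Finset.mem_univ i), Function.update_self, ← mul_assoc]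
    have h1 : (K i).factorial = K i * (K i - 1).factorial :=
      (Nat.mul_factorial_pred (by omega)).symm
    rw [h1, Nat.cast_mul]
    refine congrArg _ (Finset.prod_congr rfl fun j hj => ?_)
    rw [Function.update_of_ne (Finset.ne_of_mem_erase hj)]
  have hKi0 : (K i : ℂ) ≠ 0 := by
    have : K i ≠ 0 := by omega
    exact_mod_cast this
  rw [feynmanIntegral_propDen_mul q ν K hνK i P n hn' hΛ P.totalDegree.lt_succ_self,
    feynmanIntegral_eq_sum q _ _ hν' P n P.totalDegree.lt_succ_self, hsumK]
  refine Finset.sum_congr rfl fun r _ => ?_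
  rw [hface K _ (by omega), add_zero, hprod]
  field_simp

theorem bary_edge (i : Fin 3) (t : ℝ) :
    bary (edge i t) = i.insertNth 0 (bary fun _ : Fin 1 => t) := by
  fin_cases i <;> funext j <;> fin_cases j <;> simp [bary, edge, Fin.insertNth] <;> rfl

theorem wt_edge_of_ne (i : Fin 3) (K : Fin 3 → ℕ) (h : K i ≠ 0) (t : ℝ) : wt K (edge i t) = 0 := by
  refine Finset.prod_eq_zero (Finset.mem_univ i) ?_
  rw [bary_edge, Fin.insertNth_apply_same]
  simpa using h

theorem wt_edge (i : Fin 3) (K : Fin 3 → ℕ) (h : K i = 0) (t : ℝ) :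
    wt K (edge i t) = wt (fun j => K (i.succAbove j)) fun _ : Fin 1 => t := by
  unfold wt
  rw [Fin.prod_univ_succAbove _ i, h, pow_zero, one_mul, bary_edge]
  simp only [Fin.insertNth_apply_succAbove]

theorem symF_edge (i : Fin 3) (q : Fin 3 → Fin (d + 1) → ℝ) (t : ℝ) :
    symF q (edge i t) = symF (fun j => q (i.succAbove j)) fun _ : Fin 1 => t := by
  unfold symF
  rw [bary_edge]
  unfold secondSymanzik
  fin_cases i <;>
    simp [Fin.sum_univ_succ, Fin.insertNth, bary, Fin.succAboveCases, Fin.succAbove]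

theorem evalShift_edge (i : Fin 3) (q : Fin 3 → Fin (d + 1) → ℝ) (P : LoopPoly d) (t : ℝ) :
    evalShift q P (edge i t) = evalShift (fun j => q (i.succAbove j)) P fun _ : Fin 1 => t := by
  have hs : ∑ j, bary (edge i t) j • q j
      = ∑ j, bary (fun _ : Fin 1 => t) j • q (i.succAbove j) := by
    rw [Fin.sum_univ_succAbove _ i, bary_edge]
    simp
  unfold evalShift shiftPoint
  rw [hs]

/-- A propagator of the triangle is contracted by the numerator `(k + q_i)²`. -/
theorem feynmanIntegral_contract (q : Fin 3 → Fin (d + 1) → ℝ)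
    (ν : Fin 3 → ℕ) (hν : ∀ i, 1 ≤ ν i) (i : Fin 3) (hi : ν i = 1) (P : LoopPoly d)
    (n : ℂ) (hn : 2 * ((∑ j, ν j : ℕ) : ℝ) < n.re) :
    feynmanIntegral q ν (propDen (q i) * P) n
      = feynmanIntegral (fun j => q (i.succAbove j)) (fun j => ν (i.succAbove j)) P n := by
  set K : Fin 3 → ℕ := fun j => ν j - 1 with hK
  have hνK : ∀ j, ν j = K j + 1 := fun j => by have := hν j; simp only [hK]; omega
  have hKi : K i = 0 := by simp [hK, hi]
  have hsum : ∑ j, ν j = ∑ j, K j + 2 + 1 := by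
    simp [hνK, Finset.sum_add_distrib, add_assoc]
  have hn' : 2 * (((∑ j, K j + 2 : ℕ) : ℝ) + 1) < n.re := by
    rw [hsum] at hn; exact_mod_cast hn
  have hsumK : ∑ j, K j = ∑ j, K (i.succAbove j) := by
    rw [Fin.sum_univ_succAbove _ i, hKi, zero_add]
  have hprod : ∏ j, ((K j).factorial : ℂ) = ∏ j, ((K (i.succAbove j)).factorial : ℂ) := by
    rw [Fin.prod_univ_succAbove _ i, hKi]; simp
  rw [feynmanIntegral_propDen_mul q ν K hνK i P n hn' (isFaceIntegral_two i)
      P.totalDegree.lt_succ_self,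
    feynmanIntegral_eq_sum _ _ (fun j => K (i.succAbove j)) (fun j => hνK _) P n
      P.totalDegree.lt_succ_self]
  refine Finset.sum_congr rfl fun r _ => ?_
  rw [hKi, Nat.cast_zero, zero_mul, zero_add, hprod, hsumK]
  refine congrArg _ ?_
  unfold paramIntegral
  rw [integral_simplex_one]
  refine intervalIntegral.integral_congr fun t _ => ?_
  simp only [wt_edge i K hKi, symF_edge, evalShift_edge]

theorem propDen_zero : propDen (0 : Fin (d + 1) → ℝ) = X none := by
  rw [propDen_eq]
  simp [mdot]

end Propagators

/-! ### Reflection of the loop momentum -/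

section LoopIntegrals

variable {d m : ℕ}

theorem re_exponent_pos {n : ℂ} {A : ℕ} (r : ℕ) (hn : 2 * (A : ℝ) < n.re) :
    0 < (n / 2 + r - (A : ℂ)).re := by
  have : (n / 2).re = n.re / 2 := by
    rw [show (2 : ℂ) = ((2 : ℝ) : ℂ) by norm_num, Complex.div_ofReal_re]
  simp [this]
  have : (0 : ℝ) ≤ r := r.cast_nonneg
  linarith

theorem feynmanIntegral_add (q : Fin (m + 1) → Fin (d + 1) → ℝ) (ν : Fin (m + 1) → ℕ)
    (hν : ∀ i, 1 ≤ ν i) (P Q : LoopPoly d) (n : ℂ) (hn : 2 * ((∑ j, ν j : ℕ) : ℝ) < n.re) :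
    feynmanIntegral q ν (P + Q) n = feynmanIntegral q ν P n + feynmanIntegral q ν Q n := by
  set K : Fin (m + 1) → ℕ := fun j => ν j - 1 with hK
  have hνK : ∀ j, ν j = K j + 1 := fun j => by have := hν j; simp only [hK]; omega
  have hsum : ∑ j, ν j = ∑ j, K j + m + 1 := by
    simp [hνK, Finset.sum_add_distrib, add_assoc]
  obtain ⟨R, h1, h2, h3⟩ : ∃ R, (P + Q).totalDegree < R ∧ P.totalDegree < R ∧ Q.totalDegree < R :=
    ⟨(P + Q).totalDegree + P.totalDegree + Q.totalDegree + 1, by omega, by omega, by omega⟩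
  rw [feynmanIntegral_eq_sum q ν K hνK _ n h1, feynmanIntegral_eq_sum q ν K hνK _ n h2,
    feynmanIntegral_eq_sum q ν K hνK _ n h3, ← Finset.sum_add_distrib]
  refine Finset.sum_congr rfl fun r _ => ?_
  rw [hsum] at hn
  rw [iterate_box_add, paramIntegral_add _ _ _ _ (re_exponent_pos r hn), mul_add]

theorem feynmanIntegral_C_mul (q : Fin (m + 1) → Fin (d + 1) → ℝ) (ν : Fin (m + 1) → ℕ)
    (hν : ∀ i, 1 ≤ ν i) (c : ℂ) (P : LoopPoly d) (n : ℂ) :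
    feynmanIntegral q ν (C c * P) n = c * feynmanIntegral q ν P n := by
  set K : Fin (m + 1) → ℕ := fun j => ν j - 1 with hK
  have hνK : ∀ j, ν j = K j + 1 := fun j => by have := hν j; simp only [hK]; omega
  obtain ⟨R, h1, h2⟩ : ∃ R, (C c * P).totalDegree < R ∧ P.totalDegree < R :=
    ⟨(C c * P).totalDegree + P.totalDegree + 1, by omega, by omega⟩
  rw [feynmanIntegral_eq_sum q ν K hνK _ n h1, feynmanIntegral_eq_sum q ν K hνK _ n h2,
    Finset.mul_sum]
  refine Finset.sum_congr rfl fun r _ => ?_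
  rw [iterate_box_C_mul, paramIntegral_C_mul]
  ring

/-- The substitution `k → -k - v` in polynomials in the loop momentum. -/
def reflect (v : Fin (d + 1) → ℝ) : LoopPoly d →ₐ[ℂ] LoopPoly d :=
  aeval fun i => i.elim (X none + 2 * ∑ μ, C (eta μ : ℂ) * X (some μ) * C (v μ : ℂ)
      + C (mdot v v : ℂ)) (fun μ => -X (some μ) - C (v μ : ℂ))

theorem reflect_C (v : Fin (d + 1) → ℝ) (c : ℂ) : reflect v (C c) = C c := by
  simp [reflect, MvPolynomial.algebraMap_eq]

theorem reflect_none (v : Fin (d + 1) → ℝ) : reflect v (X none) = X none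
    + 2 * ∑ μ, C (eta μ : ℂ) * X (some μ) * C (v μ : ℂ) + C (mdot v v : ℂ) := by
  simp [reflect]

theorem reflect_some (v : Fin (d + 1) → ℝ) (μ : Fin (d + 1)) :
    reflect v (X (some μ)) = -X (some μ) - C (v μ : ℂ) := by
  simp [reflect]

theorem pderiv_none_reflect (v : Fin (d + 1) → ℝ) (P : LoopPoly d) :
    pderiv none (reflect v P) = reflect v (pderiv none P) := by
  induction P using MvPolynomial.induction_on with
  | C c => rw [reflect_C]; simp
  | add P Q hP hQ => simp only [map_add, hP, hQ]
  | mul_X P i hP =>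
    rw [map_mul, pderiv_mul, pderiv_mul, hP, map_add, map_mul, map_mul]
    refine congrArg (reflect v (pderiv none P) * reflect v (X i) + reflect v P * ·) ?_
    cases i with
    | none =>
      have h : (X none + 2 * ∑ μ, C (eta μ : ℂ) * X (some μ) * C (v μ : ℂ)
          + C (mdot v v : ℂ) : LoopPoly d) = propDen v := (propDen_eq v).symm
      rw [reflect_none, h, pderiv_none_propDen, pderiv_X_self, map_one]
    | some μ =>
      rw [reflect_some, map_sub, map_neg, pderiv_C, pderiv_X_of_ne (by simp), map_zero]
      simp

theorem pderiv_some_reflect (v : Fin (d + 1) → ℝ) (μ : Fin (d + 1)) (P : LoopPoly d) :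
    pderiv (some μ) (reflect v P) = -reflect v (pderiv (some μ) P)
      + 2 * (C (eta μ : ℂ) * C (v μ : ℂ)) * reflect v (pderiv none P) := by
  induction P using MvPolynomial.induction_on with
  | C c => rw [reflect_C]; simp
  | add P Q hP hQ => simp only [map_add, hP, hQ]; ring
  | mul_X P i hP =>
    rw [map_mul, pderiv_mul, pderiv_mul, pderiv_mul, hP, map_add, map_mul, map_mul, map_add,
      map_mul, map_mul]
    have hi : pderiv (some μ) (reflect v (X i)) = -reflect v (pderiv (some μ) (X i))
      + 2 * (C (eta μ : ℂ) * C (v μ : ℂ)) * reflect v (pderiv none (X i)) := by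
      cases i with
      | none =>
        have h : (X none + 2 * ∑ μ, C (eta μ : ℂ) * X (some μ) * C (v μ : ℂ)
            + C (mdot v v : ℂ) : LoopPoly d) = propDen v := (propDen_eq v).symm
        rw [reflect_none, h, pderiv_some_propDen, pderiv_X_self, pderiv_X_of_ne (by simp), map_one,
          map_zero]
        ring
      | some ν =>
        rw [reflect_some, map_sub, map_neg, pderiv_C, pderiv_X_of_ne (i := none) (by simp)]
        by_cases h : ν = μ
        · subst h
          simp
        · rw [pderiv_X_of_ne (by simpa using h)]; simp
    rw [hi]
    ring

theorem box_reflect (n : ℂ) (v : Fin (d + 1) → ℝ) (P : LoopPoly d) :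
    box n (reflect v P) = reflect v (box n P) := by
  have h4 : reflect v (4 : LoopPoly d) = 4 := map_ofNat _ 4
  have hv : (C (mdot v v : ℂ) : LoopPoly d) = ∑ μ, C (eta μ : ℂ) * C (v μ : ℂ) * C (v μ : ℂ) := by
    rw [mdot]; push_cast; rw [map_sum]; simp only [map_mul]
  have hc : ∀ μ, (2 * (C (eta μ : ℂ) * C (v μ : ℂ)) : LoopPoly d) = C (2 * ((eta μ : ℂ) * (v μ : ℂ))) := by
    intro μ; simp only [map_mul, map_ofNat]
  have h2 : ∀ μ, pderiv (some μ) (pderiv (some μ) (reflect v P))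
      = reflect v (pderiv (some μ) (pderiv (some μ) P))
        - 4 * (C (eta μ : ℂ) * C (v μ : ℂ)) * reflect v (pderiv (some μ) (pderiv none P))
        + 4 * (C (eta μ : ℂ) * C (v μ : ℂ)) ^ 2 * reflect v (pderiv none (pderiv none P)) := by
    intro μ
    rw [pderiv_some_reflect, map_add, map_neg, pderiv_some_reflect, hc, pderiv_C_mul,
      pderiv_some_reflect, pderiv_comm none (some μ), ← hc]
    ring
  simp only [box, pderiv_none_reflect, h2, map_add, map_mul, map_sum, reflect_C, reflect_none,
    reflect_some, h4, hv]
  simp only [pderiv_some_reflect]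
  have hs : ∀ μ, 4 * (X (some μ) * (-reflect v (pderiv (some μ) (pderiv none P))
        + 2 * (C (eta μ : ℂ) * C (v μ : ℂ)) * reflect v (pderiv none (pderiv none P))))
      + C (eta μ : ℂ) * (reflect v (pderiv (some μ) (pderiv (some μ) P))
        - 4 * (C (eta μ : ℂ) * C (v μ : ℂ)) * reflect v (pderiv (some μ) (pderiv none P))
        + 4 * (C (eta μ : ℂ) * C (v μ : ℂ)) ^ 2 * reflect v (pderiv none (pderiv none P)))
      = 4 * (2 * (C (eta μ : ℂ) * X (some μ) * C (v μ : ℂ))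
          + C (eta μ : ℂ) * C (v μ : ℂ) * C (v μ : ℂ)) * reflect v (pderiv none (pderiv none P))
        + (4 * ((-X (some μ) - C (v μ : ℂ)) * reflect v (pderiv (some μ) (pderiv none P)))
        + C (eta μ : ℂ) * reflect v (pderiv (some μ) (pderiv (some μ) P))) := by
    intro μ
    linear_combination (4 * (C (v μ : ℂ)) ^ 2 * C (eta μ : ℂ) *
      reflect v (pderiv none (pderiv none P)) - 4 * C (v μ : ℂ) * 
      reflect v (pderiv (some μ) (pderiv none P))) * eta_mul_eta (d := d) μ
  have hsum := Finset.sum_congr (rfl : (Finset.univ : Finset (Fin (d + 1))) = Finset.univ)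
    fun μ _ => hs μ
  simp only [Finset.sum_add_distrib, ← Finset.mul_sum, ← Finset.sum_mul] at hsum
  linear_combination hsum

theorem iterate_box_reflect (n : ℂ) (v : Fin (d + 1) → ℝ) (r : ℕ) (P : LoopPoly d) :
    (box n)^[r] (reflect v P) = reflect v ((box n)^[r] P) := by
  induction r generalizing P with
  | zero => rfl
  | succ r ih => rw [Function.iterate_succ_apply, Function.iterate_succ_apply, box_reflect, ih]

/-- The shift point of the bubble with momenta `q₁, q₂` under `k → -k - q₁ - q₂`. -/
theorem evalShift_reflect (q₁ q₂ : Fin (d + 1) → ℝ) (P : LoopPoly d) (t : ℝ) :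
    evalShift ![q₁, q₂] (reflect (q₁ + q₂) P) (fun _ : Fin 1 => t)
      = evalShift ![q₁, q₂] P (fun _ : Fin 1 => 1 - t) := by
  set Q := ∑ j, bary (fun _ : Fin 1 => t) j • ![q₁, q₂] j with hQ
  have hQ' : ∑ j, bary (fun _ : Fin 1 => 1 - t) j • ![q₁, q₂] j = q₁ + q₂ - Q := by
    simp only [hQ, bary, Fin.sum_univ_succ]
    simp
    module
  have hX : ∀ i, evalShift ![q₁, q₂] (reflect (q₁ + q₂) (X i)) (fun _ : Fin 1 => t)
      = evalShift ![q₁, q₂] (X i) (fun _ : Fin 1 => 1 - t) := by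
    intro i
    rw [evalShift, evalShift, eval_X]
    cases i with
    | none =>
      rw [reflect_none]
      simp only [shiftPoint, map_add, map_mul, map_sum, eval_X, eval_C, Option.elim, ← hQ, hQ',
        map_ofNat]
      rw [mdot_sub_left, mdot_sub_right, mdot_sub_right, mdot_comm (q₁ + q₂) Q]
      have h : mdot Q (q₁ + q₂) = ∑ μ, eta μ * Q μ * (q₁ + q₂) μ := rfl
      have h2 : ∑ μ, (eta μ : ℂ) * ((-Q μ : ℝ) : ℂ) * ((q₁ + q₂) μ : ℂ)
          = -(mdot Q (q₁ + q₂) : ℂ) := by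
        rw [h]
        push_cast
        rw [← Finset.sum_neg_distrib]
        exact Finset.sum_congr rfl fun μ _ => by ring
      rw [h2]
      push_cast
      ring
    | some μ =>
      rw [reflect_some]
      simp only [shiftPoint, map_sub, map_neg, eval_X, eval_C, Option.elim, ← hQ, hQ']
      simp only [Pi.sub_apply]
      push_cast
      ring
  induction P using MvPolynomial.induction_on with
  | C c => rw [reflect_C, evalShift_C, evalShift_C]
  | add P Q hP hQ => rw [map_add, evalShift_add, evalShift_add, hP, hQ]
  | mul_X P i hP => rw [map_mul, evalShift_mul, evalShift_mul, hP, hX]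

theorem symF_reflect (q₁ q₂ : Fin (d + 1) → ℝ) (t : ℝ) :
    symF ![q₁, q₂] (fun _ : Fin 1 => 1 - t) = symF ![q₁, q₂] (fun _ : Fin 1 => t) := by
  simp [symF, secondSymanzik, bary, Fin.sum_univ_succ]
  left
  ring

/-- The bubble is invariant under `k → -k - q₁ - q₂`, which exchanges its two propagators. -/
theorem feynmanIntegral_reflect (q₁ q₂ : Fin (d + 1) → ℝ) (b c : ℕ) (hb : 1 ≤ b) (hc : 1 ≤ c)
    (P : LoopPoly d) (n : ℂ) :
    feynmanIntegral ![q₁, q₂] ![b, c] (reflect (q₁ + q₂) P) n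
      = feynmanIntegral ![q₁, q₂] ![c, b] P n := by
  obtain ⟨R, h1, h2⟩ : ∃ R, (reflect (q₁ + q₂) P).totalDegree < R ∧ P.totalDegree < R :=
    ⟨(reflect (q₁ + q₂) P).totalDegree + P.totalDegree + 1, by omega, by omega⟩
  have hν : ∀ b c : ℕ, 1 ≤ b → 1 ≤ c → ∀ i, ![b, c] i = ![b - 1, c - 1] i + 1 := by
    intro b c hb hc i
    fin_cases i
    · simp; omega
    · simp; omega
  rw [feynmanIntegral_eq_sum _ _ _ (hν b c hb hc) _ n h1,
    feynmanIntegral_eq_sum _ _ _ (hν c b hc hb) _ n h2]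
  refine Finset.sum_congr rfl fun r _ => ?_
  have e1 : ∑ i, ![b - 1, c - 1] i = ∑ i, ![c - 1, b - 1] i := by simp [add_comm]
  have e2 : ∏ i, ((![b - 1, c - 1] i).factorial : ℂ) = ∏ i, ((![c - 1, b - 1] i).factorial : ℂ) := by
    simp [mul_comm]
  rw [e1, e2]
  refine congrArg _ ?_
  unfold paramIntegral
  rw [integral_simplex_one, integral_simplex_one]
  have h := intervalIntegral.integral_comp_sub_left (a := (0 : ℝ)) (b := 1)
    (fun t => wt ![c - 1, b - 1] (fun _ : Fin 1 => t) * (evalShift ![q₁, q₂] ((box n)^[r] P)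
      (fun _ => t) * powI0 (symF ![q₁, q₂] fun _ : Fin 1 => t)
        (n / 2 + r - (∑ i, ![c - 1, b - 1] i + 1 + 1 : ℕ)))) 1
  simp only [sub_self, sub_zero] at h
  rw [← h]
  refine intervalIntegral.integral_congr fun t _ => ?_
  rw [iterate_box_reflect, evalShift_reflect, symF_reflect]
  refine congrArg (· * _) ?_
  simp [wt, bary, Fin.prod_univ_succ, mul_comm]

end LoopIntegrals

/-! ### Integrals with at most three propagators -/

section Reduction

variable {d : ℕ}

/-- The integral with propagators `k²`, `(k + p₁)²`, `(k + p₂)²` to the powers `a`, `b`, `c`, at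
most one of which is zero. -/
def loopInt (p₁ p₂ : Fin (d + 1) → ℝ) (n : ℂ) (a b c : ℕ) (P : LoopPoly d) : ℂ :=
  if a = 0 then feynmanIntegral ![p₁, p₂] ![b, c] P n
  else if b = 0 then feynmanIntegral ![0, p₂] ![a, c] P n
  else if c = 0 then feynmanIntegral ![0, p₁] ![a, b] P n
  else feynmanIntegral ![0, p₁, p₂] ![a, b, c] P n

/-- The exponents admit at most one zero and are small enough for the parametric representation. -/
def Admissible (n : ℂ) (a b c : ℕ) : Prop :=
  a + b + c ≤ 6 ∧ 12 < n.re ∧ 1 ≤ a + b ∧ 1 ≤ a + c ∧ 1 ≤ b + c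

variable {p₁ p₂ : Fin (d + 1) → ℝ} {n : ℂ} {a b c : ℕ}

theorem two_mul_lt_re {A : ℕ} (hA : A ≤ 6) (hn : 12 < n.re) : 2 * (A : ℝ) < n.re := by
  have : (A : ℝ) ≤ 6 := by exact_mod_cast hA
  linarith

theorem one_le_pair (hb : 1 ≤ b) (hc : 1 ≤ c) : ∀ i, 1 ≤ ![b, c] i := by
  intro i
  fin_cases i
  · exact hb
  · exact hc

theorem one_le_triple (ha : 1 ≤ a) (hb : 1 ≤ b) (hc : 1 ≤ c) : ∀ i, 1 ≤ ![a, b, c] i := by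
  intro i
  fin_cases i
  · exact ha
  · exact hb
  · exact hc

theorem continuous_param {m : ℕ} (q : Fin (m + 1) → Fin (d + 1) → ℝ) (K : Fin (m + 1) → ℕ)
    (Q : LoopPoly d) {s : ℂ} (hs : 0 < s.re) :
    Continuous fun x => wt K x * (evalShift q Q x * powI0 (symF q x) s) :=
  (contDiff_wt K).continuous.mul ((contDiff_evalShift q Q).continuous.mul (continuous_powF q hs))

theorem loopInt_add (h : Admissible n a b c) (P Q : LoopPoly d) :
    loopInt p₁ p₂ n a b c (P + Q) = loopInt p₁ p₂ n a b c P + loopInt p₁ p₂ n a b c Q := by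
  obtain ⟨h6, hn, h1, h2, h3⟩ := h
  unfold loopInt
  split_ifs with ha hb hc
  · exact feynmanIntegral_add _ _ (one_le_pair (by omega) (by omega)) _ _ _
      (two_mul_lt_re (by simp; omega) hn)
  · exact feynmanIntegral_add _ _ (one_le_pair (by omega) (by omega)) _ _ _
      (two_mul_lt_re (by simp; omega) hn)
  · exact feynmanIntegral_add _ _ (one_le_pair (by omega) (by omega)) _ _ _
      (two_mul_lt_re (by simp; omega) hn)
  · exact feynmanIntegral_add _ _ (one_le_triple (by omega) (by omega) (by omega)) _ _ _
      (two_mul_lt_re (by simp [Fin.sum_univ_succ]; omega) hn)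

theorem loopInt_C_mul (h : Admissible n a b c) (z : ℂ) (P : LoopPoly d) :
    loopInt p₁ p₂ n a b c (C z * P) = z * loopInt p₁ p₂ n a b c P := by
  obtain ⟨h6, hn, h1, h2, h3⟩ := h
  unfold loopInt
  split_ifs with ha hb hc
  · exact feynmanIntegral_C_mul _ _ (one_le_pair (by omega) (by omega)) _ _ _
  · exact feynmanIntegral_C_mul _ _ (one_le_pair (by omega) (by omega)) _ _ _
  · exact feynmanIntegral_C_mul _ _ (one_le_pair (by omega) (by omega)) _ _ _
  · exact feynmanIntegral_C_mul _ _ (one_le_triple (by omega) (by omega) (by omega)) _ _ _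

theorem loopInt_sub (h : Admissible n a b c) (P Q : LoopPoly d) :
    loopInt p₁ p₂ n a b c (P - Q) = loopInt p₁ p₂ n a b c P - loopInt p₁ p₂ n a b c Q := by
  have h1 : P - Q = P + C (-1) * Q := by rw [map_neg, map_one]; ring
  rw [h1, loopInt_add h, loopInt_C_mul h]
  ring

theorem loopInt_propDen_triangle (ha : 1 ≤ a) (hb : 1 ≤ b) (hc : 1 ≤ c) (h6 : a + b + c ≤ 6)
    (hn : 12 < n.re) (P : LoopPoly d) :
    loopInt p₁ p₂ n a b c (X none * P) = loopInt p₁ p₂ n (a - 1) b c P ∧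
    loopInt p₁ p₂ n a b c (dot (loopMom + extR p₁) (loopMom + extR p₁) * P)
      = loopInt p₁ p₂ n a (b - 1) c P ∧
    loopInt p₁ p₂ n a b c (dot (loopMom + extR p₂) (loopMom + extR p₂) * P)
      = loopInt p₁ p₂ n a b (c - 1) P := by
  have hν := one_le_triple ha hb hc
  have hs : 2 * ((∑ j, ![a, b, c] j : ℕ) : ℝ) < n.re :=
    two_mul_lt_re (by simp [Fin.sum_univ_succ]; omega) hn
  have hl : ∀ (i : Fin 3), 2 ≤ ![a, b, c] i → _ := fun i hi =>
    feynmanIntegral_lower ![0, p₁, p₂] ![a, b, c] hν i hi P n hs (isFaceIntegral_two i)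
      (fun K H hK => by simp [wt_edge_of_ne i K hK])
  have hc' : ∀ (i : Fin 3), ![a, b, c] i = 1 → _ := fun i hi =>
    feynmanIntegral_contract ![0, p₁, p₂] ![a, b, c] hν i hi P n hs
  have e0 : loopInt p₁ p₂ n a b c = fun P => feynmanIntegral ![0, p₁, p₂] ![a, b, c] P n := by
    funext P
    rw [loopInt, if_neg (by omega), if_neg (by omega), if_neg (by omega)]
  simp only [e0]
  refine ⟨?_, ?_, ?_⟩
  · rw [← propDen_zero]
    rcases Nat.lt_or_ge a 2 with h | h
    · obtain rfl : a = 1 := by omega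
      rw [loopInt, if_pos rfl]
      refine (hc' 0 rfl).trans ?_
      congr 1
    · rw [loopInt, if_neg (by omega), if_neg (by omega), if_neg (by omega)]
      refine (hl 0 h).trans ?_
      congr 1
      funext j; fin_cases j <;> rfl
  · rcases Nat.lt_or_ge b 2 with h | h
    · obtain rfl : b = 1 := by omega
      rw [loopInt, if_neg (by omega), if_pos rfl]
      refine (hc' 1 rfl).trans ?_
      congr 1
      · funext j; fin_cases j <;> rfl
      · funext j; fin_cases j <;> rfl
    · rw [loopInt, if_neg (by omega), if_neg (by omega), if_neg (by omega)]
      refine (hl 1 h).trans ?_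
      congr 1
      funext j; fin_cases j <;> rfl
  · rcases Nat.lt_or_ge c 2 with h | h
    · obtain rfl : c = 1 := by omega
      rw [loopInt, if_neg (by omega), if_neg (by omega), if_pos rfl]
      refine (hc' 2 rfl).trans ?_
      congr 1
      · funext j; fin_cases j <;> rfl
      · funext j; fin_cases j <;> rfl
    · rw [loopInt, if_neg (by omega), if_neg (by omega), if_neg (by omega)]
      refine (hl 2 h).trans ?_
      congr 1
      funext j; fin_cases j <;> rfl

/-- An inverse propagator in the numerator of a bubble; both propagators are kept, since tadpoles are
not represented by `loopInt`. -/
theorem loopInt_propDen_bubble (hb : 1 ≤ b) (hc : 1 ≤ c) (h6 : b + c ≤ 6)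
    (hn : 12 < n.re) (P : LoopPoly d) :
    (2 ≤ b → loopInt p₁ p₂ n 0 b c (dot (loopMom + extR p₁) (loopMom + extR p₁) * P)
      = loopInt p₁ p₂ n 0 (b - 1) c P) ∧
    (2 ≤ c → loopInt p₁ p₂ n 0 b c (dot (loopMom + extR p₂) (loopMom + extR p₂) * P)
      = loopInt p₁ p₂ n 0 b (c - 1) P) := by
  have hν := one_le_pair hb hc
  have hs : 2 * ((∑ j, ![b, c] j : ℕ) : ℝ) < n.re := two_mul_lt_re (by simp; omega) hn
  have hw : ∀ (i : Fin 2) (K : Fin 2 → ℕ) (H : (Fin 1 → ℝ) → ℂ), K i ≠ 0 →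
      wt K (fun _ : Fin 1 => ![1, 0] i) * H (fun _ : Fin 1 => ![1, 0] i) = 0 := by
    intro i K H hK
    fin_cases i
    · simp at hK; simp [wt, bary, Fin.prod_univ_succ, hK]
    · simp at hK; simp [wt, bary, Fin.prod_univ_succ, hK]
  have hl : ∀ (i : Fin 2), 2 ≤ ![b, c] i → _ := fun i hi =>
    feynmanIntegral_lower ![p₁, p₂] ![b, c] hν i hi P n hs (isFaceIntegral_one i) (hw i)
  simp only [loopInt, if_pos]
  refine ⟨fun h => (hl 0 h).trans ?_, fun h => (hl 1 h).trans ?_⟩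
  · congr 1
    funext j; fin_cases j <;> rfl
  · congr 1
    funext j; fin_cases j <;> rfl

theorem feynmanIntegral_bubble_swap (q₁ q₂ : Fin (d + 1) → ℝ) (hb : 1 ≤ b) (hc : 1 ≤ c)
    (P : LoopPoly d) :
    feynmanIntegral ![q₁, q₂] ![b, c] P n = feynmanIntegral ![q₂, q₁] ![c, b] P n := by
  have hν : ∀ b c : ℕ, 1 ≤ b → 1 ≤ c → ∀ i, ![b, c] i = ![b - 1, c - 1] i + 1 := by
    intro b c hb hc i
    fin_cases i
    · simp; omega
    · simp; omega
  have hP := P.totalDegree.lt_succ_self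
  rw [feynmanIntegral_eq_sum _ _ _ (hν b c hb hc) _ n hP,
    feynmanIntegral_eq_sum _ _ _ (hν c b hc hb) _ n hP]
  refine Finset.sum_congr rfl fun r _ => ?_
  have e1 : ∑ i, ![b - 1, c - 1] i = ∑ i, ![c - 1, b - 1] i := by simp [add_comm]
  have e2 : ∏ i, ((![b - 1, c - 1] i).factorial : ℂ) = ∏ i, ((![c - 1, b - 1] i).factorial : ℂ) := by
    simp [mul_comm]
  rw [e1, e2]
  refine congrArg _ ?_
  unfold paramIntegral
  rw [integral_simplex_one, integral_simplex_one]
  have h := intervalIntegral.integral_comp_sub_left (a := (0 : ℝ)) (b := 1)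
    (fun t => wt ![c - 1, b - 1] (fun _ : Fin 1 => t) * (evalShift ![q₂, q₁] ((box n)^[r] P)
      (fun _ => t) * powI0 (symF ![q₂, q₁] fun _ : Fin 1 => t)
        (n / 2 + r - (∑ i, ![c - 1, b - 1] i + 1 + 1 : ℕ)))) 1
  simp only [sub_self, sub_zero] at h
  rw [← h]
  refine intervalIntegral.integral_congr fun t _ => ?_
  have f1 : wt ![b - 1, c - 1] (fun _ : Fin 1 => t) = wt ![c - 1, b - 1] (fun _ : Fin 1 => 1 - t) := by
    simp [wt, bary, Fin.prod_univ_succ, mul_comm]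
  have f2 : symF ![q₁, q₂] (fun _ : Fin 1 => t) = symF ![q₂, q₁] (fun _ : Fin 1 => 1 - t) := by
    have : mdot (q₁ - q₂) (q₁ - q₂) = mdot (q₂ - q₁) (q₂ - q₁) := by
      simp only [mdot_sub_left, mdot_sub_right, mdot_comm q₂ q₁]; ring
    simp [symF, secondSymanzik, bary, Fin.sum_univ_succ, this]
    left; ring
  have f3 : ∀ Q : LoopPoly d, evalShift ![q₁, q₂] Q (fun _ : Fin 1 => t)
      = evalShift ![q₂, q₁] Q (fun _ : Fin 1 => 1 - t) := by
    intro Q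
    have : ∑ j, bary (fun _ : Fin 1 => t) j • ![q₁, q₂] j
        = ∑ j, bary (fun _ : Fin 1 => 1 - t) j • ![q₂, q₁] j := by
      simp [bary, Fin.sum_univ_succ, add_comm]
    unfold evalShift shiftPoint
    rw [this]
  simp only [f1, f2, f3]

theorem feynmanIntegral_triangle_swap (q₀ q₁ q₂ : Fin (d + 1) → ℝ) (ha : 1 ≤ a) (hb : 1 ≤ b)
    (hc : 1 ≤ c) (P : LoopPoly d) (h6 : a + b + c ≤ 6) (hn : 12 < n.re) :
    feynmanIntegral ![q₀, q₁, q₂] ![a, b, c] P n = feynmanIntegral ![q₀, q₂, q₁] ![a, c, b] P n := by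
  have hν : ∀ b c : ℕ, 1 ≤ b → 1 ≤ c → ∀ i, ![a, b, c] i = ![a - 1, b - 1, c - 1] i + 1 := by
    intro b c hb hc i
    fin_cases i
    · simp; omega
    · simp; omega
    · simp; omega
  have hP := P.totalDegree.lt_succ_self
  rw [feynmanIntegral_eq_sum _ _ _ (hν b c hb hc) _ n hP,
    feynmanIntegral_eq_sum _ _ _ (hν c b hc hb) _ n hP]
  refine Finset.sum_congr rfl fun r _ => ?_
  have e1 : ∑ i, ![a - 1, b - 1, c - 1] i = ∑ i, ![a - 1, c - 1, b - 1] i := by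
    simp [Fin.sum_univ_succ, add_comm]
  have e2 : ∏ i, ((![a - 1, b - 1, c - 1] i).factorial : ℂ)
      = ∏ i, ((![a - 1, c - 1, b - 1] i).factorial : ℂ) := by
    simp [Fin.prod_univ_succ, mul_comm]
  have e3 : ∑ i, ![a - 1, c - 1, b - 1] i + 2 + 1 ≤ 6 := by
    simp [Fin.sum_univ_succ]; omega
  rw [e1, e2]
  refine congrArg _ ?_
  have hs := re_exponent_pos r (two_mul_lt_re e3 hn)
  unfold paramIntegral
  rw [integral_simplex_two (continuous_param ![q₀, q₁, q₂] _ _ hs),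
    integral_simplex_two_swap (continuous_param ![q₀, q₂, q₁] _ _ hs)]
  refine intervalIntegral.integral_congr fun x _ => intervalIntegral.integral_congr fun y _ => ?_
  have f1 : wt ![a - 1, b - 1, c - 1] ![x, y] = wt ![a - 1, c - 1, b - 1] ![y, x] := by
    simp [wt, bary, Fin.prod_univ_succ, add_comm, mul_comm]
  have f2 : symF ![q₀, q₁, q₂] ![x, y] = symF ![q₀, q₂, q₁] ![y, x] := by
    have : mdot (q₁ - q₂) (q₁ - q₂) = mdot (q₂ - q₁) (q₂ - q₁) := by
      simp only [mdot_sub_left, mdot_sub_right, mdot_comm q₂ q₁]; ring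
    simp [symF, secondSymanzik, bary, Fin.sum_univ_succ, this]
    ring
  have f3 : ∀ Q : LoopPoly d, evalShift ![q₀, q₁, q₂] Q ![x, y]
      = evalShift ![q₀, q₂, q₁] Q ![y, x] := by
    intro Q
    have : ∑ j, bary ![x, y] j • ![q₀, q₁, q₂] j = ∑ j, bary ![y, x] j • ![q₀, q₂, q₁] j := by
      simp [bary, Fin.sum_univ_succ, add_comm]
    unfold evalShift shiftPoint
    rw [this]
  simp only [f1, f2, f3]

theorem loopInt_swap (h : Admissible n a b c) (P : LoopPoly d) :
    loopInt p₁ p₂ n a b c P = loopInt p₂ p₁ n a c b P := by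
  obtain ⟨h6, hn, h1, h2, h3⟩ := h
  unfold loopInt
  by_cases ha : a = 0
  · rw [if_pos ha, if_pos ha, feynmanIntegral_bubble_swap _ _ (by omega) (by omega)]
  · rw [if_neg ha, if_neg ha]
    by_cases hb : b = 0
    · rw [if_pos hb, if_neg (by omega), if_pos hb]
    · rw [if_neg hb, if_neg hb]
      by_cases hc : c = 0
      · rw [if_pos hc, if_pos hc]
      · rw [if_neg hc, if_neg hc, feynmanIntegral_triangle_swap _ _ _ (by omega) (by omega)
          (by omega) _ h6 hn]

end Reduction

/-! ### Cancellations in the sum of the diagrams -/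

section Halves

variable {d : ℕ} {p₁ p₂ : Fin (d + 1) → ℝ} {n : ℂ}

/-- The integrals in half of the sum of the diagrams that carry an explicit factor `m² = p₁² = p₂²`,
without this factor.  Here `ξ = 1 - α`, and `t = Δ · ε₁` and `s = ε₁ · ε₂`. -/
def massTerms (ξ m t s : ℂ) (p₁ p₂ : Fin (d + 1) → ℝ) (e₁ e₂ D : LVec d) (n : ℂ) : ℂ :=
  let J := loopInt p₁ p₂ n
  let d₁ := dot D (loopMom + extR p₁)
  let d₂ := dot D (loopMom + extR p₂)
  let u₁ := dot loopMom e₁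
  let u₂ := dot loopMom e₂
  2 * ξ * J 1 2 1 (d₁ * d₂ * (u₁ * u₂))
    - J 1 1 1 (d₂ * vertexE loopMom (extR p₁) e₁ e₂ D + C t * (d₂ * u₂)) + m * ξ * s * J 1 2 1 (d₁ * d₂)
    - ξ * s * J 0 2 1 (d₁ * d₂) + m * ξ * t * J 2 1 1 (d₂ * u₂)
    - m * ξ ^ 2 * J 2 2 1 (d₁ * d₂ * (u₁ * u₂)) - ξ * t * J 2 0 1 (d₂ * u₂)
    + ξ * J 2 1 1 (d₁ * d₂ * (u₁ * u₂))

/-- Half of the gluon triangle after the cancellation of numerators against propagators. -/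
theorem loopInt_halfTriangle (hn : 12 < n.re) (ξ m t s : ℂ) (e₁ e₂ D : LVec d)
    (ht : dot D e₁ = C t) (hs : dot e₁ e₂ = C s) :
    loopInt p₁ p₂ n 2 2 2 (halfTriangle ξ m loopMom (extR p₁) (extR p₂) e₁ e₂ D)
      = m * massTerms ξ m t s p₁ p₂ e₁ e₂ D n
        + loopInt p₁ p₂ n 0 1 1 (dot D (loopMom + extR p₂) * vertexE loopMom (extR p₁) e₁ e₂ D)
        - ξ * loopInt p₁ p₂ n 0 2 1 (dot D (loopMom + extR p₁) * dot D (loopMom + extR p₂)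
          * (dot loopMom e₁ * dot loopMom e₂ + (C m - X none) * C s))
        + t * loopInt p₁ p₂ n 1 0 1 (dot D (loopMom + extR p₂) * dot loopMom e₂)
        - loopInt p₁ p₂ n 1 1 1 (dot D (loopMom + extR p₁) * dot D (loopMom + extR p₂)
          * (dot loopMom e₁ * dot loopMom e₂)) := by
  unfold massTerms halfTriangle
  rw [ht, hs, dot_loopMom_loopMom]
  generalize vertexE loopMom (extR p₁) e₁ e₂ D = E
  set L₁ := dot (loopMom + extR p₁) (loopMom + extR p₁) with hL₁
  set L₂ := dot (loopMom + extR p₂) (loopMom + extR p₂) with hL₂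
  generalize dot D (loopMom + extR p₁) = d₁
  generalize dot D (loopMom + extR p₂) = d₂
  generalize dot loopMom e₁ = u₁
  generalize dot loopMom e₂ = u₂
  have hK : ∀ a b c, 1 ≤ a → 1 ≤ b → 1 ≤ c → a + b + c ≤ 6 → ∀ P : LoopPoly d,
      loopInt p₁ p₂ n a b c (X none * P) = loopInt p₁ p₂ n (a - 1) b c P :=
    fun a b c ha hb hc h6 P => (loopInt_propDen_triangle ha hb hc h6 hn P).1
  have h1 : ∀ a b c, 1 ≤ a → 1 ≤ b → 1 ≤ c → a + b + c ≤ 6 → ∀ P : LoopPoly d,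
      loopInt p₁ p₂ n a b c (L₁ * P) = loopInt p₁ p₂ n a (b - 1) c P :=
    fun a b c ha hb hc h6 P => (loopInt_propDen_triangle ha hb hc h6 hn P).2.1
  have h2 : ∀ P : LoopPoly d, loopInt p₁ p₂ n 2 2 2 (L₂ * P) = loopInt p₁ p₂ n 2 2 1 P :=
    fun P => (loopInt_propDen_triangle (by norm_num) (by norm_num) (by norm_num) (by norm_num)
      hn P).2.2
  have h0 : ∀ P : LoopPoly d, loopInt p₁ p₂ n 0 2 1 (L₁ * P) = loopInt p₁ p₂ n 0 1 1 P :=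
    fun P => (loopInt_propDen_bubble (by norm_num) (by norm_num) (by norm_num) hn P).1 le_rfl
  have r1 : ∀ P, loopInt p₁ p₂ n 2 2 1 (X none * P) = loopInt p₁ p₂ n 1 2 1 P :=
    hK 2 2 1 (by norm_num) (by norm_num) (by norm_num) (by norm_num)
  have r2 : ∀ P, loopInt p₁ p₂ n 1 2 1 (X none * P) = loopInt p₁ p₂ n 0 2 1 P :=
    hK 1 2 1 (by norm_num) (by norm_num) (by norm_num) (by norm_num)
  have r3 : ∀ P, loopInt p₁ p₂ n 2 2 1 (L₁ * P) = loopInt p₁ p₂ n 2 1 1 P :=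
    h1 2 2 1 (by norm_num) (by norm_num) (by norm_num) (by norm_num)
  have r4 : ∀ P, loopInt p₁ p₂ n 2 1 1 (L₁ * P) = loopInt p₁ p₂ n 2 0 1 P :=
    h1 2 1 1 (by norm_num) (by norm_num) (by norm_num) (by norm_num)
  have r5 : ∀ P, loopInt p₁ p₂ n 1 2 1 (L₁ * P) = loopInt p₁ p₂ n 1 1 1 P :=
    h1 1 2 1 (by norm_num) (by norm_num) (by norm_num) (by norm_num)
  have r6 : ∀ P, loopInt p₁ p₂ n 1 1 1 (L₁ * P) = loopInt p₁ p₂ n 1 0 1 P :=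
    h1 1 1 1 (by norm_num) (by norm_num) (by norm_num) (by norm_num)
  clear_value L₁ L₂
  have adm : ∀ a b c, a + b + c ≤ 6 ∧ 1 ≤ a + b ∧ 1 ≤ a + c ∧ 1 ≤ b + c → Admissible n a b c :=
    fun a b c h => ⟨h.1, hn, h.2.1, h.2.2.1, h.2.2.2⟩
  have a222 := adm 2 2 2 (by norm_num)
  have a221 := adm 2 2 1 (by norm_num)
  have a021 := adm 0 2 1 (by norm_num)
  have a111 := adm 1 1 1 (by norm_num)
  -- the numerator as a sum of products of propagators
  have key : d₂ * L₂ * (-(C m * (X none * (L₁ * E - C ξ * (d₁ * (u₁ * u₂ + (C m - X none) * C s)))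
          - C ξ * ((C m * (L₁ * C t - C ξ * (d₁ * u₁)) - L₁ ^ 2 * C t + L₁ * (d₁ * u₁)) * u₂)))
        + X none * (X none * (L₁ * E - C ξ * (d₁ * (u₁ * u₂ + (C m - X none) * C s)))
          - u₂ * (C m * (L₁ * C t - C ξ * (d₁ * u₁)) - L₁ ^ 2 * C t + L₁ * (d₁ * u₁))))
      = L₂ * (C (-m) * (X none * (L₁ * (d₂ * E))) + C (m * ξ) * (X none * (d₁ * d₂ * (u₁ * u₂)))
        + C (m * m * ξ * s) * (X none * (d₁ * d₂))
        + C (-(m * ξ * s)) * (X none * (X none * (d₁ * d₂)))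
        + C (m * m * ξ * t) * (L₁ * (d₂ * u₂)) + C (-(m * m * ξ * ξ)) * (d₁ * d₂ * (u₁ * u₂))
        + C (-(m * ξ * t)) * (L₁ * (L₁ * (d₂ * u₂))) + C (m * ξ) * (L₁ * (d₁ * d₂ * (u₁ * u₂)))
        + X none * (X none * (L₁ * (d₂ * E)))
        + C (-ξ) * (X none * (X none * (d₁ * d₂ * (u₁ * u₂ + (C m - X none) * C s))))
        + C (-(m * t)) * (X none * (L₁ * (d₂ * u₂)))
        + C (m * ξ) * (X none * (d₁ * d₂ * (u₁ * u₂)))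
        + C t * (X none * (L₁ * (L₁ * (d₂ * u₂))))
        + C (-1) * (X none * (L₁ * (d₁ * d₂ * (u₁ * u₂))))) := by
    simp only [map_mul, map_neg, map_one]
    ring
  rw [key, h2]
  simp only [loopInt_add a221, loopInt_C_mul a221, r1, r2, r3, r4, r5, r6, h0, loopInt_add a111,
    loopInt_C_mul a111]
  ring

/-- Half of the gluon bubble after the cancellation of numerators against propagators. -/
theorem loopInt_halfBubble (hn : 12 < n.re) (ξ t s : ℂ) (e₁ e₂ D : LVec d)
    (ht : dot D e₁ = C t) (hs : dot e₁ e₂ = C s) :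
    loopInt p₁ p₂ n 0 2 2 (halfBubble ξ loopMom (extR p₁) (extR p₂) e₁ e₂ D)
      = loopInt p₁ p₂ n 0 1 1 (C (1 / 2) * (dot D (loopMom + extR p₂) *
          (2 * (C s * dot D (loopMom + extR p₂)) - C t * dot loopMom e₂
            - dot (loopMom + extR p₂) e₁ * dot D e₂)))
        - ξ * loopInt p₁ p₂ n 0 2 1 (dot D (loopMom + extR p₁) * dot D (loopMom + extR p₂) *
          (C (1 / 2) * (2 * (C s * dot (loopMom + extR p₁) (loopMom + extR p₂))
            - dot loopMom e₁ * dot loopMom e₂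
            - dot (loopMom + extR p₂) e₁ * dot (loopMom + extR p₁) e₂))) := by
  unfold halfBubble
  rw [ht, hs]
  have h2 := fun P : LoopPoly d =>
    (loopInt_propDen_bubble (p₁ := p₁) (p₂ := p₂) (b := 2) (c := 2) (by norm_num) (by norm_num)
      (by norm_num) hn P).2 le_rfl
  have h0 := fun P : LoopPoly d =>
    (loopInt_propDen_bubble (p₁ := p₁) (p₂ := p₂) (b := 2) (c := 1) (by norm_num) (by norm_num)
      (by norm_num) hn P).1 le_rfl
  have a021 : Admissible n 0 2 1 := ⟨by norm_num, hn, by norm_num, by norm_num, by norm_num⟩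
  simp only [show 2 - 1 = 1 from rfl] at h2 h0
  generalize dot (loopMom + extR p₁) (loopMom + extR p₁) = L₁ at h0 ⊢
  generalize dot (loopMom + extR p₂) (loopMom + extR p₂) = L₂ at h2 ⊢
  rw [← loopInt_C_mul a021, ← h0, ← loopInt_sub a021, ← h2]
  refine congrArg _ ?_
  ring

theorem reflect_dot_loopMom (v : Fin (d + 1) → ℝ) (e : Fin (d + 1) → ℂ) :
    reflect v (dot loopMom (ext e)) = -dot loopMom (ext e) - C (cdot e v) := by
  have h : (dot loopMom (ext e) : LoopPoly d) = ∑ μ, C (eta μ : ℂ) * X (some μ) * C (e μ) := by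
    simp [dot, loopMom, ext]
  rw [h, map_sum, cdot, map_sum, ← Finset.sum_neg_distrib, ← Finset.sum_sub_distrib]
  refine Finset.sum_congr rfl fun μ _ => ?_
  rw [map_mul, map_mul, reflect_C, reflect_C, reflect_some, map_mul, map_mul]
  ring

/-- Numerators that are odd under the exchange of the two propagators do not contribute. -/
theorem loopInt_add_eq_zero_of_reflect (hn : 12 < n.re) {P Q : LoopPoly d} {b c : ℕ}
    (hb : 1 ≤ b) (hc : 1 ≤ c) (h6 : b + c ≤ 6)
    (h : reflect (p₁ + p₂) P = -Q) :
    loopInt p₁ p₂ n 0 b c P + loopInt p₁ p₂ n 0 c b Q = 0 := by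
  have a0 : Admissible n 0 c b := ⟨by omega, hn, by omega, by omega, by omega⟩
  have h1 : loopInt p₁ p₂ n 0 c b (reflect (p₁ + p₂) P) = loopInt p₁ p₂ n 0 b c P := by
    simp only [loopInt, if_pos]
    exact feynmanIntegral_reflect p₁ p₂ c b hc hb P n
  have h2 : reflect (p₁ + p₂) P = C (-1) * Q := by rw [h, map_neg, map_one]; ring
  rw [← h1, h2, loopInt_C_mul a0]
  ring

end Halves

section Sum

variable {d : ℕ} {p₁ p₂ : Fin (d + 1) → ℝ} {n : ℂ}

theorem cdot_add_right (u : Fin (d + 1) → ℂ) (v w : Fin (d + 1) → ℝ) :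
    cdot u (v + w) = cdot u v + cdot u w := by
  simp only [cdot, Pi.add_apply, Complex.ofReal_add, mul_add, Finset.sum_add_distrib]

theorem extR_add (v w : Fin (d + 1) → ℝ) : (extR (v + w) : LVec d) = extR v + extR w := by
  funext i
  cases i <;> simp [extR, ext]

theorem reflect_loopMom_sq (v : Fin (d + 1) → ℝ) :
    reflect v (X none) = X none + 2 * dot loopMom (extR v) + C (mdot v v : ℂ) := by
  rw [reflect_none]
  simp [dot, loopMom, extR, ext]

theorem reflect_dot_extR (v w : Fin (d + 1) → ℝ) :
    reflect v (dot loopMom (extR w)) = -dot loopMom (extR w) - C (mdot w v : ℂ) := by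
  rw [extR, reflect_dot_loopMom]
  simp [cdot, mdot]

theorem dot_extR_loopMom_add (Δ p : Fin (d + 1) → ℝ) :
    dot (extR Δ) (loopMom + extR p) = dot loopMom (extR Δ) + C (mdot p Δ : ℂ) := by
  rw [dot_add_right, dot_comm, dot_extR_extR, mdot_comm]

theorem dot_loopMom_add_ext (p : Fin (d + 1) → ℝ) (ε : Fin (d + 1) → ℂ) :
    dot (loopMom + extR p) (ext ε) = dot loopMom (ext ε) + C (cdot ε p) := by
  rw [dot_add_left, dot_comm (extR p), dot_ext_extR]

theorem vertexE_eq (Δ p : Fin (d + 1) → ℝ) (ε ε' : Fin (d + 1) → ℂ) {t t' s : ℂ}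
    (ht : dot (extR Δ) (ext ε) = C t) (ht' : dot (extR Δ) (ext ε') = C t')
    (hs : dot (ext ε) (ext ε') = C s) :
    vertexE loopMom (extR p) (ext ε) (ext ε') (extR Δ)
      = 2 * (dot loopMom (ext ε) * C t')
        - C t * (dot loopMom (ext ε') + 2 * C (cdot ε' p))
        + (C (mdot p Δ : ℂ) - dot loopMom (extR Δ)) * C s := by
  unfold vertexE
  rw [dot_comm (ext ε) (extR Δ), ht, ht', hs, dot_add_left, dot_loopMom_add_ext, dot_sub_left,
    dot_extR_extR, dot_comm (extR p), dot_ext_extR]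
  ring

theorem two_mul_C_half : (2 : LoopPoly d) * C (1 / 2) = 1 := by
  rw [← map_ofNat (C (R := ℂ)) 2, ← map_mul]; norm_num

/-- The part of the gluon bubbles that is independent of the gauge parameter is odd. -/
theorem bubble_feynman_gauge_odd (Δ : Fin (d + 1) → ℝ) (ε₁ ε₂ : Fin (d + 1) → ℂ) (t₁ t₂ s : ℂ)
    (h₁ : cdot ε₁ p₁ = 0) (h₂ : cdot ε₂ p₂ = 0) (ht₁ : dot (extR Δ) (ext ε₁) = C t₁)
    (ht₂ : dot (extR Δ) (ext ε₂) = C t₂) (hs : dot (ext ε₁) (ext ε₂) = C s) :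
    reflect (p₁ + p₂) (dot (extR Δ) (loopMom + extR p₂)
        * vertexE loopMom (extR p₁) (ext ε₁) (ext ε₂) (extR Δ)
      + C (1 / 2) * (dot (extR Δ) (loopMom + extR p₂) *
          (2 * (C s * dot (extR Δ) (loopMom + extR p₂)) - C t₁ * dot loopMom (ext ε₂)
            - dot (loopMom + extR p₂) (ext ε₁) * dot (extR Δ) (ext ε₂))))
    = -(dot (extR Δ) (loopMom + extR p₁)
        * vertexE loopMom (extR p₂) (ext ε₂) (ext ε₁) (extR Δ)
      + C (1 / 2) * (dot (extR Δ) (loopMom + extR p₁) *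
          (2 * (C s * dot (extR Δ) (loopMom + extR p₁)) - C t₂ * dot loopMom (ext ε₁)
            - dot (loopMom + extR p₁) (ext ε₂) * dot (extR Δ) (ext ε₁)))) := by
  have hs' : dot (ext ε₂) (ext ε₁) = C s := by rw [dot_comm, hs]
  have hhalf := two_mul_C_half (d := d)
  rw [vertexE_eq Δ p₁ ε₁ ε₂ ht₁ ht₂ hs, vertexE_eq Δ p₂ ε₂ ε₁ ht₂ ht₁ hs', dot_extR_loopMom_add,
    dot_extR_loopMom_add, dot_loopMom_add_ext, dot_loopMom_add_ext, ht₁, ht₂]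
  simp only [map_add, map_mul, map_sub, map_ofNat, reflect_C, reflect_dot_loopMom,
    reflect_dot_extR, cdot_add_right, mdot_add_left, mdot_comm _ (p₁ + p₂), h₁, h₂,
    Complex.ofReal_add, zero_add, add_zero]
  generalize dot loopMom (extR Δ) = κ
  generalize dot loopMom (ext ε₁) = u₁
  generalize dot loopMom (ext ε₂) = u₂
  generalize (C (1 / 2) : LoopPoly d) = H at hhalf ⊢
  generalize (C t₁ : LoopPoly d) = t₁
  generalize (C t₂ : LoopPoly d) = t₂
  generalize (C s : LoopPoly d) = s
  generalize (C (mdot p₁ Δ : ℂ) : LoopPoly d) = π₁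
  generalize (C (mdot p₂ Δ : ℂ) : LoopPoly d) = π₂
  generalize (C (cdot ε₁ p₂) : LoopPoly d) = v₁
  generalize (C (cdot ε₂ p₁) : LoopPoly d) = v₂
  linear_combination ((κ + π₁) * (2 * (κ + π₁) * s - u₁ * t₂ - t₁ * v₂ - t₁ * u₂)) * hhalf

/-- The part of the bubbles that depends on the gauge parameter is odd up to the exchange of the two
propagators. -/
theorem bubble_gauge_odd (Δ : Fin (d + 1) → ℝ) (ε₁ ε₂ : Fin (d + 1) → ℂ) (m2 : ℝ) (s : ℂ)
    (hp₁ : mdot p₁ p₁ = m2) (hp₂ : mdot p₂ p₂ = m2)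
    (h₁ : cdot ε₁ p₁ = 0) (h₂ : cdot ε₂ p₂ = 0) :
    reflect (p₁ + p₂) (dot (extR Δ) (loopMom + extR p₁) * dot (extR Δ) (loopMom + extR p₂)
          * (dot loopMom (ext ε₁) * dot loopMom (ext ε₂) + (C (m2 : ℂ) - X none) * C s)
        + dot (extR Δ) (loopMom + extR p₁) * dot (extR Δ) (loopMom + extR p₂) *
          (C (1 / 2) * (2 * (C s * dot (loopMom + extR p₁) (loopMom + extR p₂))
            - dot loopMom (ext ε₁) * dot loopMom (ext ε₂)
            - dot (loopMom + extR p₂) (ext ε₁) * dot (loopMom + extR p₁) (ext ε₂))))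
      = -(dot (extR Δ) (loopMom + extR p₂) * dot (extR Δ) (loopMom + extR p₁)
          * (dot loopMom (ext ε₂) * dot loopMom (ext ε₁) + (C (m2 : ℂ) - X none) * C s)
        + dot (extR Δ) (loopMom + extR p₂) * dot (extR Δ) (loopMom + extR p₁) *
          (C (1 / 2) * (2 * (C s * dot (loopMom + extR p₂) (loopMom + extR p₁))
            - dot loopMom (ext ε₂) * dot loopMom (ext ε₁)
            - dot (loopMom + extR p₁) (ext ε₂) * dot (loopMom + extR p₂) (ext ε₁)))) := by
  have hhalf := two_mul_C_half (d := d)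
  have hl : (dot (loopMom + extR p₁) (loopMom + extR p₂) : LoopPoly d) = X none
      + dot loopMom (extR p₁) + dot loopMom (extR p₂) + C (mdot p₁ p₂ : ℂ) := by
    rw [dot_add_left, dot_add_right, dot_add_right, dot_loopMom_loopMom, dot_extR_extR,
      dot_comm (extR p₁)]
    ring
  rw [dot_comm (loopMom + extR p₂) (loopMom + extR p₁), hl, dot_extR_loopMom_add,
    dot_extR_loopMom_add, dot_loopMom_add_ext, dot_loopMom_add_ext]
  simp only [map_add, map_mul, map_sub, map_ofNat, reflect_C, reflect_dot_loopMom,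
    reflect_loopMom_sq, reflect_dot_extR, cdot_add_right, mdot_add_right, mdot_add_left, h₁, h₂,
    Complex.ofReal_add, zero_add, add_zero, mdot_comm Δ, extR_add, dot_add_right, hp₁, hp₂,
    mdot_comm p₂ p₁]
  generalize dot loopMom (extR Δ) = κ
  generalize dot loopMom (extR p₁) = κ₁
  generalize dot loopMom (extR p₂) = κ₂
  generalize dot loopMom (ext ε₁) = u₁
  generalize dot loopMom (ext ε₂) = u₂
  generalize (X none : LoopPoly d) = K
  generalize (C (1 / 2) : LoopPoly d) = H at hhalf ⊢
  generalize (C s : LoopPoly d) = s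
  generalize (C (m2 : ℂ) : LoopPoly d) = m
  generalize (C (mdot p₁ Δ : ℂ) : LoopPoly d) = π₁
  generalize (C (mdot p₂ Δ : ℂ) : LoopPoly d) = π₂
  generalize (C (mdot p₁ p₂ : ℂ) : LoopPoly d) = π
  generalize (C (cdot ε₁ p₂) : LoopPoly d) = v₁
  generalize (C (cdot ε₂ p₁) : LoopPoly d) = v₂
  linear_combination ((κ + π₁) * (κ + π₂) * (2 * s * (K + κ₁ + κ₂ + π) - 2 * (u₁ * u₂) - u₁ * v₂
    - v₁ * u₂ - v₁ * v₂)) * hhalf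

theorem dot_loopMom_ext (ε : Fin (d + 1) → ℂ) :
    (dot loopMom (ext ε) : LoopPoly d) = ∑ μ, C (eta μ : ℂ) * X (some μ) * C (ε μ) := by
  simp [dot, loopMom, ext]

theorem evalShift_dot_ext {m : ℕ} (q : Fin (m + 1) → Fin (d + 1) → ℝ) (ε : Fin (d + 1) → ℂ)
    (x : Fin m → ℝ) :
    evalShift q (dot loopMom (ext ε)) x = -∑ j, (bary x j : ℂ) * cdot ε (q j) := by
  rw [dot_loopMom_ext, evalShift]
  simp only [map_sum, map_mul, eval_C, eval_X, shiftPoint, Option.elim, cdot, Finset.mul_sum]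
  rw [Finset.sum_comm, ← Finset.sum_neg_distrib]
  refine Finset.sum_congr rfl fun μ _ => ?_
  simp only [Finset.sum_apply, Pi.smul_apply, smul_eq_mul]
  push_cast
  rw [mul_neg, neg_mul, Finset.mul_sum, Finset.sum_mul]
  exact congrArg _ (Finset.sum_congr rfl fun j _ => by ring)

theorem pderiv_none_dot_ext (ε : Fin (d + 1) → ℂ) :
    pderiv none (dot loopMom (ext ε) : LoopPoly d) = 0 := by
  rw [dot_loopMom_ext, pderiv_none_sum]

theorem pderiv_some_dot_ext (ε : Fin (d + 1) → ℂ) (μ : Fin (d + 1)) :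
    pderiv (some μ) (dot loopMom (ext ε) : LoopPoly d) = C (eta μ : ℂ) * C (ε μ) := by
  rw [dot_loopMom_ext, pderiv_some_sum]

theorem box_dot_ext (n : ℂ) (ε : Fin (d + 1) → ℂ) : box n (dot loopMom (ext ε)) = 0 := by
  have h : ∀ μ, pderiv (some μ) (C (eta μ : ℂ) * C (ε μ) : LoopPoly d) = 0 := fun μ => by
    rw [← map_mul, pderiv_C]
  simp only [box, pderiv_none_dot_ext, pderiv_some_dot_ext, h, map_zero, mul_zero,
    Finset.sum_const_zero, add_zero]

/-- A bubble that depends on `p₂` only, with a numerator `k · ε`, is proportional to `p₂ · ε`. -/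
theorem loopInt_transverse (a c : ℕ) (ha : 1 ≤ a) (ε : Fin (d + 1) → ℂ)
    (h : cdot ε p₂ = 0) : loopInt p₁ p₂ n a 0 c (dot loopMom (ext ε)) = 0 := by
  rw [loopInt, if_neg (by omega), if_pos rfl]
  unfold feynmanIntegral
  refine Finset.sum_eq_zero fun r _ => ?_
  have h0 : ∀ x : Fin 1 → ℝ, eval (shiftPoint ![0, p₂] (bary x))
      ((box n)^[r] (dot loopMom (ext ε))) = 0 := by
    intro x
    cases r with
    | zero =>
      have := evalShift_dot_ext ![0, p₂] ε x
      rw [Function.iterate_zero, id, ← evalShift, this]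
      have h0 : cdot ε (0 : Fin (d + 1) → ℝ) = 0 := by simp [cdot]
      simp [Fin.sum_univ_succ, h, h0]
    | succ r => rw [Function.iterate_succ_apply, box_dot_ext, iterate_box_zero, map_zero]
  simp only [h0]
  simp

variable {N : ℕ} {ι : Type*} [Fintype ι] [DecidableEq ι]
  {T : ι → Matrix (Fin N) (Fin N) ℂ} {f : ι → ι → ι → ℝ}

/-- The sum of the one-loop diagrams is proportional to the virtuality `m² = p₁² = p₂²`.  The terms
without this factor cancel: the triangles with three simple propagators and the bubbles with
momentum `p₁` or `p₂` between gluons and ghosts, and the bubbles with momentum `p₁ - p₂` under the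
exchange of their two propagators. -/
theorem oneLoopSum_eq (hT : IsSUGenerators T f) (g α : ℝ) (hα : α ≠ 0) (m2 : ℝ)
    (Δ : Fin (d + 1) → ℝ) (ε₁ ε₂ : Fin (d + 1) → ℂ) (a b : ι) (t₁ t₂ s : ℂ)
    (hp₁ : mdot p₁ p₁ = m2) (hp₂ : mdot p₂ p₂ = m2)
    (h₁ : cdot ε₁ p₁ = 0) (h₂ : cdot ε₂ p₂ = 0) (ht₁ : dot (extR Δ) (ext ε₁) = C t₁)
    (ht₂ : dot (extR Δ) (ext ε₂) = C t₂) (hs : dot (ext ε₁) (ext ε₂) = C s) (hn : 12 < n.re) :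
    oneLoopSum f g α Δ p₁ p₂ ε₁ ε₂ a b n
      = Complex.I * g ^ 2 * colourFactor f a b * m2 *
        (massTerms (1 - α) m2 t₁ s p₁ p₂ (ext ε₁) (ext ε₂) (extR Δ) n
          + massTerms (1 - α) m2 t₂ s p₂ p₁ (ext ε₂) (ext ε₁) (extR Δ) n) := by
  have hs' : dot (ext ε₂) (ext ε₁) = C s := by rw [dot_comm, hs]
  have adm : ∀ a b c, a + b + c ≤ 6 ∧ 1 ≤ a + b ∧ 1 ≤ a + c ∧ 1 ≤ b + c → Admissible n a b c :=
    fun a b c h => ⟨h.1, hn, h.2.1, h.2.2.1, h.2.2.2⟩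
  have a222 := adm 2 2 2 (by norm_num)
  have a022 := adm 0 2 2 (by norm_num)
  have a021 := adm 0 2 1 (by norm_num)
  have a011 := adm 0 1 1 (by norm_num)
  have a111 := adm 1 1 1 (by norm_num)
  have a101 := adm 1 0 1 (by norm_num)
  have a110 := adm 1 1 0 (by norm_num)
  have e222 : ∀ P : LoopPoly d, feynmanIntegral ![0, p₁, p₂] ![2, 2, 2] P n
      = loopInt p₁ p₂ n 2 2 2 P := fun P => rfl
  have e111 : ∀ P : LoopPoly d, feynmanIntegral ![0, p₁, p₂] ![1, 1, 1] P n
      = loopInt p₁ p₂ n 1 1 1 P := fun P => rfl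
  have e022 : ∀ P : LoopPoly d, feynmanIntegral ![p₁, p₂] ![2, 2] P n
      = loopInt p₁ p₂ n 0 2 2 P := fun P => rfl
  have e101 : ∀ P : LoopPoly d, feynmanIntegral ![0, p₂] ![1, 1] P n
      = loopInt p₁ p₂ n 1 0 1 P := fun P => rfl
  have e110 : ∀ P : LoopPoly d, feynmanIntegral ![0, p₁] ![1, 1] P n
      = loopInt p₁ p₂ n 1 1 0 P := fun P => rfl
  unfold oneLoopSum
  rw [numB_eq hT g α hα m2 Δ p₁ p₂ ε₁ ε₂ a b hp₁ hp₂ h₁ h₂,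
    numC_eq hT g α hα Δ p₁ p₂ ε₁ ε₂ a b h₁ h₂, numD_eq hT g Δ p₁ p₂ ε₁ ε₂ a b h₂,
    numE_eq hT g Δ p₁ p₂ ε₁ ε₂ a b h₁, numF_eq hT g Δ p₂ ε₁ ε₂ a b h₂,
    numG_eq hT g Δ p₁ ε₁ ε₂ a b, e222, e022, e111, e101, e110, loopInt_C_mul a222,
    loopInt_C_mul a022, loopInt_C_mul a111, loopInt_C_mul a101,
    loopInt_C_mul a110, loopInt_add a222, loopInt_add a022]
  have b1 := loopInt_halfTriangle (p₁ := p₁) (p₂ := p₂) hn (1 - α) m2 t₁ s _ _ _ ht₁ hs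
  have b2 := loopInt_halfTriangle (p₁ := p₂) (p₂ := p₁) hn (1 - α) m2 t₂ s _ _ _ ht₂ hs'
  have c1 := loopInt_halfBubble (p₁ := p₁) (p₂ := p₂) hn (1 - α) t₁ s _ _ _ ht₁ hs
  have c2 := loopInt_halfBubble (p₁ := p₂) (p₂ := p₁) hn (1 - α) t₂ s _ _ _ ht₂ hs'
  rw [← loopInt_swap a222] at b2
  rw [← loopInt_swap a022] at c2
  have s111 := loopInt_swap (p₁ := p₁) (p₂ := p₂) a111 (dot (extR Δ) (loopMom + extR p₂)
    * dot (extR Δ) (loopMom + extR p₁) * (dot loopMom (ext ε₂) * dot loopMom (ext ε₁)))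
  have s110 := fun P : LoopPoly d => loopInt_swap (p₁ := p₁) (p₂ := p₂) a110 P
  have s011 := fun P : LoopPoly d => loopInt_swap (p₁ := p₁) (p₂ := p₂) a011 P
  have s012 := fun P : LoopPoly d => loopInt_swap (p₁ := p₁) (p₂ := p₂) (adm 0 1 2 (by norm_num)) P
  have o1 := loopInt_add_eq_zero_of_reflect hn le_rfl le_rfl (by norm_num)
    (bubble_feynman_gauge_odd Δ ε₁ ε₂ t₁ t₂ s h₁ h₂ ht₁ ht₂ hs)
  have o2 := loopInt_add_eq_zero_of_reflect (b := 2) (c := 1) hn (by norm_num) le_rfl (by norm_num)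
    (bubble_gauge_odd Δ ε₁ ε₂ m2 s hp₁ hp₂ h₁ h₂)
  rw [loopInt_add a011, loopInt_add a011, s011 (dot (extR Δ) (loopMom + extR p₁) * _),
    s011 (C (1 / 2) * (dot (extR Δ) (loopMom + extR p₁) * _))] at o1
  rw [loopInt_add a021, loopInt_add (adm 0 1 2 (by norm_num)), s012, s012] at o2
  have f1 : loopInt p₁ p₂ n 1 0 1 (-(dot (extR Δ) loopMom * dot (extR Δ) (ext ε₁)
      * dot loopMom (ext ε₂)))
      = -t₁ * loopInt p₁ p₂ n 1 0 1 (dot (extR Δ) (loopMom + extR p₂) * dot loopMom (ext ε₂)) := by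
    have h := loopInt_transverse (p₁ := p₁) (n := n) 1 1 le_rfl ε₂ h₂
    have hd : dot (extR Δ) (loopMom + extR p₂) * dot loopMom (ext ε₂)
        = dot (extR Δ) loopMom * dot loopMom (ext ε₂)
          + C (mdot p₂ Δ : ℂ) * dot loopMom (ext ε₂) := by
      rw [dot_extR_loopMom_add, dot_comm (extR Δ)]; ring
    rw [hd, loopInt_add a101, loopInt_C_mul a101, h, mul_zero, add_zero, ← loopInt_C_mul a101, ht₁,
      map_neg]
    refine congrArg _ ?_
    ring
  have g1 : loopInt p₁ p₂ n 1 1 0 (-(dot (extR Δ) (loopMom + extR p₁) * dot (extR Δ) (ext ε₂)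
      * dot loopMom (ext ε₁)))
      = -t₂ * loopInt p₂ p₁ n 1 0 1 (dot (extR Δ) (loopMom + extR p₁) * dot loopMom (ext ε₁)) := by
    rw [← s110, ← loopInt_C_mul a110, ht₂, map_neg]
    refine congrArg _ ?_
    ring
  have d1 : loopInt p₂ p₁ n 1 1 1 (dot (extR Δ) (loopMom + extR p₂) * dot (extR Δ) (loopMom + extR p₁)
      * (dot loopMom (ext ε₂) * dot loopMom (ext ε₁)))
      = loopInt p₁ p₂ n 1 1 1 (dot (extR Δ) (loopMom + extR p₁) * dot (extR Δ) (loopMom + extR p₂)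
      * (dot loopMom (ext ε₁) * dot loopMom (ext ε₂))) := by
    rw [← s111]
    refine congrArg _ ?_
    ring
  rw [b1, b2, c1, c2, f1, g1, d1]
  linear_combination (Complex.I * g ^ 2 * colourFactor f a b) * o1
    - (Complex.I * g ^ 2 * colourFactor f a b) * (1 - α) * o2

end Sum

/-! ### Holomorphic parameter integrals -/

section Parametric

theorem differentiableAt_integral_of_dominated {β : Type*} [MeasurableSpace β] {μ : Measure β}
    {f : ℂ → β → ℂ} {s₀ : ℂ} {ρ : ℝ} (hρ : 0 < ρ) {bound : β → ℝ}
    (hmeas : ∀ s ∈ Metric.ball s₀ ρ, AEStronglyMeasurable (f s) μ)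
    (hd : ∀ᵐ x ∂μ, DifferentiableOn ℂ (fun s => f s x) (Metric.ball s₀ ρ))
    (hb : Integrable bound μ) (hbound : ∀ᵐ x ∂μ, ∀ s ∈ Metric.ball s₀ ρ, ‖f s x‖ ≤ bound x) :
    DifferentiableAt ℂ (fun s => ∫ x, f s x ∂μ) s₀ := by
  have hs₀ : s₀ ∈ Metric.ball s₀ ρ := Metric.mem_ball_self hρ
  set ε := ρ / 3 with hε
  have hε0 : 0 < ε := by positivity
  have hsub : ∀ s ∈ Metric.ball s₀ ε, Metric.closedBall s ε ⊆ Metric.ball s₀ ρ := by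
    intro s hs z hz
    rw [Metric.mem_ball] at hs ⊢
    rw [Metric.mem_closedBall] at hz
    calc dist z s₀ ≤ dist z s + dist s s₀ := dist_triangle _ _ _
      _ < ρ := by linarith
  have hda : ∀ᵐ x ∂μ, ∀ s ∈ Metric.ball s₀ ε,
      HasDerivAt (fun s => f s x) (deriv (fun s => f s x) s) s := by
    filter_upwards [hd] with x hx s hs
    exact (hx.differentiableAt (Metric.isOpen_ball.mem_nhds
      (hsub s hs (Metric.mem_closedBall_self hε0.le)))).hasDerivAt
  refine (hasDerivAt_integral_of_dominated_loc_of_deriv_le (Metric.ball_mem_nhds s₀ hε0)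
    (F' := fun s x => deriv (fun s => f s x) s) (bound := fun x => bound x / ε)
    ?_ ?_ ?_ ?_ (hb.div_const ε) hda).2.differentiableAt
  · filter_upwards [Metric.ball_mem_nhds s₀ hρ] with s hs using hmeas s hs
  · exact hb.mono' (hmeas s₀ hs₀) (hbound.mono fun x hx => hx s₀ hs₀)
  · -- the derivative is a pointwise limit of difference quotients
    have hu : Filter.Tendsto (fun k : ℕ => s₀ + ((ε / (k + 2) : ℝ) : ℂ)) Filter.atTop
        (nhdsWithin s₀ {s₀}ᶜ) := by
      refine tendsto_nhdsWithin_iff.mpr ⟨?_, Filter.Eventually.of_forall fun k => ?_⟩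
      · have h0 : Filter.Tendsto (fun k : ℕ => ε / ((k : ℝ) + 2)) Filter.atTop (nhds 0) :=
          Filter.Tendsto.div_atTop tendsto_const_nhds
            (Filter.tendsto_atTop_add_const_right _ _ tendsto_natCast_atTop_atTop)
        have := ((Complex.continuous_ofReal.tendsto 0).comp h0).const_add s₀
        simpa using this
      · have : (ε / ((k : ℝ) + 2)) ≠ 0 := by positivity
        simp only [mem_compl_iff, mem_singleton_iff, add_eq_left]
        exact_mod_cast this
    refine aestronglyMeasurable_of_tendsto_ae Filter.atTop
      (f := fun (k : ℕ) x => slope (fun s => f s x) s₀ (s₀ + ((ε / (k + 2) : ℝ) : ℂ))) ?_ ?_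
    · intro k
      have hk : s₀ + ((ε / (k + 2) : ℝ) : ℂ) ∈ Metric.ball s₀ ρ := by
        rw [Metric.mem_ball, dist_eq_norm, add_sub_cancel_left, Complex.norm_real, Real.norm_eq_abs,
          abs_of_pos (by positivity)]
        have : ε / ((k : ℝ) + 2) ≤ ε := div_le_self hε0.le (by linarith [(Nat.cast_nonneg k : (0:ℝ) ≤ k)])
        linarith
      exact ((hmeas _ hk).sub (hmeas _ hs₀)).const_smul
        (s₀ + ((ε / (k + 2) : ℝ) : ℂ) - s₀)⁻¹
    · filter_upwards [hda] with x hx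
      exact (hasDerivAt_iff_tendsto_slope.mp (hx s₀ (Metric.mem_ball_self hε0))).comp hu
  · filter_upwards [hd, hbound] with x hx hbx s hs
    refine Complex.norm_deriv_le_of_forall_mem_sphere_norm_le hε0 ?_ ?_
    · refine ⟨hx.mono ((Metric.ball_subset_closedBall).trans (hsub s hs)), ?_⟩
      exact hx.continuousOn.mono ((Metric.closure_ball_subset_closedBall).trans (hsub s hs))
    · exact fun z hz => hbx z (hsub s hs (Metric.sphere_subset_closedBall hz))

theorem differentiableAt_powI0 (F : ℝ) {s : ℂ} (h : F ≠ 0 ∨ s ≠ 0) :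
    DifferentiableAt ℂ (fun s => powI0 F s) s := by
  simp only [powI0_eq]
  refine DifferentiableAt.mul (by fun_prop) ?_
  refine DifferentiableAt.const_cpow differentiableAt_id ?_
  rcases h with h | h
  · left
    simpa using h
  · right
    exact h

theorem norm_powI0_le (F : ℝ) (s : ℂ) :
    ‖powI0 F s‖ ≤ |F| ^ s.re * Real.exp (2 * Real.pi * |s.im|) := by
  rw [powI0_eq, norm_mul, Complex.norm_exp]
  have h1 : (-(Real.pi : ℂ) / 2 * Complex.I * s).re = Real.pi / 2 * s.im := by
    simp
    ring
  have h2 : ‖Complex.I * (F : ℂ)‖ = |F| := by simp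
  have h3 := Complex.norm_cpow_le (Complex.I * (F : ℂ)) s
  have h4 := Complex.abs_arg_le_pi (Complex.I * (F : ℂ))
  rw [h1]
  rw [h2, div_eq_mul_inv, ← Real.exp_neg] at h3
  have hpi := Real.pi_pos
  have h5 : -(Complex.arg (Complex.I * (F : ℂ)) * s.im) ≤ Real.pi * |s.im| := by
    calc _ ≤ |Complex.arg (Complex.I * (F : ℂ)) * s.im| := neg_le_abs _
      _ = |Complex.arg (Complex.I * (F : ℂ))| * |s.im| := abs_mul _ _
      _ ≤ _ := by gcongr
  have h6 : Real.pi / 2 * s.im ≤ Real.pi * |s.im| := by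
    have := le_abs_self s.im
    have := abs_nonneg s.im
    nlinarith
  calc _ ≤ Real.exp (Real.pi / 2 * s.im)
        * (|F| ^ s.re * Real.exp (-(Complex.arg (Complex.I * (F : ℂ)) * s.im))) := by gcongr
    _ = |F| ^ s.re * Real.exp (Real.pi / 2 * s.im
        + -(Complex.arg (Complex.I * (F : ℂ)) * s.im)) := by rw [Real.exp_add]; ring
    _ ≤ _ := by
      gcongr
      linarith

theorem powI0_mul_of_nonneg {c r : ℝ} (hr : 0 ≤ r) (s : ℂ) :
    powI0 (c * r) s = powI0 c s * (r : ℂ) ^ s := by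
  rcases eq_or_ne s 0 with rfl | hs
  · simp [powI0]
  rcases hr.eq_or_lt with rfl | hr
  · simp [powI0, hs]
  rcases eq_or_ne c 0 with rfl | hc
  · simp [powI0, hs]
  rw [powI0_eq, powI0_eq]
  have h1 : Complex.I * ((c * r : ℝ) : ℂ) = (r : ℂ) * (Complex.I * c) := by push_cast; ring
  have h2 : (r : ℂ) ≠ 0 := by exact_mod_cast hr.ne'
  have h3 : Complex.I * (c : ℂ) ≠ 0 := by simpa using hc
  rw [h1, Complex.cpow_def_of_ne_zero (mul_ne_zero h2 h3), Complex.cpow_def_of_ne_zero h3,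
    Complex.cpow_def_of_ne_zero h2, Complex.log_ofReal_mul hr h3, Complex.ofReal_log hr.le,
    add_mul, Complex.exp_add]
  ring

end Parametric

/-! ### Bubble integrals -/

section Edge

/-- The meromorphic continuation in `s` of `∫₀¹ (1 - t)^p t^q (c (1 - t) t - i0)^s dt`. -/
def edgeMero (c : ℝ) (p q : ℕ) (s : ℂ) : ℂ :=
  powI0 c s * (Complex.Gamma (q + s + 1) * Complex.Gamma (p + s + 1)
    / Complex.Gamma (q + s + 1 + (p + s + 1)))

/-- The bubble integral is a Beta integral. -/
theorem integral_edge (c : ℝ) (p q : ℕ) {s : ℂ} (hs : 0 < s.re) :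
    ∫ t in (0 : ℝ)..1, ((1 - t : ℝ) : ℂ) ^ p * (t : ℂ) ^ q * powI0 (c * ((1 - t) * t)) s
      = edgeMero c p q s := by
  have hre : ∀ k : ℕ, 0 < ((k : ℂ) + s + 1).re := fun k => by
    simp
    have : (0 : ℝ) ≤ k := k.cast_nonneg
    linarith
  have hne : Complex.Gamma ((q : ℂ) + s + 1 + ((p : ℂ) + s + 1)) ≠ 0 :=
    Complex.Gamma_ne_zero_of_re_pos (by rw [Complex.add_re]; linarith [hre p, hre q])
  rw [edgeMero, Complex.Gamma_mul_Gamma_eq_betaIntegral (hre q) (hre p),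
    mul_div_cancel_left₀ _ hne, Complex.betaIntegral, ← intervalIntegral.integral_const_mul]
  refine intervalIntegral.integral_congr fun t ht => ?_
  rw [uIcc_of_le zero_le_one] at ht
  have h0 : 0 ≤ t := ht.1
  have h1 : 0 ≤ 1 - t := by linarith [ht.2]
  have hs0 : s ≠ 0 := fun h => by simp [h] at hs
  have key : ∀ (k : ℕ) {r : ℝ}, 0 ≤ r → (r : ℂ) ^ ((k : ℂ) + s + 1 - 1) = (r : ℂ) ^ k * (r : ℂ) ^ s := by
    intro k r hr
    rw [add_sub_cancel_right]
    rcases hr.eq_or_lt with rfl | hr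
    · have : (k : ℂ) + s ≠ 0 := fun h => by
        have := hre k
        rw [h] at this
        have h' := congrArg Complex.re h
        simp at h'
        have : (0 : ℝ) ≤ k := k.cast_nonneg
        linarith
      simp [hs0, Complex.zero_cpow this]
    · have : (r : ℂ) ≠ 0 := by exact_mod_cast hr.ne'
      rw [Complex.cpow_add _ _ this, Complex.cpow_natCast]
  have h2 : (1 : ℂ) - (t : ℂ) = ((1 - t : ℝ) : ℂ) := by push_cast; rfl
  rw [powI0_mul_of_nonneg (mul_nonneg h1 h0), h2, key q h0, key p h1, Complex.ofReal_mul,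
    Complex.mul_cpow_ofReal_nonneg h1 h0]
  ring

theorem meromorphic_edgeMero {c : ℝ} (hc : c ≠ 0) (p q : ℕ) : Meromorphic (edgeMero c p q) := by
  have h1 : Meromorphic (fun s => powI0 c s) := fun s =>
    (Differentiable.analyticAt (fun s => differentiableAt_powI0 c (Or.inl hc)) s).meromorphicAt
  have h2 : ∀ g : ℂ → ℂ, Differentiable ℂ g → Meromorphic (fun s => Complex.Gamma (g s)) := fun g hg s => (Meromorphic.Gamma (g s)).comp_analyticAt (hg.analyticAt s)
  exact h1.mul (((h2 _ (by fun_prop)).mul (h2 _ (by fun_prop))).div (h2 _ (by fun_prop)))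

end Edge

/-! ### Meromorphic continuation of the triangle integrals -/

section Continuation

variable (M Q : ℝ)

/-- The quadratic form `F` of the triangle, for `p₁² = p₂² = M` and `(p₁ - p₂)² = Q`. -/
def triF (x : Fin 2 → ℝ) : ℝ :=
  -(M * (bary x 0 * bary x 1) + M * (bary x 0 * bary x 2) + Q * (bary x 1 * bary x 2))

/-- The parameter integral of a monomial over the triangle. -/
def triInt (e : Fin 3 → ℕ) (s : ℂ) : ℂ :=
  ∫ x in feynmanSimplex 2, wt e x * powI0 (triF M Q x) s

theorem contDiff_triF : ContDiff ℝ 1 (triF M Q) := by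
  have h := fun i : Fin 3 => contDiff_bary (m := 2) i
  unfold triF
  exact (((contDiff_const.mul ((h 0).mul (h 1))).add (contDiff_const.mul ((h 0).mul (h 2)))).add
    (contDiff_const.mul ((h 1).mul (h 2)))).neg

theorem continuous_powI0_triF {s : ℂ} (hs : 0 < s.re) :
    Continuous fun x => powI0 (triF M Q x) s :=
  (continuous_powI0 hs).comp (contDiff_triF M Q).continuous

theorem differentiableAt_triInt (e : Fin 3 → ℕ) {s : ℂ} (hs : 0 < s.re) :
    DifferentiableAt ℂ (triInt M Q e) s := by
  have hball : ∀ z ∈ Metric.ball s s.re, 0 < z.re ∧ z.re < 2 * s.re ∧ |z.im| < |s.im| + s.re := by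
    intro z hz
    rw [mem_ball_iff_norm] at hz
    have h1 := (Complex.abs_re_le_norm (z - s)).trans_lt hz
    have h2 := (Complex.abs_im_le_norm (z - s)).trans_lt hz
    rw [Complex.sub_re, abs_lt] at h1
    rw [Complex.sub_im] at h2
    refine ⟨by linarith, by linarith, ?_⟩
    have := abs_sub_abs_le_abs_sub z.im s.im
    linarith
  have hcF : Continuous fun x => ‖wt e x‖ * ((1 + |triF M Q x|) ^ (2 * s.re)
      * Real.exp (2 * Real.pi * (|s.im| + s.re))) := by
    refine (contDiff_wt e).continuous.norm.mul (Continuous.mul ?_ continuous_const)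
    refine Continuous.rpow_const (by have := (contDiff_triF M Q).continuous; fun_prop) fun x => ?_
    exact Or.inr (by linarith)
  refine differentiableAt_integral_of_dominated hs
    (bound := fun x => ‖wt e x‖ * ((1 + |triF M Q x|) ^ (2 * s.re)
      * Real.exp (2 * Real.pi * (|s.im| + s.re)))) ?_ ?_ ?_ ?_
  · intro z hz
    exact ((contDiff_wt e).continuous.mul
      (continuous_powI0_triF M Q (hball z hz).1)).aestronglyMeasurable
  · refine Filter.Eventually.of_forall fun x => ?_
    intro z hz
    refine ((differentiableAt_powI0 _ (Or.inr ?_)).const_mul _).differentiableWithinAt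
    intro h
    have := (hball z hz).1
    simp [h] at this
  · exact hcF.continuousOn.integrableOn_compact (isCompact_feynmanSimplex 2)
  · refine Filter.Eventually.of_forall fun x z hz => ?_
    obtain ⟨h1, h2, h3⟩ := hball z hz
    rw [norm_mul]
    refine mul_le_mul_of_nonneg_left ((norm_powI0_le _ _).trans ?_) (norm_nonneg _)
    have h4 : |triF M Q x| ^ z.re ≤ (1 + |triF M Q x|) ^ (2 * s.re) := by
      have h0 := abs_nonneg (triF M Q x)
      calc |triF M Q x| ^ z.re ≤ (1 + |triF M Q x|) ^ z.re :=
            Real.rpow_le_rpow h0 (by linarith) h1.le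
        _ ≤ _ := Real.rpow_le_rpow_of_exponent_le (by linarith) h2.le
    have hpi := Real.pi_pos
    gcongr

/-- The squared momenta through the face opposite to the vertex `i`. -/
def faceMass (i : Fin 3) : ℝ := ![Q, M, M] i

/-- The meromorphic continuation of the boundary terms. -/
def faceMero (i : Fin 3) (e : Fin 3 → ℕ) (s : ℂ) : ℂ :=
  if e i = 0 then
    edgeMero (-faceMass M Q i) (e (i.succAbove 0)) (e (i.succAbove 1)) s
  else 0

theorem triF_edge (i : Fin 3) (t : ℝ) :
    triF M Q (edge i t) = -faceMass M Q i * ((1 - t) * t) := by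
  unfold triF faceMass
  rw [bary_edge]
  fin_cases i
  · simp [Fin.insertNth, bary, Fin.succAboveCases]
  · simp [Fin.insertNth, bary, Fin.succAboveCases]
  · simp [Fin.insertNth, bary, Fin.succAboveCases]

theorem integral_face (i : Fin 3) (e : Fin 3 → ℕ) {s : ℂ} (hs : 0 < s.re) :
    ∫ t in (0 : ℝ)..1, wt e (edge i t) * powI0 (triF M Q (edge i t)) s = faceMero M Q i e s := by
  unfold faceMero
  split_ifs with h
  · rw [← integral_edge _ _ _ hs]
    refine intervalIntegral.integral_congr fun t _ => ?_
    simp only [wt_edge i e h, triF_edge]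
    simp [wt, bary, Fin.prod_univ_succ]
  · simp [wt_edge_of_ne i e h]

theorem hasDerivAt_triF (i : Fin 3) (x : Fin 2 → ℝ) :
    HasDerivAt (fun t : ℝ => triF M Q (x + t • (vtx i - x)))
      (![-(M * (bary x 1 + bary x 2)), -(M * bary x 0 + Q * bary x 2),
        -(M * bary x 0 + Q * bary x 1)] i - 2 * triF M Q x) 0 := by
  have h := fun j : Fin 3 => hasDerivAt_bary_line i j x
  have h2 := (((((h 0).mul (h 1)).const_mul M).add (((h 0).mul (h 2)).const_mul M)).add
    (((h 1).mul (h 2)).const_mul Q)).neg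
  refine h2.congr_deriv ?_
  simp only [zero_smul, add_zero]
  unfold triF
  fin_cases i <;> simp <;> ring

/-- The coefficients of the vector field along which the derivative of `F` is the sum of a multiple
of `F` and the constant `1`. -/
def fieldCoeff (i : Fin 3) : ℝ :=
  ![(-1 + Q / (2 * M)) / M, -1 / (2 * M), -1 / (2 * M)] i

theorem sum_fieldCoeff (hM : M ≠ 0) (x : Fin 2 → ℝ) :
    ∑ i, fieldCoeff M Q i * (![-(M * (bary x 1 + bary x 2)), -(M * bary x 0 + Q * bary x 2),
        -(M * bary x 0 + Q * bary x 1)] i - 2 * triF M Q x)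
      = 1 - 2 * (∑ i, fieldCoeff M Q i) * triF M Q x := by
  have h : bary x 0 + bary x 1 + bary x 2 = 1 := (Fin.sum_univ_three (bary x)).symm.trans (sum_bary x)
  have h0 : bary x 0 = 1 - bary x 1 - bary x 2 := by linarith
  rw [Fin.sum_univ_three, Fin.sum_univ_three]
  change (-1 + Q / (2 * M)) / M * (-(M * (bary x 1 + bary x 2)) - 2 * triF M Q x)
      + -1 / (2 * M) * (-(M * bary x 0 + Q * bary x 2) - 2 * triF M Q x)
      + -1 / (2 * M) * (-(M * bary x 0 + Q * bary x 1) - 2 * triF M Q x)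
    = 1 - 2 * ((-1 + Q / (2 * M)) / M + -1 / (2 * M) + -1 / (2 * M)) * triF M Q x
  rw [h0]
  field_simp
  ring

/-- The triangle integral with exponent `s` in terms of integrals with exponent `s + 1`.  A linear
combination of the vector fields that point to the vertices maps `F` to `1` up to a multiple of `F`,
so that `F^s` is, up to a multiple of `F^(s + 1)`, a derivative of `F^(s + 1)`, and integration by
parts applies. -/
theorem triInt_recursion (hM : M ≠ 0) (e : Fin 3 → ℕ) {s : ℂ} (hs : 0 < s.re) :
    (s + 1) * triInt M Q e s
      = (∑ i, (fieldCoeff M Q i : ℂ)) * (((∑ j, e j : ℕ) : ℂ) + 2 + 2 * (s + 1))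
          * triInt M Q e (s + 1)
        - ∑ i, (fieldCoeff M Q i : ℂ) * (e i * triInt M Q (Function.update e i (e i - 1)) (s + 1)
          + faceMero M Q i e (s + 1)) := by
  have hs1 : 1 < (s + 1).re := by simpa using hs
  have hs0 : 0 < (s + 1).re := by linarith
  have hne : s + 1 ≠ 0 := fun h => by rw [h] at hs0; simp at hs0
  have hH : ContDiff ℝ 1 fun x => powI0 (triF M Q x) (s + 1) :=
    (contDiff_powI0 hs1).comp (contDiff_triF M Q)
  have hder : ∀ i x, fderiv ℝ (fun x => powI0 (triF M Q x) (s + 1)) x (vtx i - x)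
      = (s + 1) * powI0 (triF M Q x) s * ((![-(M * (bary x 1 + bary x 2)),
        -(M * bary x 0 + Q * bary x 2), -(M * bary x 0 + Q * bary x 1)] i - 2 * triF M Q x : ℝ)) := by
    intro i x
    refine fderiv_vtx hH i x ?_
    have e2 : HasDerivAt (fun F : ℝ => powI0 F (s + 1)) ((s + 1) * powI0 (triF M Q x) s)
        (triF M Q (x + (0 : ℝ) • (vtx i - x))) := by
      rw [zero_smul, add_zero]
      simpa using hasDerivAt_powI0 hs1 (triF M Q x)
    have e3 := HasDerivAt.scomp (0 : ℝ) e2 (hasDerivAt_triF M Q i x)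
    refine e3.congr_deriv ?_
    rw [Complex.real_smul, mul_comm]
  have hint : ∀ (e : Fin 3 → ℕ) {z : ℂ}, 0 < z.re →
      IntegrableOn (fun x => wt e x * powI0 (triF M Q x) z) (feynmanSimplex 2) := fun e z hz =>
    integrableOn_simplex ((contDiff_wt e).continuous.mul (continuous_powI0_triF M Q hz))
  have hibp : ∀ i, ∫ x in feynmanSimplex 2, wt e x * ((((∑ j, e j : ℕ) : ℂ) + (2 : ℕ))
        * powI0 (triF M Q x) (s + 1)
        - fderiv ℝ (fun x => powI0 (triF M Q x) (s + 1)) x (vtx i - x))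
      = e i * triInt M Q (Function.update e i (e i - 1)) (s + 1) + faceMero M Q i e (s + 1) := by
    intro i
    have h := (isFaceIntegral_two i).ibp e hH
    rw [integral_face M Q i e hs0] at h
    exact h
  have hci : ∀ i, IntegrableOn (fun x => wt e x * ((((∑ j, e j : ℕ) : ℂ) + (2 : ℕ))
        * powI0 (triF M Q x) (s + 1)
        - fderiv ℝ (fun x => powI0 (triF M Q x) (s + 1)) x (vtx i - x))) (feynmanSimplex 2) :=
    fun i => integrableOn_simplex ((contDiff_wt e).continuous.mul
      ((continuous_const.mul hH.continuous).sub (continuous_fderiv_vtx hH i)))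
  simp only [← hibp, ← integral_const_mul]
  rw [← integral_finsetSum _ fun i _ => (hci i).const_mul _]
  unfold triInt
  rw [← integral_const_mul, ← integral_const_mul,
    ← integral_sub ((hint e hs0).const_mul _) (integrable_finsetSum _ fun i _ => (hci i).const_mul _)]
  refine integral_congr_ae (Filter.Eventually.of_forall fun x => ?_)
  have h1 := sum_fieldCoeff M Q hM x
  have h2 : ∑ i, (fieldCoeff M Q i : ℂ) * ((![-(M * (bary x 1 + bary x 2)),
        -(M * bary x 0 + Q * bary x 2), -(M * bary x 0 + Q * bary x 1)] i - 2 * triF M Q x : ℝ) : ℂ)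
      = 1 - 2 * (∑ i, (fieldCoeff M Q i : ℂ)) * triF M Q x := by
    have := congrArg (fun r : ℝ => (r : ℂ)) h1
    push_cast at this ⊢
    exact this
  have h3 := powI0_mul_self (triF M Q x) hne
  rw [add_sub_cancel_right] at h3
  have h4 : ∀ i, (fieldCoeff M Q i : ℂ) * (wt e x * ((((∑ j, e j : ℕ) : ℂ) + (2 : ℕ))
        * powI0 (triF M Q x) (s + 1)
        - fderiv ℝ (fun x => powI0 (triF M Q x) (s + 1)) x (vtx i - x)))
      = (fieldCoeff M Q i : ℂ) * (wt e x * ((((∑ j, e j : ℕ) : ℂ) + (2 : ℕ))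
        * powI0 (triF M Q x) (s + 1))) - wt e x * ((s + 1) * powI0 (triF M Q x) s) *
        ((fieldCoeff M Q i : ℂ) * ((![-(M * (bary x 1 + bary x 2)),
        -(M * bary x 0 + Q * bary x 2), -(M * bary x 0 + Q * bary x 1)] i - 2 * triF M Q x : ℝ) : ℂ)) := by
    intro i
    rw [hder]
    ring
  simp only [h4, Finset.sum_sub_distrib, ← Finset.sum_mul, ← Finset.mul_sum, h2]
  rw [← h3]
  push_cast
  ring

/-- One step of the recursion in the exponent `s`. -/
def triStep (f : (Fin 3 → ℕ) → ℂ → ℂ) (e : Fin 3 → ℕ) (s : ℂ) : ℂ :=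
  ((∑ i, (fieldCoeff M Q i : ℂ)) * (((∑ j, e j : ℕ) : ℂ) + 2 + 2 * (s + 1)) * f e (s + 1)
    - ∑ i, (fieldCoeff M Q i : ℂ) * (e i * f (Function.update e i (e i - 1)) (s + 1)
      + faceMero M Q i e (s + 1))) / (s + 1)

/-- The continuation of the triangle integrals after `N` steps of the recursion. -/
def triRec : ℕ → (Fin 3 → ℕ) → ℂ → ℂ
  | 0 => triInt M Q
  | N + 1 => triStep M Q (triRec N)

theorem triStep_congr {f f' : (Fin 3 → ℕ) → ℂ → ℂ} {s : ℂ} (h : ∀ e, f e (s + 1) = f' e (s + 1))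
    (e : Fin 3 → ℕ) : triStep M Q f e s = triStep M Q f' e s := by
  simp only [triStep, h]

theorem triRec_succ_eq (hM : M ≠ 0) (N : ℕ) (e : Fin 3 → ℕ) {s : ℂ} (hs : -(N : ℝ) < s.re) :
    triRec M Q (N + 1) e s = triRec M Q N e s := by
  induction N generalizing e s with
  | zero =>
    have hs' : 0 < s.re := by simpa using hs
    have hne : s + 1 ≠ 0 := fun h => by
      have : (s + 1).re = s.re + 1 := by simp
      rw [h] at this
      simp at this
      linarith
    change triStep M Q (triInt M Q) e s = triInt M Q e s
    rw [triStep, ← triInt_recursion M Q hM e hs', mul_div_cancel_left₀ _ hne]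
  | succ N ih =>
    have hs' : -(N : ℝ) < (s + 1).re := by
      push_cast at hs
      simp
      linarith
    exact triStep_congr M Q (fun e => ih e hs') e

/-- The meromorphic continuation in `s` of the triangle integrals. -/
def triMero (e : Fin 3 → ℕ) (s : ℂ) : ℂ := triRec M Q (⌈|s.re|⌉₊ + 1) e s

theorem triRec_eq_triMero (hM : M ≠ 0) (N : ℕ) (e : Fin 3 → ℕ) {s : ℂ} (hs : |s.re| + 1 ≤ N) :
    triRec M Q N e s = triMero M Q e s := by
  have h0 : ⌈|s.re|⌉₊ + 1 ≤ N := by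
    have h1 : ⌈|s.re|⌉₊ ≤ N - 1 := Nat.ceil_le.mpr (by
      have : 1 ≤ N := by
        have := abs_nonneg s.re
        have : (1 : ℝ) ≤ N := by linarith
        exact_mod_cast this
      push_cast [this]
      linarith)
    have : 1 ≤ N := by
      have := abs_nonneg s.re
      have : (1 : ℝ) ≤ N := by linarith
      exact_mod_cast this
    omega
  unfold triMero
  induction N, h0 using Nat.le_induction with
  | base => rfl
  | succ K hK ih =>
    have h1 : |s.re| + 1 ≤ K := by
      have h2 := Nat.le_ceil |s.re|
      have h3 : ((⌈|s.re|⌉₊ + 1 : ℕ) : ℝ) ≤ K := by exact_mod_cast hK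
      push_cast at h3
      linarith
    rw [triRec_succ_eq M Q hM K e (by linarith [neg_abs_le s.re]), ih h1]

theorem meromorphicAt_triRec (hM : M ≠ 0) (hQ : Q ≠ 0) (N : ℕ) (e : Fin 3 → ℕ) {s : ℂ}
    (hs : -(N : ℝ) < s.re) : MeromorphicAt (triRec M Q N e) s := by
  induction N generalizing e s with
  | zero =>
    have hs' : 0 < s.re := by simpa using hs
    refine AnalyticAt.meromorphicAt (DifferentiableOn.analyticAt (s := {z : ℂ | 0 < z.re}) ?_ ?_)
    · exact fun z hz => (differentiableAt_triInt M Q e hz).differentiableWithinAt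
    · exact (isOpen_lt continuous_const Complex.continuous_re).mem_nhds hs'
  | succ N ih =>
    have hs' : -(N : ℝ) < (s + 1).re := by
      push_cast at hs
      simp
      linarith
    have ha : AnalyticAt ℂ (fun z : ℂ => z + 1) s := by fun_prop
    have h1 : ∀ e, MeromorphicAt (fun z => triRec M Q N e (z + 1)) s := fun e =>
      (ih e hs').comp_analyticAt (g := fun z : ℂ => z + 1) ha
    have h2 : ∀ i, MeromorphicAt (fun z => faceMero M Q i e (z + 1)) s := by
      intro i
      unfold faceMero
      split_ifs
      · have hf : -faceMass M Q i ≠ 0 := by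
          fin_cases i <;> simp [faceMass, hM, hQ]
        exact (meromorphic_edgeMero hf _ _ (s + 1)).comp_analyticAt (g := fun z : ℂ => z + 1) ha
      · exact MeromorphicAt.const 0 s
    have h3 : MeromorphicAt (fun z : ℂ => z) s := MeromorphicAt.id s
    have h4 : ∀ c : ℂ, MeromorphicAt (fun _ : ℂ => c) s := fun c => MeromorphicAt.const c s
    change MeromorphicAt (fun z => triStep M Q (triRec M Q N) e z) s
    simp only [triStep, Fin.sum_univ_three]
    fun_prop

theorem meromorphic_triMero (hM : M ≠ 0) (hQ : Q ≠ 0) (e : Fin 3 → ℕ) :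
    Meromorphic (triMero M Q e) := by
  intro s
  obtain ⟨N, hN⟩ := exists_nat_gt (|s.re| + 1)
  have hs : -(N : ℝ) < s.re := by linarith [neg_abs_le s.re]
  refine (meromorphicAt_triRec M Q hM hQ N e hs).congr ?_
  have : ∀ᶠ z : ℂ in nhds s, |z.re| + 1 < (N : ℝ) :=
    (ContinuousAt.eventually_lt (f := fun z : ℂ => |z.re| + 1) (g := fun _ => (N : ℝ))
      (by fun_prop) (by fun_prop) hN)
  exact (this.mono fun z hz => triRec_eq_triMero M Q hM N e hz.le).filter_mono nhdsWithin_le_nhds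

theorem triMero_eq_triInt (hM : M ≠ 0) (e : Fin 3 → ℕ) {s : ℂ} (hs : 0 < s.re) :
    triMero M Q e s = triInt M Q e s := by
  unfold triMero
  induction ⌈|s.re|⌉₊ + 1 with
  | zero => rfl
  | succ N ih => rw [triRec_succ_eq M Q hM N e (by linarith [(Nat.cast_nonneg N : (0 : ℝ) ≤ N)]), ih]

theorem analyticAt_triMero (hM : M ≠ 0) (e : Fin 3 → ℕ) (s : ℂ) (hs : 0 < s.re) :
    AnalyticAt ℂ (triMero M Q e) s := by
  have ho : IsOpen {s : ℂ | 0 < s.re} := isOpen_lt continuous_const Complex.continuous_re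
  have h : DifferentiableOn ℂ (triMero M Q e) {s : ℂ | 0 < s.re} :=
    DifferentiableOn.congr (fun z hz => (differentiableAt_triInt M Q e hz).differentiableWithinAt)
      fun z hz => triMero_eq_triInt M Q hM e hz
  exact h.analyticAt (ho.mem_nhds hs)

end Continuation

/-! ### Conical coordinates and the rotation of the contour -/

section Rotation

open Filter Topology

theorem integrable_exp_neg_mul_abs {δ : ℝ} (hδ : 0 < δ) :
    Integrable fun x : ℝ => Real.exp (-δ * |x|) := by
  rw [← integrableOn_univ, ← Iic_union_Ioi (a := (0 : ℝ))]
  refine IntegrableOn.union ?_ ?_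
  · refine (integrableOn_exp_mul_Iic hδ 0).congr_fun (fun x hx => ?_) measurableSet_Iic
    rw [abs_of_nonpos hx, neg_mul_neg]
  · refine (exp_neg_integrableOn_Ioi 0 hδ).congr_fun (fun x hx => ?_) measurableSet_Ioi
    rw [abs_of_pos hx]

/-- Cauchy's theorem for a strip in which the integrand decays exponentially. -/
theorem integral_eq_integral_add_mul_I {f : ℂ → ℂ} {h : ℝ}
    (hc : ContinuousOn f {w | w.im ∈ uIcc 0 h})
    (hd : DifferentiableOn ℂ f {w | w.im ∈ Ioo (min 0 h) (max 0 h)}) {K δ : ℝ} (hδ : 0 < δ)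
    (hb : ∀ w : ℂ, w.im ∈ uIcc 0 h → ‖f w‖ ≤ K * Real.exp (-δ * |w.re|)) :
    ∫ x : ℝ, f x = ∫ x : ℝ, f (x + h * Complex.I) := by
  have hint : ∀ y ∈ uIcc 0 h, Integrable fun x : ℝ => f (x + y * Complex.I) := by
    intro y hy
    refine ((integrable_exp_neg_mul_abs hδ).const_mul K).mono' ?_ (Eventually.of_forall fun x => ?_)
    · refine Continuous.aestronglyMeasurable ?_
      refine hc.comp_continuous (by fun_prop) fun x => ?_
      simpa using hy
    · simpa using hb (x + y * Complex.I) (by simpa using hy)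
  have hlim : ∀ y ∈ uIcc 0 h, Tendsto (fun R : ℝ => ∫ x in -R..R, f (x + y * Complex.I)) atTop
      (𝓝 (∫ x : ℝ, f (x + y * Complex.I))) := fun y hy =>
    intervalIntegral_tendsto_integral (hint y hy) tendsto_neg_atTop_atBot tendsto_id
  have hK : Tendsto (fun R : ℝ => K * Real.exp (-δ * |R|) * |h - 0|) atTop (𝓝 0) := by
    have h1 : Tendsto (fun R : ℝ => δ * |R|) atTop atTop :=
      tendsto_abs_atTop_atTop.const_mul_atTop hδ
    have h2 := ((Real.tendsto_exp_neg_atTop_nhds_zero.comp h1).const_mul K).mul_const |h - 0|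
    simpa [Function.comp_def, neg_mul] using h2
  have hv : ∀ σ : ℝ, |σ| = 1 →
      Tendsto (fun R : ℝ => ∫ y in (0 : ℝ)..h, f ((σ * R : ℝ) + y * Complex.I)) atTop (𝓝 0) := by
    intro σ hσ
    refine squeeze_zero_norm (fun R => ?_) hK
    refine intervalIntegral.norm_integral_le_of_norm_le_const fun y hy => ?_
    have h1 := hb ((σ * R : ℝ) + y * Complex.I) (by simpa using uIoc_subset_uIcc hy)
    simpa [abs_mul, hσ] using h1
  have h0 : ∀ R : ℝ, (∫ x in -R..R, f (x + (0 : ℝ) * Complex.I))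
      - (∫ x in -R..R, f (x + h * Complex.I))
      + Complex.I • (∫ y in (0 : ℝ)..h, f ((1 * R : ℝ) + y * Complex.I))
      - Complex.I • (∫ y in (0 : ℝ)..h, f (((-1) * R : ℝ) + y * Complex.I)) = 0 := by
    intro R
    have := Complex.integral_boundary_rect_eq_zero_of_continuousOn_of_differentiableOn f
      ((-R : ℝ) : ℂ) ((R : ℝ) + h * Complex.I) ?_ ?_
    · simpa using this
    · refine hc.mono fun w hw => ?_
      rw [Complex.mem_reProdIm] at hw
      simpa using hw.2
    · refine hd.mono fun w hw => ?_
      rw [Complex.mem_reProdIm] at hw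
      simpa using hw.2
  have hall := (((hlim 0 left_mem_uIcc).sub (hlim h right_mem_uIcc)).add
    ((hv 1 (by simp)).const_smul Complex.I)).sub ((hv (-1) (by simp)).const_smul Complex.I)
  have h1 := tendsto_nhds_unique (hall.congr h0) tendsto_const_nhds
  simp only [smul_zero, add_zero, sub_zero, Complex.ofReal_zero, zero_mul] at h1
  exact sub_eq_zero.mp h1

/-- Conical coordinates `x = (ρ u, ρ (1 - u))` on the triangle. -/
theorem integral_simplex_two_cone {φ : (Fin 2 → ℝ) → ℂ} (hφ : Continuous φ) :
    ∫ x in feynmanSimplex 2, φ x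
      = ∫ u in (0 : ℝ)..1, ∫ r in (0 : ℝ)..1, (r : ℂ) * φ ![r * u, r * (1 - u)] := by
  have hf : Continuous fun z : ℝ × ℝ => φ ![z.1, 1 - z.1 - z.2] := hφ.comp (by fun_prop)
  have h1 := integral_triangle hf
  rw [integral_triangle_swap hf] at h1
  rw [integral_simplex_two hφ]
  have h2 : ∀ x : ℝ, ∫ y in (0 : ℝ)..1 - x, φ ![x, 1 - x - y]
      = ∫ y in (0 : ℝ)..1 - x, φ ![x, y] := fun x => by
    rw [intervalIntegral.integral_comp_sub_left (fun y => φ ![x, y])]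
    simp
  simp only [h2] at h1
  rw [← h1]
  have h3 := intervalIntegral.integral_comp_sub_left (a := 0) (b := 1)
    (fun r => ∫ x in (0 : ℝ)..r, φ ![x, r - x]) 1
  have h4 : ∀ r : ℝ, ∫ x in (0 : ℝ)..r, φ ![x, r - x]
      = ∫ u in (0 : ℝ)..1, (r : ℂ) * φ ![r * u, r * (1 - u)] := fun r => by
    have := intervalIntegral.smul_integral_comp_mul_left (a := 0) (b := 1)
      (fun x => φ ![x, r - x]) r
    rw [mul_zero, mul_one] at this
    rw [← this, Complex.real_smul, intervalIntegral.integral_const_mul]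
    simp only [mul_sub, mul_one]
  have h5 : ∀ y x : ℝ, φ ![x, 1 - x - y] = φ ![x, 1 - y - x] := fun y x => by
    rw [sub_right_comm]
  simp only [h5]
  rw [h3]
  simp only [sub_self, sub_zero, h4]
  refine intervalIntegral_intervalIntegral_swap ?_
  have hg : Continuous fun z : ℝ × ℝ => (z.1 : ℂ) * φ ![z.1 * z.2, z.1 * (1 - z.2)] :=
    (Complex.continuous_ofReal.comp continuous_fst).mul (hφ.comp (by fun_prop))
  exact (hg.continuousOn.integrableOn_compact (isCompact_uIcc.prod isCompact_uIcc)).mono_set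
    (prod_mono uIoc_subset_uIcc uIoc_subset_uIcc)

theorem integral_comp_sigmoid (G : ℝ → ℂ) :
    ∫ r in (0 : ℝ)..1, G r
      = ∫ x : ℝ, (Real.sigmoid x * (1 - Real.sigmoid x) : ℝ) * G (Real.sigmoid x) := by
  rw [intervalIntegral.integral_of_le zero_le_one, integral_Ioc_eq_integral_Ioo,
    ← Real.range_sigmoid, ← image_univ, integral_image_eq_integral_abs_deriv_smul MeasurableSet.univ
      (fun x _ => (Real.hasDerivAt_sigmoid x).hasDerivWithinAt) Real.sigmoid_injective.injOn,
    setIntegral_univ]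
  refine integral_congr_ae (Eventually.of_forall fun x => ?_)
  simp only
  rw [abs_of_pos (mul_pos (Real.sigmoid_pos x) (sub_pos.mpr (Real.sigmoid_lt_one x))),
    Complex.real_smul]

end Rotation

section Ray

open Filter Topology

/-- The integrand of the radial integral, `e^w` being the ratio of the radial Feynman parameter
to its complement.  The factor `i` in the base and the phase that compensates it implement the `-i0`
prescription: for real `A + B e^w` the base is on the imaginary axis, off the cut. -/
def rayInt (A B : ℝ) (k N : ℕ) (s w : ℂ) : ℂ :=
  Complex.exp w ^ k * ((1 + Complex.exp w) ^ N)⁻¹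
    * (Complex.exp (s * w) * (1 + Complex.exp w) ^ (-2 * s)
      * Complex.exp (-(Real.pi : ℂ) / 2 * Complex.I * s)
      * (Complex.I * (A + B * Complex.exp w)) ^ s)

/-- The modulus of the quantity that is raised to the power `s` in `rayInt`. -/
def rayBase (A B : ℝ) (w : ℂ) : ℝ :=
  ‖Complex.exp w‖ * ‖A + B * Complex.exp w‖ / ‖1 + Complex.exp w‖ ^ 2

theorem norm_cpow_le_exp (z s : ℂ) :
    ‖z ^ s‖ ≤ ‖z‖ ^ s.re * Real.exp (Real.pi * |s.im|) := by
  refine (Complex.norm_cpow_le z s).trans ?_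
  rw [div_eq_mul_inv, ← Real.exp_neg]
  gcongr
  calc -(z.arg * s.im) ≤ |z.arg * s.im| := neg_le_abs _
    _ = |z.arg| * |s.im| := abs_mul _ _
    _ ≤ _ := by gcongr; exact Complex.abs_arg_le_pi z


theorem one_le_norm_one_add {z : ℂ} (hz : 0 ≤ z.re) : 1 ≤ ‖1 + z‖ := by
  refine le_trans ?_ (Complex.abs_re_le_norm (1 + z))
  rw [Complex.add_re, Complex.one_re]
  exact le_trans (by linarith) (le_abs_self _)

theorem one_add_sq_le_norm_one_add_sq {z : ℂ} (hz : 0 ≤ z.re) : 1 + ‖z‖ ^ 2 ≤ ‖1 + z‖ ^ 2 := by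
  rw [← Complex.normSq_eq_norm_sq, ← Complex.normSq_eq_norm_sq, Complex.normSq_apply,
    Complex.normSq_apply]
  simp
  nlinarith

theorem norm_le_norm_one_add {z : ℂ} (hz : 0 ≤ z.re) : ‖z‖ ≤ ‖1 + z‖ :=
  abs_le_of_sq_le_sq' (by have := one_add_sq_le_norm_one_add_sq hz; linarith) (norm_nonneg _) |>.2

theorem rayBase_nonneg (A B : ℝ) (w : ℂ) : 0 ≤ rayBase A B w := by
  unfold rayBase
  positivity

theorem rayBase_le (A B : ℝ) {w : ℂ} (hw : 0 ≤ (Complex.exp w).re) :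
    rayBase A B w ≤ |A| + |B| := by
  unfold rayBase
  set z := Complex.exp w
  have h1 := one_add_sq_le_norm_one_add_sq hw
  have h2 := one_le_norm_one_add hw
  rw [div_le_iff₀ (by positivity)]
  have h3 : ‖(A : ℂ) + B * z‖ ≤ |A| + |B| * ‖z‖ := by
    refine (norm_add_le _ _).trans ?_
    rw [norm_mul, Complex.norm_real, Complex.norm_real, Real.norm_eq_abs, Real.norm_eq_abs]
  have hA := abs_nonneg A
  have hB := abs_nonneg B
  have hz := norm_nonneg z
  calc ‖z‖ * ‖(A : ℂ) + B * z‖ ≤ ‖z‖ * (|A| + |B| * ‖z‖) := by gcongr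
    _ ≤ (|A| + |B|) * (1 + ‖z‖ ^ 2) := by
      nlinarith [mul_nonneg hA (by nlinarith [sq_nonneg (‖z‖ - 1)] : 0 ≤ 1 + ‖z‖ ^ 2 - ‖z‖)]
    _ ≤ _ := by gcongr

/-- Up to a factor that depends on the imaginary part of the exponent, the integrand is bounded by
its value at the moduli. -/
theorem norm_rayInt_le (A B : ℝ) (k N : ℕ) (s : ℂ) {w : ℂ} (hw : 0 ≤ (Complex.exp w).re)
    (hi : |w.im| ≤ 2) :
    ‖rayInt A B k N s w‖ ≤ ‖Complex.exp w‖ ^ k / ‖1 + Complex.exp w‖ ^ N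
      * (rayBase A B w ^ s.re * Real.exp (14 * |s.im|)) := by
  have h0 := one_le_norm_one_add hw
  have hr : 0 < ‖Complex.exp w‖ := norm_pos_iff.mpr (Complex.exp_ne_zero w)
  have hpi := Real.pi_lt_d2
  have hs := abs_nonneg s.im
  have e1 : ‖Complex.exp (s * w)‖ ≤ ‖Complex.exp w‖ ^ s.re * Real.exp (2 * |s.im|) := by
    rw [Complex.norm_exp, Complex.norm_exp, ← Real.exp_mul, ← Real.exp_add]
    refine Real.exp_le_exp.mpr ?_
    rw [Complex.mul_re]
    have : -(s.im * w.im) ≤ 2 * |s.im| :=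
      calc -(s.im * w.im) ≤ |s.im * w.im| := neg_le_abs _
        _ = |w.im| * |s.im| := by rw [abs_mul, mul_comm]
        _ ≤ _ := by gcongr
    linarith
  have e2 : ‖(1 + Complex.exp w) ^ (-2 * s)‖
      ≤ (‖1 + Complex.exp w‖ ^ 2) ^ (-s.re) * Real.exp (6.3 * |s.im|) := by
    refine (norm_cpow_le_exp _ _).trans ?_
    have h1 : (-2 * s).re = 2 * -s.re := by simp
    have h2 : |(-2 * s).im| = 2 * |s.im| := by simp [abs_mul]
    rw [h1, h2, Real.rpow_mul (norm_nonneg _)]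
    norm_cast
    refine mul_le_mul_of_nonneg_left (Real.exp_le_exp.mpr ?_) (by positivity)
    linarith [mul_le_mul_of_nonneg_right hpi.le hs]
  have e3 : ‖Complex.exp (-(Real.pi : ℂ) / 2 * Complex.I * s)‖ ≤ Real.exp (1.6 * |s.im|) := by
    rw [Complex.norm_exp]
    refine Real.exp_le_exp.mpr ?_
    have h1 : (-(Real.pi : ℂ) / 2 * Complex.I * s).re = Real.pi / 2 * s.im := by
      simp
      ring
    rw [h1]
    have h2 := mul_le_mul_of_nonneg_left (le_abs_self s.im) (half_pos Real.pi_pos).le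
    nlinarith
  have e4 : ‖(Complex.I * (A + B * Complex.exp w)) ^ s‖
      ≤ ‖(A : ℂ) + B * Complex.exp w‖ ^ s.re * Real.exp (3.2 * |s.im|) := by
    refine (norm_cpow_le_exp _ _).trans ?_
    rw [norm_mul, Complex.norm_I, one_mul]
    gcongr
    linarith
  unfold rayInt
  rw [norm_mul, norm_mul, norm_inv, norm_pow, norm_pow, ← div_eq_mul_inv, norm_mul, norm_mul,
    norm_mul]
  refine mul_le_mul_of_nonneg_left ?_ (by positivity)
  calc _ ≤ (‖Complex.exp w‖ ^ s.re * Real.exp (2 * |s.im|))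
        * ((‖1 + Complex.exp w‖ ^ 2) ^ (-s.re) * Real.exp (6.3 * |s.im|))
        * Real.exp (1.6 * |s.im|)
        * (‖(A : ℂ) + B * Complex.exp w‖ ^ s.re * Real.exp (3.2 * |s.im|)) :=
        mul_le_mul (mul_le_mul (mul_le_mul e1 e2 (norm_nonneg _) (by positivity)) e3
          (norm_nonneg _) (by positivity)) e4 (norm_nonneg _) (by positivity)
    _ = rayBase A B w ^ s.re * (Real.exp (2 * |s.im|) * Real.exp (6.3 * |s.im|)
        * Real.exp (1.6 * |s.im|) * Real.exp (3.2 * |s.im|)) := by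
      unfold rayBase
      rw [Real.div_rpow (by positivity) (by positivity), Real.mul_rpow hr.le (norm_nonneg _),
        Real.rpow_neg (by positivity)]
      ring
    _ ≤ _ := by
      have := rayBase_nonneg A B w
      rw [← Real.exp_add, ← Real.exp_add, ← Real.exp_add]
      refine mul_le_mul_of_nonneg_left (Real.exp_le_exp.mpr ?_) (by positivity)
      linarith

/-- On the strip, the integrand decays exponentially. -/
theorem norm_rayInt_le_exp (A B : ℝ) {k N : ℕ} (hk : 1 ≤ k) (hN : k < N) {s : ℂ} (hs : 0 ≤ s.re)
    {w : ℂ} (hw : 0 ≤ (Complex.exp w).re) (hi : |w.im| ≤ 2) :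
    ‖rayInt A B k N s w‖
      ≤ (|A| + |B|) ^ s.re * Real.exp (14 * |s.im|) * Real.exp (-1 * |w.re|) := by
  refine (norm_rayInt_le A B k N s hw hi).trans ?_
  rw [mul_comm]
  have h1 := one_le_norm_one_add hw
  have h2 := norm_le_norm_one_add hw
  gcongr ?_ * _ * ?_
  · exact Real.rpow_le_rpow (rayBase_nonneg _ _ _) (rayBase_le A B hw) hs
  have h3 : ‖Complex.exp w‖ = Real.exp w.re := Complex.norm_exp w
  rw [div_le_iff₀ (by positivity)]
  rcases le_total 0 w.re with h | h
  · have h4 : 1 ≤ ‖Complex.exp w‖ := h3 ▸ Real.one_le_exp h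
    calc ‖Complex.exp w‖ ^ k = Real.exp (-1 * |w.re|) * ‖Complex.exp w‖ ^ (k + 1) := by
          rw [abs_of_nonneg h, pow_succ, h3, neg_one_mul, Real.exp_neg]
          field_simp
      _ ≤ Real.exp (-1 * |w.re|) * ‖1 + Complex.exp w‖ ^ N := by
        gcongr
        exact (pow_le_pow_right₀ h4 hN).trans (pow_le_pow_left₀ (norm_nonneg _) h2 N)
  · have h4 : ‖Complex.exp w‖ ≤ 1 := h3 ▸ Real.exp_le_one_iff.mpr h
    calc ‖Complex.exp w‖ ^ k ≤ ‖Complex.exp w‖ ^ 1 := pow_le_pow_of_le_one (norm_nonneg _) h4 hk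
      _ = Real.exp (-1 * |w.re|) * 1 := by rw [abs_of_nonpos h, pow_one, h3]; simp
      _ ≤ _ := by
        gcongr
        exact one_le_pow₀ h1

/-- On the real axis, `rayInt` is the integrand of the triangle integral in conical
coordinates. -/
theorem rayInt_ofReal (M Q : ℝ) (e : Fin 3 → ℕ) (s : ℂ) (u x : ℝ) :
    (Real.sigmoid x * (1 - Real.sigmoid x) : ℝ) * ((Real.sigmoid x : ℂ)
        * (wt e ![Real.sigmoid x * u, Real.sigmoid x * (1 - u)]
          * powI0 (triF M Q ![Real.sigmoid x * u, Real.sigmoid x * (1 - u)]) s))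
      = (u : ℂ) ^ e 1 * (1 - u : ℂ) ^ e 2 * rayInt (-M) (-(Q * (u * (1 - u)))) (e 1 + e 2 + 2)
          (e 0 + e 1 + e 2 + 3) s x := by
  have ht := Real.exp_pos x
  set t := Real.exp x with htdef
  have hσ : Real.sigmoid x = t / (1 + t) := by
    rw [Real.sigmoid_def, Real.exp_neg, ← htdef]
    field_simp
    ring
  have hσ' : 1 - Real.sigmoid x = (1 + t)⁻¹ := by
    rw [hσ]
    field_simp
    ring
  have hb0 : bary ![Real.sigmoid x * u, Real.sigmoid x * (1 - u)] 0 = (1 + t)⁻¹ := by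
    rw [← hσ']
    simp [bary]
    ring
  have hb1 : bary ![Real.sigmoid x * u, Real.sigmoid x * (1 - u)] 1 = t / (1 + t) * u := by
    rw [← hσ]
    rfl
  have hb2 : bary ![Real.sigmoid x * u, Real.sigmoid x * (1 - u)] 2 = t / (1 + t) * (1 - u) := by
    rw [← hσ]
    rfl
  have hF : triF M Q ![Real.sigmoid x * u, Real.sigmoid x * (1 - u)]
      = (-M + -(Q * (u * (1 - u))) * t) * (t / (1 + t) ^ 2) := by
    unfold triF
    rw [hb0, hb1, hb2]
    field_simp
    ring
  have hne : (1 + t : ℂ) ≠ 0 := by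
    have : (1 + t : ℝ) ≠ 0 := by positivity
    exact_mod_cast this
  have hexp : Complex.exp (x : ℂ) = (t : ℂ) := by rw [htdef, Complex.ofReal_exp]
  have hpow : ((t / (1 + t) ^ 2 : ℝ) : ℂ) ^ s
      = Complex.exp (s * x) * (1 + Complex.exp x) ^ (-2 * s) := by
    have h1 : (1 + Complex.exp x) = ((1 + t : ℝ) : ℂ) := by rw [hexp]; push_cast; rfl
    have h2 : ((1 + t : ℝ) : ℂ) ≠ 0 := by push_cast; exact hne
    have h3 : ((t / (1 + t) ^ 2 : ℝ) : ℂ) ≠ 0 := by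
      have : t / (1 + t) ^ 2 ≠ 0 := by positivity
      exact_mod_cast this
    rw [h1, Complex.cpow_def_of_ne_zero h2, Complex.cpow_def_of_ne_zero h3, ← Complex.exp_add,
      ← Complex.ofReal_log (by positivity), ← Complex.ofReal_log (by positivity),
      Real.log_div (by positivity) (by positivity), Real.log_pow, htdef, Real.log_exp]
    congr 1
    push_cast
    ring
  have hwt : wt e ![Real.sigmoid x * u, Real.sigmoid x * (1 - u)]
      = ((1 + t : ℂ)⁻¹) ^ e 0 * (t / (1 + t) * u) ^ e 1 * (t / (1 + t) * (1 - u)) ^ e 2 := by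
    unfold wt
    rw [Fin.prod_univ_three, hb0, hb1, hb2]
    push_cast
    rfl
  rw [hF, powI0_mul_of_nonneg (by positivity), powI0_eq, hpow, hwt, hσ', hσ]
  unfold rayInt
  rw [hexp]
  push_cast
  simp only [mul_pow, div_pow, pow_add, inv_pow]
  field_simp

end Ray

section Ray

open Filter Topology

theorem one_add_mem_slitPlane {z : ℂ} (hz : 0 ≤ z.re) : 1 + z ∈ Complex.slitPlane :=
  Or.inl (by simp; linarith)

theorem re_I_mul_ray (A B : ℝ) (w : ℂ) :
    (Complex.I * (A + B * Complex.exp w)).re = Real.exp w.re * -(B * Real.sin w.im) := by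
  simp [Complex.exp_im]
  ring

theorem continuousAt_rayInt {A B : ℝ} {k N : ℕ} {s w : ℂ} (hs : 0 < s.re)
    (hw : 0 ≤ (Complex.exp w).re) (hB : B * Real.sin w.im ≤ 0) :
    ContinuousAt (rayInt A B k N s) w := by
  have h1 := one_add_mem_slitPlane hw
  have h2 : (1 + Complex.exp w) ^ N ≠ 0 := pow_ne_zero _ (Complex.slitPlane_ne_zero h1)
  have h3 : ContinuousAt (fun w => (Complex.I * (A + B * Complex.exp w)) ^ s) w := by
    refine ContinuousAt.comp (g := fun z : ℂ => z ^ s)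
      (Complex.continuousAt_cpow_const_of_re_pos (Or.inl ?_) hs) (by fun_prop)
    rw [re_I_mul_ray]
    exact mul_nonneg (Real.exp_pos _).le (by linarith)
  have h4 : ContinuousAt (fun w => (1 + Complex.exp w) ^ (-2 * s)) w :=
    ContinuousAt.cpow (by fun_prop) continuousAt_const h1
  have h5 : ContinuousAt (fun w => ((1 + Complex.exp w) ^ N)⁻¹) w :=
    ContinuousAt.inv₀ (by fun_prop) h2
  have h6 : ContinuousAt (fun w => Complex.exp w ^ k) w := by fun_prop
  have h7 : ContinuousAt (fun w => Complex.exp (s * w)) w := by fun_prop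
  exact (h6.mul h5).mul (((h7.mul h4).mul continuousAt_const).mul h3)

theorem differentiableAt_rayInt {A B : ℝ} {k N : ℕ} {s w : ℂ}
    (hw : 0 ≤ (Complex.exp w).re) (hB : B * Real.sin w.im < 0) :
    DifferentiableAt ℂ (rayInt A B k N s) w := by
  have h1 := one_add_mem_slitPlane hw
  have h2 : (1 + Complex.exp w) ^ N ≠ 0 := pow_ne_zero _ (Complex.slitPlane_ne_zero h1)
  have h3 : DifferentiableAt ℂ (fun w => (Complex.I * (A + B * Complex.exp w)) ^ s) w := by
    refine DifferentiableAt.cpow_const (by fun_prop) (Or.inl ?_)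
    rw [re_I_mul_ray]
    exact mul_pos (Real.exp_pos _) (by linarith)
  have h4 : DifferentiableAt ℂ (fun w => (1 + Complex.exp w) ^ (-2 * s)) w :=
    DifferentiableAt.cpow_const (by fun_prop) h1
  have h5 : DifferentiableAt ℂ (fun w => ((1 + Complex.exp w) ^ N)⁻¹) w :=
    DifferentiableAt.fun_inv (by fun_prop) h2
  have h6 : DifferentiableAt ℂ (fun w => Complex.exp w ^ k) w := by fun_prop
  have h7 : DifferentiableAt ℂ (fun w => Complex.exp (s * w)) w := by fun_prop
  exact (h6.mul h5).mul (((h7.mul h4).mul (differentiableAt_const _)).mul h3)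

/-- The dependence of the rotated integrand on the exponent is entire. -/
theorem differentiable_rayInt_exponent {A B : ℝ} {k N : ℕ} {w : ℂ}
    (hw : 0 ≤ (Complex.exp w).re) (hB : B * Real.sin w.im < 0) :
    Differentiable ℂ fun s => rayInt A B k N s w := by
  have h1 := Complex.slitPlane_ne_zero (one_add_mem_slitPlane hw)
  have h3 : Complex.I * (A + B * Complex.exp w) ≠ 0 := fun h => by
    have h4 := re_I_mul_ray A B w
    rw [h, Complex.zero_re] at h4
    have := mul_pos (Real.exp_pos w.re) (by linarith : 0 < -(B * Real.sin w.im))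
    linarith
  intro s
  unfold rayInt
  refine DifferentiableAt.const_mul (DifferentiableAt.mul (DifferentiableAt.mul
    (DifferentiableAt.mul (by fun_prop) ?_) (by fun_prop)) ?_) _
  · exact DifferentiableAt.const_cpow (by fun_prop) (Or.inl h1)
  · exact DifferentiableAt.const_cpow (by fun_prop) (Or.inl h3)

theorem abs_le_two_of_mem {h y : ℝ} (hh : |h| = Real.pi / 2) (hy : y ∈ uIcc 0 h) : |y| ≤ 2 := by
  have h1 := abs_sub_left_of_mem_uIcc hy
  rw [sub_zero, sub_zero, hh] at h1
  linarith [Real.pi_lt_d2]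

theorem cos_nonneg_of_mem {h y : ℝ} (hh : |h| = Real.pi / 2) (hy : y ∈ uIcc 0 h) :
    0 ≤ Real.cos y := by
  have h1 := abs_sub_left_of_mem_uIcc hy
  rw [sub_zero, sub_zero, hh, abs_le] at h1
  exact Real.cos_nonneg_of_mem_Icc h1

theorem mul_sin_nonpos_of_mem {h y B : ℝ} (hh : |h| = Real.pi / 2) (hB : B * h < 0)
    (hy : y ∈ uIcc 0 h) : B * Real.sin y ≤ 0 := by
  have hpi := Real.pi_pos
  rcases le_total 0 h with h0 | h0
  · rw [uIcc_of_le h0] at hy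
    rw [abs_of_nonneg h0] at hh
    have := Real.sin_nonneg_of_nonneg_of_le_pi hy.1 (by linarith [hy.2])
    have : B < 0 := by nlinarith
    nlinarith
  · rw [uIcc_of_ge h0] at hy
    rw [abs_of_nonpos h0] at hh
    have := Real.sin_nonpos_of_nonpos_of_neg_pi_le hy.2 (by linarith [hy.1])
    have : 0 < B := by nlinarith
    nlinarith

theorem mul_sin_neg_of_mem {h y B : ℝ} (hh : |h| = Real.pi / 2) (hB : B * h < 0)
    (hy : y ∈ uIcc 0 h) (hy0 : y ≠ 0) : B * Real.sin y < 0 := by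
  have hpi := Real.pi_pos
  rcases le_total 0 h with h0 | h0
  · rw [uIcc_of_le h0] at hy
    rw [abs_of_nonneg h0] at hh
    have := Real.sin_pos_of_pos_of_lt_pi (lt_of_le_of_ne hy.1 (Ne.symm hy0)) (by linarith [hy.2])
    have : B < 0 := by nlinarith
    nlinarith
  · rw [uIcc_of_ge h0] at hy
    rw [abs_of_nonpos h0] at hh
    have := Real.sin_neg_of_neg_of_neg_pi_lt (lt_of_le_of_ne hy.2 hy0) (by linarith [hy.1])
    have : 0 < B := by nlinarith
    nlinarith

/-- Rotation of the radial contour by a right angle.  As `B h < 0`, the real part of the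
base `i (A + B e^w)` is positive inside the strip, so that no branch cut is crossed. -/
theorem integral_rayInt_rotate {A B h : ℝ} (hh : |h| = Real.pi / 2) (hB : B * h < 0) {k N : ℕ}
    (hk : 1 ≤ k) (hN : k < N) {s : ℂ} (hs : 0 < s.re) :
    ∫ x : ℝ, rayInt A B k N s x = ∫ x : ℝ, rayInt A B k N s (x + h * Complex.I) := by
  have hre : ∀ w : ℂ, w.im ∈ uIcc 0 h → 0 ≤ (Complex.exp w).re := fun w hw => by
    rw [Complex.exp_re]
    exact mul_nonneg (Real.exp_pos _).le (cos_nonneg_of_mem hh hw)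
  refine integral_eq_integral_add_mul_I (fun w hw => ?_) (fun w hw => ?_) one_pos
    (fun w hw => norm_rayInt_le_exp A B hk hN hs.le (hre w hw) (abs_le_two_of_mem hh hw))
  · exact (continuousAt_rayInt hs (hre w hw) (mul_sin_nonpos_of_mem hh hB hw)).continuousWithinAt
  · refine (differentiableAt_rayInt (hre w (Ioo_subset_Icc_self hw))
      (mul_sin_neg_of_mem hh hB (Ioo_subset_Icc_self hw) fun h0 => ?_)).differentiableWithinAt
    change w.im ∈ Ioo (min 0 h) (max 0 h) at hw
    rw [h0] at hw
    rcases le_total 0 h with h1 | h1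
    · rw [min_eq_left h1] at hw
      exact lt_irrefl _ hw.1
    · rw [max_eq_left h1] at hw
      exact lt_irrefl _ hw.2

end Ray

section RotatedBound

open Filter Topology

theorem integrable_rpow_mul_rpow {p q : ℝ} (hp : -1 < p) (hq : -1 < q) :
    Integrable (fun u : ℝ => u ^ p * (1 - u) ^ q) (volume.restrict (Ioo 0 1)) := by
  have h := Complex.betaIntegral_convergent (u := (p + 1 : ℝ)) (v := (q + 1 : ℝ))
    (by rw [Complex.ofReal_re]; linarith) (by rw [Complex.ofReal_re]; linarith)
  rw [intervalIntegrable_iff_integrableOn_Ioo_of_le zero_le_one] at h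
  refine h.norm.congr ((ae_restrict_iff' measurableSet_Ioo).mpr (Eventually.of_forall fun u hu => ?_))
  have h1 : (0 : ℝ) < 1 - u := by linarith [hu.2]
  simp only [norm_mul]
  rw [Complex.norm_cpow_eq_rpow_re_of_pos hu.1,
    show (1 - (u : ℂ)) = ((1 - u : ℝ) : ℂ) by push_cast; rfl,
    Complex.norm_cpow_eq_rpow_re_of_pos h1]
  simp

theorem norm_one_add_rpow_le {x p q δ n : ℝ} (h1 : 1 ≤ n) (h2 : Real.exp x ≤ n) (hδ : 0 ≤ δ)
    (hp : δ ≤ p) (hq : δ ≤ q) : Real.exp x ^ p * n ^ (-(p + q)) ≤ Real.exp (-δ * |x|) := by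
  have hr := Real.exp_pos x
  rcases le_total 0 x with hx | hx
  · calc Real.exp x ^ p * n ^ (-(p + q)) ≤ Real.exp x ^ p * Real.exp x ^ (-(p + q)) := by
          refine mul_le_mul_of_nonneg_left ?_ (by positivity)
          exact Real.rpow_le_rpow_of_nonpos hr h2 (by linarith)
      _ = Real.exp (x * -q) := by
        rw [← Real.rpow_add hr, Real.exp_mul]
        congr 1
        ring
      _ ≤ _ := by
        refine Real.exp_le_exp.mpr ?_
        rw [abs_of_nonneg hx]
        nlinarith
  · calc Real.exp x ^ p * n ^ (-(p + q)) ≤ Real.exp x ^ p * 1 := by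
          refine mul_le_mul_of_nonneg_left ?_ (by positivity)
          exact Real.rpow_le_one_of_one_le_of_nonpos h1 (by linarith)
      _ = Real.exp (x * p) := by rw [mul_one, Real.exp_mul]
      _ ≤ _ := by
        refine Real.exp_le_exp.mpr ?_
        rw [abs_of_nonpos hx]
        nlinarith

/-- Exponents for which the rotated integral converges at real part `-σ` of the exponent, with a bound
by `|p₁²|^(-(σ - y))`.  The conditions `lt_one` and `lt_two` make the angular integral converge,
`small` and `large` the radial integral at its two ends, with rate `δ`. -/
structure RayExponents (e : Fin 3 → ℕ) (σ y δ : ℝ) : Prop where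
  pos : 0 < δ
  le_one : δ ≤ 1
  nonneg : 0 ≤ y
  le : y ≤ σ
  lt_one : y < e 1 + 1
  lt_two : y < e 2 + 1
  small : δ ≤ e 1 + e 2 + 2 - σ - y
  large : δ ≤ e 0 + 1 - (σ - y)

/-- On the rotated line `e^w` is imaginary, so that `|A + B e^w|` is at least `|A|` and at least
`|B e^w|`: the power `σ` of its inverse is shared out as `σ - y` and `y` between these two bounds. -/
theorem norm_rayInt_rotated_le {A B h σ y δ : ℝ} (hA : A ≠ 0) (hB : B ≠ 0)
    (hh : |h| = Real.pi / 2) {e : Fin 3 → ℕ} (H : RayExponents e σ y δ) {s : ℂ}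
    (hs : -σ ≤ s.re) (hs1 : s.re ≤ 1) (hi : |s.im| ≤ 1) (x : ℝ) :
    ‖rayInt A B (e 1 + e 2 + 2) (e 0 + e 1 + e 2 + 3) s (x + h * Complex.I)‖
      ≤ (|A| ^ (-(σ - y)) * |B| ^ (-y) + (|A| + |B|)) * Real.exp 14 * Real.exp (-δ * |x|) := by
  set w : ℂ := x + h * Complex.I with hw
  have hre : w.re = x := by simp [hw]
  have him : w.im = h := by simp [hw]
  have hcos : Real.cos h = 0 := by
    rw [← Real.cos_abs, hh, Real.cos_pi_div_two]
  have hsin : |Real.sin h| = 1 := by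
    have h1 := Real.sin_sq_add_cos_sq h
    rw [hcos, zero_pow two_ne_zero, add_zero, sq_eq_one_iff] at h1
    rcases h1 with h1 | h1 <;> simp [h1]
  have hz : (Complex.exp w).re = 0 := by rw [Complex.exp_re, him, hcos, mul_zero]
  have hr : ‖Complex.exp w‖ = Real.exp x := by rw [Complex.norm_exp, hre]
  have h1 := one_le_norm_one_add hz.ge
  have h2 := norm_le_norm_one_add hz.ge
  have hE := rayBase_le A B hz.ge
  have hr0 := Real.exp_pos x
  have hA0 := abs_pos.mpr hA
  have hB0 := abs_pos.mpr hB
  have hA1 : |A| ≤ ‖(A : ℂ) + B * Complex.exp w‖ := by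
    refine le_trans (le_of_eq ?_) (Complex.abs_re_le_norm _)
    simp [hz]
  have hB1 : |B| * Real.exp x ≤ ‖(A : ℂ) + B * Complex.exp w‖ := by
    refine le_trans (le_of_eq ?_) (Complex.abs_im_le_norm _)
    simp [Complex.exp_im, hre, him, abs_mul, hsin]
  have hn := norm_rayInt_le A B (e 1 + e 2 + 2) (e 0 + e 1 + e 2 + 3) s hz.ge
    (abs_le_two_of_mem hh (y := w.im) (him ▸ right_mem_uIcc))
  refine hn.trans ?_
  rw [hr] at h2 ⊢
  have hbase : rayBase A B w = Real.exp x * ‖(A : ℂ) + B * Complex.exp w‖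
      / ‖1 + Complex.exp w‖ ^ 2 := by
    unfold rayBase
    rw [hr]
  set n := ‖1 + Complex.exp w‖
  set D := ‖(A : ℂ) + B * Complex.exp w‖
  set E := rayBase A B w
  have hn0 : 0 < n := by linarith
  have hD0 : 0 < D := by linarith
  have hE0 : 0 < E := by rw [hbase]; positivity
  have hpow : Real.exp x ^ (e 1 + e 2 + 2) / n ^ (e 0 + e 1 + e 2 + 3)
      = Real.exp x ^ ((e 1 + e 2 + 2 : ℕ) : ℝ) * n ^ (-((e 0 + e 1 + e 2 + 3 : ℕ) : ℝ)) := by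
    rw [Real.rpow_natCast, Real.rpow_neg hn0.le, Real.rpow_natCast, div_eq_mul_inv]
  have hEs : E ^ s.re ≤ E ^ (-σ) + E := by
    rcases le_total 1 E with h3 | h3
    · calc E ^ s.re ≤ E ^ (1 : ℝ) := Real.rpow_le_rpow_of_exponent_le h3 hs1
        _ = E := Real.rpow_one E
        _ ≤ _ := by linarith [Real.rpow_pos_of_pos hE0 (-σ)]
    · calc E ^ s.re ≤ E ^ (-σ) := Real.rpow_le_rpow_of_exponent_ge hE0 h3 hs
        _ ≤ _ := by linarith
  have hE1 : E ^ (-σ) ≤ |A| ^ (-(σ - y)) * |B| ^ (-y) * Real.exp x ^ (-σ - y) * n ^ (2 * σ) := by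
    have h3 : D ^ (-σ) ≤ |A| ^ (-(σ - y)) * (|B| * Real.exp x) ^ (-y) := by
      calc D ^ (-σ) = D ^ (-(σ - y)) * D ^ (-y) := by
            rw [← Real.rpow_add hD0]
            congr 1
            ring
        _ ≤ _ := mul_le_mul
            (Real.rpow_le_rpow_of_nonpos hA0 hA1 (by linarith [H.le]))
            (Real.rpow_le_rpow_of_nonpos (by positivity) hB1 (by linarith [H.nonneg]))
            (by positivity) (by positivity)
    rw [Real.mul_rpow hB0.le hr0.le] at h3
    have h4 : (n ^ 2) ^ (-σ) = (n ^ (2 * σ))⁻¹ := by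
      rw [← Real.rpow_natCast, ← Real.rpow_mul hn0.le, ← Real.rpow_neg hn0.le]
      congr 1
      push_cast
      ring
    rw [hbase, Real.div_rpow (by positivity) (by positivity), Real.mul_rpow hr0.le hD0.le, h4,
      div_inv_eq_mul]
    refine mul_le_mul_of_nonneg_right ?_ (by positivity)
    calc Real.exp x ^ (-σ) * D ^ (-σ)
        ≤ Real.exp x ^ (-σ) * (|A| ^ (-(σ - y)) * (|B| ^ (-y) * Real.exp x ^ (-y))) := by gcongr
      _ = _ := by
        rw [sub_eq_add_neg (-σ) y, Real.rpow_add hr0]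
        ring
  have hsmall := H.small
  have hlarge := H.large
  have hw1 := norm_one_add_rpow_le (p := e 1 + e 2 + 2 - σ - y) (q := e 0 + 1 - (σ - y)) h1 h2
    H.pos.le hsmall hlarge
  have hw2 := norm_one_add_rpow_le (p := e 1 + e 2 + 2) (q := e 0 + 1) h1 h2 H.pos.le
    (by linarith [H.nonneg, H.le]) (by linarith [H.nonneg, H.le])
  rw [hpow]
  have him' : Real.exp (14 * |s.im|) ≤ Real.exp 14 := Real.exp_le_exp.mpr (by linarith)
  have hP : 0 ≤ Real.exp x ^ ((e 1 + e 2 + 2 : ℕ) : ℝ) * n ^ (-((e 0 + e 1 + e 2 + 3 : ℕ) : ℝ)) := by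
    positivity
  calc _ ≤ Real.exp x ^ ((e 1 + e 2 + 2 : ℕ) : ℝ) * n ^ (-((e 0 + e 1 + e 2 + 3 : ℕ) : ℝ))
        * ((|A| ^ (-(σ - y)) * |B| ^ (-y) * Real.exp x ^ (-σ - y) * n ^ (2 * σ) + E)
          * Real.exp 14) := by
        refine mul_le_mul_of_nonneg_left (mul_le_mul (hEs.trans ?_) him' (by positivity)
          (by positivity)) hP
        linarith
    _ = (|A| ^ (-(σ - y)) * |B| ^ (-y)) * Real.exp 14
          * (Real.exp x ^ ((e 1 + e 2 + 2 : ℝ) - σ - y)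
            * n ^ (-((e 1 + e 2 + 2 : ℝ) - σ - y + (e 0 + 1 - (σ - y)))))
        + E * Real.exp 14 * (Real.exp x ^ (e 1 + e 2 + 2 : ℝ)
            * n ^ (-((e 1 + e 2 + 2 : ℝ) + (e 0 + 1)))) := by
      have h5 : Real.exp x ^ ((e 1 + e 2 + 2 : ℝ) - σ - y)
          = Real.exp x ^ ((e 1 + e 2 + 2 : ℕ) : ℝ) * Real.exp x ^ (-σ - y) := by
        rw [← Real.rpow_add hr0]
        congr 1
        push_cast
        ring
      have h6 : n ^ (-((e 1 + e 2 + 2 : ℝ) - σ - y + (e 0 + 1 - (σ - y))))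
          = n ^ (-((e 0 + e 1 + e 2 + 3 : ℕ) : ℝ)) * n ^ (2 * σ) := by
        rw [← Real.rpow_add hn0]
        congr 1
        push_cast
        ring
      have h7 : n ^ (-((e 1 + e 2 + 2 : ℝ) + (e 0 + 1)))
          = n ^ (-((e 0 + e 1 + e 2 + 3 : ℕ) : ℝ)) := by
        congr 1
        push_cast
        ring
      have h8 : Real.exp x ^ (e 1 + e 2 + 2 : ℝ) = Real.exp x ^ ((e 1 + e 2 + 2 : ℕ) : ℝ) := by
        congr 1
        push_cast
        ring
      rw [h5, h6, h7, h8]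
      ring
    _ ≤ (|A| ^ (-(σ - y)) * |B| ^ (-y)) * Real.exp 14 * Real.exp (-δ * |x|)
        + (|A| + |B|) * Real.exp 14 * Real.exp (-δ * |x|) := by
      refine add_le_add (mul_le_mul_of_nonneg_left hw1 (by positivity)) ?_
      exact mul_le_mul (mul_le_mul_of_nonneg_right hE (Real.exp_pos _).le) hw2 (by positivity)
        (by positivity)
    _ = _ := by ring

end RotatedBound

section RotatedIntegral

open Filter Topology

/-- The identity theorem for meromorphic functions. -/
theorem eventually_eq_of_meromorphicOn {f g : ℂ → ℂ} {U : Set ℂ} (hf : MeromorphicOn f U)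
    (hg : MeromorphicOn g U) (hU : IsPreconnected U) {x y : ℂ} (hx : x ∈ U)
    (hfg : ∀ᶠ z in 𝓝[≠] x, f z = g z) (hy : y ∈ U) : ∀ᶠ z in 𝓝[≠] y, f z = g z := by
  have h1 : meromorphicOrderAt (f - g) y = ⊤ := by
    by_contra h
    exact (hf.sub hg).meromorphicOrderAt_ne_top_of_isPreconnected hU hy hx h
      (meromorphicOrderAt_eq_top_iff.mpr (hfg.mono fun z hz => by simp [hz]))
  exact (meromorphicOrderAt_eq_top_iff.mp h1).mono fun z hz => sub_eq_zero.mp hz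

/-- The measure on the angular parameter `0 < u < 1` and the logarithmic radial parameter. -/
abbrev coneMeasure : Measure (ℝ × ℝ) := (volume.restrict (Ioo 0 1)).prod volume

/-- The integrand of the rotated triangle integral. -/
def coneInt (M Q h : ℝ) (e : Fin 3 → ℕ) (s : ℂ) (z : ℝ × ℝ) : ℂ :=
  (z.1 : ℂ) ^ e 1 * (1 - z.1 : ℂ) ^ e 2
    * rayInt (-M) (-(Q * (z.1 * (1 - z.1)))) (e 1 + e 2 + 2) (e 0 + e 1 + e 2 + 3) s
        (z.2 + h * Complex.I)

/-- A dominating function for `coneInt`, up to a constant. -/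
def coneBound (e : Fin 3 → ℕ) (y δ : ℝ) (z : ℝ × ℝ) : ℝ :=
  z.1 ^ (e 1 - y) * (1 - z.1) ^ (e 2 - y) * Real.exp (-δ * |z.2|)

theorem integrable_coneBound {e : Fin 3 → ℕ} {σ y δ : ℝ} (H : RayExponents e σ y δ) :
    Integrable (coneBound e y δ) coneMeasure :=
  (integrable_rpow_mul_rpow (by linarith [H.lt_one]) (by linarith [H.lt_two])).mul_prod
    (integrable_exp_neg_mul_abs H.pos)

theorem coneBound_nonneg {e : Fin 3 → ℕ} {y δ : ℝ} {z : ℝ × ℝ} (hz : z.1 ∈ Ioo (0 : ℝ) 1) :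
    0 ≤ coneBound e y δ z := by
  have := hz.1
  have h2 : 0 < 1 - z.1 := by linarith [hz.2]
  unfold coneBound
  positivity

theorem ae_coneMeasure : ∀ᵐ z ∂coneMeasure, z.1 ∈ Ioo (0 : ℝ) 1 :=
  Measure.quasiMeasurePreserving_fst.ae (ae_restrict_mem measurableSet_Ioo)

/-- The constant in the bound of the rotated integrand. -/
def coneConst (M Q σ y : ℝ) : ℝ :=
  (|M| ^ (-(σ - y)) * |Q| ^ (-y) + (|M| + |Q|)) * Real.exp 14

variable {M Q h : ℝ}

theorem norm_coneInt_le (hM : M ≠ 0) (hQ : Q ≠ 0) (hh : |h| = Real.pi / 2) {e : Fin 3 → ℕ}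
    {σ y δ : ℝ} (H : RayExponents e σ y δ) {s : ℂ} (hs : -σ ≤ s.re) (hs1 : s.re ≤ 1)
    (hi : |s.im| ≤ 1) {z : ℝ × ℝ} (hz : z.1 ∈ Ioo (0 : ℝ) 1) :
    ‖coneInt M Q h e s z‖ ≤ coneConst M Q σ y * coneBound e y δ z := by
  obtain ⟨u, x⟩ := z
  have hu0 : 0 < u := hz.1
  have hu1 : 0 < 1 - u := by have : u < 1 := hz.2; linarith
  have huu : u * (1 - u) ≤ 1 := by nlinarith
  have hQ0 := abs_pos.mpr hQ
  have hM0 := abs_pos.mpr hM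
  have hB : |-(Q * (u * (1 - u)))| = |Q| * (u * (1 - u)) := by
    rw [abs_neg, abs_mul, abs_of_pos (mul_pos hu0 hu1)]
  have h1 := norm_rayInt_rotated_le (A := -M) (B := -(Q * (u * (1 - u)))) (neg_ne_zero.mpr hM)
    (neg_ne_zero.mpr (mul_ne_zero hQ (mul_pos hu0 hu1).ne')) hh H hs hs1 hi x
  rw [hB, abs_neg] at h1
  have hy := H.nonneg
  have h2 : u ^ e 1 * (1 - u) ^ e 2 * (|Q| * (u * (1 - u))) ^ (-y)
      = |Q| ^ (-y) * (u ^ (e 1 - y) * (1 - u) ^ (e 2 - y)) := by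
    rw [Real.mul_rpow hQ0.le (by positivity), Real.mul_rpow hu0.le hu1.le, sub_eq_add_neg _ y,
      sub_eq_add_neg _ y, Real.rpow_add hu0, Real.rpow_add hu1, Real.rpow_natCast,
      Real.rpow_natCast]
    ring
  have h3 : u ^ e 1 * (1 - u) ^ e 2 ≤ u ^ (e 1 - y) * (1 - u) ^ (e 2 - y) := by
    rw [← Real.rpow_natCast u, ← Real.rpow_natCast (1 - u)]
    refine mul_le_mul ?_ ?_ (by positivity) (by positivity)
    · exact Real.rpow_le_rpow_of_exponent_ge hu0 (by linarith) (by linarith)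
    · exact Real.rpow_le_rpow_of_exponent_ge hu1 (by linarith) (by linarith)
  have hnorm : ‖coneInt M Q h e s (u, x)‖ = u ^ e 1 * (1 - u) ^ e 2
      * ‖rayInt (-M) (-(Q * (u * (1 - u)))) (e 1 + e 2 + 2) (e 0 + e 1 + e 2 + 3) s
        (x + h * Complex.I)‖ := by
    unfold coneInt
    rw [norm_mul, norm_mul, norm_pow, norm_pow,
      show (1 - ((u, x).1 : ℂ)) = ((1 - u : ℝ) : ℂ) by push_cast; rfl, Complex.norm_real,
      Complex.norm_real, Real.norm_of_nonneg hu0.le, Real.norm_of_nonneg hu1.le]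
  rw [hnorm]
  unfold coneConst coneBound
  simp only
  calc u ^ e 1 * (1 - u) ^ e 2 * _
      ≤ u ^ e 1 * (1 - u) ^ e 2 * ((|M| ^ (-(σ - y)) * (|Q| * (u * (1 - u))) ^ (-y)
        + (|M| + |Q| * (u * (1 - u)))) * Real.exp 14 * Real.exp (-δ * |x|)) :=
        mul_le_mul_of_nonneg_left h1 (by positivity)
    _ = (|M| ^ (-(σ - y)) * (u ^ e 1 * (1 - u) ^ e 2 * (|Q| * (u * (1 - u))) ^ (-y))
        + u ^ e 1 * (1 - u) ^ e 2 * (|M| + |Q| * (u * (1 - u)))) * Real.exp 14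
          * Real.exp (-δ * |x|) := by ring
    _ ≤ (|M| ^ (-(σ - y)) * (|Q| ^ (-y) * (u ^ (e 1 - y) * (1 - u) ^ (e 2 - y)))
        + u ^ (e 1 - y) * (1 - u) ^ (e 2 - y) * (|M| + |Q|)) * Real.exp 14
          * Real.exp (-δ * |x|) := by
      rw [h2]
      have h4 : |M| + |Q| * (u * (1 - u)) ≤ |M| + |Q| := by nlinarith
      have h5 := mul_le_mul h3 h4 (by positivity) (by positivity)
      gcongr
    _ = _ := by ring

theorem re_exp_rotated (hh : |h| = Real.pi / 2) (x : ℝ) :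
    0 ≤ (Complex.exp (x + h * Complex.I)).re := by
  rw [Complex.exp_re]
  refine mul_nonneg (Real.exp_pos _).le (cos_nonneg_of_mem hh ?_)
  simp

theorem mul_sin_rotated (hh : |h| = Real.pi / 2) {B : ℝ} (hB : B * h < 0) (x : ℝ) :
    B * Real.sin (x + h * Complex.I : ℂ).im < 0 := by
  have h0 : h ≠ 0 := fun h0 => by simp [h0] at hB
  refine mul_sin_neg_of_mem hh hB ?_ ?_ <;> simp [h0]

theorem neg_mul_rotated (hQ : 0 < Q * h) {u : ℝ} (hu : u ∈ Ioo (0 : ℝ) 1) :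
    -(Q * (u * (1 - u))) * h < 0 := by
  have := mul_pos hu.1 (sub_pos.mpr hu.2)
  nlinarith

theorem measurable_coneInt (e : Fin 3 → ℕ) (s : ℂ) : Measurable (coneInt M Q h e s) := by
  unfold coneInt rayInt
  fun_prop

theorem integrable_coneInt (hM : M ≠ 0) (hQ : 0 < Q * h) (hh : |h| = Real.pi / 2)
    {e : Fin 3 → ℕ} {σ y δ : ℝ} (H : RayExponents e σ y δ) {s : ℂ} (hs : -σ ≤ s.re)
    (hs1 : s.re ≤ 1) (hi : |s.im| ≤ 1) : Integrable (coneInt M Q h e s) coneMeasure :=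
  ((integrable_coneBound H).const_mul _).mono' (measurable_coneInt e s).aestronglyMeasurable
    (ae_coneMeasure.mono fun _ hz =>
      norm_coneInt_le hM (left_ne_zero_of_mul hQ.ne') hh H hs hs1 hi hz)

theorem norm_integral_coneInt_le (hM : M ≠ 0) (hQ : 0 < Q * h) (hh : |h| = Real.pi / 2)
    {e : Fin 3 → ℕ} {σ y δ : ℝ} (H : RayExponents e σ y δ) {s : ℂ} (hs : -σ ≤ s.re)
    (hs1 : s.re ≤ 1) (hi : |s.im| ≤ 1) :
    ‖∫ z, coneInt M Q h e s z ∂coneMeasure‖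
      ≤ coneConst M Q σ y * ∫ z, coneBound e y δ z ∂coneMeasure := by
  rw [← integral_const_mul]
  exact norm_integral_le_of_norm_le ((integrable_coneBound H).const_mul _)
    (ae_coneMeasure.mono fun _ hz =>
      norm_coneInt_le hM (left_ne_zero_of_mul hQ.ne') hh H hs hs1 hi hz)

/-- The domain of exponents in which the rotated integral is holomorphic. -/
def expDomain (σ : ℝ) : Set ℂ := Ioo (-σ) 1 ×ℂ Ioo (-1) 1

theorem isOpen_expDomain (σ : ℝ) : IsOpen (expDomain σ) := isOpen_Ioo.reProdIm isOpen_Ioo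

theorem isPreconnected_expDomain (σ : ℝ) : IsPreconnected (expDomain σ) :=
  (((convex_Ioo (-σ) 1).linear_preimage Complex.reLm).inter
    ((convex_Ioo (-1) 1).linear_preimage Complex.imLm)).isPreconnected

theorem mem_expDomain {σ : ℝ} {s : ℂ} :
    s ∈ expDomain σ ↔ (-σ < s.re ∧ s.re < 1) ∧ |s.im| < 1 := by
  rw [expDomain, Complex.mem_reProdIm, mem_Ioo, mem_Ioo, abs_lt]

theorem differentiableAt_integral_coneInt (hM : M ≠ 0) (hQ : 0 < Q * h) (hh : |h| = Real.pi / 2)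
    {e : Fin 3 → ℕ} {σ y δ : ℝ} (H : RayExponents e σ y δ) {s : ℂ} (hs : s ∈ expDomain σ) :
    DifferentiableAt ℂ (fun s => ∫ z, coneInt M Q h e s z ∂coneMeasure) s := by
  obtain ⟨ρ, hρ, hball⟩ := Metric.isOpen_iff.mp (isOpen_expDomain σ) s hs
  refine differentiableAt_integral_of_dominated hρ
    (fun s _ => (measurable_coneInt e s).aestronglyMeasurable) ?_
    ((integrable_coneBound H).const_mul (coneConst M Q σ y)) ?_
  · refine ae_coneMeasure.mono fun z hz => ?_
    exact ((differentiable_rayInt_exponent (re_exp_rotated hh z.2)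
      (mul_sin_rotated hh (neg_mul_rotated hQ hz) z.2)).const_mul _).differentiableOn
  · refine ae_coneMeasure.mono fun z hz s hs => ?_
    obtain ⟨⟨h1, h2⟩, h3⟩ := mem_expDomain.mp (hball hs)
    exact norm_coneInt_le hM (left_ne_zero_of_mul hQ.ne') hh H h1.le h2.le h3.le hz

/-- Rotating the radial contour does not change the triangle integral. -/
theorem triInt_eq_integral_coneInt (hM : M ≠ 0) (hQ : 0 < Q * h) (hh : |h| = Real.pi / 2)
    {e : Fin 3 → ℕ} {σ y δ : ℝ} (H : RayExponents e σ y δ) {s : ℂ} (hs : 0 < s.re)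
    (hs1 : s.re ≤ 1) (hi : |s.im| ≤ 1) :
    triInt M Q e s = ∫ z, coneInt M Q h e s z ∂coneMeasure := by
  rw [integral_prod _ (integrable_coneInt hM hQ hh H (by linarith [H.nonneg, H.le]) hs1 hi)]
  unfold triInt
  rw [integral_simplex_two_cone (φ := fun x => wt e x * powI0 (triF M Q x) s) ((contDiff_wt e).continuous.mul (continuous_powI0_triF M Q hs)),
    intervalIntegral.integral_of_le zero_le_one, integral_Ioc_eq_integral_Ioo]
  refine setIntegral_congr_fun measurableSet_Ioo fun u hu => ?_
  rw [integral_comp_sigmoid]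
  simp only [rayInt_ofReal]
  unfold coneInt
  simp only
  rw [integral_const_mul, integral_const_mul,
    integral_rayInt_rotate hh (neg_mul_rotated hQ hu) (by omega) (by omega) hs]

/-- Near exponents with real part at least `-σ` the continued triangle integral agrees with a
holomorphic function that is `O(|M|^(-(σ - y)))`, uniformly for `Q` in compact sets not
containing `0`. -/
theorem exists_holomorphic_triMero {e : Fin 3 → ℕ} {σ y δ : ℝ} (H : RayExponents e σ y δ)
    {q₀ : ℝ} (hq₀ : 0 < q₀) (q₁ : ℝ) : ∃ K : ℝ, 0 ≤ K ∧ ∀ M Q : ℝ, M ≠ 0 → |M| ≤ 1 → q₀ ≤ |Q| →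
      |Q| ≤ q₁ → ∃ φ : ℂ → ℂ, DifferentiableOn ℂ φ (expDomain σ) ∧
        (∀ s ∈ expDomain σ, ‖φ s‖ ≤ K * |M| ^ (-(σ - y))) ∧
        ∀ s ∈ expDomain σ, ∀ᶠ z in 𝓝[≠] s, triMero M Q e z = φ z := by
  have hI : 0 ≤ ∫ z, coneBound e y δ z ∂coneMeasure :=
    integral_nonneg_of_ae (ae_coneMeasure.mono fun _ hz => coneBound_nonneg hz)
  have hσ : 0 ≤ σ := H.nonneg.trans H.le
  refine ⟨(q₀ ^ (-y) + (1 + |q₁|)) * Real.exp 14 * ∫ z, coneBound e y δ z ∂coneMeasure,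
    by positivity, fun M Q hM hM1 h0 h1 => ?_⟩
  have hQ0 : Q ≠ 0 := fun h => by rw [h, abs_zero] at h0; linarith
  have hpi := Real.pi_pos
  obtain ⟨h, hh, hQ⟩ : ∃ h : ℝ, |h| = Real.pi / 2 ∧ 0 < Q * h := by
    rcases hQ0.lt_or_gt with h2 | h2
    · exact ⟨-(Real.pi / 2), by rw [abs_neg, abs_of_pos (by positivity)], by nlinarith⟩
    · exact ⟨Real.pi / 2, abs_of_pos (by positivity), by positivity⟩
  have hφ : DifferentiableOn ℂ (fun s => ∫ z, coneInt M Q h e s z ∂coneMeasure) (expDomain σ) :=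
    fun s hs => (differentiableAt_integral_coneInt hM hQ hh H hs).differentiableWithinAt
  refine ⟨fun s => ∫ z, coneInt M Q h e s z ∂coneMeasure, hφ, fun s hs => ?_, fun s hs => ?_⟩
  · obtain ⟨⟨h2, h3⟩, h4⟩ := mem_expDomain.mp hs
    refine (norm_integral_coneInt_le hM hQ hh H h2.le h3.le h4.le).trans ?_
    have hM0 := abs_pos.mpr hM
    have h5 : |Q| ^ (-y) ≤ q₀ ^ (-y) :=
      Real.rpow_le_rpow_of_nonpos hq₀ h0 (by linarith [H.nonneg])
    have h6 : 1 ≤ |M| ^ (-(σ - y)) :=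
      Real.one_le_rpow_of_pos_of_le_one_of_nonpos hM0 hM1 (by linarith [H.le])
    have h7 : |M| + |Q| ≤ |M| ^ (-(σ - y)) * (1 + |q₁|) :=
      calc |M| + |Q| ≤ 1 * (1 + |q₁|) := by linarith [le_abs_self q₁]
        _ ≤ _ := by gcongr
    have h8 : |M| ^ (-(σ - y)) * |Q| ^ (-y) ≤ |M| ^ (-(σ - y)) * q₀ ^ (-y) := by gcongr
    unfold coneConst
    calc _ ≤ (|M| ^ (-(σ - y)) * q₀ ^ (-y) + |M| ^ (-(σ - y)) * (1 + |q₁|)) * Real.exp 14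
          * ∫ z, coneBound e y δ z ∂coneMeasure := by gcongr
      _ = _ := by ring
  · -- both sides agree for positive real parts, hence everywhere by the identity theorem
    have hhalf : ((1 / 2 : ℝ) : ℂ) ∈ expDomain σ := by
      refine mem_expDomain.mpr ⟨⟨?_, ?_⟩, ?_⟩ <;> norm_num
      linarith
    refine eventually_eq_of_meromorphicOn (meromorphic_triMero M Q hM hQ0 e).meromorphicOn
      (fun z hz => (hφ.analyticAt ((isOpen_expDomain σ).mem_nhds hz)).meromorphicAt)
      (isPreconnected_expDomain σ) hhalf ?_ hs
    have h2 : ∀ᶠ z : ℂ in 𝓝 ((1 / 2 : ℝ) : ℂ), z ∈ expDomain 0 := by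
      refine (isOpen_expDomain 0).mem_nhds (mem_expDomain.mpr ⟨⟨?_, ?_⟩, ?_⟩) <;> norm_num
    refine (h2.filter_mono nhdsWithin_le_nhds).mono fun z hz => ?_
    obtain ⟨⟨h3, h4⟩, h5⟩ := mem_expDomain.mp hz
    rw [neg_zero] at h3
    rw [triMero_eq_triInt M Q hM e h3, triInt_eq_integral_coneInt hM hQ hh H h3 h4.le h5.le]

end RotatedIntegral

/-! ### Families of amplitudes that vanish at four dimensions -/

section Vanishing

open Filter Topology Asymptotics

/-- The meromorphic continuation of `S y`, given for `Re n > 12`, has at most a simple pole at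
`n = 4`, and `(n - 4) S y` tends to zero along `l` uniformly in a neighbourhood of `n = 4`. -/
def VanishingAtFour {Y : Type*} (l : Filter Y) (S : Y → ℂ → ℂ) : Prop :=
  ∃ η : Y → ℝ, Tendsto η l (𝓝 0) ∧ ∀ᶠ y in l, ∃ G H : ℂ → ℂ,
    Meromorphic G ∧ (∀ n : ℂ, 12 < n.re → G n = S y n) ∧
    (∀ n : ℂ, 12 < n.re → (∀ j : ℤ, n ≠ 2 * (j : ℂ)) → AnalyticAt ℂ G n) ∧
    DifferentiableOn ℂ H (Metric.ball 4 (1 / 4)) ∧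
    (∀ n ∈ Metric.ball (4 : ℂ) (1 / 4), ‖H n‖ ≤ η y) ∧
    ∀ᶠ n in 𝓝[≠] (4 : ℂ), (n - 4) * G n = H n

variable {Y : Type*} {l : Filter Y}

theorem VanishingAtFour.congr {S S' : Y → ℂ → ℂ} (h : VanishingAtFour l S)
    (hS : ∀ᶠ y in l, ∀ n : ℂ, 12 < n.re → S y n = S' y n) : VanishingAtFour l S' := by
  obtain ⟨η, hη, h⟩ := h
  refine ⟨η, hη, (h.and hS).mono ?_⟩
  rintro y ⟨⟨G, H, h1, h2, h3⟩, h4⟩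
  exact ⟨G, H, h1, fun n hn => (h2 n hn).trans (h4 n hn), h3⟩

theorem VanishingAtFour.add {S S' : Y → ℂ → ℂ} (h : VanishingAtFour l S)
    (h' : VanishingAtFour l S') : VanishingAtFour l fun y n => S y n + S' y n := by
  obtain ⟨η, hη, h⟩ := h
  obtain ⟨η', hη', h'⟩ := h'
  refine ⟨fun y => η y + η' y, by simpa using hη.add hη', (h.and h').mono ?_⟩
  rintro y ⟨⟨G, H, h1, h2, ha, h3, h4, h5⟩, G', H', h1', h2', ha', h3', h4', h5'⟩
  refine ⟨fun n => G n + G' n, fun n => H n + H' n, h1.add h1',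
    fun n hn => congrArg₂ (· + ·) (h2 n hn) (h2' n hn),
    fun n hn hj => (ha n hn hj).add (ha' n hn hj), h3.add h3',
    fun n hn => (norm_add_le _ _).trans (add_le_add (h4 n hn) (h4' n hn)), (h5.and h5').mono ?_⟩
  rintro n ⟨h6, h7⟩
  rw [mul_add, h6, h7]

theorem VanishingAtFour.const_mul {S : Y → ℂ → ℂ} {c : Y → ℂ} (hc : c =O[l] fun _ => (1 : ℝ))
    (h : VanishingAtFour l S) : VanishingAtFour l fun y n => c y * S y n := by
  obtain ⟨η, hη, h⟩ := h
  obtain ⟨K, hK⟩ := hc.bound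
  refine ⟨fun y => |K| * |η y|, by simpa using (hη.abs.const_mul |K|), (h.and hK).mono ?_⟩
  rintro y ⟨⟨G, H, h1, h2, ha, h3, h4, h5⟩, h6⟩
  rw [norm_one, mul_one] at h6
  refine ⟨fun n => c y * G n, fun n => c y * H n,
    Meromorphic.mul (fun z => MeromorphicAt.const (c y) z) h1,
    fun n hn => congrArg (c y * ·) (h2 n hn),
    fun n hn hj => analyticAt_const.mul (ha n hn hj), h3.const_mul _,
    fun n hn => ?_, h5.mono fun n hn => by rw [mul_left_comm, hn]⟩
  rw [norm_mul]
  exact mul_le_mul (h6.trans (le_abs_self K)) ((h4 n hn).trans (le_abs_self _)) (norm_nonneg _)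
    (abs_nonneg K)

theorem meromorphic_loopCoef (A r : ℕ) : Meromorphic (loopCoef A r) := by
  intro z
  have h1 : MeromorphicAt (fun n : ℂ => Complex.Gamma ((A : ℂ) - r - n / 2)) z :=
    (Meromorphic.Gamma _).comp_analyticAt (g := fun n : ℂ => (A : ℂ) - r - n / 2) (by fun_prop)
  have hpi : (4 * (Real.pi : ℂ)) ≠ 0 := by
    have := Real.pi_ne_zero
    exact mul_ne_zero (by norm_num) (by exact_mod_cast this)
  have h2 : MeromorphicAt (fun n : ℂ => (4 * (Real.pi : ℂ)) ^ (n / 2)) z := by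
    refine AnalyticAt.meromorphicAt (Differentiable.analyticAt (fun n => ?_) z)
    exact DifferentiableAt.const_cpow (by fun_prop) (Or.inl hpi)
  have h3 : ∀ c : ℂ, MeromorphicAt (fun _ : ℂ => c) z := fun c => MeromorphicAt.const c z
  unfold loopCoef
  exact (((h3 _).div h2).mul h1).div (h3 _)

/-- Off the even integers the coefficients of the loop integrals are analytic. -/
theorem analyticAt_loopCoef (A r : ℕ) {n : ℂ} (hn : ∀ j : ℤ, n ≠ 2 * (j : ℂ)) :
    AnalyticAt ℂ (loopCoef A r) n := by
  have hpi : (4 * (Real.pi : ℂ)) ≠ 0 := by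
    have := Real.pi_ne_zero
    exact mul_ne_zero (by norm_num) (by exact_mod_cast this)
  have hdom : ∀ᶠ z in 𝓝 n, ∀ j : ℤ, z ≠ 2 * (j : ℂ) := by
    have h1 : IsClosed (Set.range fun j : ℤ => (2 * j : ℂ)) := by
      have h2 : IsClosed ((fun z : ℂ => z / 2) ⁻¹' Set.range ((↑) : ℤ → ℂ)) :=
        Complex.isClosed_range_intCast.preimage (by fun_prop)
      convert h2 using 1
      ext z
      constructor
      · rintro ⟨j, rfl⟩
        exact ⟨j, (mul_div_cancel_left₀ _ two_ne_zero).symm⟩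
      · rintro ⟨j, hj⟩
        exact ⟨j, by
          show (2 * j : ℂ) = z
          rw [hj]
          ring⟩
    have h3 : n ∈ (Set.range fun j : ℤ => (2 * j : ℂ))ᶜ := by
      rintro ⟨j, hj⟩
      exact hn j hj.symm
    filter_upwards [h1.isOpen_compl.mem_nhds h3] with z hz j hj
    exact hz ⟨j, hj.symm⟩
  refine Complex.analyticAt_iff_eventually_differentiableAt.mpr (hdom.mono fun z hz => ?_)
  have h1 : DifferentiableAt ℂ Complex.Gamma ((A : ℂ) - r - z / 2) := by
    refine Complex.differentiableAt_Gamma _ fun m hm => hz (A - r + m) ?_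
    push_cast
    linear_combination (-2 : ℂ) * hm
  have h2 : DifferentiableAt ℂ (fun n : ℂ => Complex.Gamma ((A : ℂ) - r - n / 2)) z :=
    h1.comp z (f := fun n : ℂ => (A : ℂ) - r - n / 2) (by fun_prop)
  have h3 : DifferentiableAt ℂ (fun n : ℂ => (4 * (Real.pi : ℂ)) ^ (n / 2)) z :=
    DifferentiableAt.const_cpow (by fun_prop) (Or.inl hpi)
  exact (((differentiableAt_const _).fun_div h3 (Complex.cpow_ne_zero_iff.mpr (Or.inl hpi))).mul
    h2).div_const _

/-- The coefficients of the loop integrals have at most a simple pole at `n = 4`. -/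
theorem exists_loopCoef_eq {A r : ℕ} (h : r + 2 ≤ A) : ∃ L : ℂ → ℂ,
    DifferentiableOn ℂ L (Metric.ball 4 1) ∧
      ∀ n ∈ Metric.ball (4 : ℂ) 1, n ≠ 4 → (n - 4) * loopCoef A r n = L n := by
  have hpi : (4 * (Real.pi : ℂ)) ≠ 0 := by
    have := Real.pi_ne_zero
    exact mul_ne_zero (by norm_num) (by exact_mod_cast this)
  have hre : ∀ n ∈ Metric.ball (4 : ℂ) 1, -1 / 2 < (2 - n / 2).re := by
    intro n hn
    rw [mem_ball_iff_norm] at hn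
    have h1 := (le_abs_self _).trans_lt ((Complex.abs_re_le_norm (n - 4)).trans_lt hn)
    have h2 : (n / 2).re = n.re / 2 := by
      rw [show (2 : ℂ) = ((2 : ℝ) : ℂ) by norm_num, Complex.div_ofReal_re]
    rw [Complex.sub_re, h2]
    simp at h1 ⊢
    linarith
  have hΓ : ∀ (k : ℕ), 1 ≤ k → DifferentiableOn ℂ (fun n => Complex.Gamma (k + (2 - n / 2)))
      (Metric.ball 4 1) := by
    intro k hk n hn
    have h1 : DifferentiableAt ℂ Complex.Gamma (k + (2 - n / 2)) := by
      refine Complex.differentiableAt_Gamma _ fun m hm => ?_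
      have h2 := congrArg Complex.re hm
      have h3 := hre n hn
      rw [Complex.add_re, Complex.natCast_re, Complex.neg_re, Complex.natCast_re] at h2
      have h4 : (1 : ℝ) ≤ k := by exact_mod_cast hk
      linarith [(Nat.cast_nonneg m : (0 : ℝ) ≤ m)]
    exact (h1.comp n (f := fun n : ℂ => k + (2 - n / 2)) (by fun_prop)).differentiableWithinAt
  have hpref : ∀ Γ : ℂ → ℂ, DifferentiableOn ℂ Γ (Metric.ball 4 1) → DifferentiableOn ℂ
      (fun n => Complex.I * (-1) ^ (A + r) / (4 * (Real.pi : ℂ)) ^ (n / 2) * Γ n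
        / (4 ^ r * (r.factorial : ℂ))) (Metric.ball 4 1) := by
    intro Γ hΓ
    refine DifferentiableOn.div_const (DifferentiableOn.mul (DifferentiableOn.fun_div
      (differentiableOn_const _) (fun n _ => ?_) fun n _ => ?_) hΓ) _
    · exact (DifferentiableAt.const_cpow (by fun_prop) (Or.inl hpi)).differentiableWithinAt
    · exact Complex.cpow_ne_zero_iff.mpr (Or.inl hpi)
  obtain ⟨σ, rfl⟩ := Nat.exists_eq_add_of_le h
  have harg : ∀ n : ℂ, ((r + 2 + σ : ℕ) : ℂ) - r - n / 2 = σ + (2 - n / 2) := fun n => by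
    push_cast
    ring
  rcases Nat.eq_zero_or_pos σ with rfl | hσ
  · refine ⟨_, hpref _ ((hΓ 1 le_rfl).const_mul (-2)), fun n hn hn4 => ?_⟩
    have hz : (2 : ℂ) - n / 2 ≠ 0 := fun h0 => hn4 (by linear_combination (-2 : ℂ) * h0)
    have h2 := Complex.Gamma_add_one _ hz
    unfold loopCoef
    rw [harg, Nat.cast_zero, zero_add, Nat.cast_one, add_comm (1 : ℂ), h2]
    ring
  · refine ⟨_, hpref _ ((differentiableOn_id.sub_const 4).mul (hΓ σ hσ)), fun n hn hn4 => ?_⟩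
    unfold loopCoef
    rw [harg]
    simp only [Pi.mul_apply, id]
    ring

/-- Near `n = 4` the exponent of `F` stays in a domain in which the triangle integrals are under
control, with a margin `1 / 4` in its real part. -/
theorem half_mem_expDomain {A r : ℕ} (h : r + 2 ≤ A) {n : ℂ} (hn : n ∈ Metric.ball (4 : ℂ) (1 / 4)) :
    n / 2 + r - A ∈ expDomain (A - r - 2 + 1 / 4 : ℝ) := by
  rw [mem_ball_iff_norm] at hn
  have h1 := abs_lt.mp ((Complex.abs_re_le_norm (n - 4)).trans_lt hn)
  have h2 := (Complex.abs_im_le_norm (n - 4)).trans_lt hn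
  have h3 : (n / 2).re = n.re / 2 := by
    rw [show (2 : ℂ) = ((2 : ℝ) : ℂ) by norm_num, Complex.div_ofReal_re]
  have h4 : (n / 2).im = n.im / 2 := by
    rw [show (2 : ℂ) = ((2 : ℝ) : ℂ) by norm_num, Complex.div_ofReal_im]
  have hA : (r : ℝ) + 2 ≤ A := by exact_mod_cast h
  simp at h1 h2
  rw [mem_expDomain]
  simp only [Complex.sub_re, Complex.add_re, h3, Complex.natCast_re, Complex.sub_im, Complex.add_im,
    h4, Complex.natCast_im, add_zero, sub_zero, abs_div, abs_two]
  refine ⟨⟨by linarith, by linarith⟩, by linarith⟩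

theorem tendsto_half_punctured (A r : ℕ) :
    Tendsto (fun n : ℂ => n / 2 + r - A) (𝓝[≠] 4) (𝓝[≠] (4 / 2 + r - A)) := by
  refine tendsto_nhdsWithin_iff.mpr ⟨?_, ?_⟩
  · have : Continuous fun n : ℂ => n / 2 + r - A := by fun_prop
    exact (this.tendsto 4).mono_left nhdsWithin_le_nhds
  · filter_upwards [self_mem_nhdsWithin] with n hn h
    rw [mem_singleton_iff] at h
    exact hn (show n = 4 by linear_combination (2 : ℂ) * h)

theorem meromorphic_comp_half {φ : ℂ → ℂ} (hφ : Meromorphic φ) (A r : ℕ) :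
    Meromorphic fun n : ℂ => φ (n / 2 + r - A) := fun z =>
  (hφ _).comp_analyticAt (g := fun n : ℂ => n / 2 + r - A) (by fun_prop)

theorem re_half_pos {A r : ℕ} (hA : A ≤ 6) {n : ℂ} (hn : 12 < n.re) : 0 < (n / 2 + r - A).re := by
  have h3 : (n / 2).re = n.re / 2 := by
    rw [show (2 : ℂ) = ((2 : ℝ) : ℂ) by norm_num, Complex.div_ofReal_re]
  have h4 : (A : ℝ) ≤ 6 := by exact_mod_cast hA
  simp [h3]
  linarith [(Nat.cast_nonneg r : (0 : ℝ) ≤ r)]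

/-- A product of a loop coefficient and a function of the exponent `n / 2 + r - A` that is small
near `n = 4` defines a vanishing family. -/
theorem vanishingAtFour_of_bound {A r : ℕ} (h : r + 2 ≤ A) (hA : A ≤ 6) {μ : Y → ℂ} {J S : Y → ℂ → ℂ}
    {η : Y → ℝ} (hη : Tendsto η l (𝓝 0))
    (hJ : ∀ᶠ y in l, Meromorphic (J y) ∧
      (∀ n : ℂ, 12 < n.re → J y (n / 2 + r - A) = S y n) ∧
      (∀ s : ℂ, 0 < s.re → AnalyticAt ℂ (J y) s) ∧
      ∃ φ : ℂ → ℂ, DifferentiableOn ℂ φ (expDomain (A - r - 2 + 1 / 4 : ℝ)) ∧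
        (∀ s ∈ expDomain (A - r - 2 + 1 / 4 : ℝ), ‖μ y * φ s‖ ≤ η y) ∧
        ∀ s ∈ expDomain (A - r - 2 + 1 / 4 : ℝ), ∀ᶠ z in 𝓝[≠] s, J y z = φ z) :
    VanishingAtFour l fun y n => μ y * (loopCoef A r n * S y n) := by
  obtain ⟨L, hL, hLeq⟩ := exists_loopCoef_eq h
  obtain ⟨K, hK⟩ : ∃ K, ∀ n ∈ Metric.closedBall (4 : ℂ) (1 / 4), ‖L n‖ ≤ K :=
    (isCompact_closedBall (4 : ℂ) (1 / 4)).exists_bound_of_continuousOn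
      (hL.continuousOn.mono (Metric.closedBall_subset_ball (by norm_num)))
  have h4 : (4 : ℂ) ∈ Metric.ball (4 : ℂ) (1 / 4) := Metric.mem_ball_self (by norm_num)
  refine ⟨fun y => |K| * |η y|, by simpa using (hη.abs.const_mul |K|), hJ.mono ?_⟩
  rintro y ⟨h1, h2, ha, φ, h5, h6, h7⟩
  refine ⟨fun n => μ y * (loopCoef A r n * J y (n / 2 + r - A)),
    fun n => L n * (μ y * φ (n / 2 + r - A)), ?_,
    fun n hn => congrArg (fun z => μ y * (loopCoef A r n * z)) (h2 n hn),
    fun n hn hj => ?_, ?_, ?_, ?_⟩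
  · exact Meromorphic.mul (fun z => MeromorphicAt.const (μ y) z)
      ((meromorphic_loopCoef A r).mul (meromorphic_comp_half h1 A r))
  · refine analyticAt_const.mul ((analyticAt_loopCoef A r hj).mul ?_)
    exact (ha _ (re_half_pos hA hn)).comp_of_eq (f := fun n : ℂ => n / 2 + r - A) (by fun_prop) rfl
  · refine (hL.mono (Metric.ball_subset_ball (by norm_num))).mul (DifferentiableOn.const_mul ?_ _)
    exact h5.comp (by fun_prop) fun n hn => half_mem_expDomain h hn
  · intro n hn
    rw [norm_mul]
    exact mul_le_mul ((hK n (Metric.ball_subset_closedBall hn)).trans (le_abs_self K))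
      ((h6 _ (half_mem_expDomain h hn)).trans (le_abs_self _)) (norm_nonneg _) (abs_nonneg _)
  · have h8 := (tendsto_half_punctured A r).eventually (h7 _ (half_mem_expDomain h h4))
    have h9 : ∀ᶠ n in 𝓝[≠] (4 : ℂ), n ∈ Metric.ball (4 : ℂ) 1 :=
      nhdsWithin_le_nhds (Metric.ball_mem_nhds 4 one_pos)
    filter_upwards [h8, h9, self_mem_nhdsWithin] with n hn hn1 hn4
    rw [hn, ← hLeq n hn1 hn4]
    ring

end Vanishing

/-! ### Families of triangle integrals -/

section TriangleFamilies

open Filter Topology Asymptotics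

/-- Exponents of a monomial whose triangle integral, with exponent of `F` near `-σ`, is
`o(|M|^(-j))` as `M → 0`; the margin `1 / 4` accommodates the neighbourhood of `n = 4`. -/
def GoodExponents (σ : ℝ) (j : ℕ) (e : Fin 3 → ℕ) : Prop :=
  ∃ y δ, RayExponents e (σ + 1 / 4) y δ ∧ σ + 1 / 4 - y < j

theorem RayExponents.mono {e e' : Fin 3 → ℕ} {σ y δ : ℝ} (H : RayExponents e σ y δ) (h : e ≤ e') :
    RayExponents e' σ y δ := by
  have h0 : (e 0 : ℝ) ≤ e' 0 := by exact_mod_cast h 0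
  have h1 : (e 1 : ℝ) ≤ e' 1 := by exact_mod_cast h 1
  have h2 : (e 2 : ℝ) ≤ e' 2 := by exact_mod_cast h 2
  exact ⟨H.pos, H.le_one, H.nonneg, H.le, by linarith [H.lt_one], by linarith [H.lt_two],
    by linarith [H.small], by linarith [H.large]⟩

theorem GoodExponents.mono {σ : ℝ} {j : ℕ} {e e' : Fin 3 → ℕ} (H : GoodExponents σ j e)
    (h : e ≤ e') : GoodExponents σ j e' :=
  let ⟨y, δ, H1, H2⟩ := H
  ⟨y, δ, H1.mono h, H2⟩

variable {Y : Type*} {l : Filter Y}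

/-- Linear combinations with bounded coefficients of monomials with good exponents. -/
inductive GoodNumerator (l : Filter Y) (σ : ℝ) (j : ℕ) : (Y → (Fin 2 → ℝ) → ℂ) → Prop
  | monomial {e : Fin 3 → ℕ} (he : GoodExponents σ j e) {c : Y → ℂ}
      (hc : c =O[l] fun _ => (1 : ℝ)) : GoodNumerator l σ j fun y x => c y * wt e x
  | add {N N' : Y → (Fin 2 → ℝ) → ℂ} (h : GoodNumerator l σ j N) (h' : GoodNumerator l σ j N') :
      GoodNumerator l σ j fun y x => N y x + N' y x

theorem wt_mul_bary (e : Fin 3 → ℕ) (i : Fin 3) (x : Fin 2 → ℝ) :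
    (bary x i : ℂ) * wt e x = wt (e + Pi.single i 1) x := by
  unfold wt
  simp only [Pi.add_apply, pow_add, Finset.prod_mul_distrib]
  rw [mul_comm, Finset.prod_eq_single (f := fun j => (bary x j : ℂ) ^ (Pi.single i 1 : Fin 3 → ℕ) j) i
    (fun j _ hj => by simp [Pi.single_eq_of_ne hj]) (by simp)]
  simp

namespace GoodNumerator

variable {σ : ℝ} {j : ℕ} {N N' : Y → (Fin 2 → ℝ) → ℂ}

theorem of_eq (h : GoodNumerator l σ j N) (hN : ∀ y x, N' y x = N y x) :
    GoodNumerator l σ j N' := by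
  have : N' = N := by
    funext y x
    exact hN y x
  rwa [this]

theorem mul_bary (h : GoodNumerator l σ j N) (i : Fin 3) {c : Y → ℂ}
    (hc : c =O[l] fun _ => (1 : ℝ)) :
    GoodNumerator l σ j fun y x => c y * (bary x i : ℂ) * N y x := by
  induction h with
  | monomial he hc' =>
    refine of_eq (monomial (he.mono (e' := _ + Pi.single i 1) le_self_add)
      ((hc.mul hc').trans_eventuallyEq (by simp))) fun y x => ?_
    rw [← wt_mul_bary]
    ring
  | add _ _ ih ih' => exact of_eq (ih.add ih') fun y x => by ring

theorem mul_linear (h : GoodNumerator l σ j N) {c₀ c₁ c₂ : Y → ℂ}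
    (h₀ : c₀ =O[l] fun _ => (1 : ℝ)) (h₁ : c₁ =O[l] fun _ => (1 : ℝ))
    (h₂ : c₂ =O[l] fun _ => (1 : ℝ)) :
    GoodNumerator l σ j fun y x =>
      (c₀ y * (bary x 0 : ℂ) + c₁ y * (bary x 1 : ℂ) + c₂ y * (bary x 2 : ℂ)) * N y x :=
  of_eq (((h.mul_bary 0 h₀).add (h.mul_bary 1 h₁)).add (h.mul_bary 2 h₂)) fun y x => by ring

theorem continuous (h : GoodNumerator l σ j N) (y : Y) : Continuous (N y) := by
  induction h with
  | monomial => exact continuous_const.mul (contDiff_wt _).continuous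
  | add _ _ ih ih' => exact ih.add ih'

end GoodNumerator

/-- The masses of a family of triangles with `p₁² = p₂² = M → 0` and `(p₁ - p₂)² = Q` bounded and
bounded away from zero. -/
structure MassLimit (l : Filter Y) (M Q : Y → ℝ) : Prop where
  ne_zero : ∀ y, M y ≠ 0
  tendsto : Tendsto M l (𝓝 0)
  bounds : ∃ q₀ q₁ : ℝ, 0 < q₀ ∧ ∀ᶠ y in l, q₀ ≤ |Q y| ∧ |Q y| ≤ q₁

variable {M Q : Y → ℝ}

theorem MassLimit.eventually_le_one (h : MassLimit l M Q) : ∀ᶠ y in l, |M y| ≤ 1 := by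
  have h1 := h.tendsto.abs
  rw [abs_zero] at h1
  exact (h1.eventually_lt_const one_pos).mono fun _ h => h.le

theorem MassLimit.tendsto_rpow (h : MassLimit l M Q) {p : ℝ} (hp : 0 < p) :
    Tendsto (fun y => |M y| ^ p) l (𝓝 0) := by
  have h1 := h.tendsto.abs.rpow_const (p := p) (Or.inr hp.le)
  rwa [abs_zero, Real.zero_rpow hp.ne'] at h1

theorem vanishingAtFour_triInt (h : MassLimit l M Q) {A r j : ℕ} (hr : r + 2 ≤ A) (hA : A ≤ 6)
    {e : Fin 3 → ℕ} (he : GoodExponents (A - r - 2) j e) :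
    VanishingAtFour l fun y n =>
      (M y : ℂ) ^ j * (loopCoef A r n * triInt (M y) (Q y) e (n / 2 + r - A)) := by
  obtain ⟨y', δ, H, hj⟩ := he
  obtain ⟨q₀, q₁, hq₀, hq⟩ := h.bounds
  obtain ⟨K, -, hK⟩ := exists_holomorphic_triMero H hq₀ q₁
  have hη := (h.tendsto_rpow (sub_pos.mpr hj)).const_mul K
  rw [mul_zero] at hη
  refine vanishingAtFour_of_bound hr hA (J := fun y => triMero (M y) (Q y) e) hη ?_
  filter_upwards [hq, h.eventually_le_one] with y hqy hM1
  have hM := h.ne_zero y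
  have hQ : Q y ≠ 0 := fun h0 => by rw [h0, abs_zero] at hqy; linarith [hqy.1]
  obtain ⟨φ, h1, h2, h3⟩ := hK (M y) (Q y) hM hM1 hqy.1 hqy.2
  refine ⟨meromorphic_triMero _ _ hM hQ e,
    fun n hn => triMero_eq_triInt _ _ hM e (re_half_pos hA hn),
    analyticAt_triMero _ _ hM e, φ, h1, fun s hs => ?_, h3⟩
  rw [norm_mul, norm_pow, Complex.norm_real, Real.norm_eq_abs]
  calc |M y| ^ j * ‖φ s‖ ≤ |M y| ^ j * (K * |M y| ^ (-((A : ℝ) - r - 2 + 1 / 4 - y'))) := by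
        gcongr
        exact h2 s hs
    _ = K * |M y| ^ ((j : ℝ) - ((A : ℝ) - r - 2 + 1 / 4 - y')) := by
      rw [sub_eq_add_neg (j : ℝ), Real.rpow_add (abs_pos.mpr hM), Real.rpow_natCast]
      ring

theorem GoodNumerator.vanishingAtFour (h : MassLimit l M Q) {A r j : ℕ} (hr : r + 2 ≤ A)
    (hA : A ≤ 6) {N : Y → (Fin 2 → ℝ) → ℂ} (hN : GoodNumerator l (A - r - 2) j N) :
    VanishingAtFour l fun y n => (M y : ℂ) ^ j * (loopCoef A r n
      * ∫ x in feynmanSimplex 2, N y x * powI0 (triF (M y) (Q y) x) (n / 2 + r - A)) := by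
  induction hN with
  | monomial he hc =>
    refine ((vanishingAtFour_triInt h hr hA he).const_mul hc).congr
      (Eventually.of_forall fun y n hn => ?_)
    simp only [mul_assoc]
    rw [integral_const_mul, triInt]
    ring
  | @add N N' hN hN' ih ih' =>
    refine (ih.add ih').congr (Eventually.of_forall fun y n hn => ?_)
    have hint : ∀ {N : Y → (Fin 2 → ℝ) → ℂ}, GoodNumerator l (A - r - 2) j N →
        IntegrableOn (fun x => N y x * powI0 (triF (M y) (Q y) x) (n / 2 + r - A))
          (feynmanSimplex 2) := fun hN =>
      integrableOn_simplex ((hN.continuous y).mul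
        (continuous_powI0_triF _ _ (re_half_pos hA hn)))
    simp only [add_mul]
    rw [integral_add (hint hN) (hint hN')]
    ring

/-- A Feynman integral whose numerator is annihilated by the third power of `□`. -/
theorem feynmanIntegral_eq_three {d m : ℕ} (q : Fin (m + 1) → Fin (d + 1) → ℝ)
    (ν K : Fin (m + 1) → ℕ) (hν : ∀ i, ν i = K i + 1) (hK : ∏ i, (K i).factorial = 1)
    {A : ℕ} (hA : ∑ i, K i + m + 1 = A) {P₀ P₁ P₂ : LoopPoly d} {n : ℂ} (h₁ : box n P₀ = P₁)
    (h₂ : box n P₁ = P₂) (h₃ : box n P₂ = 0) :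
    feynmanIntegral q ν P₀ n = loopCoef A 0 n * paramIntegral q K P₀ (n / 2 + (0 : ℕ) - A)
      + loopCoef A 1 n * paramIntegral q K P₁ (n / 2 + (1 : ℕ) - A)
      + loopCoef A 2 n * paramIntegral q K P₂ (n / 2 + (2 : ℕ) - A) := by
  have hK' : ∏ i, ((K i).factorial : ℂ) = 1 := by exact_mod_cast hK
  rw [feynmanIntegral_eq_sum q ν K hν P₀ n (R := P₀.totalDegree + 3) (by omega),
    ← Finset.sum_subset (s₁ := Finset.range 3) (Finset.range_subset_range.mpr (by omega))]
  · simp only [Finset.sum_range_succ, Finset.sum_range_zero, zero_add, hK', div_one, hA,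
      Function.iterate_succ_apply', Function.iterate_zero, id, h₁, h₂]
  · intro r _ hr
    obtain ⟨k, rfl⟩ : ∃ k, r = k + 3 := ⟨r - 3, by simp at hr; omega⟩
    rw [Function.iterate_add_apply]
    simp only [Function.iterate_succ_apply, h₁, h₂, h₃,
      iterate_box_zero, paramIntegral_zero, mul_zero]

theorem symF_triangle {d : ℕ} {p₁ p₂ : Fin (d + 1) → ℝ} {m2 : ℝ} (h₁ : mdot p₁ p₁ = m2)
    (h₂ : mdot p₂ p₂ = m2) (x : Fin 2 → ℝ) :
    symF ![0, p₁, p₂] x = triF m2 (mdot (p₁ - p₂) (p₁ - p₂)) x := by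
  have hneg : ∀ p : Fin (d + 1) → ℝ, mdot (-p) (-p) = mdot p p := fun p => by
    simp [mdot]
  unfold symF secondSymanzik triF
  simp [Fin.sum_univ_succ, hneg, h₁, h₂]
  ring

/-- The terms of a triangle integral vanish if all contractions of its numerator are good. -/
theorem vanishingAtFour_paramIntegral {d : ℕ} {p₁ p₂ : Y → Fin (d + 1) → ℝ}
    (h : MassLimit l M fun y => mdot (p₁ y - p₂ y) (p₁ y - p₂ y))
    (h₁ : ∀ y, mdot (p₁ y) (p₁ y) = M y) (h₂ : ∀ y, mdot (p₂ y) (p₂ y) = M y)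
    (K : Fin 3 → ℕ) {A r j : ℕ} (hr : r + 2 ≤ A) (hA : A ≤ 6) {P : Y → LoopPoly d}
    (hN : GoodNumerator l (A - r - 2) j fun y x =>
      wt K x * evalShift ![0, p₁ y, p₂ y] (P y) x) :
    VanishingAtFour l fun y n => (M y : ℂ) ^ j
      * (loopCoef A r n * paramIntegral ![0, p₁ y, p₂ y] K (P y) (n / 2 + r - A)) := by
  refine (hN.vanishingAtFour h hr hA).congr (Eventually.of_forall fun y n _ => ?_)
  unfold paramIntegral
  simp only [symF_triangle (h₁ y) (h₂ y), mul_assoc]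

end TriangleFamilies

/-! ### Contractions of linear forms in the loop momentum -/

section Contractions

variable {d : ℕ} {n : ℂ}

theorem gradForm_mul_left (P Q R : LoopPoly d) :
    gradForm (P * Q) R = P * gradForm Q R + Q * gradForm P R := by
  have h : ∀ i, pderiv i (P * Q) = pderiv i P * Q + P * pderiv i Q := fun i => pderiv_mul
  unfold gradForm
  simp only [h]
  have e1 : ∑ μ, X (some μ) * ((pderiv (some μ) P * Q + P * pderiv (some μ) Q) * pderiv none R
        + (pderiv none P * Q + P * pderiv none Q) * pderiv (some μ) R)
      = Q * ∑ μ, X (some μ) * (pderiv (some μ) P * pderiv none R + pderiv none P * pderiv (some μ) R)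
        + P * ∑ μ, X (some μ) * (pderiv (some μ) Q * pderiv none R
          + pderiv none Q * pderiv (some μ) R) := by
    rw [Finset.mul_sum, Finset.mul_sum, ← Finset.sum_add_distrib]
    refine Finset.sum_congr rfl fun μ _ => ?_
    ring
  have e2 : ∑ μ, C (eta μ : ℂ) * ((pderiv (some μ) P * Q + P * pderiv (some μ) Q)
        * pderiv (some μ) R)
      = Q * ∑ μ, C (eta μ : ℂ) * (pderiv (some μ) P * pderiv (some μ) R)
        + P * ∑ μ, C (eta μ : ℂ) * (pderiv (some μ) Q * pderiv (some μ) R) := by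
    rw [Finset.mul_sum, Finset.mul_sum, ← Finset.sum_add_distrib]
    refine Finset.sum_congr rfl fun μ _ => ?_
    ring
  rw [e1, e2]
  ring

theorem gradForm_comm (P Q : LoopPoly d) : gradForm P Q = gradForm Q P := by
  unfold gradForm
  have e1 : ∀ μ, X (some μ) * (pderiv (some μ) P * pderiv none Q
      + pderiv none P * pderiv (some μ) Q) = (X (some μ) * (pderiv (some μ) Q * pderiv none P
        + pderiv none Q * pderiv (some μ) P) : LoopPoly d) := fun μ => by ring
  have e2 : ∀ μ, C (eta μ : ℂ) * (pderiv (some μ) P * pderiv (some μ) Q)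
      = (C (eta μ : ℂ) * (pderiv (some μ) Q * pderiv (some μ) P) : LoopPoly d) := fun μ => by ring
  simp only [e1, e2]
  rw [mul_comm (pderiv none P) (pderiv none Q)]

theorem gradForm_mul_right (P Q R : LoopPoly d) :
    gradForm P (Q * R) = Q * gradForm P R + R * gradForm P Q := by
  rw [gradForm_comm, gradForm_mul_left, gradForm_comm R, gradForm_comm Q]

theorem box_C (n c : ℂ) : box n (C c : LoopPoly d) = 0 := by
  simp only [box, pderiv_C, map_zero, mul_zero, Finset.sum_const_zero, add_zero]

/-- Polynomials that are linear in the loop momentum: `box` annihilates them, and `gradForm` of two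
of them is the constant `g`. -/
structure Contracts (P Q : LoopPoly d) (g : ℂ) : Prop where
  box_left : ∀ n, box n P = 0
  box_right : ∀ n, box n Q = 0
  grad : gradForm P Q = C g

theorem contracts_affine {u v : Fin (d + 1) → ℂ} {g : ℂ} (h : dot (ext u) (ext v) = C g)
    (a b : ℂ) : Contracts (dot loopMom (ext u) + C a : LoopPoly d) (dot loopMom (ext v) + C b) g := by
  have hb : ∀ (u : Fin (d + 1) → ℂ) (a n : ℂ), box n (dot loopMom (ext u) + C a) = 0 := by
    intro u a n
    rw [box_add, box_dot_ext, box_C, add_zero]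
  refine ⟨hb u a, hb v b, ?_⟩
  have h0 : ∀ (u : Fin (d + 1) → ℂ) (a : ℂ),
      pderiv none (dot loopMom (ext u) + C a : LoopPoly d) = 0 := fun u a => by
    rw [map_add, pderiv_none_dot_ext, pderiv_C, add_zero]
  have h1 : ∀ (u : Fin (d + 1) → ℂ) (a : ℂ) (μ : Fin (d + 1)),
      pderiv (some μ) (dot loopMom (ext u) + C a : LoopPoly d) = C (eta μ : ℂ) * C (u μ) :=
    fun u a μ => by rw [map_add, pderiv_some_dot_ext, pderiv_C, add_zero]
  have hη : ∀ μ : Fin (d + 1), (eta μ : ℂ) * eta μ = 1 := fun μ => by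
    unfold eta
    split_ifs <;> simp
  rw [← h, dot_ext_ext]
  unfold gradForm
  simp only [h0, h1, mul_zero, zero_mul, add_zero, zero_add, Finset.sum_const_zero, map_sum,
    map_mul]
  refine Finset.sum_congr rfl fun μ _ => ?_
  have h2 : (C (eta μ : ℂ) * C (eta μ : ℂ) : LoopPoly d) = 1 := by rw [← map_mul, hη, map_one]
  linear_combination (C (eta μ : ℂ) * C (u μ) * C (v μ)) * h2

theorem Contracts.box_mul {P Q : LoopPoly d} {g : ℂ} (h : Contracts P Q g) (n : ℂ) :
    box n (P * Q) = C (2 * g) := by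
  rw [GVOperator.box_mul, h.box_left, h.box_right, h.grad, map_mul, map_ofNat]
  ring

variable {d₁ d₂ u₁ u₂ : LoopPoly d} {t₁ t₂ s : ℂ}

/-- The first contraction of the product of four linear forms. -/
theorem box_four (h₀ : Contracts d₁ d₂ 0) (h₁ : Contracts d₁ u₁ t₁) (h₂ : Contracts d₁ u₂ t₂)
    (h₃ : Contracts d₂ u₁ t₁) (h₄ : Contracts d₂ u₂ t₂) (h₅ : Contracts u₁ u₂ s) (n : ℂ) :
    box n (d₁ * d₂ * (u₁ * u₂)) = C (2 * s) * (d₁ * d₂) + C (2 * t₂) * (d₁ * u₁)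
      + C (2 * t₁) * (d₁ * u₂) + C (2 * t₂) * (d₂ * u₁) + C (2 * t₁) * (d₂ * u₂) := by
  rw [box_mul, h₀.box_mul, h₅.box_mul, gradForm_mul_left, gradForm_mul_right, gradForm_mul_right,
    h₁.grad, h₂.grad, h₃.grad, h₄.grad]
  simp only [map_mul, map_ofNat, map_zero]
  ring

/-- The second contraction of the product of four linear forms. -/
theorem box_box_four (h₀ : Contracts d₁ d₂ 0) (h₁ : Contracts d₁ u₁ t₁) (h₂ : Contracts d₁ u₂ t₂)
    (h₃ : Contracts d₂ u₁ t₁) (h₄ : Contracts d₂ u₂ t₂) (n : ℂ) :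
    box n (C (2 * s) * (d₁ * d₂) + C (2 * t₂) * (d₁ * u₁)
      + C (2 * t₁) * (d₁ * u₂) + C (2 * t₂) * (d₂ * u₁) + C (2 * t₁) * (d₂ * u₂))
      = C (16 * t₁ * t₂) := by
  rw [box_add, box_add, box_add, box_add, box_C_mul, box_C_mul, box_C_mul, box_C_mul, box_C_mul,
    h₀.box_mul, h₁.box_mul, h₂.box_mul, h₃.box_mul, h₄.box_mul]
  simp only [map_mul, map_ofNat, map_zero]
  ring

end Contractions

/-! ### Families of bubble integrals -/

section EdgeFamilies

open Filter Topology Asymptotics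

variable {Y : Type*} {l : Filter Y}

theorem differentiableOn_edgeMero {c : ℝ} (hc : c ≠ 0) {p q : ℕ} {σ : ℝ} (hp : σ < p + 1)
    (hq : σ < q + 1) : DifferentiableOn ℂ (edgeMero c p q) {s | -σ ≤ s.re} := by
  have hΓ : ∀ k : ℕ, σ < k + 1 → ∀ s : ℂ, -σ ≤ s.re →
      DifferentiableAt ℂ (fun s => Complex.Gamma (k + s + 1)) s := by
    intro k hk s hs
    have h1 : DifferentiableAt ℂ Complex.Gamma (k + s + 1) := by
      refine Complex.differentiableAt_Gamma _ fun m hm => ?_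
      have h2 := congrArg Complex.re hm
      simp at h2
      linarith [(Nat.cast_nonneg m : (0 : ℝ) ≤ m)]
    exact h1.comp s (f := fun s : ℂ => k + s + 1) (by fun_prop)
  intro s hs
  refine DifferentiableAt.differentiableWithinAt ?_
  have h3 : DifferentiableAt ℂ (fun s : ℂ => (Complex.Gamma (q + s + 1 + (p + s + 1)))⁻¹) s :=
    (Complex.differentiable_one_div_Gamma _).comp s
      (f := fun s : ℂ => q + s + 1 + (p + s + 1)) (by fun_prop)
  have h4 : edgeMero c p q = fun s => powI0 c s * (Complex.Gamma (q + s + 1)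
      * Complex.Gamma (p + s + 1) * (Complex.Gamma (q + s + 1 + (p + s + 1)))⁻¹) := by
    funext s
    rw [edgeMero, div_eq_mul_inv]
  rw [h4]
  exact (differentiableAt_powI0 c (Or.inl hc)).mul (((hΓ q hq s hs).mul (hΓ p hp s hs)).mul h3)

theorem analyticAt_edgeMero {c : ℝ} (hc : c ≠ 0) (p q : ℕ) (s : ℂ) (hs : 0 < s.re) :
    AnalyticAt ℂ (edgeMero c p q) s := by
  have h : DifferentiableOn ℂ (edgeMero c p q) {s | -(0 : ℝ) ≤ s.re} :=
    differentiableOn_edgeMero hc (by positivity) (by positivity)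
  refine (h.mono fun z (hz : 0 < z.re) => ?_).analyticAt
    ((isOpen_lt continuous_const Complex.continuous_re).mem_nhds hs)
  rw [neg_zero]
  exact hz.le

/-- The Beta functions from the edges are bounded by a power of the mass. -/
theorem exists_norm_edgeMero_le {p q : ℕ} {σ : ℝ} (hp : σ < p + 1) (hq : σ < q + 1) :
    ∃ K : ℝ, 0 ≤ K ∧ ∀ c : ℝ, ∀ s ∈ expDomain σ, ‖edgeMero c p q s‖ ≤ K * |c| ^ s.re := by
  have hcpt : IsCompact (Icc (-σ) 1 ×ℂ Icc (-1) 1) := isCompact_Icc.reProdIm isCompact_Icc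
  have hone : ∀ s, edgeMero 1 p q s = Complex.Gamma (q + s + 1) * Complex.Gamma (p + s + 1)
      / Complex.Gamma (q + s + 1 + (p + s + 1)) := fun s => by
    simp [edgeMero, powI0]
  obtain ⟨K, hK⟩ := hcpt.exists_bound_of_continuousOn
    ((differentiableOn_edgeMero one_ne_zero hp hq).continuousOn.mono fun s hs => hs.1.1)
  refine ⟨|K| * Real.exp (2 * Real.pi), by positivity, fun c s hs => ?_⟩
  have h1 := hK s ⟨Ioo_subset_Icc_self hs.1, Ioo_subset_Icc_self hs.2⟩
  rw [hone] at h1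
  have h2 := (mem_expDomain.mp hs).2
  have h3 : ‖powI0 c s‖ ≤ |c| ^ s.re * Real.exp (2 * Real.pi) := by
    refine (norm_powI0_le c s).trans ?_
    refine mul_le_mul_of_nonneg_left (Real.exp_le_exp.mpr ?_) (by positivity)
    nlinarith [Real.pi_pos]
  unfold edgeMero
  rw [norm_mul]
  calc _ ≤ |c| ^ s.re * Real.exp (2 * Real.pi) * |K| :=
        mul_le_mul h3 (h1.trans (le_abs_self K)) (norm_nonneg _) (by positivity)
    _ = _ := by ring

theorem vanishingAtFour_edgeMero {A r j : ℕ} (hr : r + 2 ≤ A) (hA : A ≤ 6) {p q : ℕ} (hp : A ≤ p + r + 2)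
    (hq : A ≤ q + r + 2) {M c : Y → ℝ} {η : Y → ℝ} (hη : Tendsto η l (𝓝 0))
    (hc : ∀ᶠ y in l, c y ≠ 0 ∧ ∀ s ∈ expDomain (A - r - 2 + 1 / 4 : ℝ),
      |M y| ^ j * |c y| ^ s.re ≤ η y) :
    VanishingAtFour l fun y n =>
      (M y : ℂ) ^ j * (loopCoef A r n * edgeMero (c y) p q (n / 2 + r - A)) := by
  have hp' : (A : ℝ) ≤ p + r + 2 := by exact_mod_cast hp
  have hq' : (A : ℝ) ≤ q + r + 2 := by exact_mod_cast hq
  obtain ⟨K, hK0, hK⟩ := exists_norm_edgeMero_le (p := p) (q := q)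
    (σ := (A - r - 2 + 1 / 4 : ℝ)) (by linarith) (by linarith)
  have hη' := hη.const_mul K
  rw [mul_zero] at hη'
  refine vanishingAtFour_of_bound hr hA (J := fun y => edgeMero (c y) p q) hη' (hc.mono ?_)
  rintro y ⟨hcy, hb⟩
  refine ⟨meromorphic_edgeMero hcy p q, fun _ _ => rfl, analyticAt_edgeMero hcy p q, edgeMero (c y) p q,
    (differentiableOn_edgeMero hcy (σ := (A - r - 2 + 1 / 4 : ℝ)) (by linarith)
      (by linarith)).mono fun s hs => hs.1.1.le, fun s hs => ?_,
    fun s _ => Eventually.of_forall fun _ => rfl⟩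
  rw [norm_mul, norm_pow, Complex.norm_real, Real.norm_eq_abs]
  calc |M y| ^ j * ‖edgeMero (c y) p q s‖ ≤ |M y| ^ j * (K * |c y| ^ s.re) := by
        gcongr
        exact hK _ s hs
    _ = K * (|M y| ^ j * |c y| ^ s.re) := by ring
    _ ≤ _ := mul_le_mul_of_nonneg_left (hb s hs) hK0

end EdgeFamilies

/-! ### The terms that multiply the virtuality -/

section Kinematics

open Filter Topology Asymptotics

variable {Y : Type*} {l : Filter Y}

/-- Linear forms in the barycentric coordinates with bounded coefficients. -/
def BddLinear (l : Filter Y) (L : Y → (Fin 2 → ℝ) → ℂ) : Prop :=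
  ∃ c : Fin 3 → Y → ℂ, (∀ i, c i =O[l] fun _ => (1 : ℝ)) ∧
    ∀ y x, L y x = c 0 y * (bary x 0 : ℂ) + c 1 y * (bary x 1 : ℂ) + c 2 y * (bary x 2 : ℂ)

theorem BddLinear.const {c : Y → ℂ} (hc : c =O[l] fun _ => (1 : ℝ)) :
    BddLinear l fun y _ => c y := by
  refine ⟨fun _ => c, fun _ => hc, fun y x => ?_⟩
  have h : bary x 0 + bary x 1 + bary x 2 = 1 :=
    (Fin.sum_univ_three (bary x)).symm.trans (sum_bary x)
  have h' : (bary x 0 : ℂ) + bary x 1 + bary x 2 = 1 := by exact_mod_cast h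
  rw [← mul_add, ← mul_add, h', mul_one]

theorem GoodNumerator.mul {σ : ℝ} {j : ℕ} {N L : Y → (Fin 2 → ℝ) → ℂ}
    (h : GoodNumerator l σ j N) (hL : BddLinear l L) :
    GoodNumerator l σ j fun y x => L y x * N y x := by
  obtain ⟨c, hc, hL⟩ := hL
  exact (h.mul_linear (hc 0) (hc 1) (hc 2)).of_eq fun y x => by rw [hL]

theorem isBigO_one_mul {c c' : Y → ℂ} (h : c =O[l] fun _ => (1 : ℝ))
    (h' : c' =O[l] fun _ => (1 : ℝ)) : (fun y => c y * c' y) =O[l] fun _ => (1 : ℝ) :=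
  (h.mul h').trans_eventuallyEq (by simp)

theorem isBigO_one_const (c : ℂ) : (fun _ : Y => c) =O[l] fun _ => (1 : ℝ) :=
  isBigO_const_const c one_ne_zero l

theorem wt_three (a b c : ℕ) (x : Fin 2 → ℝ) :
    wt ![a, b, c] x = (bary x 0 : ℂ) ^ a * (bary x 1 : ℂ) ^ b * (bary x 2 : ℂ) ^ c := by
  unfold wt
  rw [Fin.prod_univ_three]
  rfl

theorem GoodExponents.good {σ : ℝ} {j : ℕ} {e : Fin 3 → ℕ} (h : GoodExponents σ j e) :
    GoodNumerator l σ j fun (_ : Y) x => wt e x :=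
  (GoodNumerator.monomial h (isBigO_one_const (1 : ℂ))).of_eq fun _ _ => (one_mul _).symm

variable {d : ℕ}

/-- Kinematics of the limit `p₁² = p₂² = m2 → 0`, with the scalar products in the amplitude
bounded.  Here `t₁ = Δ · ε₁`, `t₂ = Δ · ε₂` and `s = ε₁ · ε₂`. -/
structure KinematicLimit (l : Filter Y) (Δ : Fin (d + 1) → ℝ) (m2 : Y → ℝ)
    (p₁ p₂ : Y → Fin (d + 1) → ℝ) (ε₁ ε₂ : Y → Fin (d + 1) → ℂ) (t₁ t₂ s : Y → ℂ) : Prop where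
  null : mdot Δ Δ = 0
  mass : MassLimit l m2 fun y => mdot (p₁ y - p₂ y) (p₁ y - p₂ y)
  sq₁ : ∀ y, mdot (p₁ y) (p₁ y) = m2 y
  sq₂ : ∀ y, mdot (p₂ y) (p₂ y) = m2 y
  trans₁ : ∀ y, cdot (ε₁ y) (p₁ y) = 0
  trans₂ : ∀ y, cdot (ε₂ y) (p₂ y) = 0
  dot₁ : ∀ y, dot (extR Δ) (ext (ε₁ y)) = C (t₁ y)
  dot₂ : ∀ y, dot (extR Δ) (ext (ε₂ y)) = C (t₂ y)
  dot₁₂ : ∀ y, dot (ext (ε₁ y)) (ext (ε₂ y)) = C (s y)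
  bdd_proj₁ : (fun y => (mdot (p₁ y) Δ : ℂ)) =O[l] fun _ => (1 : ℝ)
  bdd_proj₂ : (fun y => (mdot (p₂ y) Δ : ℂ)) =O[l] fun _ => (1 : ℝ)
  bdd_pol₁ : (fun y => cdot (ε₁ y) (p₂ y)) =O[l] fun _ => (1 : ℝ)
  bdd_pol₂ : (fun y => cdot (ε₂ y) (p₁ y)) =O[l] fun _ => (1 : ℝ)
  bdd_dot₁ : t₁ =O[l] fun _ => (1 : ℝ)
  bdd_dot₂ : t₂ =O[l] fun _ => (1 : ℝ)
  bdd_dot₁₂ : s =O[l] fun _ => (1 : ℝ)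

section Shift

variable (Δ p₁ p₂ : Fin (d + 1) → ℝ) (ε₁ ε₂ : Fin (d + 1) → ℂ)

theorem evalShift_proj {m : ℕ} (q : Fin (m + 1) → Fin (d + 1) → ℝ) (p : Fin (d + 1) → ℝ)
    (x : Fin m → ℝ) : evalShift q (dot (extR Δ) (loopMom + extR p)) x
      = (mdot p Δ : ℂ) - ∑ j, (bary x j : ℂ) * (mdot (q j) Δ : ℂ) := by
  have h : ∀ v : Fin (d + 1) → ℝ, cdot (fun μ => (Δ μ : ℂ)) v = (mdot v Δ : ℂ) := fun v => by
    rw [mdot_comm]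
    simp [cdot, mdot]
  rw [dot_extR_loopMom_add, evalShift_add, evalShift_C, extR, evalShift_dot_ext]
  simp only [h]
  ring

theorem sum_bary_complex (x : Fin 2 → ℝ) :
    (bary x 0 : ℂ) + (bary x 1 : ℂ) + (bary x 2 : ℂ) = 1 := by
  have h : bary x 0 + bary x 1 + bary x 2 = 1 :=
    (Fin.sum_univ_three (bary x)).symm.trans (sum_bary x)
  exact_mod_cast h

theorem mdot_zero_left (v : Fin (d + 1) → ℝ) : mdot 0 v = 0 := by simp [mdot]

theorem cdot_zero_right (u : Fin (d + 1) → ℂ) : cdot u 0 = 0 := by simp [cdot]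

theorem evalShift_proj₁ (x : Fin 2 → ℝ) :
    evalShift ![0, p₁, p₂] (dot (extR Δ) (loopMom + extR p₁)) x
      = (mdot p₁ Δ : ℂ) * (bary x 0 : ℂ) + ((mdot p₁ Δ : ℂ) - mdot p₂ Δ) * (bary x 2 : ℂ) := by
  rw [evalShift_proj, Fin.sum_univ_three]
  change (mdot p₁ Δ : ℂ) - ((bary x 0 : ℂ) * (mdot 0 Δ : ℂ) + (bary x 1 : ℂ) * (mdot p₁ Δ : ℂ)
    + (bary x 2 : ℂ) * (mdot p₂ Δ : ℂ)) = _
  rw [mdot_zero_left, Complex.ofReal_zero]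
  linear_combination (-(mdot p₁ Δ : ℂ)) * sum_bary_complex x

theorem evalShift_proj₂ (x : Fin 2 → ℝ) :
    evalShift ![0, p₁, p₂] (dot (extR Δ) (loopMom + extR p₂)) x
      = (mdot p₂ Δ : ℂ) * (bary x 0 : ℂ) - ((mdot p₁ Δ : ℂ) - mdot p₂ Δ) * (bary x 1 : ℂ) := by
  rw [evalShift_proj, Fin.sum_univ_three]
  change (mdot p₂ Δ : ℂ) - ((bary x 0 : ℂ) * (mdot 0 Δ : ℂ) + (bary x 1 : ℂ) * (mdot p₁ Δ : ℂ)
    + (bary x 2 : ℂ) * (mdot p₂ Δ : ℂ)) = _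
  rw [mdot_zero_left, Complex.ofReal_zero]
  linear_combination (-(mdot p₂ Δ : ℂ)) * sum_bary_complex x

theorem evalShift_pol₁ (h : cdot ε₁ p₁ = 0) (x : Fin 2 → ℝ) :
    evalShift ![0, p₁, p₂] (dot loopMom (ext ε₁)) x = -cdot ε₁ p₂ * (bary x 2 : ℂ) := by
  rw [evalShift_dot_ext, Fin.sum_univ_three]
  change -((bary x 0 : ℂ) * cdot ε₁ 0 + (bary x 1 : ℂ) * cdot ε₁ p₁
    + (bary x 2 : ℂ) * cdot ε₁ p₂) = _
  rw [cdot_zero_right, h]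
  ring

theorem evalShift_pol₂ (h : cdot ε₂ p₂ = 0) (x : Fin 2 → ℝ) :
    evalShift ![0, p₁, p₂] (dot loopMom (ext ε₂)) x = -cdot ε₂ p₁ * (bary x 1 : ℂ) := by
  rw [evalShift_dot_ext, Fin.sum_univ_three]
  change -((bary x 0 : ℂ) * cdot ε₂ 0 + (bary x 1 : ℂ) * cdot ε₂ p₁
    + (bary x 2 : ℂ) * cdot ε₂ p₂) = _
  rw [cdot_zero_right, h]
  ring

end Shift

namespace KinematicLimit

variable {Δ : Fin (d + 1) → ℝ} {m2 : Y → ℝ} {p₁ p₂ : Y → Fin (d + 1) → ℝ}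
  {ε₁ ε₂ : Y → Fin (d + 1) → ℂ} {t₁ t₂ s : Y → ℂ}

theorem symm (h : KinematicLimit l Δ m2 p₁ p₂ ε₁ ε₂ t₁ t₂ s) :
    KinematicLimit l Δ m2 p₂ p₁ ε₂ ε₁ t₂ t₁ s := by
  have hQ : ∀ y, mdot (p₂ y - p₁ y) (p₂ y - p₁ y) = mdot (p₁ y - p₂ y) (p₁ y - p₂ y) := fun y => by
    unfold mdot
    refine Finset.sum_congr rfl fun μ _ => ?_
    simp only [Pi.sub_apply]
    ring
  refine ⟨h.null, ?_, h.sq₂, h.sq₁, h.trans₂, h.trans₁, h.dot₂, h.dot₁,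
    fun y => by rw [dot_comm, h.dot₁₂], h.bdd_proj₂, h.bdd_proj₁, h.bdd_pol₂, h.bdd_pol₁,
    h.bdd_dot₂, h.bdd_dot₁, h.bdd_dot₁₂⟩
  simp only [hQ]
  exact h.mass

theorem contracts_pol (p : Fin (d + 1) → ℝ) {ε : Fin (d + 1) → ℂ} {t : ℂ}
    (ht : dot (extR Δ) (ext ε) = C t) :
    Contracts (dot (extR Δ) (loopMom + extR p) : LoopPoly d) (dot loopMom (ext ε)) t := by
  have h1 := contracts_affine (d := d) (u := fun μ => (Δ μ : ℂ)) (v := ε) ht (mdot p Δ : ℂ) 0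
  rw [map_zero, add_zero] at h1
  rw [dot_extR_loopMom_add]
  exact h1

theorem good_two {σ : ℝ} {j : ℕ} {K : Fin 3 → ℕ} (hK : GoodExponents σ j K)
    {P P' : Y → LoopPoly d}
    (hP : BddLinear l fun y x => evalShift ![0, p₁ y, p₂ y] (P y) x)
    (hP' : BddLinear l fun y x => evalShift ![0, p₁ y, p₂ y] (P' y) x) {c : Y → ℂ}
    (hc : c =O[l] fun _ => (1 : ℝ)) :
    GoodNumerator l σ j fun y x => wt K x
      * evalShift ![0, p₁ y, p₂ y] (C (c y) * (P y * P' y)) x :=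
  (((hK.good.mul hP).mul hP').mul (BddLinear.const hc)).of_eq fun y x => by
    rw [evalShift_mul, evalShift_mul, evalShift_C]
    ring

variable (h : KinematicLimit l Δ m2 p₁ p₂ ε₁ ε₂ t₁ t₂ s)
include h

theorem bdd_diff : (fun y => (mdot (p₁ y) Δ : ℂ) - mdot (p₂ y) Δ) =O[l] fun _ => (1 : ℝ) :=
  h.bdd_proj₁.sub h.bdd_proj₂

theorem linear_proj₁ : BddLinear l fun y x =>
    evalShift ![0, p₁ y, p₂ y] (dot (extR Δ) (loopMom + extR (p₁ y))) x := by
  refine ⟨![fun y => (mdot (p₁ y) Δ : ℂ), fun _ => 0,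
    fun y => (mdot (p₁ y) Δ : ℂ) - mdot (p₂ y) Δ], fun i => ?_, fun y x => ?_⟩
  · fin_cases i
    · exact h.bdd_proj₁
    · exact isBigO_one_const 0
    · exact h.bdd_diff
  · refine (evalShift_proj₁ _ _ _ x).trans ?_
    simp

theorem linear_proj₂ : BddLinear l fun y x =>
    evalShift ![0, p₁ y, p₂ y] (dot (extR Δ) (loopMom + extR (p₂ y))) x := by
  refine ⟨![fun y => (mdot (p₂ y) Δ : ℂ), fun y => -((mdot (p₁ y) Δ : ℂ) - mdot (p₂ y) Δ),
    fun _ => 0], fun i => ?_, fun y x => ?_⟩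
  · fin_cases i
    · exact h.bdd_proj₂
    · exact h.bdd_diff.neg_left
    · exact isBigO_one_const 0
  · refine (evalShift_proj₂ _ _ _ x).trans ?_
    simp
    ring

theorem linear_pol₁ : BddLinear l fun y x =>
    evalShift ![0, p₁ y, p₂ y] (dot loopMom (ext (ε₁ y))) x := by
  refine ⟨![fun _ => 0, fun _ => 0, fun y => -cdot (ε₁ y) (p₂ y)], fun i => ?_, fun y x => ?_⟩
  · fin_cases i
    · exact isBigO_one_const 0
    · exact isBigO_one_const 0
    · exact h.bdd_pol₁.neg_left
  · refine (evalShift_pol₁ _ _ _ (h.trans₁ y) x).trans ?_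
    simp

theorem linear_pol₂ : BddLinear l fun y x =>
    evalShift ![0, p₁ y, p₂ y] (dot loopMom (ext (ε₂ y))) x := by
  refine ⟨![fun _ => 0, fun y => -cdot (ε₂ y) (p₁ y), fun _ => 0], fun i => ?_, fun y x => ?_⟩
  · fin_cases i
    · exact isBigO_one_const 0
    · exact h.bdd_pol₂.neg_left
    · exact isBigO_one_const 0
  · refine (evalShift_pol₂ _ _ _ (h.trans₂ y) x).trans ?_
    simp

theorem contracts_proj (y : Y) : Contracts (dot (extR Δ) (loopMom + extR (p₁ y)) : LoopPoly d)
    (dot (extR Δ) (loopMom + extR (p₂ y))) 0 := by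
  rw [dot_extR_loopMom_add, dot_extR_loopMom_add]
  refine contracts_affine ?_ _ _
  change dot (extR Δ) (extR Δ) = _
  rw [dot_extR_extR, h.null, Complex.ofReal_zero]

theorem contracts_self (y : Y) : Contracts (dot (extR Δ) (loopMom + extR (p₂ y)) : LoopPoly d)
    (dot (extR Δ) (loopMom + extR (p₂ y))) 0 := by
  rw [dot_extR_loopMom_add]
  refine contracts_affine ?_ _ _
  change dot (extR Δ) (extR Δ) = _
  rw [dot_extR_extR, h.null, Complex.ofReal_zero]

theorem contracts_pols (y : Y) : Contracts (dot loopMom (ext (ε₁ y)) : LoopPoly d)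
    (dot loopMom (ext (ε₂ y))) (s y) := by
  have h1 := contracts_affine (d := d) (h.dot₁₂ y) 0 0
  rwa [map_zero, add_zero, add_zero] at h1

/-- Triangles whose numerator is the product of four linear forms, in terms of the exponents of
their terms with no, one and two contractions.  The uncontracted polarisations contribute the factor
`x₁ x₂` to the first of these. -/
theorem vanishing_four {ν K : Fin 3 → ℕ} (hν : ∀ i, ν i = K i + 1)
    (hK : ∏ i, (K i).factorial = 1) {A j : ℕ} (hA : ∑ i, K i + 2 + 1 = A) (hA4 : 4 ≤ A)
    (hA6 : A ≤ 6) (he₀ : GoodExponents (A - (0 : ℕ) - 2) j (K + ![0, 1, 1]))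
    (he₁ : GoodExponents (A - (1 : ℕ) - 2) j K) (he₂ : GoodExponents (A - (2 : ℕ) - 2) j K) :
    VanishingAtFour l fun y n => (m2 y : ℂ) ^ j * feynmanIntegral ![0, p₁ y, p₂ y] ν
      (dot (extR Δ) (loopMom + extR (p₁ y)) * dot (extR Δ) (loopMom + extR (p₂ y))
        * (dot loopMom (ext (ε₁ y)) * dot loopMom (ext (ε₂ y)))) n := by
  have v₀ := vanishingAtFour_paramIntegral h.mass h.sq₁ h.sq₂ K (r := 0) (j := j)
    (by omega : 0 + 2 ≤ A) hA6
    (P := fun y => dot (extR Δ) (loopMom + extR (p₁ y)) * dot (extR Δ) (loopMom + extR (p₂ y))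
        * (dot loopMom (ext (ε₁ y)) * dot loopMom (ext (ε₂ y)))) ?_
  · have v₁ := vanishingAtFour_paramIntegral h.mass h.sq₁ h.sq₂ K (r := 1) (j := j)
      (by omega : 1 + 2 ≤ A) hA6
      (P := fun y =>
        C (2 * s y) * (dot (extR Δ) (loopMom + extR (p₁ y)) * dot (extR Δ) (loopMom + extR (p₂ y)))
        + C (2 * t₂ y) * (dot (extR Δ) (loopMom + extR (p₁ y)) * dot loopMom (ext (ε₁ y)))
        + C (2 * t₁ y) * (dot (extR Δ) (loopMom + extR (p₁ y)) * dot loopMom (ext (ε₂ y)))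
        + C (2 * t₂ y) * (dot (extR Δ) (loopMom + extR (p₂ y)) * dot loopMom (ext (ε₁ y)))
        + C (2 * t₁ y) * (dot (extR Δ) (loopMom + extR (p₂ y)) * dot loopMom (ext (ε₂ y)))) ?_
    · have v₂ := vanishingAtFour_paramIntegral h.mass h.sq₁ h.sq₂ K (r := 2) (j := j)
        (by omega : 2 + 2 ≤ A) hA6 (P := fun y => C (16 * t₁ y * t₂ y)) ?_
      · refine ((v₀.add v₁).add v₂).congr (Eventually.of_forall fun y n _ => ?_)
        have c₁ := contracts_pol (p₁ y) (h.dot₁ y)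
        have c₂ := contracts_pol (p₁ y) (h.dot₂ y)
        have c₃ := contracts_pol (p₂ y) (h.dot₁ y)
        have c₄ := contracts_pol (p₂ y) (h.dot₂ y)
        rw [feynmanIntegral_eq_three _ ν K hν hK hA
          (box_four (h.contracts_proj y) c₁ c₂ c₃ c₄ (h.contracts_pols y) n)
          (box_box_four (h.contracts_proj y) c₁ c₂ c₃ c₄ n) (box_C n _)]
        ring
      · refine (he₂.good.mul (BddLinear.const (isBigO_one_mul
          (isBigO_one_mul (isBigO_one_const 16) h.bdd_dot₁) h.bdd_dot₂))).of_eq fun y x => ?_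
        rw [evalShift_C]
        ring
    · have b₁ := isBigO_one_mul (isBigO_one_const (2 : ℂ)) h.bdd_dot₁
      have b₂ := isBigO_one_mul (isBigO_one_const (2 : ℂ)) h.bdd_dot₂
      have b₃ := isBigO_one_mul (isBigO_one_const (2 : ℂ)) h.bdd_dot₁₂
      refine (((((good_two he₁ h.linear_proj₁ h.linear_proj₂ b₃).add
        (good_two he₁ h.linear_proj₁ h.linear_pol₁ b₂)).add
        (good_two he₁ h.linear_proj₁ h.linear_pol₂ b₁)).add
        (good_two he₁ h.linear_proj₂ h.linear_pol₁ b₂)).add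
        (good_two he₁ h.linear_proj₂ h.linear_pol₂ b₁)).of_eq fun y x => ?_
      simp only [evalShift_add, mul_add]
  · refine (((GoodNumerator.monomial he₀ (isBigO_one_mul h.bdd_pol₁ h.bdd_pol₂)).mul
      h.linear_proj₁).mul h.linear_proj₂).of_eq fun y x => ?_
    have e1 : wt (K + ![0, 1, 1]) x = wt K x * ((bary x 1 : ℂ) * (bary x 2 : ℂ)) := by
      unfold wt
      simp only [Pi.add_apply, pow_add, Finset.prod_mul_distrib]
      rw [Fin.prod_univ_three (f := fun i => (bary x i : ℂ) ^ (![0, 1, 1] : Fin 3 → ℕ) i)]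
      simp
    rw [evalShift_mul, evalShift_mul, evalShift_mul, evalShift_pol₁ _ _ _ (h.trans₁ y),
      evalShift_pol₂ _ _ _ (h.trans₂ y), e1]
    ring

end KinematicLimit

end Kinematics

section MassTerms

open Filter Topology Asymptotics

variable {Y : Type*} {l : Filter Y} {d : ℕ}

theorem goodExponents_of {σ : ℝ} {j a b c : ℕ} (y : ℝ) (h0 : 0 ≤ y) (hσ : y ≤ σ + 1 / 4)
    (hb : y < b + 1) (hc : y < c + 1) (hbc : σ + 1 / 4 + y < b + c + 2)
    (ha : σ + 1 / 4 - y < a + 1) (hj : σ + 1 / 4 - y < j) : GoodExponents σ j ![a, b, c] :=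
  ⟨y, min 1 (min (b + c + 2 - (σ + 1 / 4) - y) (a + 1 - (σ + 1 / 4 - y))),
    ⟨lt_min one_pos (lt_min (by linarith) (by linarith)), min_le_left _ _, h0, hσ, hb, hc,
      (min_le_right _ _).trans (min_le_left _ _), (min_le_right _ _).trans (min_le_right _ _)⟩, hj⟩

namespace KinematicLimit

variable {Δ : Fin (d + 1) → ℝ} {m2 : Y → ℝ} {p₁ p₂ : Y → Fin (d + 1) → ℝ}
  {ε₁ ε₂ : Y → Fin (d + 1) → ℂ} {t₁ t₂ s : Y → ℂ}
  (h : KinematicLimit l Δ m2 p₁ p₂ ε₁ ε₂ t₁ t₂ s)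
include h

theorem vanishing_four_121 : VanishingAtFour l fun y n =>
    (m2 y : ℂ) ^ 1 * loopInt (p₁ y) (p₂ y) n 1 2 1
      (dot (extR Δ) (loopMom + extR (p₁ y)) * dot (extR Δ) (loopMom + extR (p₂ y))
        * (dot loopMom (ext (ε₁ y)) * dot loopMom (ext (ε₂ y)))) := by
  have e : (![0, 1, 0] + ![0, 1, 1] : Fin 3 → ℕ) = ![0, 2, 1] := by decide
  refine h.vanishing_four (ν := ![1, 2, 1]) (K := ![0, 1, 0]) (A := 4) (by decide) (by decide)
    (by decide) (by norm_num) (by norm_num) ?_ ?_ ?_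
  · rw [e]
    exact goodExponents_of (3 / 2) (by norm_num) (by norm_num) (by norm_num) (by norm_num)
      (by norm_num) (by norm_num) (by norm_num)
  · exact goodExponents_of (1 / 2) (by norm_num) (by norm_num) (by norm_num) (by norm_num)
      (by norm_num) (by norm_num) (by norm_num)
  · exact goodExponents_of 0 (by norm_num) (by norm_num) (by norm_num) (by norm_num)
      (by norm_num) (by norm_num) (by norm_num)

theorem vanishing_four_211 : VanishingAtFour l fun y n =>
    (m2 y : ℂ) ^ 1 * loopInt (p₁ y) (p₂ y) n 2 1 1
      (dot (extR Δ) (loopMom + extR (p₁ y)) * dot (extR Δ) (loopMom + extR (p₂ y))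
        * (dot loopMom (ext (ε₁ y)) * dot loopMom (ext (ε₂ y)))) := by
  have e : (![1, 0, 0] + ![0, 1, 1] : Fin 3 → ℕ) = ![1, 1, 1] := by decide
  refine h.vanishing_four (ν := ![2, 1, 1]) (K := ![1, 0, 0]) (A := 4) (by decide) (by decide)
    (by decide) (by norm_num) (by norm_num) ?_ ?_ ?_
  · rw [e]
    exact goodExponents_of (3 / 2) (by norm_num) (by norm_num) (by norm_num) (by norm_num)
      (by norm_num) (by norm_num) (by norm_num)
  · exact goodExponents_of (1 / 2) (by norm_num) (by norm_num) (by norm_num) (by norm_num)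
      (by norm_num) (by norm_num) (by norm_num)
  · exact goodExponents_of 0 (by norm_num) (by norm_num) (by norm_num) (by norm_num)
      (by norm_num) (by norm_num) (by norm_num)

theorem vanishing_four_221 : VanishingAtFour l fun y n =>
    (m2 y : ℂ) ^ 2 * loopInt (p₁ y) (p₂ y) n 2 2 1
      (dot (extR Δ) (loopMom + extR (p₁ y)) * dot (extR Δ) (loopMom + extR (p₂ y))
        * (dot loopMom (ext (ε₁ y)) * dot loopMom (ext (ε₂ y)))) := by
  have e : (![1, 1, 0] + ![0, 1, 1] : Fin 3 → ℕ) = ![1, 2, 1] := by decide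
  refine h.vanishing_four (ν := ![2, 2, 1]) (K := ![1, 1, 0]) (A := 5) (by decide) (by decide)
    (by decide) (by norm_num) (by norm_num) ?_ ?_ ?_
  · rw [e]
    exact goodExponents_of (3 / 2) (by norm_num) (by norm_num) (by norm_num) (by norm_num)
      (by norm_num) (by norm_num) (by norm_num)
  · exact goodExponents_of (1 / 2) (by norm_num) (by norm_num) (by norm_num) (by norm_num)
      (by norm_num) (by norm_num) (by norm_num)
  · exact goodExponents_of (1 / 2) (by norm_num) (by norm_num) (by norm_num) (by norm_num)
      (by norm_num) (by norm_num) (by norm_num)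

/-- The product of the two projections is expanded, since its monomials require different exponents
`y` in the bound of the rotated integral. -/
theorem vanishing_projections_121 : VanishingAtFour l fun y n =>
    (m2 y : ℂ) ^ 2 * loopInt (p₁ y) (p₂ y) n 1 2 1
      (dot (extR Δ) (loopMom + extR (p₁ y)) * dot (extR Δ) (loopMom + extR (p₂ y))) := by
  have v₀ := vanishingAtFour_paramIntegral h.mass h.sq₁ h.sq₂ ![0, 1, 0] (A := 4) (r := 0) (j := 2)
    (by norm_num) (by norm_num)
    (P := fun y => dot (extR Δ) (loopMom + extR (p₁ y)) * dot (extR Δ) (loopMom + extR (p₂ y))) ?_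
  · refine v₀.congr (Eventually.of_forall fun y n _ => ?_)
    change _ = (m2 y : ℂ) ^ 2 * feynmanIntegral ![0, p₁ y, p₂ y] ![1, 2, 1] _ n
    have e := (h.contracts_proj y).box_mul n
    rw [mul_zero, map_zero] at e
    rw [feynmanIntegral_eq_three _ ![1, 2, 1] ![0, 1, 0] (by decide) (by decide) (A := 4) (by decide)
      e (box_zero n) (box_zero n), paramIntegral_zero, paramIntegral_zero]
    ring
  · have e₁ : GoodExponents ((4 : ℕ) - (0 : ℕ) - 2) 2 ![1, 1, 0] :=
      goodExponents_of (1 / 2) (by norm_num) (by norm_num) (by norm_num) (by norm_num)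
        (by norm_num) (by norm_num) (by norm_num)
    have e₂ : GoodExponents ((4 : ℕ) - (0 : ℕ) - 2) 2 ![0, 2, 1] :=
      goodExponents_of (3 / 2) (by norm_num) (by norm_num) (by norm_num) (by norm_num)
        (by norm_num) (by norm_num) (by norm_num)
    have e₃ : GoodExponents ((4 : ℕ) - (0 : ℕ) - 2) 2 ![1, 2, 0] :=
      goodExponents_of (1 / 2) (by norm_num) (by norm_num) (by norm_num) (by norm_num)
        (by norm_num) (by norm_num) (by norm_num)
    refine ((((GoodNumerator.monomial e₁ h.bdd_proj₂).mul h.linear_proj₁).add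
      (GoodNumerator.monomial e₃ (isBigO_one_mul h.bdd_diff h.bdd_proj₁).neg_left)).add
      (GoodNumerator.monomial e₂ (isBigO_one_mul h.bdd_diff h.bdd_diff).neg_left)).of_eq
      fun y x => ?_
    rw [evalShift_mul, evalShift_proj₁, evalShift_proj₂, wt_three, wt_three, wt_three, wt_three]
    ring

theorem vanishing_211 : VanishingAtFour l fun y n =>
    (m2 y : ℂ) ^ 2 * loopInt (p₁ y) (p₂ y) n 2 1 1
      (dot (extR Δ) (loopMom + extR (p₂ y)) * dot loopMom (ext (ε₂ y))) := by
  have v₀ := vanishingAtFour_paramIntegral h.mass h.sq₁ h.sq₂ ![1, 0, 0] (A := 4) (r := 0) (j := 2)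
    (by norm_num) (by norm_num)
    (P := fun y => dot (extR Δ) (loopMom + extR (p₂ y)) * dot loopMom (ext (ε₂ y))) ?_
  · have v₁ := vanishingAtFour_paramIntegral h.mass h.sq₁ h.sq₂ ![1, 0, 0] (A := 4) (r := 1)
      (j := 2) (by norm_num) (by norm_num) (P := fun y => C (2 * t₂ y)) ?_
    · refine (v₀.add v₁).congr (Eventually.of_forall fun y n _ => ?_)
      change _ = (m2 y : ℂ) ^ 2 * feynmanIntegral ![0, p₁ y, p₂ y] ![2, 1, 1] _ n
      rw [feynmanIntegral_eq_three _ ![2, 1, 1] ![1, 0, 0] (by decide) (by decide) (A := 4)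
        (by decide) ((contracts_pol (p₂ y) (h.dot₂ y)).box_mul n) (box_C n _) (box_zero n),
        paramIntegral_zero]
      ring
    · have e₁ : GoodExponents ((4 : ℕ) - (1 : ℕ) - 2) 2 ![1, 0, 0] :=
        goodExponents_of (1 / 2) (by norm_num) (by norm_num) (by norm_num) (by norm_num)
          (by norm_num) (by norm_num) (by norm_num)
      refine (e₁.good.mul (BddLinear.const (isBigO_one_mul (isBigO_one_const 2)
        h.bdd_dot₂))).of_eq fun y x => ?_
      rw [evalShift_C]
      ring
  · have e₁ : GoodExponents ((4 : ℕ) - (0 : ℕ) - 2) 2 ![1, 1, 0] :=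
      goodExponents_of (1 / 2) (by norm_num) (by norm_num) (by norm_num) (by norm_num)
        (by norm_num) (by norm_num) (by norm_num)
    refine ((GoodNumerator.monomial e₁ h.bdd_pol₂.neg_left).mul h.linear_proj₂).of_eq
      fun y x => ?_
    rw [evalShift_mul, evalShift_pol₂ _ _ _ (h.trans₂ y), wt_three, wt_three]
    ring

theorem vanishing_vertex : VanishingAtFour l fun y n =>
    (m2 y : ℂ) ^ 1 * loopInt (p₁ y) (p₂ y) n 1 1 1
      (dot (extR Δ) (loopMom + extR (p₂ y))
          * vertexE loopMom (extR (p₁ y)) (ext (ε₁ y)) (ext (ε₂ y)) (extR Δ)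
        + C (t₁ y) * (dot (extR Δ) (loopMom + extR (p₂ y)) * dot loopMom (ext (ε₂ y)))) := by
  -- the numerator as a combination of products of linear forms
  have hP : ∀ y, dot (extR Δ) (loopMom + extR (p₂ y))
          * vertexE loopMom (extR (p₁ y)) (ext (ε₁ y)) (ext (ε₂ y)) (extR Δ)
        + C (t₁ y) * (dot (extR Δ) (loopMom + extR (p₂ y)) * dot loopMom (ext (ε₂ y)))
      = C (2 * t₂ y) * (dot (extR Δ) (loopMom + extR (p₂ y)) * dot loopMom (ext (ε₁ y)))
        + C (-s y) * (dot (extR Δ) (loopMom + extR (p₂ y)) * dot (extR Δ) (loopMom + extR (p₂ y)))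
        + C (((mdot (p₁ y) Δ : ℂ) + mdot (p₂ y) Δ) * s y - 2 * (t₁ y * cdot (ε₂ y) (p₁ y)))
          * dot (extR Δ) (loopMom + extR (p₂ y)) := by
    intro y
    rw [vertexE_eq Δ (p₁ y) (ε₁ y) (ε₂ y) (h.dot₁ y) (h.dot₂ y) (h.dot₁₂ y), dot_extR_loopMom_add]
    simp only [map_mul, map_add, map_sub, map_neg, map_ofNat]
    ring
  have hb : ∀ y n, box n (C (2 * t₂ y) * (dot (extR Δ) (loopMom + extR (p₂ y))
          * dot loopMom (ext (ε₁ y)))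
        + C (-s y) * (dot (extR Δ) (loopMom + extR (p₂ y)) * dot (extR Δ) (loopMom + extR (p₂ y)))
        + C (((mdot (p₁ y) Δ : ℂ) + mdot (p₂ y) Δ) * s y - 2 * (t₁ y * cdot (ε₂ y) (p₁ y)))
          * dot (extR Δ) (loopMom + extR (p₂ y)))
      = C (4 * (t₁ y * t₂ y)) := by
    intro y n
    have e₁ := (contracts_pol (p₂ y) (h.dot₁ y)).box_mul n
    have e₂ := (h.contracts_self y).box_mul n
    have e₃ := (h.contracts_self y).box_left n
    rw [box_add, box_add, box_C_mul, box_C_mul, box_C_mul, e₁, e₂, e₃]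
    simp only [map_mul, map_ofNat, map_zero]
    ring
  have e₀ : GoodExponents ((3 : ℕ) - (0 : ℕ) - 2) 1 ![0, 0, 0] :=
    goodExponents_of (1 / 2) (by norm_num) (by norm_num) (by norm_num) (by norm_num)
      (by norm_num) (by norm_num) (by norm_num)
  have e₁ : GoodExponents ((3 : ℕ) - (1 : ℕ) - 2) 1 ![0, 0, 0] :=
    goodExponents_of 0 (by norm_num) (by norm_num) (by norm_num) (by norm_num)
      (by norm_num) (by norm_num) (by norm_num)
  have b₀ := isBigO_one_mul (isBigO_one_const (2 : ℂ)) h.bdd_dot₂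
  have b₁ : (fun y => ((mdot (p₁ y) Δ : ℂ) + mdot (p₂ y) Δ) * s y
      - 2 * (t₁ y * cdot (ε₂ y) (p₁ y))) =O[l] fun _ => (1 : ℝ) :=
    (isBigO_one_mul (h.bdd_proj₁.add h.bdd_proj₂) h.bdd_dot₁₂).sub
      (isBigO_one_mul (isBigO_one_const 2) (isBigO_one_mul h.bdd_dot₁ h.bdd_pol₂))
  have v₀ := vanishingAtFour_paramIntegral h.mass h.sq₁ h.sq₂ ![0, 0, 0] (A := 3) (r := 0) (j := 1)
    (by norm_num) (by norm_num) (((good_two e₀ h.linear_proj₂ h.linear_pol₁ b₀).add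
      (good_two e₀ h.linear_proj₂ h.linear_proj₂ h.bdd_dot₁₂.neg_left)).add
      ((e₀.good.mul h.linear_proj₂).mul (BddLinear.const b₁)) |>.of_eq
      (N' := fun y x => wt ![0, 0, 0] x * evalShift ![0, p₁ y, p₂ y]
        (C (2 * t₂ y) * (dot (extR Δ) (loopMom + extR (p₂ y)) * dot loopMom (ext (ε₁ y)))
        + C (-s y) * (dot (extR Δ) (loopMom + extR (p₂ y)) * dot (extR Δ) (loopMom + extR (p₂ y)))
        + C (((mdot (p₁ y) Δ : ℂ) + mdot (p₂ y) Δ) * s y - 2 * (t₁ y * cdot (ε₂ y) (p₁ y)))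
          * dot (extR Δ) (loopMom + extR (p₂ y))) x)
      fun y x => by
        rw [evalShift_add, evalShift_add, evalShift_mul _ (C (_ - _)), evalShift_C, mul_add, mul_add]
        ring)
  have v₁ := vanishingAtFour_paramIntegral h.mass h.sq₁ h.sq₂ ![0, 0, 0] (A := 3) (r := 1) (j := 1)
    (by norm_num) (by norm_num) (P := fun y => C (4 * (t₁ y * t₂ y)))
    ((e₁.good.mul (BddLinear.const (isBigO_one_mul (isBigO_one_const 4)
      (isBigO_one_mul h.bdd_dot₁ h.bdd_dot₂)))).of_eq fun y x => by
        rw [evalShift_C]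
        ring)
  refine (v₀.add v₁).congr (Eventually.of_forall fun y n _ => ?_)
  rw [hP]
  change _ = (m2 y : ℂ) ^ 1 * feynmanIntegral ![0, p₁ y, p₂ y] ![1, 1, 1] _ n
  rw [feynmanIntegral_eq_three _ ![1, 1, 1] ![0, 0, 0] (by decide) (by decide) (A := 3)
    (by decide) (hb y n) (box_C n _) (box_zero n), paramIntegral_zero]
  ring

end KinematicLimit

end MassTerms

section Bubbles

open Filter Topology Asymptotics

variable {Y : Type*} {l : Filter Y} {d : ℕ}

theorem symF_bubble (q₀ q₁ : Fin (d + 1) → ℝ) (t : ℝ) :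
    symF ![q₀, q₁] (fun _ : Fin 1 => t) = -mdot (q₀ - q₁) (q₀ - q₁) * ((1 - t) * t) := by
  unfold symF secondSymanzik
  simp [Fin.sum_univ_succ, bary]
  ring

/-- The parameter integral of a bubble whose numerator is, at the shift point, a monomial. -/
theorem paramIntegral_bubble {q₀ q₁ : Fin (d + 1) → ℝ} {P : LoopPoly d} {z : ℂ} {p q : ℕ}
    (hP : ∀ t : ℝ, (1 - t : ℂ) * evalShift ![q₀, q₁] P (fun _ : Fin 1 => t)
      = z * ((1 - t : ℂ) ^ p * (t : ℂ) ^ q)) {s : ℂ} (hs : 0 < s.re) :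
    paramIntegral ![q₀, q₁] ![1, 0] P s = z * edgeMero (-mdot (q₀ - q₁) (q₀ - q₁)) p q s := by
  unfold paramIntegral
  rw [integral_simplex_one, ← integral_edge _ _ _ hs, ← intervalIntegral.integral_const_mul]
  refine intervalIntegral.integral_congr fun t _ => ?_
  rw [symF_bubble]
  have hw : wt ![1, 0] (fun _ : Fin 1 => t) = (1 - t : ℂ) := by
    unfold wt
    simp [Fin.prod_univ_succ, bary]
  rw [hw, ← mul_assoc, hP]
  push_cast
  ring

namespace KinematicLimit

variable {Δ : Fin (d + 1) → ℝ} {m2 : Y → ℝ} {p₁ p₂ : Y → Fin (d + 1) → ℝ}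
  {ε₁ ε₂ : Y → Fin (d + 1) → ℂ} {t₁ t₂ s : Y → ℂ}
  (h : KinematicLimit l Δ m2 p₁ p₂ ε₁ ε₂ t₁ t₂ s)
include h

/-- This bubble carries the momentum `p₁ - p₂`, and is bounded as `m2 → 0`. -/
theorem vanishing_021 : VanishingAtFour l fun y n =>
    (m2 y : ℂ) ^ 1 * loopInt (p₁ y) (p₂ y) n 0 2 1
      (dot (extR Δ) (loopMom + extR (p₁ y)) * dot (extR Δ) (loopMom + extR (p₂ y))) := by
  obtain ⟨q₀, q₁, hq₀, hq⟩ := h.mass.bounds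
  have hη : Tendsto (fun y => |m2 y| * (q₀ ^ (-(5 / 4) : ℝ) + |q₁|)) l (𝓝 0) := by
    simpa using h.mass.tendsto.abs.mul_const (q₀ ^ (-(5 / 4) : ℝ) + |q₁|)
  have v₀ := vanishingAtFour_edgeMero (l := l) (A := 3) (r := 0) (j := 1) (p := 2) (q := 1)
    (by norm_num) (by norm_num) (by norm_num) (by norm_num) (M := m2)
    (c := fun y => -mdot (p₁ y - p₂ y) (p₁ y - p₂ y)) hη (hq.mono fun y hy => ?_)
  · refine (v₀.const_mul (isBigO_one_mul h.bdd_diff h.bdd_diff).neg_left).congr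
      (Eventually.of_forall fun y n hn => ?_)
    change _ = (m2 y : ℂ) ^ 1 * feynmanIntegral ![p₁ y, p₂ y] ![2, 1] _ n
    have e := (h.contracts_proj y).box_mul n
    rw [mul_zero, map_zero] at e
    rw [feynmanIntegral_eq_three _ ![2, 1] ![1, 0] (by decide) (by decide) (A := 3) (by decide)
      e (box_zero n) (box_zero n), paramIntegral_zero, paramIntegral_zero,
      paramIntegral_bubble (z := -(((mdot (p₁ y) Δ : ℂ) - mdot (p₂ y) Δ)
        * ((mdot (p₁ y) Δ : ℂ) - mdot (p₂ y) Δ))) (p := 2) (q := 1) (fun t => ?_)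
        (re_half_pos (by norm_num) hn)]
    · ring
    · rw [evalShift_mul, evalShift_proj, evalShift_proj]
      simp [Fin.sum_univ_succ, bary]
      ring
  · have hQ := hq₀.trans_le hy.1
    refine ⟨neg_ne_zero.mpr (abs_pos.mp hQ), fun z hz => ?_⟩
    obtain ⟨⟨h1, h2⟩, -⟩ := mem_expDomain.mp hz
    norm_num at h1
    rw [pow_one, abs_neg]
    refine mul_le_mul_of_nonneg_left ?_ (abs_nonneg _)
    have h3 : |mdot (p₁ y - p₂ y) (p₁ y - p₂ y)| ^ (-(5 / 4) : ℝ) ≤ q₀ ^ (-(5 / 4) : ℝ) :=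
      Real.rpow_le_rpow_of_nonpos hq₀ hy.1 (by norm_num)
    have h4 := hy.2.trans (le_abs_self q₁)
    rcases le_total 1 |mdot (p₁ y - p₂ y) (p₁ y - p₂ y)| with h5 | h5
    · have h6 := Real.rpow_le_rpow_of_exponent_le h5 h2.le
      rw [Real.rpow_one] at h6
      have := Real.rpow_nonneg hq₀.le (-(5 / 4))
      linarith
    · have h6 := Real.rpow_le_rpow_of_exponent_ge hQ h5 (by linarith : -(5 / 4) ≤ z.re)
      linarith [abs_nonneg q₁]

/-- This bubble carries the momentum `p₂`.  Its uncontracted term vanishes by transversality, and the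
other term is a power of `m2` with a small exponent near `n = 4`. -/
theorem vanishing_201 : VanishingAtFour l fun y n =>
    (m2 y : ℂ) ^ 1 * loopInt (p₁ y) (p₂ y) n 2 0 1
      (dot (extR Δ) (loopMom + extR (p₂ y)) * dot loopMom (ext (ε₂ y))) := by
  have hη := h.mass.tendsto_rpow (p := 3 / 4) (by norm_num)
  have v₀ := vanishingAtFour_edgeMero (l := l) (A := 3) (r := 1) (j := 1) (p := 1) (q := 0)
    (by norm_num) (by norm_num) (by norm_num) (by norm_num) (M := m2) (c := fun y => -m2 y) hη
    (h.mass.eventually_le_one.mono fun y hy => ?_)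
  · refine (v₀.const_mul (isBigO_one_mul (isBigO_one_const 2) h.bdd_dot₂)).congr
      (Eventually.of_forall fun y n hn => ?_)
    change _ = (m2 y : ℂ) ^ 1 * feynmanIntegral ![0, p₂ y] ![2, 1] _ n
    have hm : mdot (0 - p₂ y) (0 - p₂ y) = m2 y := by
      rw [← h.sq₂ y]
      simp [mdot]
    rw [feynmanIntegral_eq_three _ ![2, 1] ![1, 0] (by decide) (by decide) (A := 3) (by decide)
      ((contracts_pol (p₂ y) (h.dot₂ y)).box_mul n) (box_C n _) (box_zero n),
      paramIntegral_zero, paramIntegral_bubble (z := 0) (p := 0) (q := 0) (fun t => ?_)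
        (re_half_pos (by norm_num) hn),
      paramIntegral_bubble (P := C (2 * t₂ y)) (z := 2 * t₂ y) (p := 1) (q := 0) (fun t => ?_)
        (re_half_pos (by norm_num) hn), hm]
    · ring
    · rw [evalShift_C]
      ring
    · rw [evalShift_mul, evalShift_dot_ext]
      simp [Fin.sum_univ_succ, h.trans₂ y, cdot_zero_right]
  · have hM := abs_pos.mpr (h.mass.ne_zero y)
    refine ⟨neg_ne_zero.mpr (h.mass.ne_zero y), fun z hz => ?_⟩
    obtain ⟨⟨h1, -⟩, -⟩ := mem_expDomain.mp hz
    norm_num at h1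
    rw [pow_one, abs_neg]
    calc |m2 y| * |m2 y| ^ z.re = |m2 y| ^ (1 + z.re) := by
          rw [Real.rpow_add hM, Real.rpow_one]
      _ ≤ _ := Real.rpow_le_rpow_of_exponent_ge hM hy (by linarith)

/-- The terms that multiply the virtuality of the external gluons are less singular than its
inverse. -/
theorem vanishing_massTerms (ξ : ℂ) : VanishingAtFour l fun y n =>
    (m2 y : ℂ) * massTerms ξ (m2 y) (t₁ y) (s y) (p₁ y) (p₂ y) (ext (ε₁ y)) (ext (ε₂ y))
      (extR Δ) n := by
  have c₁ : (fun _ : Y => 2 * ξ) =O[l] fun _ => (1 : ℝ) := isBigO_one_const _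
  have c₂ : (fun _ : Y => (-1 : ℂ)) =O[l] fun _ => (1 : ℝ) := isBigO_one_const _
  have c₃ : (fun y => ξ * s y) =O[l] fun _ => (1 : ℝ) :=
    isBigO_one_mul (isBigO_one_const ξ) h.bdd_dot₁₂
  have c₄ : (fun y => ξ * t₁ y) =O[l] fun _ => (1 : ℝ) :=
    isBigO_one_mul (isBigO_one_const ξ) h.bdd_dot₁
  have c₅ : (fun _ : Y => -ξ ^ 2) =O[l] fun _ => (1 : ℝ) := isBigO_one_const _
  refine ((((((((h.vanishing_four_121.const_mul c₁).add (h.vanishing_vertex.const_mul c₂)).add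
    (h.vanishing_projections_121.const_mul c₃)).add (h.vanishing_021.const_mul c₃.neg_left)).add
    (h.vanishing_211.const_mul c₄)).add (h.vanishing_four_221.const_mul c₅)).add
    (h.vanishing_201.const_mul c₄.neg_left)).add
    (h.vanishing_four_211.const_mul (isBigO_one_const ξ))).congr
    (Eventually.of_forall fun y n _ => ?_)
  unfold massTerms
  simp only
  ring

end KinematicLimit

/-- The one-loop amplitudes vanish as `p₁² = p₂² → 0`, after `n → 4`. -/
theorem KinematicLimit.vanishing_oneLoopSum {N : ℕ} {ι : Type*} [Fintype ι] [DecidableEq ι]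
    {T : ι → Matrix (Fin N) (Fin N) ℂ} {f : ι → ι → ι → ℝ} (hT : IsSUGenerators T f) (g : ℝ)
    {α : ℝ} (hα : α ≠ 0) (a b : ι) {Δ : Fin (d + 1) → ℝ} {m2 : Y → ℝ}
    {p₁ p₂ : Y → Fin (d + 1) → ℝ} {ε₁ ε₂ : Y → Fin (d + 1) → ℂ} {t₁ t₂ s : Y → ℂ}
    (h : KinematicLimit l Δ m2 p₁ p₂ ε₁ ε₂ t₁ t₂ s) :
    VanishingAtFour l fun y => oneLoopSum f g α Δ (p₁ y) (p₂ y) (ε₁ y) (ε₂ y) a b := by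
  refine (((h.vanishing_massTerms (1 - α)).add (h.symm.vanishing_massTerms (1 - α))).const_mul
    (isBigO_one_const (Complex.I * g ^ 2 * colourFactor f a b))).congr
    (Eventually.of_forall fun y n hn => ?_)
  rw [oneLoopSum_eq hT g α hα (m2 y) Δ (ε₁ y) (ε₂ y) a b (t₁ y) (t₂ y) (s y) (h.sq₁ y) (h.sq₂ y)
    (h.trans₁ y) (h.trans₂ y) (h.dot₁ y) (h.dot₂ y) (h.dot₁₂ y) hn]
  ring

end Bubbles

/-! ### Passage to four dimensions and to massless gluons -/

section Limits

open Filter Topology Asymptotics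

theorem toMeromorphicNFOn_eq_of_analyticAt {G : ℂ → ℂ} (hG : Meromorphic G) {n : ℂ}
    (hn : AnalyticAt ℂ G n) : toMeromorphicNFOn G univ n = G n := by
  rw [toMeromorphicNFOn_eq_toMeromorphicNFAt (fun z _ => hG z) (mem_univ n)]
  rw [toMeromorphicNFAt_eq_self.mpr hn.meromorphicNFAt]

/-- The Laurent coefficients at `n = 4` of a function with at most a simple pole there are
controlled by the size of `(n - 4) B n` near `n = 4`. -/
theorem exists_laurent_of_simple_pole {B H : ℂ → ℂ} {η : ℝ}
    (hH : DifferentiableOn ℂ H (Metric.ball 4 (1 / 4)))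
    (hb : ∀ n ∈ Metric.ball (4 : ℂ) (1 / 4), ‖H n‖ ≤ η)
    (hB : ∀ᶠ n in 𝓝[≠] (4 : ℂ), (n - 4) * B n = H n) : ∃ c₁ c₀ : ℂ, ‖c₁‖ ≤ η ∧ ‖c₀‖ ≤ η / (1 / 8) ∧
      Tendsto (fun n : ℂ => B n - c₁ / (n - 4)) (𝓝[≠] 4) (𝓝 c₀) := by
  have h4 : (4 : ℂ) ∈ Metric.ball (4 : ℂ) (1 / 4) := Metric.mem_ball_self (by norm_num)
  have hsub : Metric.closedBall (4 : ℂ) (1 / 8) ⊆ Metric.ball 4 (1 / 4) :=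
    Metric.closedBall_subset_ball (by norm_num)
  refine ⟨H 4, deriv H 4, hb 4 h4, ?_, ?_⟩
  · -- Cauchy's estimate on the circle of radius `1 / 8`
    refine Complex.norm_deriv_le_of_forall_mem_sphere_norm_le (by norm_num) ?_ fun z hz =>
      hb z (hsub (Metric.sphere_subset_closedBall hz))
    exact (hH.mono hsub).diffContOnCl_ball subset_rfl
  · have hd := ((hH.differentiableAt (Metric.isOpen_ball.mem_nhds h4)).hasDerivAt).tendsto_slope
    refine hd.congr' ?_
    filter_upwards [hB, self_mem_nhdsWithin] with n hn hn4
    have h0 : n - 4 ≠ 0 := sub_ne_zero.mpr hn4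
    rw [slope_def_field, ← hn]
    field_simp

/-- A family that vanishes at four dimensions has a dimensionally regularised continuation whose pole
part and finite part at `n = 4` tend to zero. -/
theorem VanishingAtFour.exists_isDimRegularised {Y : Type*} {l : Filter Y} {S : Y → ℂ → ℂ}
    (h : VanishingAtFour l S) : ∃ (B : Y → ℂ → ℂ) (c₁ c₀ : Y → ℂ),
      (∀ᶠ y in l, IsDimRegularised (S y) (B y) ∧
        Tendsto (fun n : ℂ => B y n - c₁ y / (n - 4)) (𝓝[≠] 4) (𝓝 (c₀ y))) ∧
      Tendsto c₁ l (𝓝 0) ∧ Tendsto c₀ l (𝓝 0) := by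
  obtain ⟨η, hη, h⟩ := h
  have key : ∀ᶠ y in l, ∃ (B : ℂ → ℂ) (c₁ c₀ : ℂ), IsDimRegularised (S y) B ∧
      ‖c₁‖ ≤ η y ∧ ‖c₀‖ ≤ η y / (1 / 8) ∧
      Tendsto (fun n : ℂ => B n - c₁ / (n - 4)) (𝓝[≠] 4) (𝓝 c₀) := by
    refine h.mono ?_
    rintro y ⟨G, H, h1, h2, h3, h4, h5, h6⟩
    have hU : MeromorphicOn G univ := fun z _ => h1 z
    have h7 : ∀ᶠ n in 𝓝[≠] (4 : ℂ), (n - 4) * toMeromorphicNFOn G univ n = H n := by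
      have h8 := hU.toMeromorphicNFOn_eq_self_on_nhdsNE (mem_univ (4 : ℂ))
      filter_upwards [h6, h8] with n hn hn'
      rw [hn', hn]
    obtain ⟨c₁, c₀, hc₁, hc₀, hc⟩ := exists_laurent_of_simple_pole h4 h5 h7
    refine ⟨toMeromorphicNFOn G univ, c₁, c₀, ⟨meromorphicNFOn_toMeromorphicNFOn _ _,
      fun n hn hj => ?_⟩, hc₁, hc₀, hc⟩
    rw [toMeromorphicNFOn_eq_of_analyticAt h1 (h3 n hn hj), h2 n hn]
  obtain ⟨V, hV, key⟩ := key.exists_mem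
  choose! B c₁ c₀ hB using key
  refine ⟨B, c₁, c₀, ?_, ?_, ?_⟩
  · filter_upwards [hV] with y hy
    exact ⟨(hB y hy).1, (hB y hy).2.2.2⟩
  · refine squeeze_zero_norm' ?_ hη
    filter_upwards [hV] with y hy
    exact (hB y hy).2.1
  · have hη' := hη.div_const (1 / 8)
    rw [zero_div] at hη'
    refine squeeze_zero_norm' ?_ hη'
    filter_upwards [hV] with y hy
    exact (hB y hy).2.2.1

variable {Y : Type*} {l : Filter Y} {d : ℕ}

theorem tendsto_mdot {u v : Y → Fin (d + 1) → ℝ} {u' v' : Fin (d + 1) → ℝ}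
    (hu : Tendsto u l (𝓝 u')) (hv : Tendsto v l (𝓝 v')) :
    Tendsto (fun y => mdot (u y) (v y)) l (𝓝 (mdot u' v')) :=
  tendsto_finsetSum _ fun μ _ => ((tendsto_pi_nhds.mp hu μ).const_mul _).mul
    (tendsto_pi_nhds.mp hv μ)

theorem tendsto_cdot {u : Y → Fin (d + 1) → ℂ} {v : Y → Fin (d + 1) → ℝ} {u' : Fin (d + 1) → ℂ}
    {v' : Fin (d + 1) → ℝ} (hu : Tendsto u l (𝓝 u')) (hv : Tendsto v l (𝓝 v')) :
    Tendsto (fun y => cdot (u y) (v y)) l (𝓝 (cdot u' v')) :=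
  tendsto_finsetSum _ fun μ _ => ((tendsto_pi_nhds.mp hu μ).const_mul _).mul
    (tendsto_pi_nhds.mp hv μ).ofReal

theorem exists_kinematicLimit {Δ : Fin (d + 1) → ℝ} {m2 : Y → ℝ} {p₁ p₂ : Y → Fin (d + 1) → ℝ}
    {ε₁ ε₂ : Y → Fin (d + 1) → ℂ} {p₁' p₂' : Fin (d + 1) → ℝ} {ε₁' ε₂' : Fin (d + 1) → ℂ}
    (hΔ : mdot Δ Δ = 0) (hm : ∀ y, m2 y ≠ 0) (h₁ : ∀ y, mdot (p₁ y) (p₁ y) = m2 y)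
    (h₂ : ∀ y, mdot (p₂ y) (p₂ y) = m2 y) (ht₁ : ∀ y, cdot (ε₁ y) (p₁ y) = 0)
    (ht₂ : ∀ y, cdot (ε₂ y) (p₂ y) = 0) (hm0 : Tendsto m2 l (𝓝 0)) (hp₁ : Tendsto p₁ l (𝓝 p₁'))
    (hp₂ : Tendsto p₂ l (𝓝 p₂')) (hε₁ : Tendsto ε₁ l (𝓝 ε₁')) (hε₂ : Tendsto ε₂ l (𝓝 ε₂'))
    (hQ : mdot (p₁' - p₂') (p₁' - p₂') ≠ 0) :
    ∃ t₁ t₂ s : Y → ℂ, KinematicLimit l Δ m2 p₁ p₂ ε₁ ε₂ t₁ t₂ s := by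
  have hΔc : Tendsto (fun _ : Y => Δ) l (𝓝 Δ) := tendsto_const_nhds
  have hs : Tendsto (fun y => ∑ μ, (eta μ : ℂ) * ε₁ y μ * ε₂ y μ) l
      (𝓝 (∑ μ, (eta μ : ℂ) * ε₁' μ * ε₂' μ)) :=
    tendsto_finsetSum _ fun μ _ => ((tendsto_pi_nhds.mp hε₁ μ).const_mul _).mul
      (tendsto_pi_nhds.mp hε₂ μ)
  have hQt := (tendsto_mdot (hp₁.sub hp₂) (hp₁.sub hp₂)).abs
  have hQ0 := abs_pos.mpr hQ
  refine ⟨fun y => cdot (ε₁ y) Δ, fun y => cdot (ε₂ y) Δ,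
    fun y => ∑ μ, (eta μ : ℂ) * ε₁ y μ * ε₂ y μ, hΔ, ⟨hm, hm0,
      |mdot (p₁' - p₂') (p₁' - p₂')| / 2, 2 * |mdot (p₁' - p₂') (p₁' - p₂')|, by positivity, ?_⟩,
    h₁, h₂, ht₁, ht₂, fun y => by rw [dot_comm, dot_ext_extR], fun y => by rw [dot_comm, dot_ext_extR],
    fun y => dot_ext_ext _ _, (tendsto_mdot hp₁ hΔc).ofReal.isBigO_one ℝ,
    (tendsto_mdot hp₂ hΔc).ofReal.isBigO_one ℝ, (tendsto_cdot hε₁ hp₂).isBigO_one ℝ,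
    (tendsto_cdot hε₂ hp₁).isBigO_one ℝ, (tendsto_cdot hε₁ hΔc).isBigO_one ℝ,
    (tendsto_cdot hε₂ hΔc).isBigO_one ℝ, hs.isBigO_one ℝ⟩
  filter_upwards [hQt.eventually_const_lt (half_lt_self hQ0),
    hQt.eventually_lt_const (show _ < 2 * |mdot (p₁' - p₂') (p₁' - p₂')| by linarith)] with y h3 h4
  exact ⟨h3.le, h4.le⟩

end Limits

end GVOperator

end

theorem mainTheorem1 {d N : ℕ} {ι : Type*} [Fintype ι] [DecidableEq ι]
    (T : ι → Matrix (Fin N) (Fin N) ℂ) (f : ι → ι → ι → ℝ)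
    (hT : GVOperator.IsSUGenerators T f) (g α : ℝ) (hα : α ≠ 0)
    (Δ : Fin (d + 1) → ℝ) (hΔ : GVOperator.mdot Δ Δ = 0) (a b : ι) :
    -- massless on-shell gluons
    (∀ (p₁ p₂ : Fin (d + 1) → ℝ) (ε₁ ε₂ : Fin (d + 1) → ℂ),
      GVOperator.mdot p₁ p₁ = 0 → GVOperator.mdot p₂ p₂ = 0 → p₁ - p₂ ≠ 0 →
      GVOperator.cdot ε₁ p₁ = 0 → GVOperator.cdot ε₂ p₂ = 0 →
      ∃ B : ℂ → ℂ,
        GVOperator.IsDimRegularised (GVOperator.oneLoopSum f g α Δ p₁ p₂ ε₁ ε₂ a b) B ∧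
        ∀ n : ℂ, GVOperator.treeElement α Δ p₁ p₂ ε₁ ε₂ a b + B n = B n ∧ B n = 0) ∧
    -- the limit `n → 4` at `p₁² = p₂² = m² ≠ 0`, followed by `m² → 0`
    (∀ {Y : Type} (l : Filter Y) (m2 : Y → ℝ) (p₁ p₂ : Y → Fin (d + 1) → ℝ)
      (ε₁ ε₂ : Y → Fin (d + 1) → ℂ) (p₁' p₂' : Fin (d + 1) → ℝ) (ε₁' ε₂' : Fin (d + 1) → ℂ),
      (∀ y, m2 y ≠ 0) →
      (∀ y, GVOperator.mdot (p₁ y) (p₁ y) = m2 y) →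
      (∀ y, GVOperator.mdot (p₂ y) (p₂ y) = m2 y) →
      (∀ y, GVOperator.cdot (ε₁ y) (p₁ y) = 0) →
      (∀ y, GVOperator.cdot (ε₂ y) (p₂ y) = 0) →
      Filter.Tendsto m2 l (nhds 0) →
      Filter.Tendsto p₁ l (nhds p₁') → Filter.Tendsto p₂ l (nhds p₂') →
      Filter.Tendsto ε₁ l (nhds ε₁') → Filter.Tendsto ε₂ l (nhds ε₂') →
      GVOperator.mdot (p₁' - p₂') (p₁' - p₂') ≠ 0 →
      (∀ y, GVOperator.treeElement α Δ (p₁ y) (p₂ y) (ε₁ y) (ε₂ y) a b = 0) ∧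
      ∃ (B : Y → ℂ → ℂ) (c₁ c₀ : Y → ℂ),
        (∀ᶠ y in l,
          GVOperator.IsDimRegularised
            (GVOperator.oneLoopSum f g α Δ (p₁ y) (p₂ y) (ε₁ y) (ε₂ y) a b) (B y) ∧
          Filter.Tendsto (fun n : ℂ => B y n - c₁ y / (n - 4)) (nhdsWithin 4 {4}ᶜ)
            (nhds (c₀ y))) ∧
        Filter.Tendsto c₁ l (nhds 0) ∧ Filter.Tendsto c₀ l (nhds 0)) := by
  refine ⟨fun p₁ p₂ ε₁ ε₂ hp₁ hp₂ _ h₁ h₂ => ⟨fun _ => 0, ⟨fun _ _ =>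
    analyticAt_const.meromorphicNFAt, fun n hn _ => ?_⟩, fun n => ⟨?_, rfl⟩⟩, ?_⟩
  · rw [GVOperator.oneLoopSum_eq hT g α hα 0 Δ ε₁ ε₂ a b _ _ _ hp₁ hp₂ h₁ h₂
      ((GVOperator.dot_comm _ _).trans (GVOperator.dot_ext_extR _ _))
      ((GVOperator.dot_comm _ _).trans (GVOperator.dot_ext_extR _ _))
      (GVOperator.dot_ext_ext _ _) hn, Complex.ofReal_zero, mul_zero, zero_mul]
  · rw [GVOperator.treeElement_eq_zero α Δ p₁ p₂ ε₁ ε₂ a b h₁ h₂, zero_add]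
  · intro Y l m2 p₁ p₂ ε₁ ε₂ p₁' p₂' ε₁' ε₂' hm hp₁ hp₂ h₁ h₂ hm0 tp₁ tp₂ tε₁ tε₂ hQ
    obtain ⟨t₁, t₂, s, h⟩ := GVOperator.exists_kinematicLimit hΔ hm hp₁ hp₂ h₁ h₂ hm0 tp₁ tp₂ tε₁
      tε₂ hQ
    exact ⟨fun y => GVOperator.treeElement_eq_zero α Δ _ _ _ _ a b (h₁ y) (h₂ y),
      (h.vanishing_oneLoopSum hT g hα a b).exists_isDimRegularised⟩
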